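/- **Model.** The Asymmetric Nested Parallel (NP) model is a fork–join random access machine. A computation starts with a single root task. Each task has constantly many registers, a private small memory of $O(\log n)$ words, and access to a shared, unbounded large memory; words have $\Theta(\log n)$ bits, and coordinates and priorities are keys from an arbitrary linear order that can only be copied and compared, each occupying one cell. Besides the usual RAM instructions and an instruction producing a uniformly random word there is a binary fork: the task suspends until its two child tasks (which get a copy of its registers, and are told which child they are) have finished. Parallel tasks may read the same large-memory cell, but neither may access a cell that the other writes. A write to the large memory costs $\omega\ge 1$, every other instruction costs $1$. The *work* is the total cost of all executed instructions, and the *depth* is the number of instructions on a longest path of the resulting series–parallel DAG. **Interval tree.** For $n$ closed intervals $[l_i,r_i]$, $l_i\le r_i$: a binary search tree on the multiset of the $2n$ endpoints which is perfectly balanced, that is, at every node the key is a median of the keys in its subtree, and the numbers of keys in the left and right subtrees differ by at most one. The intervals that contain the key of the root are stored at the root, in two red–black trees (inner trees) ordered by left and by right endpoints respectively; the intervals completely to the left (right) of the key are stored in the left (right) subtree in the same way. **Priority search tree.** For $n$ points $(x_i,y_i)$ with coordinate $x_i$ and priority $y_i$: the root stores a point of highest priority, and the other points are split by a median of their coordinates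 (kept at the root as the splitter) into two parts whose sizes differ by at most one, with coordinates at most, respectively at least, the splitter; the parts recursively form the left and right subtrees. **Theorem.** There are a program $P$ and a constant $C$, and likewise a program $P'$ and a constant $C'$, for the Asymmetric NP model (where the constant factors in the word length and in the size of the small memory are sufficiently large) such that the following holds. 1. Given an array of any $n\ge 0$ intervals together with the list of their $2n$ endpoints in sorted order, $P$ almost surely halts with an interval tree for these intervals in the large memory. 2. Given an array of any $n\ge 0$ points sorted by coordinate, $P'$ almost surely halts with a priority search tree for these points in the large memory. In both cases, if $n\ge2$, then (with $C'$ in place of $C$ in the second case) the expected work is at most $C\omega n$ for every write cost $\omega\ge1$, the expected number of writes to the large memory is at most $Cn$, and for every $c\ge 1$ the depth is at most $C\,c\,\log_2^2 n$ with probability at least $1-n^{-c}$. That is, the construction takes $O(\omega n)$ expected work, $O(n)$ expected writes, and $O(\log^2 n)$ depth with high probability. -/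

import Mathlib

open MeasureTheory
open scoped ENNReal

/-! # A nested-parallel random access machine with asymmetric read and write costs

The machine has an infinite shared large memory. A task has a program counter, constantly many
registers (those named by the program text), and a private small memory of bounded size. A memory
cell or register holds a machine word (a natural number below `2 ^ w`) or a key from a linear
order; keys can only be moved and compared.
-/

namespace ANP

universe u

/-- Contents of a cell: a machine word or a key. -/
inductive Val (α : Type u) : Type u
  | num (k : ℕ) : Val α
  | key (a : α) : Val α

/-- The large memory. -/
abbrev Mem (α : Type u) : Type u := ℕ → Val α

/-- Arithmetic and bitwise operations on words. -/
inductive Op : Type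
  | add | sub | mul | div | mod | and | or | xor | shl | shr

/-- All operations are performed modulo `2 ^ w`. -/
def Op.eval (w : ℕ) (f : Op) (a b : ℕ) : ℕ :=
  (match f with
    | .add => a + b
    | .sub => a + 2 ^ w - b
    | .mul => a * b
    | .div => a / b
    | .mod => a % b
    | .and => a &&& b
    | .or => a ||| b
    | .xor => a ^^^ b
    | .shl => a <<< b
    | .shr => a >>> b) % 2 ^ w

/-- The instruction set. Registers are addressed directly, both memories indirectly through a
register. -/
inductive Instr : Type
  /-- `reg d := c` -/
  | const (d c : ℕ)
  /-- `reg d := reg a` -/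
  | move (d a : ℕ)
  /-- `reg d := f (reg a) (reg b)`, for words -/
  | arith (f : Op) (d a b : ℕ)
  /-- `reg d := 1` if `reg a ≤ reg b`, otherwise `0`; for two words or for two keys -/
  | le (d a b : ℕ)
  /-- `reg d :=` a uniformly random word -/
  | rand (d : ℕ)
  /-- `reg d := small (reg a)` -/
  | loadSmall (d a : ℕ)
  /-- `small (reg a) := reg b` -/
  | storeSmall (a b : ℕ)
  /-- jump to the instruction number `l` -/
  | jump (l : ℕ)
  /-- jump to the instruction number `l` if `reg a` is the word `0` -/
  | jumpZero (a l : ℕ)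
  /-- `reg d := large (reg a)` -/
  | load (d a : ℕ)
  /-- `large (reg a) := reg b` -/
  | store (a b : ℕ)
  /-- create two child tasks, which start at instruction `l` with a copy of the registers, except
  that `reg d` is `1` in the first and `2` in the second child; continue after both have halted -/
  | fork (d l : ℕ)
  /-- end of the task -/
  | halt

abbrev Program : Type := List Instr

/-- An instruction execution is identified by the fork history of its task and the number of
instructions that the task has executed before it. -/
abbrev Event : Type := List (Bool × ℕ) × ℕ

/-- The outcomes of all random choices: one random word for each possible instruction execution. -/
abbrev Coins (w : ℕ) : Type := Event → Fin (2 ^ w)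

/-- The random words are independent and uniformly distributed. -/
noncomputable def coinMeasure (w : ℕ) : Measure (Coins w) :=
  Measure.infinitePi fun _ : Event => (PMF.uniformOfFintype (Fin (2 ^ w))).toMeasure

/-- The state of a task. A cell of the small memory that has not been written yet holds `none`. -/
structure Task (α : Type u) : Type u where
  pc : ℕ
  reg : ℕ → Val α
  small : ℕ → Option (Val α)
  history : List (Bool × ℕ)
  clock : ℕ

namespace Task

variable {α : Type u}

/-- Advance to the instruction number `l`. -/
def goto (t : Task α) (l : ℕ) : Task α := { t with pc := l, clock := t.clock + 1 }

/-- Advance to the next instruction. -/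
def next (t : Task α) : Task α := t.goto (t.pc + 1)

def setReg (t : Task α) (d : ℕ) (v : Val α) : Task α := { t with reg := Function.update t.reg d v }

/-- The first (`b = false`) or second (`b = true`) child of a fork; its small memory is blank. -/
def child (t : Task α) (d l : ℕ) (b : Bool) : Task α where
  pc := l
  reg := Function.update t.reg d (.num (if b then 2 else 1))
  small := fun _ => none
  history := (b, t.clock) :: t.history
  clock := 0

/-- The root task at the start: register `0` holds the input size. -/
def init (α : Type u) (n : ℕ) : Task α where
  pc := 0
  reg := Function.update (fun _ => .num 0) 0 (.num n)
  small := fun _ => none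
  history := []
  clock := 0

end Task

/-- The effect of an instruction that does not touch the large memory. The parameters are the word
length `w`, the size `M` of the small memory, and the random words. The result is `none` on
faulty access, on operands of the wrong kind, and for the remaining instructions. -/
def Instr.localStep {α : Type u} [LinearOrder α] {w : ℕ} (M : ℕ) (ρ : Coins w) (t : Task α) :
    Instr → Option (Task α)
  | .const d c => some (t.next.setReg d (.num (c % 2 ^ w)))
  | .move d a => some (t.next.setReg d (t.reg a))
  | .arith f d a b =>
    match t.reg a, t.reg b with
    | .num x, .num y => some (t.next.setReg d (.num (f.eval w x y)))
    | _, _ => none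
  | .le d a b =>
    match t.reg a, t.reg b with
    | .num x, .num y => some (t.next.setReg d (.num ((if x ≤ y then 1 else 0) % 2 ^ w)))
    | .key x, .key y => some (t.next.setReg d (.num ((if x ≤ y then 1 else 0) % 2 ^ w)))
    | _, _ => none
  | .rand d => some (t.next.setReg d (.num (ρ (t.history, t.clock))))
  | .loadSmall d a =>
    match t.reg a with
    | .num x => if x < M then (t.small x).map fun v => t.next.setReg d v else none
    | .key _ => none
  | .storeSmall a b =>
    match t.reg a with
    | .num x =>
      if x < M then some { t.next with small := Function.update t.small x (some (t.reg b)) }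
      else none
    | .key _ => none
  | .jump l => some (t.goto l)
  | .jumpZero a l =>
    match t.reg a with
    | .num 0 => some (t.goto l)
    | _ => some t.next
  | .load _ _ => none
  | .store _ _ => none
  | .fork _ _ => none
  | .halt => none

/-- What is observed of a finished task, with all its descendants: the large memory, the number of
executed instructions that are not writes to the large memory, the number of writes to the large
memory, the number of instructions on a longest path of the series-parallel DAG, and the addresses
in the large memory that were read and written. -/
structure Outcome (α : Type u) : Type u where
  mem : Mem α
  ops : ℕ
  writes : ℕ
  depth : ℕ
  readSet : Set ℕ
  writeSet : Set ℕ

/-- A write to the large memory costs `ω`, every other instruction costs `1`. -/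
def Outcome.work {α : Type u} (ω : ℝ) (o : Outcome α) : ℝ := o.ops + ω * o.writes

open Classical in
/-- The memory after two parallel tasks that write to disjoint sets of addresses. -/
noncomputable def mergeMem {α : Type u} (o₁ o₂ : Outcome α) : Mem α :=
  fun x => if x ∈ o₁.writeSet then o₁.mem x else o₂.mem x

/-- Parallel tasks may read the same address, but neither may access an address that the other one
writes. -/
def RaceFree {α : Type u} (o₁ o₂ : Outcome α) : Prop :=
  Disjoint o₁.writeSet (o₂.readSet ∪ o₂.writeSet) ∧ Disjoint o₂.writeSet o₁.readSet

/-- `Exec P M ρ t m o`: started in the large memory `m`, the task `t` halts with outcome `o`. There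
is no rule for faults and races, so that an execution with a fault or a race does not halt; in
particular no program can rely on a rule that resolves conflicting concurrent accesses. -/
inductive Exec {α : Type u} [LinearOrder α] {w : ℕ} (P : Program) (M : ℕ) (ρ : Coins w) :
    Task α → Mem α → Outcome α → Prop
  | halt {t : Task α} {m : Mem α} (h : P[t.pc]? = some .halt) :
      Exec P M ρ t m ⟨m, 1, 0, 1, ∅, ∅⟩
  | localStep {t t' : Task α} {m : Mem α} {o : Outcome α} {i : Instr} (h : P[t.pc]? = some i)
      (hi : i.localStep M ρ t = some t') (ho : Exec P M ρ t' m o) :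
      Exec P M ρ t m { o with ops := 1 + o.ops, depth := 1 + o.depth }
  | load {t : Task α} {m : Mem α} {o : Outcome α} {d a x : ℕ} (h : P[t.pc]? = some (.load d a))
      (ha : t.reg a = .num x) (ho : Exec P M ρ (t.next.setReg d (m x)) m o) :
      Exec P M ρ t m
        { o with ops := 1 + o.ops, depth := 1 + o.depth, readSet := insert x o.readSet }
  | store {t : Task α} {m : Mem α} {o : Outcome α} {a b x : ℕ} (h : P[t.pc]? = some (.store a b))
      (ha : t.reg a = .num x) (ho : Exec P M ρ t.next (Function.update m x (t.reg b)) o) :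
      Exec P M ρ t m
        { o with writes := 1 + o.writes, depth := 1 + o.depth, writeSet := insert x o.writeSet }
  | fork {t : Task α} {m : Mem α} {o₁ o₂ o : Outcome α} {d l : ℕ}
      (h : P[t.pc]? = some (.fork d l))
      (h₁ : Exec P M ρ (t.child d l false) m o₁) (h₂ : Exec P M ρ (t.child d l true) m o₂)
      (hr : RaceFree o₁ o₂) (ho : Exec P M ρ t.next (mergeMem o₁ o₂) o) :
      Exec P M ρ t m
        { mem := o.mem
          ops := 1 + o₁.ops + o₂.ops + o.ops
          writes := o₁.writes + o₂.writes + o.writes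
          depth := 1 + max o₁.depth o₂.depth + o.depth
          readSet := o₁.readSet ∪ o₂.readSet ∪ o.readSet
          writeSet := o₁.writeSet ∪ o₂.writeSet ∪ o.writeSet }

/-- Given the random words, the outcome is unique. -/
theorem Exec.det {α : Type u} [LinearOrder α] {w : ℕ} {P : Program} {M : ℕ} {ρ : Coins w}
    {t : Task α} {m : Mem α} {o o' : Outcome α} (h : Exec P M ρ t m o) (h' : Exec P M ρ t m o') :
    o = o' := by
  induction h generalizing o' with
  | halt h =>
    cases h' with
    | halt _ => rfl
    | localStep k ki _ => cases Option.some.inj (h.symm.trans k); cases ki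
    | load k _ _ => cases Option.some.inj (h.symm.trans k)
    | store k _ _ => cases Option.some.inj (h.symm.trans k)
    | fork k _ _ _ _ => cases Option.some.inj (h.symm.trans k)
  | localStep h hi ho ih =>
    cases h' with
    | halt k => cases Option.some.inj (h.symm.trans k); cases hi
    | localStep k ki ko =>
      cases Option.some.inj (h.symm.trans k)
      cases Option.some.inj (hi.symm.trans ki)
      rw [ih ko]
    | load k _ _ => cases Option.some.inj (h.symm.trans k); cases hi
    | store k _ _ => cases Option.some.inj (h.symm.trans k); cases hi
    | fork k _ _ _ _ => cases Option.some.inj (h.symm.trans k); cases hi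
  | load h ha ho ih =>
    cases h' with
    | halt k => cases Option.some.inj (h.symm.trans k)
    | localStep k ki _ => cases Option.some.inj (h.symm.trans k); cases ki
    | load k ka ko =>
      cases Option.some.inj (h.symm.trans k)
      cases ha.symm.trans ka
      rw [ih ko]
    | store k _ _ => cases Option.some.inj (h.symm.trans k)
    | fork k _ _ _ _ => cases Option.some.inj (h.symm.trans k)
  | store h ha ho ih =>
    cases h' with
    | halt k => cases Option.some.inj (h.symm.trans k)
    | localStep k ki _ => cases Option.some.inj (h.symm.trans k); cases ki
    | load k _ _ => cases Option.some.inj (h.symm.trans k)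
    | store k ka ko =>
      cases Option.some.inj (h.symm.trans k)
      cases ha.symm.trans ka
      rw [ih ko]
    | fork k _ _ _ _ => cases Option.some.inj (h.symm.trans k)
  | fork h h₁ h₂ hr ho ih₁ ih₂ ih =>
    cases h' with
    | halt k => cases Option.some.inj (h.symm.trans k)
    | localStep k ki _ => cases Option.some.inj (h.symm.trans k); cases ki
    | load k _ _ => cases Option.some.inj (h.symm.trans k)
    | store k _ _ => cases Option.some.inj (h.symm.trans k)
    | fork k k₁ k₂ kr ko =>
      cases Option.some.inj (h.symm.trans k)
      cases ih₁ k₁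
      cases ih₂ k₂
      rw [ih ko]

/-- The program, started with input size `n` and large memory `m`, halts with outcome `o`. -/
def Runs {α : Type u} [LinearOrder α] {w : ℕ} (P : Program) (M n : ℕ) (m : Mem α) (ρ : Coins w)
    (o : Outcome α) : Prop :=
  Exec P M ρ (Task.init α n) m o

/-- The random variable `f` of the outcome; it is `∞` where the program does not halt. -/
noncomputable def cost {α : Type u} [LinearOrder α] {w : ℕ} (P : Program) (M n : ℕ) (m : Mem α)
    (f : Outcome α → ℝ) (ρ : Coins w) : ℝ≥0∞ :=
  ⨅ (o : Outcome α) (_ : Runs P M n m ρ o), ENNReal.ofReal (f o)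

/-- The program `P`, on input size `n` and initial memory `m`, halts almost surely in a memory that
satisfies `Correct`. If `2 ≤ n`, then it does so in expected work at most `C ω n` for every write
cost `ω ≥ 1`, with at most `C n` expected writes, and, for every `c ≥ 1`, in depth at most
`C c (log₂ n) ^ 2` with probability at least `1 - 1 / n ^ c`. This holds for words of at least
`k (⌊log₂ n⌋ + 1)` bits and a small memory of at least `s (⌊log₂ n⌋ + 1)` words. -/
def BuildsWithin {α : Type u} [LinearOrder α] (P : Program) (k s : ℕ) (C : ℝ) (n : ℕ) (m : Mem α)
    (Correct : Mem α → Prop) : Prop :=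
  ∀ w M : ℕ, k * (Nat.log 2 n + 1) ≤ w → s * (Nat.log 2 n + 1) ≤ M →
    (∀ᵐ ρ ∂coinMeasure w, ∃ o, Runs P M n m ρ o ∧ Correct o.mem) ∧
    (2 ≤ n →
      (∀ ω : ℝ, 1 ≤ ω →
        AEMeasurable (cost P M n m (Outcome.work ω)) (coinMeasure w) ∧
        ∫⁻ ρ, cost P M n m (Outcome.work ω) ρ ∂coinMeasure w ≤ ENNReal.ofReal (C * ω * n)) ∧
      (AEMeasurable (cost P M n m (fun o => o.writes)) (coinMeasure w) ∧
        ∫⁻ ρ, cost P M n m (fun o => o.writes) ρ ∂coinMeasure w ≤ ENNReal.ofReal (C * n)) ∧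
      ∀ c : ℝ, 1 ≤ c →
        coinMeasure w
            {ρ | ¬ ∃ o, Runs P M n m ρ o ∧ (o.depth : ℝ) ≤ C * c * Real.logb 2 n ^ 2} ≤
          ENNReal.ofReal (1 / (n : ℝ) ^ c))

/-! ## Trees and their representation in memory -/

inductive BTree (β : Type u) : Type u
  | nil : BTree β
  | node (v : β) (l r : BTree β) : BTree β

/-- The labels of the nodes in symmetric order. -/
def BTree.toList {β : Type u} : BTree β → List β
  | .nil => []
  | .node v l r => l.toList ++ v :: r.toList

/-- `Stored m R p t F`: in the memory `m` there is a copy of the tree `t` with root pointer `p`,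
which occupies exactly the cells in `F`. The null pointer is `0`. A node at address `p` consists of
the pointers to its children, in the cells `p` and `p + 1`, and of its label, from the cell `p + 2`
on, where `R q v G` says that the label `v` is stored from the cell `q` on and occupies exactly the
cells in `G`. Distinct nodes do not share cells. -/
inductive Stored {α β : Type u} (m : Mem α) (R : ℕ → β → Set ℕ → Prop) :
    ℕ → BTree β → Set ℕ → Prop
  | nil : Stored m R 0 .nil ∅
  | node {p pl pr : ℕ} {v : β} {l r : BTree β} {G Fl Fr : Set ℕ} (hp : p ≠ 0)
      (hpl : m p = .num pl) (hpr : m (p + 1) = .num pr) (hv : R (p + 2) v G)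
      (hl : Stored m R pl l Fl) (hr : Stored m R pr r Fr)
      (hG : Disjoint {p, p + 1} G) (hFl : Disjoint ({p, p + 1} ∪ G) Fl)
      (hFr : Disjoint ({p, p + 1} ∪ G ∪ Fl) Fr) :
      Stored m R p (.node v l r) ({p, p + 1} ∪ G ∪ Fl ∪ Fr)

/-- `s` is a median of the nonempty multiset `X`. -/
def IsMedian {α : Type u} [LinearOrder α] (s : α) (X : Multiset α) : Prop :=
  s ∈ X ∧ 2 * X.countP (· < s) ≤ X.card ∧ 2 * X.countP (s < ·) ≤ X.card

/-! ## Interval trees -/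

/-- Label of a node of an inner tree: colour, key, and number of the interval. -/
structure InnerLabel (α : Type u) : Type u where
  red : Bool
  key : α
  idx : ℕ

/-- `RedBlackAux t c h`: the tree satisfies the red-black conditions (a red node has no red child,
all paths from the root to an empty tree have the same number `h` of black nodes), and `c` says
whether the root is red. -/
inductive RedBlackAux {α : Type u} : BTree (InnerLabel α) → Bool → ℕ → Prop
  | nil : RedBlackAux .nil false 0
  | red {v : InnerLabel α} {l r : BTree (InnerLabel α)} {h : ℕ} (hv : v.red = true)
      (hl : RedBlackAux l false h) (hr : RedBlackAux r false h) :
      RedBlackAux (.node v l r) true h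
  | black {v : InnerLabel α} {l r : BTree (InnerLabel α)} {cl cr : Bool} {h : ℕ}
      (hv : v.red = false) (hl : RedBlackAux l cl h) (hr : RedBlackAux r cr h) :
      RedBlackAux (.node v l r) false (h + 1)

/-- A red-black tree, with black root. -/
def IsRedBlack {α : Type u} (t : BTree (InnerLabel α)) : Prop := ∃ h, RedBlackAux t false h

/-- `t` is a red-black search tree that contains exactly the intervals in `S`, each one once, with
the endpoints `e` as keys. -/
def IsInnerTree {α : Type u} [LinearOrder α] {n : ℕ} (e : Fin n → α) (S : Finset (Fin n))
    (t : BTree (InnerLabel α)) : Prop :=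
  IsRedBlack t ∧
  (t.toList.map InnerLabel.key).Pairwise (· ≤ ·) ∧
  (t.toList.map fun v => (v.idx, v.key)).Perm (S.toList.map fun i : Fin n => ((i : ℕ), e i))

/-- Label of a node of an interval tree: key and the two inner trees. -/
structure IntervalLabel (α : Type u) : Type u where
  key : α
  byLeft : BTree (InnerLabel α)
  byRight : BTree (InnerLabel α)

/-- `IsIntervalTree lo hi E S t`: the tree `t` is an interval tree for the intervals
`[lo i, hi i]`, `i ∈ S`, on the multiset `E` of keys. The key at the root is a median of `E` that
splits the other keys evenly. The intervals that cover it are kept at the root, ordered by left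
and by right endpoints; those completely to its left (right) are in the left (right) subtree. -/
def IsIntervalTree {α : Type u} [LinearOrder α] {n : ℕ} (lo hi : Fin n → α) :
    Multiset α → Finset (Fin n) → BTree (IntervalLabel α) → Prop
  | E, S, .nil => E = 0 ∧ S = ∅
  | E, S, .node v l r =>
    IsMedian v.key E ∧
    IsInnerTree lo (S.filter fun i => lo i ≤ v.key ∧ v.key ≤ hi i) v.byLeft ∧
    IsInnerTree hi (S.filter fun i => lo i ≤ v.key ∧ v.key ≤ hi i) v.byRight ∧
    ∃ El Er : Multiset α, E = v.key ::ₘ (El + Er) ∧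
      (∀ x ∈ El, x ≤ v.key) ∧ (∀ x ∈ Er, v.key ≤ x) ∧
      El.card ≤ Er.card + 1 ∧ Er.card ≤ El.card + 1 ∧
      IsIntervalTree lo hi El (S.filter fun i => hi i < v.key) l ∧
      IsIntervalTree lo hi Er (S.filter fun i => v.key < lo i) r

/-- Cells of the label of an inner node: key, number of the interval, colour (`1` for red). -/
def innerLabelAt {α : Type u} (m : Mem α) (q : ℕ) (v : InnerLabel α) (G : Set ℕ) : Prop :=
  m q = .key v.key ∧ m (q + 1) = .num v.idx ∧ m (q + 2) = .num (if v.red then 1 else 0) ∧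
  G = {q, q + 1, q + 2}

/-- Cells of the label of an interval tree node: key, pointers to the two inner trees. -/
def intervalLabelAt {α : Type u} (m : Mem α) (q : ℕ) (v : IntervalLabel α) (G : Set ℕ) : Prop :=
  ∃ (pl pr : ℕ) (Fl Fr : Set ℕ),
    m q = .key v.key ∧ m (q + 1) = .num pl ∧ m (q + 2) = .num pr ∧
    Stored m (innerLabelAt m) pl v.byLeft Fl ∧ Stored m (innerLabelAt m) pr v.byRight Fr ∧
    Disjoint {q, q + 1, q + 2} Fl ∧ Disjoint ({q, q + 1, q + 2} ∪ Fl) Fr ∧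
    G = {q, q + 1, q + 2} ∪ Fl ∪ Fr

/-- The left (`false`) or right (`true`) endpoint of an interval. -/
def endpoint {α : Type u} {n : ℕ} (lo hi : Fin n → α) (e : Fin n × Bool) : α :=
  if e.2 then hi e.1 else lo e.1

/-- Input for interval trees. The endpoints of the interval `[lo i, hi i]`, `i < n`, are stored
in the cells `1 + 2 i` and `2 + 2 i`, and the cells `2 n + 1, …, 4 n` enumerate all `2 n` endpoints in
sorted order, where the left and the right endpoint of the interval `i` are denoted by the words
`2 i` and `2 i + 1`. All other cells are arbitrary. -/
def HoldsSortedIntervals {α : Type u} [LinearOrder α] {n : ℕ} (m : Mem α) (lo hi : Fin n → α) :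
    Prop :=
  (∀ i : Fin n, m (1 + 2 * i) = .key (lo i) ∧ m (2 + 2 * i) = .key (hi i)) ∧
  ∃ σ : Fin (2 * n) ≃ Fin n × Bool, Monotone (fun j => endpoint lo hi (σ j)) ∧
    ∀ j : Fin (2 * n),
      m (1 + 2 * n + j) = .num (2 * ((σ j).1 : ℕ) + if (σ j).2 then 1 else 0)

/-- Output for interval trees: cell `0` points to an interval tree for all intervals, on the `2 n`
endpoints. -/
def HoldsIntervalTree {α : Type u} [LinearOrder α] {n : ℕ} (lo hi : Fin n → α) (m : Mem α) :
    Prop :=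
  ∃ (p : ℕ) (t : BTree (IntervalLabel α)) (F : Set ℕ),
    m 0 = .num p ∧ Stored m (intervalLabelAt m) p t F ∧ 0 ∉ F ∧
    IsIntervalTree lo hi (Finset.univ.val.map (endpoint lo hi)) Finset.univ t

/-! ## Priority search trees -/

/-- Label of a node of a priority search tree: a point (coordinate and priority) and the splitter
between the coordinates in the two subtrees. -/
structure PriorityLabel (α : Type u) : Type u where
  coord : α
  prio : α
  split : α

/-- `t` is a priority search tree for the multiset `Q` of points (coordinate, priority). A point of
highest priority is at the root; the other points are split evenly by the median of their
coordinates. (The splitter of a leaf is irrelevant.) -/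
def IsPriorityTree {α : Type u} [LinearOrder α] :
    Multiset (α × α) → BTree (PriorityLabel α) → Prop
  | Q, .nil => Q = 0
  | Q, .node v l r =>
    ∃ Ql Qr : Multiset (α × α), Q = (v.coord, v.prio) ::ₘ (Ql + Qr) ∧
      (∀ q ∈ Ql + Qr, q.2 ≤ v.prio) ∧
      (Ql + Qr ≠ 0 → IsMedian v.split ((Ql + Qr).map Prod.fst)) ∧
      (∀ q ∈ Ql, q.1 ≤ v.split) ∧ (∀ q ∈ Qr, v.split ≤ q.1) ∧
      Ql.card ≤ Qr.card + 1 ∧ Qr.card ≤ Ql.card + 1 ∧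
      IsPriorityTree Ql l ∧ IsPriorityTree Qr r

/-- Cells of the label of a priority search tree node: coordinate, priority, splitter. -/
def priorityLabelAt {α : Type u} (m : Mem α) (q : ℕ) (v : PriorityLabel α) (G : Set ℕ) : Prop :=
  m q = .key v.coord ∧ m (q + 1) = .key v.prio ∧ m (q + 2) = .key v.split ∧ G = {q, q + 1, q + 2}

/-- Input for priority search trees: `n` points, sorted by coordinate. The coordinate
and the priority of the point `i < n` are stored in the cells `1 + 2 i` and `2 + 2 i`; all other cells
are arbitrary. -/
def HoldsSortedPoints {α : Type u} [LinearOrder α] {n : ℕ} (m : Mem α) (x y : Fin n → α) : Prop :=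
  Monotone x ∧ ∀ i : Fin n, m (1 + 2 * i) = .key (x i) ∧ m (2 + 2 * i) = .key (y i)

/-- Output for priority search trees: cell `0` points to a priority search tree for all points. -/
def HoldsPriorityTree {α : Type u} [LinearOrder α] {n : ℕ} (x y : Fin n → α) (m : Mem α) : Prop :=
  ∃ (p : ℕ) (t : BTree (PriorityLabel α)) (F : Set ℕ),
    m 0 = .num p ∧ Stored m (priorityLabelAt m) p t F ∧ 0 ∉ F ∧
    IsPriorityTree (Finset.univ.val.map fun i => (x i, y i)) t

end ANP

set_option linter.unusedSectionVars false
set_option linter.unusedSimpArgs false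


namespace ANP

universe u

/-! ## A structured language -/

/-- The value of an operation without the reduction modulo the word size. -/
def Op.ideal (f : Op) (a b : ℕ) : ℕ :=
  match f with
  | .add => a + b
  | .sub => a - b
  | .mul => a * b
  | .div => a / b
  | .mod => a % b
  | .and => a &&& b
  | .or => a ||| b
  | .xor => a ^^^ b
  | .shl => a <<< b
  | .shr => a >>> b

/-- The operands for which the operation is meaningful. -/
def Op.Dom : Op → ℕ → ℕ → Prop
  | .sub, a, b => b ≤ a
  | _, _, _ => True

theorem Op.eval_eq_ideal {w : ℕ} {f : Op} {a b : ℕ} (h : f.Dom a b) (hlt : f.ideal a b < 2 ^ w) :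
    f.eval w a b = f.ideal a b := by
  cases f <;> simp only [Op.eval, Op.ideal, Op.Dom] at * <;> try exact Nat.mod_eq_of_lt hlt
  rw [show a + 2 ^ w - b = (a - b) + 2 ^ w by omega, Nat.add_mod_right, Nat.mod_eq_of_lt hlt]

/-- Numerical expressions over the numerical variables. -/
inductive Expr : Type
  | var (v : ℕ)
  | lit (c : ℕ)
  | bin (f : Op) (a b : Expr)

namespace Expr

instance : Add Expr := ⟨bin .add⟩
instance : Sub Expr := ⟨bin .sub⟩
instance : Mul Expr := ⟨bin .mul⟩
instance : Div Expr := ⟨bin .div⟩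
instance : Mod Expr := ⟨bin .mod⟩
instance (k : ℕ) : OfNat Expr k := ⟨lit k⟩

/-- The value of an expression. -/
def eval (ν : ℕ → ℕ) : Expr → ℕ
  | var v => ν v
  | lit c => c
  | bin f a b => f.ideal (a.eval ν) (b.eval ν)

/-- All subexpressions are meaningful and all intermediate results are below `B`. -/
def Ok (B : ℕ) (ν : ℕ → ℕ) : Expr → Prop
  | var _ => True
  | lit c => c < B
  | bin f a b => a.Ok B ν ∧ b.Ok B ν ∧ f.Dom (a.eval ν) (b.eval ν) ∧
      f.ideal (a.eval ν) (b.eval ν) < B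

/-- Evaluation into the temporary register number `i`. -/
def code : Expr → ℕ → List Instr
  | var v, i => [.move (3 * i + 2) (3 * v)]
  | lit c, i => [.const (3 * i + 2) c]
  | bin f a b, i => a.code i ++ (b.code (i + 1) ++
      [.arith f (3 * i + 2) (3 * i + 2) (3 * (i + 1) + 2)])

section
variable (B : ℕ) (ν : ℕ → ℕ) (a b : Expr) (k : ℕ)
@[simp] theorem eval_var (v : ℕ) : (var v).eval ν = ν v := rfl
@[simp] theorem eval_ofNat : eval ν (no_index (@OfNat.ofNat Expr k _)) = @OfNat.ofNat ℕ k (instOfNatNat k) := rfl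
@[simp] theorem eval_lit : eval ν (lit k) = k := rfl
@[simp] theorem eval_add : (a + b).eval ν = a.eval ν + b.eval ν := rfl
@[simp] theorem eval_sub : (a - b).eval ν = a.eval ν - b.eval ν := rfl
@[simp] theorem eval_mul : (a * b).eval ν = a.eval ν * b.eval ν := rfl
@[simp] theorem eval_div : (a / b).eval ν = a.eval ν / b.eval ν := rfl
@[simp] theorem eval_mod : (a % b).eval ν = a.eval ν % b.eval ν := rfl
@[simp] theorem eval_bin (f : Op) : (bin f a b).eval ν = f.ideal (a.eval ν) (b.eval ν) := rfl
@[simp] theorem ok_var (v : ℕ) : (var v).Ok B ν ↔ True := Iff.rfl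
@[simp] theorem ok_ofNat : Ok B ν (no_index (@OfNat.ofNat Expr k _)) ↔ @OfNat.ofNat ℕ k (instOfNatNat k) < B :=
  Iff.rfl
@[simp] theorem ok_lit : Ok B ν (lit k) ↔ k < B := Iff.rfl
@[simp] theorem ok_add : (a + b).Ok B ν ↔ a.Ok B ν ∧ b.Ok B ν ∧ a.eval ν + b.eval ν < B := by
  show _ ∧ _ ∧ True ∧ _ ↔ _
  simp [Op.ideal]
@[simp] theorem ok_sub : (a - b).Ok B ν ↔
    a.Ok B ν ∧ b.Ok B ν ∧ b.eval ν ≤ a.eval ν ∧ a.eval ν - b.eval ν < B := Iff.rfl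
@[simp] theorem ok_mul : (a * b).Ok B ν ↔ a.Ok B ν ∧ b.Ok B ν ∧ a.eval ν * b.eval ν < B := by
  show _ ∧ _ ∧ True ∧ _ ↔ _
  simp [Op.ideal]
@[simp] theorem ok_div : (a / b).Ok B ν ↔ a.Ok B ν ∧ b.Ok B ν ∧ a.eval ν / b.eval ν < B := by
  show _ ∧ _ ∧ True ∧ _ ↔ _
  simp [Op.ideal]
@[simp] theorem ok_mod : (a % b).Ok B ν ↔ a.Ok B ν ∧ b.Ok B ν ∧ a.eval ν % b.eval ν < B := by
  show _ ∧ _ ∧ True ∧ _ ↔ _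
  simp [Op.ideal]
@[simp] theorem ok_bin (f : Op) : (bin f a b).Ok B ν ↔ a.Ok B ν ∧ b.Ok B ν ∧
    f.Dom (a.eval ν) (b.eval ν) ∧ f.ideal (a.eval ν) (b.eval ν) < B := Iff.rfl
end

end Expr

/-- Conditions: comparison of two numbers or of two key variables. -/
inductive Cond : Type
  | le (a b : Expr)
  | kle (a b : ℕ)

/-- The test leaves `0` in the first temporary register if it fails. -/
def Cond.code : Cond → List Instr
  | .le a b => a.code 0 ++ (b.code 1 ++ [.le 2 2 5])
  | .kle a b => [.le 2 (3 * a + 1) (3 * b + 1)]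

/-- Commands. -/
inductive Cmd : Type
  | skip
  /-- assignment to a numerical variable -/
  | set (x : ℕ) (e : Expr)
  /-- assignment to a key variable -/
  | setK (x y : ℕ)
  | load (x : ℕ) (e : Expr)
  | loadK (x : ℕ) (e : Expr)
  | store (e e' : Expr)
  | storeK (e : Expr) (x : ℕ)
  | seq (c₁ c₂ : Cmd)
  | ite (b : Cond) (c₁ c₂ : Cmd)
  | loop (b : Cond) (c : Cmd)
  /-- two parallel calls of procedure `p`, told apart by the variable `d` -/
  | fork (d p : ℕ)

infixr:67 " ;; " => Cmd.seq

namespace Cmd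

/-- Number of instructions. -/
def len : Cmd → ℕ
  | skip => 0
  | set _ e => (e.code 0).length + 1
  | setK _ _ => 1
  | load _ e => (e.code 0).length + 1
  | loadK _ e => (e.code 0).length + 1
  | store e e' => (e.code 0).length + ((e'.code 1).length + 1)
  | storeK e _ => (e.code 0).length + 1
  | seq c₁ c₂ => c₁.len + c₂.len
  | ite b c₁ c₂ => b.code.length + (1 + (c₁.len + (1 + c₂.len)))
  | .loop b c => b.code.length + (1 + (c.len + 1))
  | fork _ _ => 1

/-- The instructions for a command, to be placed at position `pos`; the procedure `p` is at
position `L p`. -/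
def code (L : ℕ → ℕ) : Cmd → ℕ → List Instr
  | skip, _ => []
  | set x e, _ => e.code 0 ++ [.move (3 * x) 2]
  | setK x y, _ => [.move (3 * x + 1) (3 * y + 1)]
  | load x e, _ => e.code 0 ++ [.load (3 * x) 2]
  | loadK x e, _ => e.code 0 ++ [.load (3 * x + 1) 2]
  | store e e', _ => e.code 0 ++ (e'.code 1 ++ [.store 2 5])
  | storeK e x, _ => e.code 0 ++ [.store 2 (3 * x + 1)]
  | seq c₁ c₂, pos => c₁.code L pos ++ c₂.code L (pos + c₁.len)
  | ite b c₁ c₂, pos =>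
      b.code ++ ([.jumpZero 2 (pos + b.code.length + 1 + c₁.len + 1)] ++
        (c₁.code L (pos + b.code.length + 1) ++
          ([.jump (pos + b.code.length + 1 + c₁.len + 1 + c₂.len)] ++
            c₂.code L (pos + b.code.length + 1 + c₁.len + 1))))
  | .loop b c, pos =>
      b.code ++ ([.jumpZero 2 (pos + b.code.length + 1 + c.len + 1)] ++
        (c.code L (pos + b.code.length + 1) ++ [.jump pos]))
  | fork d p, _ => [.fork (3 * d) (L p)]

theorem length_code (L : ℕ → ℕ) (c : Cmd) (pos : ℕ) : (c.code L pos).length = c.len := by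
  induction c generalizing pos <;> simp_all [code, len] <;> omega

/-- Numerical variables that may be assigned. -/
def mods : Cmd → List ℕ
  | set x _ => [x]
  | load x _ => [x]
  | seq c₁ c₂ => c₁.mods ++ c₂.mods
  | ite _ c₁ c₂ => c₁.mods ++ c₂.mods
  | .loop _ c => c.mods
  | _ => []

/-- Key variables that may be assigned. -/
def kmods : Cmd → List ℕ
  | setK x _ => [x]
  | loadK x _ => [x]
  | seq c₁ c₂ => c₁.kmods ++ c₂.kmods
  | ite _ c₁ c₂ => c₁.kmods ++ c₂.kmods
  | .loop _ c => c.kmods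
  | _ => []

end Cmd

/-- A state of the structured language: numerical variables, key variables, large memory. -/
structure St (α : Type u) : Type u where
  n : ℕ → ℕ
  k : ℕ → Val α
  mem : Mem α

namespace St
variable {α : Type u} (σ : St α) (x y : ℕ) (v : ℕ) (a : Val α) (m : Mem α)

def setN : St α := { σ with n := Function.update σ.n x v }
def setK : St α := { σ with k := Function.update σ.k x a }
def store : St α := { σ with mem := Function.update σ.mem x a }
def withMem : St α := { σ with mem := m }

@[simp] theorem setN_n : (σ.setN x v).n y = if y = x then v else σ.n y := by
  simp [setN, Function.update_apply]
@[simp] theorem setN_k : (σ.setN x v).k = σ.k := rfl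
@[simp] theorem setN_mem : (σ.setN x v).mem = σ.mem := rfl
@[simp] theorem setK_k : (σ.setK x a).k y = if y = x then a else σ.k y := by
  simp [setK, Function.update_apply]
@[simp] theorem setK_n : (σ.setK x a).n = σ.n := rfl
@[simp] theorem setK_mem : (σ.setK x a).mem = σ.mem := rfl
@[simp] theorem store_mem : (σ.store x a).mem y = if y = x then a else σ.mem y := by
  simp [store, Function.update_apply]
@[simp] theorem store_n : (σ.store x a).n = σ.n := rfl
@[simp] theorem store_k : (σ.store x a).k = σ.k := rfl
@[simp] theorem withMem_mem : (σ.withMem m).mem = m := rfl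
@[simp] theorem withMem_n : (σ.withMem m).n = σ.n := rfl
@[simp] theorem withMem_k : (σ.withMem m).k = σ.k := rfl
end St

/-- The program contains the instructions `l` from position `pos` on. -/
def CodeAt (P : Program) (pos : ℕ) (l : List Instr) : Prop :=
  ∀ i x, l[i]? = some x → P[pos + i]? = some x

theorem codeAt_append {P : Program} {pos : ℕ} {l₁ l₂ : List Instr} :
    CodeAt P pos (l₁ ++ l₂) ↔ CodeAt P pos l₁ ∧ CodeAt P (pos + l₁.length) l₂ := by
  constructor
  · refine fun h => ⟨fun i x hi => h i x ?_, fun i x hi => ?_⟩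
    · rw [List.getElem?_append_left]
      · exact hi
      · by_contra hc
        rw [List.getElem?_eq_none (by omega)] at hi
        cases hi
    · rw [Nat.add_assoc]
      refine h _ x ?_
      rw [List.getElem?_append_right (by omega)]
      simpa using hi
  · rintro ⟨h₁, h₂⟩ i x hi
    by_cases hlt : i < l₁.length
    · rw [List.getElem?_append_left hlt] at hi
      exact h₁ i x hi
    · rw [List.getElem?_append_right (by omega)] at hi
      have := h₂ _ x hi
      rwa [show pos + l₁.length + (i - l₁.length) = pos + i by omega] at this

theorem codeAt_singleton {P : Program} {pos : ℕ} {i : Instr} :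
    CodeAt P pos [i] ↔ P[pos]? = some i := by
  constructor
  · exact fun h => h 0 i rfl
  · rintro h (_ | j) x hx
    · simp at hx; simpa [hx] using h
    · simp at hx

/-- A linked program: procedures `Γ`, with procedure `p` at position `L p` of the program `P`, the
size `M` of the small memory, and the word length `w`. -/
structure Ctx where
  P : Program
  L : ℕ → ℕ
  Γ : List Cmd
  M : ℕ
  w : ℕ
  one_le_w : 1 ≤ w
  codeAt : ∀ p c, Γ[p]? = some c → CodeAt P (L p) (c.code L (L p) ++ [.halt])

/-- Number of words. -/
def Ctx.B (C : Ctx) : ℕ := 2 ^ C.w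

theorem Ctx.one_lt_B (C : Ctx) : 1 < C.B := Nat.one_lt_two_pow (by have := C.one_le_w; omega)

/-- A task holds the variables of a state in its registers. -/
structure Rel {α : Type u} (t : Task α) (σ : St α) : Prop where
  n : ∀ v, t.reg (3 * v) = .num (σ.n v)
  k : ∀ v, t.reg (3 * v + 1) = σ.k v

/-- From any outcome of `t'` in memory `m'`, one obtains an outcome of `t` in memory `m` with at
most `T` additional instructions and `D` additional depth, reading from `R` and writing to `W`. -/
def Reaches {α : Type u} [LinearOrder α] (C : Ctx) (t : Task α) (m : Mem α) (t' : Task α)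
    (m' : Mem α) (T D : ℕ) (R W : Set ℕ) : Prop :=
  ∀ o, (∀ ρ : Coins C.w, Exec C.P C.M ρ t' m' o) →
    ∃ o', (∀ ρ : Coins C.w, Exec C.P C.M ρ t m o') ∧ o'.mem = o.mem ∧
      o'.ops + o'.writes ≤ T + (o.ops + o.writes) ∧ o'.depth ≤ D + o.depth ∧
      o'.readSet ⊆ R ∪ o.readSet ∧ o'.writeSet ⊆ W ∪ o.writeSet

section Reaches
variable {α : Type u} [LinearOrder α] {C : Ctx} {t t' t'' : Task α} {m m' m'' : Mem α}
  {T T' D D' : ℕ} {R R' W W' : Set ℕ}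

theorem Reaches.refl : Reaches C t m t m T D R W := fun o h =>
  ⟨o, h, rfl, by omega, by omega, Set.subset_union_right, Set.subset_union_right⟩

theorem Reaches.trans (h : Reaches C t m t' m' T D R W) (h' : Reaches C t' m' t'' m'' T' D' R W) :
    Reaches C t m t'' m'' (T + T') (D + D') R W := by
  intro o ho
  obtain ⟨o₁, e₁, hm₁, hT₁, hD₁, hR₁, hW₁⟩ := h' o ho
  obtain ⟨o₂, e₂, hm₂, hT₂, hD₂, hR₂, hW₂⟩ := h o₁ e₁
  exact ⟨o₂, e₂, hm₂.trans hm₁, by omega, by omega,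
    hR₂.trans (Set.union_subset Set.subset_union_left hR₁),
    hW₂.trans (Set.union_subset Set.subset_union_left hW₁)⟩

theorem Reaches.mono (h : Reaches C t m t' m' T D R W) (hT : T ≤ T') (hD : D ≤ D') (hR : R ⊆ R')
    (hW : W ⊆ W') : Reaches C t m t' m' T' D' R' W' := by
  intro o ho
  obtain ⟨o₂, e₂, hm₂, hT₂, hD₂, hR₂, hW₂⟩ := h o ho
  exact ⟨o₂, e₂, hm₂, by omega, by omega, hR₂.trans (Set.union_subset_union_left _ hR),
    hW₂.trans (Set.union_subset_union_left _ hW)⟩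

theorem Reaches.local {i : Instr} (h : C.P[t.pc]? = some i)
    (hi : ∀ ρ : Coins C.w, i.localStep C.M ρ t = some t') : Reaches C t m t' m 1 1 R W := fun o ho =>
  ⟨_, fun ρ => .localStep h (hi ρ) (ho ρ), rfl, by simp; omega, by simp,
    Set.subset_union_right, Set.subset_union_right⟩

theorem Reaches.load {d a x : ℕ} (h : C.P[t.pc]? = some (.load d a)) (ha : t.reg a = .num x)
    (hx : x ∈ R) : Reaches C t m (t.next.setReg d (m x)) m 1 1 R W := fun o ho =>
  ⟨_, fun ρ => .load h ha (ho ρ), rfl, by simp; omega, by simp,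
    Set.insert_subset (Or.inl hx) Set.subset_union_right, Set.subset_union_right⟩

theorem Reaches.store {b a x : ℕ} (h : C.P[t.pc]? = some (.store a b)) (ha : t.reg a = .num x)
    (hx : x ∈ W) : Reaches C t m t.next (Function.update m x (t.reg b)) 1 1 R W := fun o ho =>
  ⟨_, fun ρ => .store h ha (ho ρ), rfl, by simp; omega, by simp,
    Set.subset_union_right, Set.insert_subset (Or.inl hx) Set.subset_union_right⟩

end Reaches

/-- Cells outside the write set keep their contents. -/
theorem Exec.frame {α : Type u} [LinearOrder α] {w : ℕ} {P : Program} {M : ℕ} {ρ : Coins w}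
    {t : Task α} {m : Mem α} {o : Outcome α} (h : Exec P M ρ t m o) :
    ∀ x, x ∉ o.writeSet → o.mem x = m x := by
  induction h with
  | halt _ => intros; rfl
  | localStep _ _ _ ih => exact ih
  | load _ _ _ ih => exact ih
  | store _ _ _ ih =>
    intro x hx
    simp only [Set.mem_insert_iff, not_or] at hx
    rw [ih x hx.2, Function.update_of_ne hx.1]
  | fork _ _ _ _ _ ih₁ ih₂ ih =>
    intro x hx
    simp only [Set.mem_union, not_or] at hx
    rw [ih x hx.2, mergeMem, if_neg hx.1.1, ih₂ x hx.1.2]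

/-- `c` started in `σ` ends in a state that satisfies `Q`, within `T` instructions and depth `D`,
reading only cells in `R` and writing only cells in `W`. -/
def Tri {α : Type u} [LinearOrder α] (C : Ctx) (c : Cmd) (R W : Set ℕ) (T D : ℕ) (σ : St α)
    (Q : St α → Prop) : Prop :=
  ∀ t : Task α, Rel t σ → CodeAt C.P t.pc (c.code C.L t.pc) →
    ∃ (t' : Task α) (σ' : St α), t'.pc = t.pc + c.len ∧ Rel t' σ' ∧ Q σ' ∧
      (∀ v, v ∉ c.mods → σ'.n v = σ.n v) ∧ (∀ v, v ∉ c.kmods → σ'.k v = σ.k v) ∧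
      (∀ x, x ∉ W → σ'.mem x = σ.mem x) ∧
      Reaches C t σ.mem t' σ'.mem T D R W

section Rules
variable {α : Type u} [LinearOrder α] {C : Ctx} {c c₁ c₂ : Cmd}
  {T T' T₁ T₂ D D' D₁ D₂ : ℕ} {R R' W W' : Set ℕ} {σ : St α} {Q Q' : St α → Prop}

theorem Tri.mono (h : Tri C c R W T D σ Q) (hT : T ≤ T') (hD : D ≤ D') (hR : R ⊆ R')
    (hW : W ⊆ W') (hQ : ∀ σ', Q σ' → (∀ v, v ∉ c.mods → σ'.n v = σ.n v) →
      (∀ v, v ∉ c.kmods → σ'.k v = σ.k v) → (∀ x, x ∉ W → σ'.mem x = σ.mem x) → Q' σ') :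
    Tri C c R' W' T' D' σ Q' := by
  intro t ht hc
  obtain ⟨t', σ', h1, h2, h3, h4, h5, h6, h7⟩ := h t ht hc
  exact ⟨t', σ', h1, h2, hQ _ h3 h4 h5 h6, h4, h5, fun x hx => h6 x fun hx' => hx (hW hx'),
    h7.mono hT hD hR hW⟩

theorem Tri.conseq (h : Tri C c R W T D σ Q) (hT : T ≤ T') (hD : D ≤ D')
    (hQ : ∀ σ', Q σ' → (∀ v, v ∉ c.mods → σ'.n v = σ.n v) →
      (∀ v, v ∉ c.kmods → σ'.k v = σ.k v) → (∀ x, x ∉ W → σ'.mem x = σ.mem x) → Q' σ') :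
    Tri C c R W T' D' σ Q' :=
  h.mono hT hD subset_rfl subset_rfl hQ

theorem Tri.seq (h₁ : Tri C c₁ R W T₁ D₁ σ Q) (h₂ : ∀ σ', Q σ' →
      (∀ v, v ∉ c₁.mods → σ'.n v = σ.n v) → (∀ v, v ∉ c₁.kmods → σ'.k v = σ.k v) →
      (∀ x, x ∉ W → σ'.mem x = σ.mem x) → Tri C c₂ R W T₂ D₂ σ' Q') :
    Tri C (c₁ ;; c₂) R W (T₁ + T₂) (D₁ + D₂) σ Q' := by
  intro t ht hc
  rw [Cmd.code, codeAt_append, Cmd.length_code] at hc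
  obtain ⟨t', σ', h1, h2, h3, h4, h5, h6, h7⟩ := h₁ t ht hc.1
  obtain ⟨t'', σ'', g1, g2, g3, g4, g5, g6, g7⟩ := h₂ σ' h3 h4 h5 h6 t' h2 (h1 ▸ hc.2)
  refine ⟨t'', σ'', by rw [g1, h1, Cmd.len, Nat.add_assoc], g2, g3, fun v hv => ?_, fun v hv => ?_,
    fun x hx => (g6 x hx).trans (h6 x hx), h7.trans g7⟩
  · simp only [Cmd.mods, List.mem_append, not_or] at hv
    rw [g4 v hv.2, h4 v hv.1]
  · simp only [Cmd.kmods, List.mem_append, not_or] at hv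
    rw [g5 v hv.2, h5 v hv.1]

theorem Tri.skip (h : Q σ) : Tri C .skip R W T D σ Q := fun t ht _ =>
  ⟨t, σ, rfl, ht, h, fun _ _ => rfl, fun _ _ => rfl, fun _ _ => rfl, .refl⟩

/-- Registers other than the temporary ones from number `i` on agree. -/
def SameBelow (i : ℕ) (t t' : Task α) : Prop := ∀ r, (∀ j, i ≤ j → r ≠ 3 * j + 2) → t'.reg r = t.reg r

theorem SameBelow.trans {i j : ℕ} {t t' t'' : Task α} (h : SameBelow i t t')
    (h' : SameBelow j t' t'') (hij : i ≤ j) : SameBelow i t t'' := fun r hr => by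
  rw [h' r fun l hl => hr l (hij.trans hl), h r hr]

theorem SameBelow.rel {i : ℕ} {t t' : Task α} (h : SameBelow i t t') (ht : Rel t σ) : Rel t' σ :=
  ⟨fun v => by rw [h _ fun j _ => by omega, ht.n], fun v => by rw [h _ fun j _ => by omega, ht.k]⟩

theorem sameBelow_setReg (i : ℕ) (t : Task α) (v : Val α) :
    SameBelow i t (t.next.setReg (3 * i + 2) v) := fun r hr => by
  show Function.update t.reg (3 * i + 2) v r = t.reg r
  rw [Function.update_of_ne (hr i le_rfl)]

@[simp] theorem Task.setReg_pc (t : Task α) (d : ℕ) (v : Val α) : (t.next.setReg d v).pc = t.pc + 1 :=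
  rfl

theorem Task.setReg_reg (t : Task α) (d r : ℕ) (v : Val α) :
    (t.next.setReg d v).reg r = if r = d then v else t.reg r := by
  show Function.update t.reg d v r = _
  rw [Function.update_apply]

theorem Expr.reaches (e : Expr) (i : ℕ) (t : Task α) (m : Mem α) (ht : Rel t σ)
    (hc : CodeAt C.P t.pc (e.code i)) (hok : e.Ok C.B σ.n) :
    ∃ t' : Task α, t'.pc = t.pc + (e.code i).length ∧ SameBelow i t t' ∧
      t'.reg (3 * i + 2) = .num (e.eval σ.n) ∧
      Reaches C t m t' m (e.code i).length (e.code i).length R W := by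
  induction e generalizing i t with
  | var v =>
    refine ⟨_, rfl, sameBelow_setReg _ _ _, ?_, .local (codeAt_singleton.1 hc) fun ρ => rfl⟩
    rw [Task.setReg_reg, if_pos rfl, ht.n]; rfl
  | lit c =>
    refine ⟨_, rfl, sameBelow_setReg _ _ _, ?_, .local (codeAt_singleton.1 hc) fun ρ => rfl⟩
    rw [Task.setReg_reg, if_pos rfl, Nat.mod_eq_of_lt (show c < 2 ^ C.w from hok)]; rfl
  | bin f a b iha ihb =>
    obtain ⟨ha, hb, hdom, hlt⟩ := hok
    rw [Expr.code, codeAt_append, codeAt_append] at hc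
    obtain ⟨ta, pa, sa, va, ra⟩ := iha i t ht hc.1 ha
    obtain ⟨tb, pb, sb, vb, rb⟩ := ihb (i + 1) ta (sa.rel ht) (pa ▸ hc.2.1) hb
    have va' : tb.reg (3 * i + 2) = .num (a.eval σ.n) := by
      rw [sb _ fun j hj => by omega, va]
    refine ⟨tb.next.setReg (3 * i + 2) (.num (f.eval C.w (a.eval σ.n) (b.eval σ.n))), ?_,
      (sa.trans sb (by omega)).trans (sameBelow_setReg _ _ _) le_rfl, ?_, ?_⟩
    · simp [Expr.code, pb, pa]; omega
    · rw [Task.setReg_reg, if_pos rfl, Op.eval_eq_ideal hdom hlt]; rfl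
    · refine ((ra.trans rb).trans (.local (i := .arith f (3 * i + 2) (3 * i + 2) (3 * (i + 1) + 2))
        ?_ fun ρ => ?_)).mono (T' := _) (D' := _) (by simp [Expr.code, Nat.add_assoc])
          (by simp [Expr.code, Nat.add_assoc]) subset_rfl subset_rfl
      · rw [pb, pa]; exact codeAt_singleton.1 hc.2.2
      · simp only [Instr.localStep, va', vb]


/-- The condition is meaningful. -/
def Cond.Ok (B : ℕ) (σ : St α) : Cond → Prop
  | .le a b => a.Ok B σ.n ∧ b.Ok B σ.n
  | .kle a b => ∃ x y, σ.k a = .key x ∧ σ.k b = .key y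

def Cond.Holds (σ : St α) : Cond → Prop
  | .le a b => a.eval σ.n ≤ b.eval σ.n
  | .kle a b => ∃ x y, σ.k a = .key x ∧ σ.k b = .key y ∧ x ≤ y

theorem Cond.reaches (b : Cond) (t : Task α) (m : Mem α) (ht : Rel t σ)
    (hc : CodeAt C.P t.pc b.code) (hok : b.Ok C.B σ) :
    ∃ (t' : Task α) (v : ℕ), t'.pc = t.pc + b.code.length ∧ Rel t' σ ∧
      t'.reg 2 = .num v ∧ (v = 0 ↔ ¬ b.Holds σ) ∧
      Reaches C t m t' m b.code.length b.code.length R W := by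
  have h1 : 1 % 2 ^ C.w = 1 := Nat.mod_eq_of_lt C.one_lt_B
  cases b with
  | le a b =>
    rw [Cond.code, codeAt_append, codeAt_append] at hc
    obtain ⟨ta, pa, sa, va, ra⟩ := Expr.reaches (R := R) (W := W) a 0 t m ht hc.1 hok.1
    obtain ⟨tb, pb, sb, vb, rb⟩ :=
      Expr.reaches (R := R) (W := W) b 1 ta m (sa.rel ht) (pa ▸ hc.2.1) hok.2
    have va' : tb.reg 2 = .num (a.eval σ.n) := by
      rw [sb _ fun j hj => by omega, va]
    refine ⟨tb.next.setReg (3 * 0 + 2)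
      (.num ((if a.eval σ.n ≤ b.eval σ.n then 1 else 0) % 2 ^ C.w)),
      (if a.eval σ.n ≤ b.eval σ.n then 1 else 0) % 2 ^ C.w, ?_,
      (((sa.trans sb (by omega)).trans (sameBelow_setReg _ _ _) le_rfl)).rel ht, ?_, ?_,
      ((ra.trans rb).trans (.local (i := .le 2 2 5) ?_ fun ρ => ?_)).mono
        (T' := _) (D' := _) (by simp [Cond.code, Nat.add_assoc])
          (by simp [Cond.code, Nat.add_assoc]) subset_rfl subset_rfl⟩
    · simp [Cond.code, pb, pa]; omega
    · rw [Task.setReg_reg, if_pos rfl]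
    · simp only [Cond.Holds]
      split_ifs with h <;> simp [h, h1]
    · rw [pb, pa]; exact codeAt_singleton.1 hc.2.2
    · simp only [Instr.localStep, va', vb]
  | kle a b =>
    obtain ⟨x, y, hx, hy⟩ := hok
    refine ⟨t.next.setReg (3 * 0 + 2)
      (.num ((if x ≤ y then 1 else 0) % 2 ^ C.w)), (if x ≤ y then 1 else 0) % 2 ^ C.w, rfl,
      (sameBelow_setReg _ _ _).rel ht, ?_, ?_, .local (codeAt_singleton.1 hc) fun ρ => ?_⟩
    · rw [Task.setReg_reg, if_pos rfl]
    · simp only [Cond.Holds, hx, hy]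
      split_ifs with h <;> simp [h, h1]
    · simp only [Instr.localStep, ht.k, hx, hy]

theorem Rel.setN {t t' : Task α} (ht : Rel t σ) {x v : ℕ} (h : SameBelow 0 t t')  :
    Rel (t'.next.setReg (3 * x) (.num v)) (σ.setN x v) := by
  have ht' := h.rel ht
  constructor
  · intro y
    rw [Task.setReg_reg, St.setN_n]
    split_ifs with h1 h2 h2
    · rfl
    · omega
    · omega
    · exact ht'.n y
  · intro y
    rw [Task.setReg_reg, if_neg (by omega)]
    exact ht'.k y

theorem Rel.setK {t t' : Task α} (ht : Rel t σ) {x : ℕ} {v : Val α} (h : SameBelow 0 t t')  :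
    Rel (t'.next.setReg (3 * x + 1) v) (σ.setK x v) := by
  have ht' := h.rel ht
  constructor
  · intro y
    rw [Task.setReg_reg, if_neg (by omega)]
    exact ht'.n y
  · intro y
    rw [Task.setReg_reg, St.setK_k]
    split_ifs with h1 h2 h2
    · rfl
    · omega
    · omega
    · exact ht'.k y

theorem Tri.set {x : ℕ} {e : Expr} (hok : e.Ok C.B σ.n) (hQ : Q (σ.setN x (e.eval σ.n))) :
    Tri C (.set x e) R W (Cmd.set x e).len (Cmd.set x e).len σ Q := by
  intro t ht hc
  rw [Cmd.code, codeAt_append] at hc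
  obtain ⟨t', p, s, v, r⟩ := Expr.reaches (R := R) (W := W) e 0 t σ.mem ht hc.1 hok
  refine ⟨t'.next.setReg (3 * x) (.num (e.eval σ.n)), _, ?_, ht.setN s, hQ, fun y hy => ?_,
    fun _ _ => rfl, fun _ _ => rfl, r.trans (.local (i := .move (3 * x) 2) ?_ fun ρ => ?_)⟩
  · simp [p, Cmd.len, Nat.add_assoc]
  · rw [St.setN_n, if_neg (by simpa [Cmd.mods] using hy)]
  · rw [p]; exact codeAt_singleton.1 hc.2
  · simp only [Instr.localStep]; rw [← v]

theorem Tri.setK {x y : ℕ} (hQ : Q (σ.setK x (σ.k y))) :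
    Tri C (.setK x y) R W (Cmd.setK x y).len (Cmd.setK x y).len σ Q := by
  intro t ht hc
  refine ⟨t.next.setReg (3 * x + 1) (σ.k y), _, rfl, ht.setK fun _ _ => rfl, hQ, fun _ _ => rfl,
    fun z hz => ?_, fun _ _ => rfl, .local (codeAt_singleton.1 hc) fun ρ => ?_⟩
  · rw [St.setK_k, if_neg (by simpa [Cmd.kmods] using hz)]
  · simp only [Instr.localStep, ht.k]

theorem Tri.load {x v : ℕ} {e : Expr} (hok : e.Ok C.B σ.n) (hR : e.eval σ.n ∈ R)
    (hm : σ.mem (e.eval σ.n) = .num v) (hQ : Q (σ.setN x v)) :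
    Tri C (.load x e) R W (Cmd.load x e).len (Cmd.load x e).len σ Q := by
  intro t ht hc
  rw [Cmd.code, codeAt_append] at hc
  obtain ⟨t', p, s, hv, r⟩ := Expr.reaches (R := R) (W := W) e 0 t σ.mem ht hc.1 hok
  refine ⟨t'.next.setReg (3 * x) (σ.mem (e.eval σ.n)), _, ?_, by rw [hm]; exact ht.setN s, hQ,
    fun y hy => ?_, fun _ _ => rfl, fun _ _ => rfl, r.trans (.load (d := 3 * x) (a := 2) ?_ hv hR)⟩
  · simp [p, Cmd.len, Nat.add_assoc]
  · rw [St.setN_n, if_neg (by simpa [Cmd.mods] using hy)]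
  · rw [p]; exact codeAt_singleton.1 hc.2

theorem Tri.loadK {x : ℕ} {e : Expr} (hok : e.Ok C.B σ.n) (hR : e.eval σ.n ∈ R)
    (hQ : Q (σ.setK x (σ.mem (e.eval σ.n)))) :
    Tri C (.loadK x e) R W (Cmd.loadK x e).len (Cmd.loadK x e).len σ Q := by
  intro t ht hc
  rw [Cmd.code, codeAt_append] at hc
  obtain ⟨t', p, s, hv, r⟩ := Expr.reaches (R := R) (W := W) e 0 t σ.mem ht hc.1 hok
  refine ⟨t'.next.setReg (3 * x + 1) (σ.mem (e.eval σ.n)), _, ?_, ht.setK s, hQ,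
    fun _ _ => rfl, fun y hy => ?_, fun _ _ => rfl,
    r.trans (.load (d := 3 * x + 1) (a := 2) ?_ hv hR)⟩
  · simp [p, Cmd.len, Nat.add_assoc]
  · rw [St.setK_k, if_neg (by simpa [Cmd.kmods] using hy)]
  · rw [p]; exact codeAt_singleton.1 hc.2

theorem Tri.store {e e' : Expr} (hok : e.Ok C.B σ.n) (hok' : e'.Ok C.B σ.n)
    (hW : e.eval σ.n ∈ W) (hQ : Q (σ.store (e.eval σ.n) (.num (e'.eval σ.n)))) :
    Tri C (.store e e') R W (Cmd.store e e').len (Cmd.store e e').len σ Q := by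
  intro t ht hc
  rw [Cmd.code, codeAt_append, codeAt_append] at hc
  obtain ⟨ta, pa, sa, va, ra⟩ := Expr.reaches (R := R) (W := W) e 0 t σ.mem ht hc.1 hok
  obtain ⟨tb, pb, sb, vb, rb⟩ :=
    Expr.reaches (R := R) (W := W) e' 1 ta σ.mem (sa.rel ht) (pa ▸ hc.2.1) hok'
  have va' : tb.reg 2 = .num (e.eval σ.n) := by
    rw [sb _ fun j hj => by omega, va]
  have hr := (sa.trans sb (by omega)).rel ht
  refine ⟨tb.next, σ.store (e.eval σ.n) (.num (e'.eval σ.n)), ?_, ⟨hr.n, hr.k⟩, hQ, fun _ _ => rfl, fun _ _ => rfl, fun x hx => ?_, ?_⟩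
  · simp [pa, pb, Cmd.len, Nat.add_assoc, Task.next, Task.goto]
  · rw [St.store_mem, if_neg (by rintro rfl; exact hx hW)]
  · have := ((ra.trans rb).trans (Reaches.store (a := 2) (b := 5)
      (by rw [pb, pa]; exact codeAt_singleton.1 hc.2.2) va' hW))
    rw [vb] at this
    exact this.mono (by simp [Cmd.len, Nat.add_assoc]) (by simp [Cmd.len, Nat.add_assoc])
      subset_rfl subset_rfl

theorem Tri.storeK {e : Expr} {x : ℕ} (hok : e.Ok C.B σ.n)
    (hW : e.eval σ.n ∈ W) (hQ : Q (σ.store (e.eval σ.n) (σ.k x))) :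
    Tri C (.storeK e x) R W (Cmd.storeK e x).len (Cmd.storeK e x).len σ Q := by
  intro t ht hc
  rw [Cmd.code, codeAt_append] at hc
  obtain ⟨ta, pa, sa, va, ra⟩ := Expr.reaches (R := R) (W := W) e 0 t σ.mem ht hc.1 hok
  have hr := sa.rel ht
  refine ⟨ta.next, σ.store (e.eval σ.n) (σ.k x), ?_, ⟨hr.n, hr.k⟩, hQ, fun _ _ => rfl, fun _ _ => rfl, fun y hy => ?_, ?_⟩
  · simp [pa, Cmd.len, Nat.add_assoc, Task.next, Task.goto]
  · rw [St.store_mem, if_neg (by rintro rfl; exact hy hW)]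
  · have := (ra.trans (Reaches.store (a := 2) (b := 3 * x + 1)
      (by rw [pa]; exact codeAt_singleton.1 hc.2) va hW))
    rw [hr.k] at this
    exact this

theorem Reaches.jumpZero {t : Task α} {m : Mem α} {l v : ℕ}
    (h : C.P[t.pc]? = some (.jumpZero 2 l)) (hv : t.reg 2 = .num v) :
    Reaches C t m (t.goto (if v = 0 then l else t.pc + 1)) m 1 1 R W := by
  refine .local h fun ρ => ?_
  cases v <;> simp [Instr.localStep, hv, Task.next]

theorem Rel.goto {t : Task α} (ht : Rel t σ) (l : ℕ) : Rel (t.goto l) σ := ⟨ht.n, ht.k⟩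

theorem Tri.ite {b : Cond} (hok : b.Ok C.B σ) (h₁ : b.Holds σ → Tri C c₁ R W T D σ Q)
    (h₂ : ¬ b.Holds σ → Tri C c₂ R W T D σ Q) :
    Tri C (.ite b c₁ c₂) R W (b.code.length + 2 + T) (b.code.length + 2 + D) σ Q := by
  intro t ht hc
  simp only [Cmd.code, codeAt_append, List.length_singleton, Cmd.length_code, codeAt_singleton] at hc
  obtain ⟨hb, hj, hc₁, hj', hc₂⟩ := hc
  obtain ⟨t', v, p, hr, hv, hv0, r⟩ := Cond.reaches (R := R) (W := W) b t σ.mem ht hb hok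
  have r' := r.trans (Reaches.jumpZero (by rw [p]; exact hj) hv)
  by_cases h : b.Holds σ
  · rw [if_neg (by tauto)] at r'
    obtain ⟨t₁, σ₁, p₁, hr₁, hQ, hn, hk, hm, r₁⟩ := h₁ h _ (hr.goto (t'.pc + 1)) (by
      show CodeAt C.P (t'.pc + 1) (c₁.code C.L (t'.pc + 1)); rw [p]; exact hc₁)
    refine ⟨t₁.goto (t.pc + b.code.length + 1 + c₁.len + 1 + c₂.len), σ₁, ?_, hr₁.goto _, hQ,
      fun v hv => hn v ?_, fun v hv => hk v ?_, hm,
      ((r'.trans r₁).trans (.local (i := .jump _) ?_ fun ρ => rfl)).mono (by omega) (by omega)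
        subset_rfl subset_rfl⟩
    · simp [Task.goto, Cmd.len]; omega
    · simp only [Cmd.mods, List.mem_append, not_or] at hv; exact hv.1
    · simp only [Cmd.kmods, List.mem_append, not_or] at hv; exact hv.1
    · rw [p₁]; show C.P[t'.pc + 1 + c₁.len]? = _; rw [p]; exact hj'
  · rw [if_pos (by tauto)] at r'
    obtain ⟨t₁, σ₁, p₁, hr₁, hQ, hn, hk, hm, r₁⟩ := h₂ h _ (hr.goto _) hc₂
    refine ⟨t₁, σ₁, ?_, hr₁, hQ, fun v hv => hn v ?_, fun v hv => hk v ?_, hm,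
      (r'.trans r₁).mono (by omega) (by omega) subset_rfl subset_rfl⟩
    · rw [p₁]; simp [Task.goto, Cmd.len]; omega
    · simp only [Cmd.mods, List.mem_append, not_or] at hv; exact hv.2
    · simp only [Cmd.kmods, List.mem_append, not_or] at hv; exact hv.2

/-- One unfolding of a loop. -/
theorem Tri.loop_step {b : Cond} (hok : b.Ok C.B σ)
    (h₁ : b.Holds σ → Tri C c R W T₁ D₁ σ fun σ' => Tri C (.loop b c) R W T₂ D₂ σ' Q)
    (h₂ : ¬ b.Holds σ → Q σ) :
    Tri C (.loop b c) R W (b.code.length + 2 + T₁ + T₂) (b.code.length + 2 + D₁ + D₂) σ Q := by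
  intro t ht hcode
  have hc := hcode
  simp only [Cmd.code, codeAt_append, List.length_singleton, Cmd.length_code, codeAt_singleton] at hc
  obtain ⟨hb, hj, hc₁, hj'⟩ := hc
  obtain ⟨t', v, p, hr, hv, hv0, r⟩ := Cond.reaches (R := R) (W := W) b t σ.mem ht hb hok
  have r' := r.trans (Reaches.jumpZero (by rw [p]; exact hj) hv)
  by_cases h : b.Holds σ
  · rw [if_neg (by tauto)] at r'
    obtain ⟨t₁, σ₁, p₁, hr₁, hQ, hn, hk, hm, r₁⟩ := h₁ h _ (hr.goto (t'.pc + 1)) (by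
      show CodeAt C.P (t'.pc + 1) (c.code C.L (t'.pc + 1)); rw [p]; exact hc₁)
    obtain ⟨t₂, σ₂, p₂, hr₂, hQ₂, hn₂, hk₂, hm₂, r₂⟩ := hQ (t₁.goto t.pc) (hr₁.goto _) hcode
    refine ⟨t₂, σ₂, p₂, hr₂, hQ₂, fun v hv => (hn₂ v hv).trans (hn v hv),
      fun v hv => (hk₂ v hv).trans (hk v hv), fun x hx => (hm₂ x hx).trans (hm x hx),
      (((r'.trans r₁).trans (.local (i := .jump t.pc) ?_ fun ρ => rfl)).trans r₂).mono
        (by omega) (by omega) subset_rfl subset_rfl⟩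
    rw [p₁]; show C.P[t'.pc + 1 + c.len]? = _; rw [p]; exact hj'
  · rw [if_pos (by tauto)] at r'
    refine ⟨_, σ, ?_, hr.goto _, h₂ h, fun _ _ => rfl, fun _ _ => rfl, fun _ _ => rfl,
      r'.mono (by omega) (by omega) subset_rfl subset_rfl⟩
    simp [Task.goto, Cmd.len]; omega

/-- A loop with at most `k` iterations, the last of which is the one with number `0`. -/
theorem Tri.loop {b : Cond} (I : ℕ → St α → Prop) (Tb Db : ℕ → ℕ)
    (hok : ∀ k σ, I k σ → b.Ok C.B σ)
    (hbody : ∀ k σ, I (k + 1) σ → b.Holds σ → Tri C c R W (Tb k) (Db k) σ fun σ' => I k σ')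
    (hzero : ∀ σ, I 0 σ → ¬ b.Holds σ) (hQ : ∀ k σ, I k σ → ¬ b.Holds σ → Q σ)
    (k : ℕ) (hI : I k σ) :
    Tri C (.loop b c) R W (∑ i ∈ Finset.range k, (Tb i + (b.code.length + 2)) + (b.code.length + 2))
      (∑ i ∈ Finset.range k, (Db i + (b.code.length + 2)) + (b.code.length + 2)) σ Q := by
  induction k generalizing σ with
  | zero =>
    refine (Tri.loop_step (T₁ := 0) (D₁ := 0) (T₂ := 0) (D₂ := 0) (hok _ _ hI)
      (fun h => absurd h (hzero _ hI)) (hQ _ _ hI)).conseq (by simp) (by simp) fun _ h _ _ _ => h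
  | succ k ih =>
    refine (Tri.loop_step (hok _ _ hI) (fun h => (hbody k σ hI h).conseq le_rfl le_rfl
      fun σ' h' _ _ _ => ih h') (hQ _ _ hI)).conseq ?_ ?_ fun _ h _ _ _ => h
    · rw [Finset.sum_range_succ]; omega
    · rw [Finset.sum_range_succ]; omega

theorem Rel.child {t : Task α} (ht : Rel t σ) (d l : ℕ) (b : Bool) :
    Rel (t.child (3 * d) l b) (σ.setN d (if b then 2 else 1)) := by
  constructor
  · intro v
    show Function.update t.reg _ _ _ = _
    rw [Function.update_apply, St.setN_n]
    split_ifs with h1 h2 <;> first | rfl | omega | exact ht.n v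
  · intro v
    show Function.update t.reg _ _ _ = _
    rw [Function.update_of_ne (by omega), St.setN_k, ht.k]

theorem Tri.fork {d p : ℕ} {R₁ R₂ W₁ W₂ : Set ℕ} {Q₁ Q₂ : St α → Prop} (hp : C.Γ[p]? = some c)
    (h₁ : Tri C c R₁ W₁ T₁ D₁ (σ.setN d 1) Q₁) (h₂ : Tri C c R₂ W₂ T₂ D₂ (σ.setN d 2) Q₂)
    (hR₁ : R₁ ⊆ R) (hR₂ : R₂ ⊆ R) (hW₁ : W₁ ⊆ W) (hW₂ : W₂ ⊆ W)
    (hd₁ : Disjoint W₁ (R₂ ∪ W₂)) (hd₂ : Disjoint W₂ R₁)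
    (hQ : ∀ σ₁ σ₂ m', Q₁ σ₁ → Q₂ σ₂ → (∀ x, x ∉ W₂ → m' x = σ₁.mem x) →
      (∀ x, x ∉ W₁ → m' x = σ₂.mem x) → (∀ x, x ∉ W₁ → x ∉ W₂ → m' x = σ.mem x) →
      Q (σ.withMem m')) :
    Tri C (.fork d p) R W (T₁ + T₂ + 3) (max D₁ D₂ + 2) σ Q := by
  intro t ht hc
  have hfork := codeAt_singleton.1 hc
  have hcode := C.codeAt p c hp
  rw [codeAt_append, Cmd.length_code, codeAt_singleton] at hcode
  obtain ⟨t₁, σ₁, p₁, -, q₁, -, -, f₁, r₁⟩ := h₁ _ (ht.child d (C.L p) false) hcode.1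
  obtain ⟨t₂, σ₂, p₂, -, q₂, -, -, f₂, r₂⟩ := h₂ _ (ht.child d (C.L p) true) hcode.1
  obtain ⟨o₁, e₁, m₁, hT₁, hD₁, hr₁, hw₁⟩ := r₁ ⟨σ₁.mem, 1, 0, 1, ∅, ∅⟩ fun ρ =>
    .halt (by rw [p₁]; exact hcode.2)
  obtain ⟨o₂, e₂, m₂, hT₂, hD₂, hr₂, hw₂⟩ := r₂ ⟨σ₂.mem, 1, 0, 1, ∅, ∅⟩ fun ρ =>
    .halt (by rw [p₂]; exact hcode.2)
  simp only [Set.union_empty] at hr₁ hr₂ hw₁ hw₂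
  dsimp only at hT₁ hT₂ hD₁ hD₂ m₁ m₂
  have g₁ : ∀ x, x ∉ o₁.writeSet → σ₁.mem x = σ.mem x := fun x hx => by
    rw [← m₁]; exact (e₁ fun _ => 0).frame x hx
  have g₂ : ∀ x, x ∉ o₂.writeSet → σ₂.mem x = σ.mem x := fun x hx => by
    rw [← m₂]; exact (e₂ fun _ => 0).frame x hx
  have k₁ : ∀ x, x ∉ W₂ → mergeMem o₁ o₂ x = σ₁.mem x := fun x hx => by
    rw [mergeMem, m₁, m₂]
    split_ifs with h
    · rfl
    · rw [g₁ x h, g₂ x fun h' => hx (hw₂ h')]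
  have k₂ : ∀ x, x ∉ W₁ → mergeMem o₁ o₂ x = σ₂.mem x := fun x hx => by
    rw [mergeMem, m₂, if_neg fun h => hx (hw₁ h)]
  have k₃ : ∀ x, x ∉ W₁ → x ∉ W₂ → mergeMem o₁ o₂ x = σ.mem x := fun x h h' => by
    rw [k₁ x h', g₁ x fun h'' => h (hw₁ h'')]
  refine ⟨t.next, σ.withMem (mergeMem o₁ o₂), rfl, ⟨ht.n, ht.k⟩, hQ _ _ _ q₁ q₂ k₁ k₂ k₃,
    fun _ _ => rfl, fun _ _ => rfl, fun x hx => k₃ x (fun h => hx (hW₁ h)) fun h => hx (hW₂ h),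
    fun o ho => ⟨_, fun ρ => .fork hfork (e₁ ρ) (e₂ ρ) ⟨?_, ?_⟩ (ho ρ), rfl, ?_, ?_, ?_, ?_⟩⟩
  · exact hd₁.mono hw₁ (Set.union_subset_union hr₂ hw₂)
  · exact hd₂.mono hw₂ hr₁
  · dsimp only; omega
  · dsimp only; omega
  · exact Set.union_subset_union_left _ (Set.union_subset (hr₁.trans hR₁) (hr₂.trans hR₂))
  · exact Set.union_subset_union_left _ (Set.union_subset (hw₁.trans hW₁) (hw₂.trans hW₂))

/-! ## Weakest preconditions of blocks without loops and forks -/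

/-- Precondition under which the command, which has no loops and forks, establishes `Q`. -/
def wp (B : ℕ) (R W : Set ℕ) : Cmd → (St α → Prop) → St α → Prop
  | .skip, Q, σ => Q σ
  | .set x e, Q, σ => e.Ok B σ.n ∧ Q (σ.setN x (e.eval σ.n))
  | .setK x y, Q, σ => Q (σ.setK x (σ.k y))
  | .load x e, Q, σ => e.Ok B σ.n ∧ e.eval σ.n ∈ R ∧
      ∃ v, σ.mem (e.eval σ.n) = .num v ∧ Q (σ.setN x v)
  | .loadK x e, Q, σ => e.Ok B σ.n ∧ e.eval σ.n ∈ R ∧ Q (σ.setK x (σ.mem (e.eval σ.n)))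
  | .store e e', Q, σ => e.Ok B σ.n ∧ e'.Ok B σ.n ∧ e.eval σ.n ∈ W ∧
      Q (σ.store (e.eval σ.n) (.num (e'.eval σ.n)))
  | .storeK e x, Q, σ => e.Ok B σ.n ∧ e.eval σ.n ∈ W ∧ Q (σ.store (e.eval σ.n) (σ.k x))
  | .seq c₁ c₂, Q, σ => wp B R W c₁ (wp B R W c₂ Q) σ
  | .ite (.le a b) c₁ c₂, Q, σ => a.Ok B σ.n ∧ b.Ok B σ.n ∧
      (a.eval σ.n ≤ b.eval σ.n → wp B R W c₁ Q σ) ∧ (b.eval σ.n < a.eval σ.n → wp B R W c₂ Q σ)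
  | .ite (.kle a b) c₁ c₂, Q, σ => ∃ x y, σ.k a = .key x ∧ σ.k b = .key y ∧
      (x ≤ y → wp B R W c₁ Q σ) ∧ (y < x → wp B R W c₂ Q σ)
  | .loop _ _, _, _ => False
  | .fork _ _, _, _ => False

theorem Tri.basic (h : wp C.B R W c Q σ) : Tri C c R W c.len c.len σ Q := by
  induction c generalizing σ Q with
  | skip => exact .skip h
  | set x e => exact .set h.1 h.2
  | setK x y => exact .setK h
  | load x e => obtain ⟨h1, h2, v, h3, h4⟩ := h; exact .load h1 h2 h3 h4
  | loadK x e => exact .loadK h.1 h.2.1 h.2.2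
  | store e e' => exact .store h.1 h.2.1 h.2.2.1 h.2.2.2
  | storeK e x => exact .storeK h.1 h.2.1 h.2.2
  | seq c₁ c₂ ih₁ ih₂ => exact .seq (ih₁ h) fun σ' h' _ _ _ => ih₂ h'
  | ite b c₁ c₂ ih₁ ih₂ =>
    cases b with
    | le a b =>
      obtain ⟨h1, h2, h3, h4⟩ := h
      refine (Tri.ite (b := .le a b) (T := max c₁.len c₂.len) (D := max c₁.len c₂.len) ⟨h1, h2⟩
        (fun h => (ih₁ (h3 h)).conseq (by omega) (by omega) fun _ h _ _ _ => h)
        (fun h => (ih₂ (h4 (not_le.1 h))).conseq (by omega) (by omega) fun _ h _ _ _ => h)).conseq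
        ?_ ?_ fun _ h _ _ _ => h <;> simp only [Cmd.len] <;> omega
    | kle a b =>
      obtain ⟨x, y, h1, h2, h3, h4⟩ := h
      refine (Tri.ite (b := .kle a b) (T := max c₁.len c₂.len) (D := max c₁.len c₂.len) ⟨x, y, h1, h2⟩
        (fun h => (ih₁ (h3 ?_)).conseq (by omega) (by omega) fun _ h _ _ _ => h)
        (fun h => (ih₂ (h4 ?_)).conseq (by omega) (by omega) fun _ h _ _ _ => h)).conseq
        ?_ ?_ fun _ h _ _ _ => h
      · obtain ⟨x', y', h1', h2', h⟩ := h
        cases h1.symm.trans h1'; cases h2.symm.trans h2'; exact h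
      · exact not_le.1 fun h' => h ⟨x, y, h1, h2, h'⟩
      all_goals simp only [Cmd.len]; omega
  | loop b c ih => exact h.elim
  | fork d p => exact h.elim

end Rules


/-! ## Linking -/

/-- Position of procedure `p`. -/
def procStart : List Cmd → ℕ → ℕ
  | [], _ => 0
  | _, 0 => 0
  | c :: Γ, p + 1 => c.len + 1 + procStart Γ p

def linkFrom (L : ℕ → ℕ) : ℕ → List Cmd → Program
  | _, [] => []
  | pos, c :: Γ => (c.code L pos ++ [.halt]) ++ linkFrom L (pos + (c.len + 1)) Γ

/-- The program consisting of the given procedures. -/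
def link (Γ : List Cmd) : Program := linkFrom (procStart Γ) 0 Γ

theorem codeAt_linkFrom {P : Program} {L : ℕ → ℕ} {pos : ℕ} {Γ : List Cmd}
    (h : CodeAt P pos (linkFrom L pos Γ)) {p : ℕ} {c : Cmd} (hp : Γ[p]? = some c) :
    CodeAt P (pos + procStart Γ p) (c.code L (pos + procStart Γ p) ++ [.halt]) := by
  induction Γ generalizing pos p with
  | nil => simp at hp
  | cons c' Γ ih =>
    rw [linkFrom, codeAt_append] at h
    cases p with
    | zero =>
      simp only [List.getElem?_cons_zero, Option.some.injEq] at hp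
      subst hp
      exact h.1
    | succ p =>
      have := ih (by simpa [Cmd.length_code] using h.2) (by simpa using hp)
      rw [procStart, ← Nat.add_assoc]
      exact this

/-- The linked program with given machine parameters. -/
def mkCtx (Γ : List Cmd) (M w : ℕ) (hw : 1 ≤ w) : Ctx where
  P := link Γ
  L := procStart Γ
  Γ := Γ
  M := M
  w := w
  one_le_w := hw
  codeAt p c hp := by
    have := codeAt_linkFrom (P := link Γ) (pos := 0) (L := procStart Γ) (Γ := Γ)
      (fun i x h => by simpa [link] using h) hp
    simpa using this

/-- The initial state. -/
def initSt {α : Type u} (n : ℕ) (m : Mem α) : St α where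
  n v := if v = 0 then n else 0
  k _ := .num 0
  mem := m

instance (w : ℕ) : IsProbabilityMeasure (coinMeasure w) := by
  unfold coinMeasure
  infer_instance

theorem buildsWithin_of_tri {α : Type u} [LinearOrder α] {Γ : List Cmd} {main : Cmd}
    (h0 : Γ[0]? = some main) {k s K n : ℕ} (hk : 1 ≤ k) {m : Mem α} {Correct : Mem α → Prop}
    (h : ∀ C : Ctx, C.Γ = Γ → k * (Nat.log 2 n + 1) ≤ C.w → ∃ T D R W,
      Tri C main R W T D (initSt n m) (fun σ => Correct σ.mem) ∧
      (2 ≤ n → T + 1 ≤ K * n ∧ D + 1 ≤ K * Nat.log 2 n ^ 2)) :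
    BuildsWithin (link Γ) k s K n m Correct := by
  intro w M hw _
  have hw1 : 1 ≤ w := le_trans (by nlinarith) hw
  obtain ⟨T, D, R, W, htri, hcost⟩ := h (mkCtx Γ M w hw1) rfl hw
  have hcode := (mkCtx Γ M w hw1).codeAt 0 main h0
  have hL : (mkCtx Γ M w hw1).L 0 = 0 := by
    show procStart Γ 0 = 0
    cases Γ <;> rfl
  rw [hL, codeAt_append, Cmd.length_code, codeAt_singleton] at hcode
  have hrel : Rel (Task.init α n) (initSt n m) := by
    constructor
    · intro v
      show Function.update (fun _ : ℕ => (Val.num 0 : Val α)) 0 (.num n) (3 * v) = _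
      rw [Function.update_apply]
      simp only [initSt]
      split_ifs <;> first | rfl | omega
    · intro v
      show Function.update (fun _ : ℕ => (Val.num 0 : Val α)) 0 (.num n) (3 * v + 1) = _
      rw [Function.update_of_ne (by omega)]
      rfl
  obtain ⟨t', σ', hp, -, hQ, -, -, -, hr⟩ := htri (Task.init α n) hrel hcode.1
  obtain ⟨o, ho, hmem, hT, hD, -, -⟩ := hr ⟨σ'.mem, 1, 0, 1, ∅, ∅⟩ fun ρ =>
    .halt (by rw [hp]; exact hcode.2)
  have hrun : ∀ ρ : Coins w, Runs (link Γ) M n m ρ o := ho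
  have hcst : ∀ f : Outcome α → ℝ, cost (w := w) (link Γ) M n m f = fun _ => ENNReal.ofReal (f o) := by
    intro f
    funext ρ
    refine le_antisymm (iInf₂_le o (hrun ρ)) (le_iInf₂ fun o' ho' => ?_)
    rw [(hrun ρ).det ho']
  refine ⟨Filter.Eventually.of_forall fun ρ => ⟨o, hrun ρ, by rw [hmem]; exact hQ⟩, fun hn => ?_⟩
  obtain ⟨hT', hD'⟩ := hcost hn
  dsimp only at hT hD
  have hTn : (o.ops : ℝ) + o.writes ≤ K * n := by exact_mod_cast (show o.ops + o.writes ≤ K * n by omega)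
  refine ⟨fun ω hω => ⟨?_, ?_⟩, ⟨?_, ?_⟩, fun c hc => ?_⟩
  · rw [hcst]; exact aemeasurable_const
  · rw [hcst, lintegral_const, measure_univ, mul_one]
    refine ENNReal.ofReal_le_ofReal ?_
    have h1 : (0 : ℝ) ≤ o.ops := Nat.cast_nonneg _
    have h2 : (0 : ℝ) ≤ o.writes := Nat.cast_nonneg _
    show (o.ops : ℝ) + ω * o.writes ≤ _
    nlinarith
  · rw [hcst]; exact aemeasurable_const
  · rw [hcst, lintegral_const, measure_univ, mul_one]
    refine ENNReal.ofReal_le_ofReal ?_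
    have h1 : (0 : ℝ) ≤ o.ops := Nat.cast_nonneg _
    linarith
  · have : {ρ : Coins w | ¬ ∃ o, Runs (link Γ) M n m ρ o ∧
        (o.depth : ℝ) ≤ (K : ℝ) * c * Real.logb 2 n ^ 2} = ∅ := by
      refine Set.eq_empty_of_forall_notMem fun ρ hρ => hρ ⟨o, hrun ρ, ?_⟩
      have h1 : (o.depth : ℝ) ≤ K * (Nat.log 2 n : ℝ) ^ 2 := by
        exact_mod_cast (show o.depth ≤ K * Nat.log 2 n ^ 2 by omega)
      have h2 : (Nat.log 2 n : ℝ) ≤ Real.logb 2 n := by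
        have := Real.natLog_le_logb n 2
        exact_mod_cast this
      have h3 : (Nat.log 2 n : ℝ) ^ 2 ≤ Real.logb 2 n ^ 2 := by gcongr
      have h4 : (0 : ℝ) ≤ K := Nat.cast_nonneg _
      have h5 : (0 : ℝ) ≤ Real.logb 2 n ^ 2 := sq_nonneg _
      calc (o.depth : ℝ) ≤ K * (Nat.log 2 n : ℝ) ^ 2 := h1
        _ ≤ K * Real.logb 2 n ^ 2 := by gcongr
        _ ≤ (K * c) * Real.logb 2 n ^ 2 := by
          refine mul_le_mul_of_nonneg_right ?_ h5
          nlinarith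
    rw [this, measure_empty]
    exact zero_le

/-! ## Recursion over ranges -/

/-- Shorthand for variables. -/
abbrev V (i : ℕ) : Expr := .var i

/-- A procedure for the range `[a, b)`, with `a` in variable `1`, `b` in variable `2`; the middle of
the range is in variable `3`. The variable `4` tells the calls for the two halves apart, and `pro`
has to set up the variables accordingly. -/
def rangeBody (p : ℕ) (pre post : Cmd) : Cmd :=
  .ite (.le (V 2) (V 1)) .skip (.set 3 ((V 1 + V 2) / 2) ;; pre ;; .fork 4 p ;; post)

def rangeProc (p : ℕ) (pro pre post : Cmd) : Cmd := pro ;; rangeBody p pre post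

/-- Overhead of a call. -/
def overhead (pro post : Cmd) : ℕ := 2 * pro.len + post.len + 30

theorem wp_mono {α : Type u} [LinearOrder α] {B : ℕ} {R W : Set ℕ} {c : Cmd} {Q Q' : St α → Prop}
    {σ : St α} (h : wp B R W c Q σ) (hQ : ∀ σ', Q σ' → Q' σ') : wp B R W c Q' σ := by
  induction c generalizing σ Q Q' with
  | skip => exact hQ _ h
  | set x e => exact ⟨h.1, hQ _ h.2⟩
  | setK x y => exact hQ _ h
  | load x e => obtain ⟨h1, h2, v, h3, h4⟩ := h; exact ⟨h1, h2, v, h3, hQ _ h4⟩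
  | loadK x e => exact ⟨h.1, h.2.1, hQ _ h.2.2⟩
  | store e e' => exact ⟨h.1, h.2.1, h.2.2.1, hQ _ h.2.2.2⟩
  | storeK e x => exact ⟨h.1, h.2.1, hQ _ h.2.2⟩
  | seq c₁ c₂ ih₁ ih₂ => exact ih₁ h fun σ' h' => ih₂ h' hQ
  | ite b c₁ c₂ ih₁ ih₂ =>
    cases b with
    | le a b =>
      obtain ⟨h1, h2, h3, h4⟩ := h
      exact ⟨h1, h2, fun h => ih₁ (h3 h) hQ, fun h => ih₂ (h4 h) hQ⟩
    | kle a b =>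
      obtain ⟨x, y, h1, h2, h3, h4⟩ := h
      exact ⟨x, y, h1, h2, fun h => ih₁ (h3 h) hQ, fun h => ih₂ (h4 h) hQ⟩
  | loop b c ih => exact h.elim
  | fork d p => exact h.elim

section Range
variable {α : Type u} [LinearOrder α] {C : Ctx} {p : ℕ} {pro pre post : Cmd} {X : Type*}
  {lo hi : X → ℕ} {l r : X → X} {F : Set ℕ}

/-- The nodes `X` of the recursion tree have ranges `[lo x, hi x)` and children `l x` and `r x`. -/
structure IsRange (lo hi : X → ℕ) (l r : X → X) : Prop where
  lo_l : ∀ x, lo (l x) = lo x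
  hi_l : ∀ x, hi (l x) = (lo x + hi x) / 2
  lo_r : ∀ x, lo (r x) = (lo x + hi x) / 2 + 1
  hi_r : ∀ x, hi (r x) = hi x

theorem Tri.rangeBody (hp : C.Γ[p]? = some (rangeProc p pro pre post)) (hX : IsRange lo hi l r)
    (I : X → St α → Prop) (J : X → Mem α → Prop) (reg : X → Set ℕ) (Tp Dp Tot Dep : X → ℕ)
    (hI : ∀ x σ, I x σ → σ.n 1 = lo x ∧ σ.n 2 = hi x ∧ lo x + hi x + 2 < C.B)
    (hF : ∀ x σ, I x σ → reg x ⊆ F)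
    (hreg : ∀ x σ, I x σ → lo x < hi x → reg (l x) ⊆ reg x ∧ reg (r x) ⊆ reg x ∧
      Disjoint (reg (l x)) (reg (r x)))
    (hempty : ∀ x σ, I x σ → hi x ≤ lo x → J x σ.mem)
    (hbody : ∀ x σ, I x σ → lo x < hi x → Tri C pre (Fᶜ ∪ reg x) (reg x) (Tp x) (Dp x)
      (σ.setN 3 ((lo x + hi x) / 2)) fun σ' =>
        wp C.B ∅ ∅ pro (I (l x)) (σ'.setN 4 1) ∧ wp C.B ∅ ∅ pro (I (r x)) (σ'.setN 4 2) ∧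
        ∀ m₁ m₂ m', J (l x) m₁ → J (r x) m₂ → (∀ y, y ∉ reg (r x) → m' y = m₁ y) →
          (∀ y, y ∉ reg (l x) → m' y = m₂ y) →
          (∀ y, y ∉ reg (l x) → y ∉ reg (r x) → m' y = σ'.mem y) →
          wp C.B (Fᶜ ∪ reg x) (reg x) post (fun τ => J x τ.mem) (σ'.withMem m'))
    (hTot : ∀ x σ, I x σ → lo x < hi x → overhead pro post + Tp x + Tot (l x) + Tot (r x) ≤ Tot x)
    (hTot0 : ∀ x, overhead pro post ≤ Tot x)
    (hDep : ∀ x σ, I x σ → lo x < hi x → overhead pro post + Dp x + max (Dep (l x)) (Dep (r x)) ≤ Dep x)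
    (hDep0 : ∀ x, overhead pro post ≤ Dep x) (x : X) (σ : St α) (hx : I x σ) :
    Tri C (rangeBody p pre post) (Fᶜ ∪ reg x) (reg x) (Tot x) (Dep x) σ fun σ' => J x σ'.mem := by
  induction hs : hi x - lo x using Nat.strong_induction_on generalizing x σ with
  | _ s ih =>
    obtain ⟨h1, h2, hB⟩ := hI x σ hx
    by_cases hlt : lo x < hi x
    · obtain ⟨hl, hr, hdis⟩ := hreg x σ hx hlt
      have hsl : hi (l x) - lo (l x) < s := by have := hX.hi_l x; have := hX.lo_l x; omega
      have hsr : hi (r x) - lo (r x) < s := by have := hX.hi_r x; have := hX.lo_r x; omega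
      have key : Tri C (.set 3 ((V 1 + V 2) / 2) ;; pre ;; .fork 4 p ;; post)
          (Fᶜ ∪ reg x) (reg x)
          (6 + (Tp x + (((pro.len + Tot (l x)) + (pro.len + Tot (r x)) + 3) + post.len)))
          (6 + (Dp x + ((max (pro.len + Dep (l x)) (pro.len + Dep (r x)) + 2) + post.len)))
          σ fun σ' => J x σ'.mem := by
        refine Tri.seq (Q := fun σ' => σ' = σ.setN 3 ((lo x + hi x) / 2)) ?_ ?_
        · refine Tri.set ?_ ?_
          · simp only [Expr.ok_div, Expr.ok_add, Expr.ok_var, Expr.ok_ofNat, Expr.eval_add,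
              Expr.eval_var, Expr.eval_ofNat, h1, h2, true_and]
            refine ⟨?_, ?_, ?_⟩ <;> omega
          · simp [h1, h2]
        rintro _ rfl - - -
        refine Tri.seq (hbody x σ hx hlt) ?_
        rintro σ' ⟨hwl, hwr, hpost⟩ - - -
        refine Tri.seq (Q := fun σ'' => ∃ m₁ m₂ m', σ'' = σ'.withMem m' ∧ J (l x) m₁ ∧ J (r x) m₂ ∧
            (∀ y, y ∉ reg (r x) → m' y = m₁ y) ∧ (∀ y, y ∉ reg (l x) → m' y = m₂ y) ∧
            (∀ y, y ∉ reg (l x) → y ∉ reg (r x) → m' y = σ'.mem y)) ?_ ?_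
        · refine Tri.fork (c := rangeProc p pro pre post) (R₁ := Fᶜ ∪ reg (l x))
            (R₂ := Fᶜ ∪ reg (r x)) (W₁ := reg (l x)) (W₂ := reg (r x))
            (Q₁ := fun σ' => J (l x) σ'.mem) (Q₂ := fun σ' => J (r x) σ'.mem) hp ?_ ?_
            (Set.union_subset_union_right _ hl) (Set.union_subset_union_right _ hr) hl hr ?_ ?_ ?_
          · refine Tri.seq ((Tri.basic hwl).mono le_rfl le_rfl (Set.empty_subset _)
              (Set.empty_subset _) fun _ h _ _ _ => h) fun τ hτ _ _ _ => ih _ hsl _ _ hτ rfl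
          · refine Tri.seq ((Tri.basic hwr).mono le_rfl le_rfl (Set.empty_subset _)
              (Set.empty_subset _) fun _ h _ _ _ => h) fun τ hτ _ _ _ => ih _ hsr _ _ hτ rfl
          · refine Set.disjoint_union_right.2 ⟨Set.disjoint_union_right.2 ⟨?_, hdis⟩, hdis⟩
            exact disjoint_compl_right.mono_left (hl.trans (hF x σ hx))
          · refine Set.disjoint_union_right.2 ⟨?_, hdis.symm⟩
            exact disjoint_compl_right.mono_left (hr.trans (hF x σ hx))
          · exact fun σ₁ σ₂ m' j₁ j₂ e₁ e₂ e₃ => ⟨_, _, m', rfl, j₁, j₂, e₁, e₂, e₃⟩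
        · rintro _ ⟨m₁, m₂, m', rfl, j₁, j₂, e₁, e₂, e₃⟩ - - -
          exact Tri.basic (hpost m₁ m₂ m' j₁ j₂ e₁ e₂ e₃)
      have hT := hTot x σ hx hlt
      have hD := hDep x σ hx hlt
      refine (Tri.ite (b := .le (V 2) (V 1)) ⟨trivial, trivial⟩ (fun h => ?_) fun _ => key).conseq
        ?_ ?_ fun _ h _ _ _ => h
      · have : σ.n 2 ≤ σ.n 1 := h
        omega
      · simp only [overhead, Cond.code, Expr.code, List.length_append, List.length_singleton] at *
        omega
      · simp only [overhead, Cond.code, Expr.code, List.length_append, List.length_singleton] at *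
        omega
    · have hT := hTot0 x
      have hD := hDep0 x
      refine (Tri.ite (b := .le (V 2) (V 1)) (T := 0) (D := 0) ⟨trivial, trivial⟩
        (fun _ => Tri.skip (hempty x σ hx (not_lt.1 hlt))) fun h => ?_).conseq
        ?_ ?_ fun _ h _ _ _ => h
      · exact absurd (show σ.n 2 ≤ σ.n 1 by omega) h
      · simp only [overhead, Cond.code, Expr.code, List.length_append, List.length_singleton] at *
        omega
      · simp only [overhead, Cond.code, Expr.code, List.length_append, List.length_singleton] at *
        omega

/-- The call of a range procedure: the second call, for the node `x₂`, is void. -/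
theorem Tri.rangeFork (hp : C.Γ[p]? = some (rangeProc p pro pre post)) (hX : IsRange lo hi l r)
    (I : X → St α → Prop) (J : X → Mem α → Prop) (reg : X → Set ℕ) (Tp Dp Tot Dep : X → ℕ)
    (hI : ∀ x σ, I x σ → σ.n 1 = lo x ∧ σ.n 2 = hi x ∧ lo x + hi x + 2 < C.B)
    (hF : ∀ x σ, I x σ → reg x ⊆ F)
    (hreg : ∀ x σ, I x σ → lo x < hi x → reg (l x) ⊆ reg x ∧ reg (r x) ⊆ reg x ∧
      Disjoint (reg (l x)) (reg (r x)))
    (hempty : ∀ x σ, I x σ → hi x ≤ lo x → J x σ.mem)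
    (hbody : ∀ x σ, I x σ → lo x < hi x → Tri C pre (Fᶜ ∪ reg x) (reg x) (Tp x) (Dp x)
      (σ.setN 3 ((lo x + hi x) / 2)) fun σ' =>
        wp C.B ∅ ∅ pro (I (l x)) (σ'.setN 4 1) ∧ wp C.B ∅ ∅ pro (I (r x)) (σ'.setN 4 2) ∧
        ∀ m₁ m₂ m', J (l x) m₁ → J (r x) m₂ → (∀ y, y ∉ reg (r x) → m' y = m₁ y) →
          (∀ y, y ∉ reg (l x) → m' y = m₂ y) →
          (∀ y, y ∉ reg (l x) → y ∉ reg (r x) → m' y = σ'.mem y) →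
          wp C.B (Fᶜ ∪ reg x) (reg x) post (fun τ => J x τ.mem) (σ'.withMem m'))
    (hTot : ∀ x σ, I x σ → lo x < hi x → overhead pro post + Tp x + Tot (l x) + Tot (r x) ≤ Tot x)
    (hTot0 : ∀ x, overhead pro post ≤ Tot x)
    (hDep : ∀ x σ, I x σ → lo x < hi x → overhead pro post + Dp x + max (Dep (l x)) (Dep (r x)) ≤ Dep x)
    (hDep0 : ∀ x, overhead pro post ≤ Dep x) (x₁ x₂ : X) (σ : St α)
    (hx₁ : wp C.B ∅ ∅ pro (I x₁) (σ.setN 4 1)) (hx₂ : wp C.B ∅ ∅ pro (I x₂) (σ.setN 4 2))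
    (hreg₂ : reg x₂ = ∅) (hF₁ : reg x₁ ⊆ F) :
    Tri C (.fork 4 p) (Fᶜ ∪ reg x₁) (reg x₁)
      (Tot x₁ + Tot x₂ + (2 * pro.len + 3)) (max (Dep x₁) (Dep x₂) + (pro.len + 2)) σ
      fun σ' => ∃ m', σ' = σ.withMem m' ∧ J x₁ m' := by
  have hb := Tri.rangeBody hp hX I J reg Tp Dp Tot Dep hI hF hreg hempty hbody hTot hTot0 hDep hDep0
  refine (Tri.fork (c := rangeProc p pro pre post) (R₁ := Fᶜ ∪ reg x₁)
    (R₂ := Fᶜ ∪ reg x₂) (W₁ := reg x₁) (W₂ := reg x₂)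
    (T₁ := pro.len + Tot x₁) (T₂ := pro.len + Tot x₂) (D₁ := pro.len + Dep x₁)
    (D₂ := pro.len + Dep x₂)
    (Q₁ := fun σ' => J x₁ σ'.mem) (Q₂ := fun σ' => J x₂ σ'.mem) hp ?_ ?_
    subset_rfl ?_ subset_rfl ?_ ?_ ?_ ?_).conseq (by omega) (by omega) fun _ h _ _ _ => h
  · exact Tri.seq ((Tri.basic hx₁).mono le_rfl le_rfl (Set.empty_subset _)
      (Set.empty_subset _) fun _ h _ _ _ => h) fun τ hτ _ _ _ => hb _ _ hτ
  · exact Tri.seq ((Tri.basic hx₂).mono le_rfl le_rfl (Set.empty_subset _)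
      (Set.empty_subset _) fun _ h _ _ _ => h) fun τ hτ _ _ _ => hb _ _ hτ
  · simp [hreg₂]
  · simp [hreg₂]
  · rw [hreg₂, Set.union_empty, Set.union_empty]
    exact disjoint_compl_right.mono_left hF₁
  · rw [hreg₂]; exact Set.empty_disjoint _
  · intro σ₁ σ₂ m' j₁ j₂ e₁ e₂ e₃
    refine ⟨m', rfl, ?_⟩
    have : m' = σ₁.mem := funext fun y => e₁ y (by simp [hreg₂])
    rwa [this]

/-- All nodes of the recursion tree below `x` with nonempty range satisfy `Post`. -/
inductive TreeAll (lo hi : X → ℕ) (l r : X → X) (Post : X → Prop) : X → Prop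
  | empty {x : X} (h : hi x ≤ lo x) : TreeAll lo hi l r Post x
  | node {x : X} (h : lo x < hi x) (hx : Post x) (hl : TreeAll lo hi l r Post (l x))
      (hr : TreeAll lo hi l r Post (r x)) : TreeAll lo hi l r Post x

theorem TreeAll.mono (hX : IsRange lo hi l r) {Q Q' : X → Prop} {x : X}
    (h : TreeAll lo hi l r Q x)
    (hQ : ∀ y, lo x ≤ lo y → hi y ≤ hi x → lo y < hi y → Q y → Q' y) :
    TreeAll lo hi l r Q' x := by
  induction h with
  | empty h => exact .empty h
  | @node x h hx hl hr ihl ihr =>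
    refine .node h (hQ _ le_rfl le_rfl h hx) (ihl fun y h1 h2 h3 => hQ y ?_ ?_ h3)
      (ihr fun y h1 h2 h3 => hQ y ?_ ?_ h3)
    · rw [hX.lo_l] at h1; exact h1
    · rw [hX.hi_l] at h2; omega
    · rw [hX.lo_r] at h1; omega
    · rw [hX.hi_r] at h2; exact h2

theorem TreeAll.of_index (hX : IsRange lo hi l r) {Q : ℕ → Prop} {x : X}
    (h : TreeAll lo hi l r (fun x => Q ((lo x + hi x) / 2)) x) {i : ℕ} (h1 : lo x ≤ i)
    (h2 : i < hi x) : Q i := by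
  induction h with
  | empty h => omega
  | @node x h hx hl hr ihl ihr =>
    rw [hX.lo_l, hX.hi_l] at ihl
    rw [hX.lo_r, hX.hi_r] at ihr
    rcases lt_trichotomy i ((lo x + hi x) / 2) with h' | h' | h'
    · exact ihl h1 h'
    · rw [h']; exact hx
    · exact ihr h' h2

theorem Nat.size_half {a b : ℕ} (h : a < b) : Nat.size ((a + b) / 2 - a) + 1 ≤ Nat.size (b - a) ∧
    Nat.size (b - ((a + b) / 2 + 1)) + 1 ≤ Nat.size (b - a) := by
  have h0 : 0 < Nat.size (b - a) := Nat.size_pos.2 (by omega)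
  obtain ⟨k, hk⟩ : ∃ k, Nat.size (b - a) = k + 1 := ⟨_, (Nat.succ_pred_eq_of_pos h0).symm⟩
  have h1 := Nat.lt_size_self (b - a)
  rw [hk, pow_succ] at h1
  rw [hk]
  exact ⟨Nat.succ_le_succ (Nat.size_le.2 (by omega)), Nat.succ_le_succ (Nat.size_le.2 (by omega))⟩

/-- The cells of the indices in the range of `x`. -/
def regionOf (lo hi : X → ℕ) (cells : ℕ → Set ℕ) (x : X) : Set ℕ :=
  {y | ∃ i, lo x ≤ i ∧ i < hi x ∧ y ∈ cells i}

/-- A recursion over ranges in which the command for the node with middle `i` writes to `cells i`,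
so as to satisfy `Post`. -/
theorem Tri.rangeTree (hp : C.Γ[p]? = some (rangeProc p pro pre .skip)) (hX : IsRange lo hi l r)
    (I : X → (ℕ → ℕ) → (ℕ → Val α) → Prop) (Post : X → Mem α → Prop) (cells : ℕ → Set ℕ)
    (N : ℕ) (m₀ : Mem α) (f : ℕ → ℕ) (Dp : ℕ) (hN : 2 * N + 4 ≤ C.B)
    (hI : ∀ (x : X) ν κ, I x ν κ → ν 1 = lo x ∧ ν 2 = hi x ∧ lo x ≤ N + 1 ∧ hi x ≤ N)
    (hdis : ∀ i j, i < N → j < N → i ≠ j → Disjoint (cells i) (cells j))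
    (hF : ∀ i, i < N → cells i ⊆ F)
    (hloc : ∀ x m m', lo x < hi x → hi x ≤ N → (∀ y ∈ cells ((lo x + hi x) / 2), m' y = m y) →
      Post x m → Post x m')
    (hbody : ∀ x (σ : St α), I x σ.n σ.k → lo x < hi x →
      (∀ y, y ∉ F ∨ y ∈ cells ((lo x + hi x) / 2) → σ.mem y = m₀ y) →
      Tri C pre (Fᶜ ∪ cells ((lo x + hi x) / 2)) (cells ((lo x + hi x) / 2))
        (f ((lo x + hi x) / 2)) Dp (σ.setN 3 ((lo x + hi x) / 2)) fun σ' =>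
        wp C.B ∅ ∅ pro (fun τ => I (l x) τ.n τ.k ∧ τ.mem = σ'.mem) (σ'.setN 4 1) ∧
        wp C.B ∅ ∅ pro (fun τ => I (r x) τ.n τ.k ∧ τ.mem = σ'.mem) (σ'.setN 4 2) ∧ Post x σ'.mem)
    (x₁ x₂ : X) (σ : St α)
    (hx₁ : wp C.B ∅ ∅ pro (fun τ => I x₁ τ.n τ.k ∧ τ.mem = σ.mem) (σ.setN 4 1))
    (hx₂ : wp C.B ∅ ∅ pro (fun τ => I x₂ τ.n τ.k ∧ τ.mem = σ.mem) (σ.setN 4 2))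
    (hlo₂ : hi x₂ ≤ lo x₂) (hhi : hi x₁ ≤ N)
    (hm : ∀ y, y ∉ F ∨ y ∈ regionOf lo hi cells x₁ → σ.mem y = m₀ y) :
    Tri C (.fork 4 p) (Fᶜ ∪ regionOf lo hi cells x₁) (regionOf lo hi cells x₁)
      (∑ i ∈ Finset.Ico (lo x₁) (hi x₁), (f i + 2 * overhead pro .skip) + 3 * overhead pro .skip)
      ((Nat.size (hi x₁ - lo x₁) + 2) * (Dp + overhead pro .skip)) σ
      fun σ' => ∃ m', σ' = σ.withMem m' ∧ TreeAll lo hi l r (Post · m') x₁ := by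
  have hsub : ∀ x, hi x ≤ N → regionOf lo hi cells x ⊆ F := by
    rintro x hx y ⟨i, -, h2, h3⟩
    exact hF i (by omega) h3
  have hmid : ∀ x, lo x < hi x → cells ((lo x + hi x) / 2) ⊆ regionOf lo hi cells x :=
    fun x hx y hy => ⟨_, by omega, by omega, hy⟩
  have hregl : ∀ x, lo x < hi x → regionOf lo hi cells (l x) ⊆ regionOf lo hi cells x := by
    rintro x hx y ⟨i, h1, h2, h3⟩
    rw [hX.lo_l] at h1; rw [hX.hi_l] at h2
    exact ⟨i, by omega, by omega, h3⟩
  have hregr : ∀ x, lo x < hi x → regionOf lo hi cells (r x) ⊆ regionOf lo hi cells x := by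
    rintro x hx y ⟨i, h1, h2, h3⟩
    rw [hX.lo_r] at h1; rw [hX.hi_r] at h2
    exact ⟨i, by omega, by omega, h3⟩
  have hsep : ∀ x i y, hi x ≤ N → i < N → (i < lo x ∨ hi x ≤ i) → y ∈ cells i →
      y ∉ regionOf lo hi cells x := by
    rintro x i y hx hi h hy ⟨j, h1, h2, h3⟩
    exact Set.disjoint_left.1 (hdis i j hi (by omega) (by omega)) hy h3
  have hsum : ∀ x, lo x < hi x → ∀ g : ℕ → ℕ,
      ∑ i ∈ Finset.Ico (lo x) (hi x), g i = g ((lo x + hi x) / 2) +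
        ∑ i ∈ Finset.Ico (lo (l x)) (hi (l x)), g i +
        ∑ i ∈ Finset.Ico (lo (r x)) (hi (r x)), g i := by
    intro x hx g
    rw [hX.lo_l, hX.hi_l, hX.lo_r, hX.hi_r,
      ← Finset.sum_Ico_consecutive g (show lo x ≤ (lo x + hi x) / 2 by omega)
        (show (lo x + hi x) / 2 ≤ hi x by omega),
      Finset.sum_eq_sum_Ico_succ_bot (show (lo x + hi x) / 2 < hi x by omega)]
    ring
  refine (Tri.rangeFork (F := F) hp hX
    (I := fun x (σ : St α) => I x σ.n σ.k ∧ ∀ y, y ∉ F ∨ y ∈ regionOf lo hi cells x → σ.mem y = m₀ y)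
    (J := fun x m => TreeAll lo hi l r (Post · m) x) (reg := regionOf lo hi cells)
    (Tp := fun x => f ((lo x + hi x) / 2)) (Dp := fun _ => Dp)
    (Tot := fun x => ∑ i ∈ Finset.Ico (lo x) (hi x), (f i + 2 * overhead pro .skip) +
      overhead pro .skip)
    (Dep := fun x => (Nat.size (hi x - lo x) + 1) * (Dp + overhead pro .skip))
    ?_ ?_ ?_ ?_ ?_ ?_ ?_ ?_ ?_ x₁ x₂ σ ?_ ?_ ?_ ?_).conseq ?_ ?_ fun _ h _ _ _ => h
  · rintro x σ ⟨h, -⟩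
    obtain ⟨h1, h2, h3, h4⟩ := hI x _ _ h
    exact ⟨h1, h2, by omega⟩
  · rintro x σ ⟨h, -⟩
    exact hsub x (hI x _ _ h).2.2.2
  · rintro x σ ⟨h, -⟩ hlt
    obtain ⟨h1, h2, h3, h4⟩ := hI x _ _ h
    refine ⟨hregl x hlt, hregr x hlt, Set.disjoint_left.2 ?_⟩
    rintro y ⟨i, g1, g2, g3⟩
    rw [hX.lo_l] at g1; rw [hX.hi_l] at g2
    exact hsep _ i y (by rw [hX.hi_r]; exact h4) (by omega)
      (Or.inl (by rw [hX.lo_r]; omega)) g3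
  · exact fun x σ _ h => .empty h
  · rintro x σ ⟨h, hm⟩ hlt
    obtain ⟨h1, h2, h3, h4⟩ := hI x _ _ h
    have hmono : cells ((lo x + hi x) / 2) ⊆ regionOf lo hi cells x := hmid x hlt
    refine (hbody x σ h hlt fun y hy => hm y (hy.imp id fun h => hmono h)).mono le_rfl le_rfl
      (Set.union_subset_union_right _ hmono) hmono ?_
    rintro σ' ⟨hl, hr, hP⟩ - - hfr
    have hfr' : ∀ y, y ∉ F ∨ y ∈ regionOf lo hi cells (l x) ∨ y ∈ regionOf lo hi cells (r x) →
        σ'.mem y = m₀ y := by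
      intro y hy
      rw [hfr y, St.setN_mem]
      · refine hm y (hy.imp id ?_)
        rintro (h | h)
        · exact hregl x hlt h
        · exact hregr x hlt h
      · intro hy'
        rcases hy with h | h | h
        · exact h (hF _ (by omega) hy')
        · exact hsep (l x) _ y (by rw [hX.hi_l]; omega) (by omega)
            (Or.inr (by rw [hX.hi_l])) hy' h
        · exact hsep (r x) _ y (by rw [hX.hi_r]; omega) (by omega)
            (Or.inl (by rw [hX.lo_r]; omega)) hy' h
    refine ⟨wp_mono hl ?_, wp_mono hr ?_, ?_⟩
    · rintro τ ⟨h, hτ⟩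
      exact ⟨h, fun y hy => by rw [hτ]; exact hfr' y (hy.imp id Or.inl)⟩
    · rintro τ ⟨h, hτ⟩
      exact ⟨h, fun y hy => by rw [hτ]; exact hfr' y (hy.imp id Or.inr)⟩
    · intro m₁ m₂ m' j₁ j₂ e₁ e₂ e₃
      refine .node hlt (hloc x σ'.mem _ hlt h4 (fun y hy => ?_) hP) (j₁.mono hX ?_) (j₂.mono hX ?_)
      · refine e₃ y ?_ ?_
        · exact hsep (l x) _ y (by rw [hX.hi_l]; omega) (by omega)
            (Or.inr (by rw [hX.hi_l])) hy
        · exact hsep (r x) _ y (by rw [hX.hi_r]; omega) (by omega)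
            (Or.inl (by rw [hX.lo_r]; omega)) hy
      · intro z g1 g2 g3
        rw [hX.lo_l] at g1; rw [hX.hi_l] at g2
        refine hloc z m₁ _ g3 (by omega) fun y hy => e₁ y ?_
        exact hsep (r x) _ y (by rw [hX.hi_r]; omega) (by omega)
            (Or.inl (by rw [hX.lo_r]; omega)) hy
      · intro z g1 g2 g3
        rw [hX.lo_r] at g1; rw [hX.hi_r] at g2
        refine hloc z m₂ _ g3 (by omega) fun y hy => e₂ y ?_
        exact hsep (l x) _ y (by rw [hX.hi_l]; omega) (by omega)
            (Or.inr (by rw [hX.hi_l]; omega)) hy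
  · intro x _ _ hlt
    have := hsum x hlt (fun i => f i + 2 * overhead pro .skip)
    omega
  · intro x; omega
  · intro x _ _ hlt
    obtain ⟨h1, h2⟩ := Nat.size_half hlt
    rw [hX.lo_l, hX.hi_l, hX.lo_r, hX.hi_r]
    have h3 : max ((Nat.size ((lo x + hi x) / 2 - lo x) + 1) * (Dp + overhead pro .skip))
        ((Nat.size (hi x - ((lo x + hi x) / 2 + 1)) + 1) * (Dp + overhead pro .skip)) ≤
        Nat.size (hi x - lo x) * (Dp + overhead pro .skip) :=
      max_le (Nat.mul_le_mul_right _ h1) (Nat.mul_le_mul_right _ h2)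
    linarith
  · intro x; nlinarith
  · exact wp_mono hx₁ fun τ h => ⟨h.1, fun y hy => by rw [h.2]; exact hm y hy⟩
  · refine wp_mono hx₂ fun τ h => ⟨h.1, fun y hy => ?_⟩
    rw [h.2]
    refine hm y (hy.imp id ?_)
    rintro ⟨i, h1, h2, -⟩
    omega
  · refine Set.eq_empty_of_forall_notMem ?_
    rintro y ⟨i, h1, h2, -⟩
    omega
  · exact hsub x₁ hhi
  · have : Finset.Ico (lo x₂) (hi x₂) = ∅ := Finset.Ico_eq_empty (by omega)
    rw [this, Finset.sum_empty]
    simp only [overhead] at *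
    omega
  · have : hi x₂ - lo x₂ = 0 := by omega
    rw [this, max_eq_left (by gcongr; simp)]
    simp only [overhead] at *
    nlinarith

end Range


/-! ## Segment trees for maxima and counts -/

/-- `v` is the position of a largest entry of `y` among the elements of `L` between `s` and `e`;
the rightmost one in case of ties. -/
def IsBest {α : Type u} [LinearOrder α] (y : ℕ → α) (L : Finset ℕ) (s e v : ℕ) : Prop :=
  v ∈ L ∧ s ≤ v ∧ v < e ∧ ∀ i ∈ L, s ≤ i → i < e → y i < y v ∨ (y i = y v ∧ i ≤ v)

/-- Number of elements between `a` and `b`. -/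
def alive (L : Finset ℕ) (a b : ℕ) : ℕ := (L.filter fun i => a ≤ i ∧ i < b).card

theorem alive_add (L : Finset ℕ) {a b c : ℕ} (h : a ≤ b) (h' : b ≤ c) :
    alive L a c = alive L a b + alive L b c := by
  rw [alive, alive, alive, ← Finset.card_union_of_disjoint]
  · congr 1
    ext i
    simp only [Finset.mem_filter, Finset.mem_union]
    constructor
    · rintro ⟨h1, h2, h3⟩
      rcases lt_or_ge i b with h4 | h4
      · exact Or.inl ⟨h1, h2, h4⟩
      · exact Or.inr ⟨h1, h4, h3⟩
    · rintro (⟨h1, h2, h3⟩ | ⟨h1, h2, h3⟩)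
      · exact ⟨h1, h2, by omega⟩
      · exact ⟨h1, by omega, h3⟩
  · rw [Finset.disjoint_filter]
    omega

theorem alive_pos {L : Finset ℕ} {a b i : ℕ} (h : i ∈ L) (ha : a ≤ i) (hb : i < b) :
    0 < alive L a b := Finset.card_pos.2 ⟨i, Finset.mem_filter.2 ⟨h, ha, hb⟩⟩

theorem alive_self (L : Finset ℕ) (a : ℕ) : alive L a a = 0 := by
  rw [alive, Finset.card_eq_zero, Finset.filter_eq_empty_iff]
  omega

theorem alive_le (L : Finset ℕ) (a b : ℕ) : alive L a b ≤ b - a := by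
  rw [← Nat.card_Ico]
  refine Finset.card_le_card fun i hi => ?_
  rw [Finset.mem_filter] at hi
  exact Finset.mem_Ico.2 hi.2

theorem alive_congr {L L' : Finset ℕ} {a b : ℕ} (h : ∀ i, a ≤ i → i < b → (i ∈ L ↔ i ∈ L')) :
    alive L a b = alive L' a b := by
  refine congrArg Finset.card (Finset.ext fun i => ?_)
  simp only [Finset.mem_filter]
  constructor
  · rintro ⟨h1, h2, h3⟩; exact ⟨(h i h2 h3).1 h1, h2, h3⟩
  · rintro ⟨h1, h2, h3⟩; exact ⟨(h i h2 h3).2 h1, h2, h3⟩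

section
variable {α : Type u} [LinearOrder α] {y : ℕ → α} {L : Finset ℕ} {a b c v v' : ℕ}

theorem IsBest.unique (h : IsBest y L a b v) (h' : IsBest y L a b v') : v = v' := by
  obtain ⟨h1, h2, h3, h4⟩ := h
  obtain ⟨g1, g2, g3, g4⟩ := h'
  rcases h4 v' g1 g2 g3 with h | ⟨h, h5⟩
  · rcases g4 v h1 h2 h3 with g | ⟨g, -⟩
    · exact absurd h g.not_gt
    · exact absurd g h.ne'
  · rcases g4 v h1 h2 h3 with g | ⟨g, g5⟩
    · exact absurd h g.ne'
    · omega

theorem IsBest.merge_left (h : IsBest y L a b v) (hbc : b ≤ c)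
    (h' : ∀ i ∈ L, b ≤ i → i < c → y i < y v) : IsBest y L a c v := by
  obtain ⟨h1, h2, h3, h4⟩ := h
  refine ⟨h1, h2, by omega, fun i hi hi1 hi2 => ?_⟩
  rcases lt_or_ge i b with hb | hb
  · exact h4 i hi hi1 hb
  · exact Or.inl (h' i hi hb hi2)

theorem IsBest.merge_right (h : IsBest y L b c v) (hab : a ≤ b)
    (h' : ∀ i ∈ L, a ≤ i → i < b → y i ≤ y v) : IsBest y L a c v := by
  obtain ⟨h1, h2, h3, h4⟩ := h
  refine ⟨h1, by omega, h3, fun i hi hi1 hi2 => ?_⟩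
  rcases lt_or_ge i b with hb | hb
  · rcases (h' i hi hi1 hb).lt_or_eq with h | h
    · exact Or.inl h
    · exact Or.inr ⟨h, by omega⟩
  · exact h4 i hi hb hi2

theorem IsBest.le (h : IsBest y L a b v) {i : ℕ} (hi : i ∈ L) (h1 : a ≤ i) (h2 : i < b) :
    y i ≤ y v := by
  rcases h.2.2.2 i hi h1 h2 with h | h
  · exact h.le
  · exact h.1.le

theorem IsBest.congr {L' : Finset ℕ} (h : IsBest y L a b v)
    (hL : ∀ i, a ≤ i → i < b → (i ∈ L ↔ i ∈ L')) : IsBest y L' a b v :=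
  ⟨(hL v h.2.1 h.2.2.1).1 h.1, h.2.1, h.2.2.1, fun i hi h1 h2 => h.2.2.2 i ((hL i h1 h2).2 hi) h1 h2⟩

theorem exists_isBest (h : 0 < alive L a b) : ∃ v, IsBest y L a b v := by
  obtain ⟨v, hv, hmax⟩ := Finset.exists_max_image _ (fun i => toLex (y i, i)) (Finset.card_pos.1 h)
  simp only [Finset.mem_filter] at hv hmax
  refine ⟨v, hv.1, hv.2.1, hv.2.2, fun i hi h1 h2 => ?_⟩
  simpa [Prod.Lex.le_iff] using hmax i ⟨hi, h1, h2⟩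

end

/-- The entry of the segment tree for the block `[l, l + s)`: position of the best element, and
number of elements. -/
def Block {α : Type u} [LinearOrder α] (y : ℕ → α) (L : Finset ℕ) (n : ℕ) (m : Mem α) (l s : ℕ) :
    Prop :=
  ∃ v, m (4 * n + 2 * (2 * l + s)) = .num v ∧
    m (4 * n + 2 * (2 * l + s) + 1) = .num (alive L l (l + s)) ∧
    (0 < alive L l (l + s) → IsBest y L l (l + s) v)

/-- All dyadic blocks in `[a, b)` have entries. -/
def SegOn {α : Type u} [LinearOrder α] (y : ℕ → α) (L : Finset ℕ) (n a b : ℕ) (m : Mem α) : Prop :=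
  ∀ l k, 2 ^ k ∣ l → a ≤ l → l + 2 ^ k ≤ b → Block y L n m l (2 ^ k)

/-- Recomputes the entry of the block of length `V 6` at `V 5`. -/
def pull : Cmd :=
  .set 7 (V 6 / 2) ;; .load 8 (4 * V 0 + 2 * (2 * V 5 + V 7) + 1) ;;
  .load 9 (4 * V 0 + 2 * (2 * V 5 + V 6 + V 7) + 1) ;;
  .store (4 * V 0 + 2 * (2 * V 5 + V 6) + 1) (V 8 + V 9) ;;
  .load 14 (4 * V 0 + 2 * (2 * V 5 + V 7)) ;; .load 15 (4 * V 0 + 2 * (2 * V 5 + V 6 + V 7)) ;;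
  .ite (.le (V 9) 0) (.set 15 (V 14)) (.ite (.le (V 8) 0) .skip
    (.loadK 0 (2 + 2 * V 14) ;; .loadK 1 (2 + 2 * V 15) ;;
      .ite (.kle 0 1) .skip (.set 15 (V 14)))) ;;
  .store (4 * V 0 + 2 * (2 * V 5 + V 6)) (V 15)

section
variable {α : Type u} [LinearOrder α] {C : Ctx} {n : ℕ} {y : ℕ → α} {L : Finset ℕ}

theorem Block.congr {m m' : Mem α} {l s : ℕ} (h : Block y L n m l s)
    (h1 : m' (4 * n + 2 * (2 * l + s)) = m (4 * n + 2 * (2 * l + s)))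
    (h2 : m' (4 * n + 2 * (2 * l + s) + 1) = m (4 * n + 2 * (2 * l + s) + 1)) :
    Block y L n m' l s := by
  obtain ⟨v, g1, g2, g3⟩ := h
  exact ⟨v, h1.trans g1, h2.trans g2, g3⟩

theorem SegOn.congr {m m' : Mem α} {a b : ℕ} (h : SegOn y L n a b m)
    (hm : ∀ c, 4 * n + 4 * a + 2 ≤ c → c < 4 * n + 4 * b → m' c = m c) : SegOn y L n a b m' := by
  intro l k hd ha hb
  have := Nat.one_le_two_pow (n := k)
  exact (h l k hd ha hb).congr (hm _ (by omega) (by omega)) (hm _ (by omega) (by omega))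

theorem SegOn.mono {m : Mem α} {a b a' b' : ℕ} (h : SegOn y L n a b m) (ha : a ≤ a') (hb : b' ≤ b) :
    SegOn y L n a' b' m := fun l k hd h1 h2 => h l k hd (by omega) (by omega)

theorem wp_pull {R W : Set ℕ} {l h : ℕ} {σ : St α} (hB : 40 * (n + 1) ≤ C.B) (h0 : σ.n 0 = n)
    (h5 : σ.n 5 = l) (h6 : σ.n 6 = 2 * h) (hpos : 1 ≤ h) (hn : l + 2 * h ≤ n)
    (hy : ∀ i < n, σ.mem (2 + 2 * i) = .key (y i))
    (hR : ∀ c, c < 4 * n ∨ (4 * n + 4 * l + 2 ≤ c ∧ c < 4 * n + 4 * (l + 2 * h)) → c ∈ R)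
    (hW : 4 * n + 2 * (2 * l + 2 * h) ∈ W) (hW' : 4 * n + 2 * (2 * l + 2 * h) + 1 ∈ W)
    (b₁ : Block y L n σ.mem l h) (b₂ : Block y L n σ.mem (l + h) h) :
    wp C.B R W pull (fun σ' => Block y L n σ'.mem l (2 * h) ∧
      ∀ c, c ≠ 4 * n + 2 * (2 * l + 2 * h) → c ≠ 4 * n + 2 * (2 * l + 2 * h) + 1 →
        σ'.mem c = σ.mem c) σ := by
  obtain ⟨v₁, t₁, c₁, m₁⟩ := b₁
  obtain ⟨v₂, t₂, c₂, m₂⟩ := b₂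
  rw [show 2 * (l + h) + h = 2 * l + 2 * h + h by ring] at t₂ c₂
  rw [show l + h + h = l + 2 * h by ring] at m₂ c₂
  have hadd := alive_add L (show l ≤ l + h by omega) (show l + h ≤ l + 2 * h by omega)
  have l₁ := alive_le L l (l + h)
  have l₂ := alive_le L (l + h) (l + 2 * h)
  generalize hk₁ : alive L l (l + h) = k₁ at *
  generalize hk₂ : alive L (l + h) (l + 2 * h) = k₂ at *
  have hdiv : 2 * h / 2 = h := by omega
  have fin : ∀ (m : Mem α) (v : ℕ), m (4 * n + 2 * (2 * l + 2 * h)) = .num v →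
      m (4 * n + 2 * (2 * l + 2 * h) + 1) = .num (k₁ + k₂) →
      (0 < k₁ + k₂ → IsBest y L l (l + 2 * h) v) → Block y L n m l (2 * h) := by
    intro m v h1 h2 hv
    exact ⟨v, h1, by rwa [hadd], by rwa [hadd]⟩
  have d1 : ¬ 4 * n + 2 * (2 * l + h) = 4 * n + 2 * (2 * l + 2 * h) + 1 := by omega
  have d2 : ¬ 4 * n + 2 * (2 * l + 2 * h + h) = 4 * n + 2 * (2 * l + 2 * h) + 1 := by omega
  have empty₁ : k₁ = 0 → ∀ i ∈ L, l ≤ i → i < l + h → False := fun hk i hi h1 h2 => by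
    have := alive_pos hi h1 h2
    omega
  have empty₂ : k₂ = 0 → ∀ i ∈ L, l + h ≤ i → i < l + 2 * h → False := fun hk i hi h1 h2 => by
    have := alive_pos hi h1 h2
    omega
  simp [pull, wp, h0, h5, h6, hdiv, t₁, t₂, c₁, c₂, d1, d2]
  refine ⟨by omega, by omega, hR _ (by omega), by omega, hR _ (by omega), by omega, by omega, hW',
    by omega, hR _ (by omega), by omega, hR _ (by omega), by omega, fun hk => ⟨by omega, hW, ?_, ?_⟩,
    fun hk => ⟨by omega, fun hk' => ⟨by omega, hW, ?_, ?_⟩, fun hk' => ?_⟩⟩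
  · refine fin _ v₁ (by simp) (by simp) fun hp => (m₁ (by omega)).merge_left (by omega)
      fun i hi h1 h2 => (empty₂ hk i hi h1 h2).elim
  · intro c h1 h2; simp [h1, h2]
  · refine fin _ v₂ (by simp) (by simp) fun hp => (m₂ (by omega)).merge_right (by omega)
      fun i hi h1 h2 => (empty₁ hk' i hi h1 h2).elim
  · intro c h1 h2; simp [h1, h2]
  have M₁ := m₁ hk'
  have M₂ := m₂ hk
  have h₁ := M₁.2.2.1
  have h₂ := M₂.2.2.1
  rw [if_neg (by omega), if_neg (by omega), hy _ (by omega), hy _ (by omega)]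
  refine ⟨by omega, hR _ (by omega), by omega, hR _ (by omega), _, rfl, _, rfl,
    fun hle => ⟨by omega, hW, ?_, ?_⟩, fun hlt => ⟨by omega, hW, ?_, ?_⟩⟩
  · exact fin _ v₂ (by simp) (by simp) fun _ => M₂.merge_right (by omega)
      fun i hi h1 h2 => (M₁.le hi h1 h2).trans hle
  · intro c h1 h2; simp [h1, h2]
  · exact fin _ v₁ (by simp) (by simp) fun _ => M₁.merge_left (by omega)
      fun i hi h1 h2 => (M₂.le hi h1 h2).trans_lt hlt
  · intro c h1 h2; simp [h1, h2]


end

/-- Prologue that passes the two halves of a range. -/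
def proHalf : Cmd := .ite (.le (V 4) 1) (.set 2 (V 3)) (.set 1 (V 3 + 1))

theorem wp_proHalf_left {α : Type u} [LinearOrder α] {B : ℕ} {R W : Set ℕ} {Q : St α → Prop}
    {σ : St α} (hB : 1 < B) (hQ : Q ((σ.setN 4 1).setN 2 (σ.n 3))) :
    wp B R W proHalf Q (σ.setN 4 1) := by
  simpa [proHalf, wp, hB] using hQ

theorem wp_proHalf_right {α : Type u} [LinearOrder α] {B : ℕ} {R W : Set ℕ} {Q : St α → Prop}
    {σ : St α} (hB : 1 < B) (hn : σ.n 3 + 1 < B) (hQ : Q ((σ.setN 4 2).setN 1 (σ.n 3 + 1))) :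
    wp B R W proHalf Q (σ.setN 4 2) := by
  simpa [proHalf, wp, hB, hn] using hQ

/-- Computes the entry of the segment tree with number `V 3`. -/
def segPost : Cmd :=
  .set 5 ((V 1 - 1) / 2) ;; .set 6 ((V 2 - V 1 + 1) / 2) ;;
  .ite (.le (V 5 + V 6) (V 0))
    (.ite (.le (V 6) 1) (.store (4 * V 0 + 2 * V 3) (V 5) ;; .store (4 * V 0 + 2 * V 3 + 1) 1) pull)
    .skip

def segProc (p : ℕ) : Cmd := rangeProc p proHalf .skip segPost

/-- The entries for the blocks with numbers in `[lo, hi)`, in the in-order numbering. -/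
def SegIn {α : Type u} [LinearOrder α] (y : ℕ → α) (n lo hi : ℕ) (m : Mem α) : Prop :=
  ∀ l k, 2 ^ k ∣ l → lo ≤ 2 * l + 1 → 2 * l + 2 * 2 ^ k ≤ hi → l + 2 ^ k ≤ n →
    Block y (Finset.range n) n m l (2 ^ k)

theorem isRange_pair : IsRange (X := ℕ × ℕ) Prod.fst Prod.snd (fun x => (x.1, (x.1 + x.2) / 2))
    (fun x => ((x.1 + x.2) / 2 + 1, x.2)) :=
  ⟨fun _ => rfl, fun _ => rfl, fun _ => rfl, fun _ => rfl⟩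

section
variable {α : Type u} [LinearOrder α] {C : Ctx} {n : ℕ} {y : ℕ → α}

theorem segTree {p S K : ℕ} (hp : C.Γ[p]? = some (segProc p)) (hB : 40 * (n + 1) ≤ C.B)
    (hn : 1 ≤ n) (hS : S = 2 ^ K) (hSn : S ≤ 2 * n) {σ : St α}
    (h0 : σ.n 0 = n) (h1 : σ.n 1 = 1) (h2 : σ.n 2 = 2 * S) (h3 : σ.n 3 = 2 * S)
    (hy : ∀ i < n, σ.mem (2 + 2 * i) = .key (y i)) :
    Tri C (.fork 4 p) Set.univ {x | 4 * n ≤ x ∧ x < 12 * n}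
      (2 * S * (3 * overhead proHalf segPost))
      ((Nat.size (2 * S - 1) + 2) * (2 * overhead proHalf segPost)) σ
      (fun σ' => ∃ m', σ' = σ.withMem m' ∧ SegIn y n 1 (2 * S) m') := by
  have hS1 : 1 ≤ S := hS ▸ Nat.one_le_two_pow
  refine (Tri.rangeFork (X := ℕ × ℕ) (F := {x | 4 * n ≤ x ∧ x < 12 * n}) hp isRange_pair
    (I := fun x (σ : St α) => σ.n 0 = n ∧ σ.n 1 = x.1 ∧ σ.n 2 = x.2 ∧
      (∀ i < n, σ.mem (2 + 2 * i) = .key (y i)) ∧ x.1 ≤ 4 * n + 1 ∧ x.2 ≤ 4 * n ∧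
      (x.1 < x.2 → ∃ l k, 2 ^ k ∣ l ∧ x.1 = 2 * l + 1 ∧ x.2 = 2 * l + 2 * 2 ^ k))
    (J := fun x m => SegIn y n x.1 x.2 m) (reg := fun x => {c | 4 * n + 2 * x.1 ≤ c ∧ c < 4 * n + 2 * x.2})
    (Tp := fun _ => 0) (Dp := fun _ => 0)
    (Tot := fun x => (x.2 - x.1) * (2 * overhead proHalf segPost) + overhead proHalf segPost)
    (Dep := fun x => (Nat.size (x.2 - x.1) + 1) * (overhead proHalf segPost))
    ?_ ?_ ?_ ?_ ?_ ?_ ?_ ?_ ?_ (1, 2 * S) (2 * S + 1, 2 * S) σ ?_ ?_ ?_ ?_).mono ?_ ?_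
      (Set.subset_univ _) ?_ fun _ h _ _ _ => h
  · rintro ⟨a, b⟩ σ ⟨g0, g1, g2, gy, ga, gb, g⟩
    exact ⟨g1, g2, by dsimp only at *; omega⟩
  · rintro ⟨a, b⟩ σ ⟨g0, g1, g2, gy, ga, gb, g⟩ c ⟨hc, hc'⟩
    simp only [Set.mem_ofPred_eq] at *
    omega
  · rintro ⟨a, b⟩ σ - hlt
    simp only at hlt
    refine ⟨fun c hc => ?_, fun c hc => ?_, Set.disjoint_left.2 fun c hc hc' => ?_⟩ <;>
    · simp only [Set.mem_ofPred_eq] at *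
      omega
  · rintro ⟨a, b⟩ σ - hle l k - h1 h2
    have := Nat.one_le_two_pow (n := k)
    simp only at *
    omega
  · rintro ⟨a, b⟩ σ ⟨g0, g1, g2, gy, ga, gb, g⟩ hlt
    obtain ⟨l, k, hdvd, rfl, rfl⟩ := g hlt
    simp only at ga gb hlt g1 g2
    have hk := Nat.one_le_two_pow (n := k)
    have hmid : (2 * l + 1 + (2 * l + 2 * 2 ^ k)) / 2 = 2 * l + 2 ^ k := by omega
    refine Tri.skip ?_
    simp only [hmid]
    have hch : 2 ≤ 2 ^ k → ∃ k', k = k' + 1 := fun h => by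
      cases k with
      | zero => simp at h
      | succ k' => exact ⟨k', rfl⟩
    refine ⟨?_, ?_, ?_⟩
    · refine wp_proHalf_left C.one_lt_B ⟨?_, ?_, ?_, gy, by omega, by omega, fun hlt => ?_⟩
      · simpa using g0
      · simpa using g1
      · simp
      obtain ⟨k', rfl⟩ := hch (by omega)
      rw [pow_succ] at *
      exact ⟨l, k', (Dvd.intro _ rfl).trans hdvd, by omega, by omega⟩
    · refine wp_proHalf_right C.one_lt_B (by simp; omega)
        ⟨?_, ?_, ?_, gy, by omega, by omega, fun hlt => ?_⟩
      · simpa using g0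
      · simp
      · simpa using g2
      obtain ⟨k', rfl⟩ := hch (by omega)
      rw [pow_succ] at *
      exact ⟨l + 2 ^ k', k', (Nat.dvd_add_right ((Dvd.intro _ rfl).trans hdvd)).2 (dvd_refl _),
        by omega, by omega⟩
    · intro m₁ m₂ m' j₁ j₂ e₁ e₂ e₃
      have hin : ∀ i < n, m' (2 + 2 * i) = .key (y i) := fun i hi => by
        rw [e₃ _ (by simp; omega) (by simp; omega)]; exact gy i hi
      have hs : (2 * l + 2 * 2 ^ k - (2 * l + 1) + 1) / 2 = 2 ^ k := by omega
      have fin : ∀ m : Mem α, (∀ c, c ≠ 4 * n + 2 * (2 * l + 2 ^ k) →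
            c ≠ 4 * n + 2 * (2 * l + 2 ^ k) + 1 → m c = m' c) →
          (l + 2 ^ k ≤ n → Block y (Finset.range n) n m l (2 ^ k)) →
          SegIn y n (2 * l + 1) (2 * l + 2 * 2 ^ k) m := by
        intro m hm hv l' k' hd h1 h2 h3
        have hk' := Nat.one_le_two_pow (n := k')
        rcases lt_or_ge k' k with hlt | hge
        · obtain ⟨k, rfl⟩ : ∃ j, k = j + 1 := ⟨k - 1, by omega⟩
          have hpk : 2 ^ k' ∣ 2 ^ k := pow_dvd_pow _ (by omega)
          obtain ⟨q, rfl⟩ := hd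
          obtain ⟨r, hr⟩ : 2 ^ k' ∣ l + 2 ^ k :=
            (Nat.dvd_add_right (((pow_dvd_pow 2 (by omega : k' ≤ k + 1))).trans hdvd)).2 hpk
          rw [pow_succ] at *
          rcases lt_or_ge q r with hq | hq
          · have hle : 2 ^ k' * (q + 1) ≤ 2 ^ k' * r := Nat.mul_le_mul_left _ hq
            rw [Nat.mul_succ] at hle
            refine (j₁ (2 ^ k' * q) k' ⟨q, rfl⟩ (by omega) (by omega) h3).congr ?_ ?_ <;>
              rw [hm _ (by omega) (by omega), e₁ _ (by simp; omega)]
          · have hle : 2 ^ k' * r ≤ 2 ^ k' * q := Nat.mul_le_mul_left _ hq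
            refine (j₂ (2 ^ k' * q) k' ⟨q, rfl⟩ (by simp; omega) (by omega) h3).congr ?_ ?_ <;>
              rw [hm _ (by omega) (by omega), e₂ _ (by simp; omega)]
        · have hle : 2 ^ k ≤ 2 ^ k' := pow_le_pow_right₀ (by norm_num) hge
          obtain rfl : l' = l := by omega
          have : 2 ^ k' = 2 ^ k := by omega
          rw [this] at h3 ⊢
          exact hv h3
      have hB1 := C.one_lt_B
      cases k with
      | zero =>
        simp [segPost, wp, g0, g1, g2]
        refine ⟨by omega, by omega, by omega, fun h => ⟨by omega, by omega, by omega, by omega,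
          by omega, fin _ (fun c h1 h2 => by simp at h1 h2; simp [h1, h2]) fun _ => ?_⟩,
          fun h => fin _ (fun _ _ _ => rfl) fun h' => by simp at h'; omega⟩
        have ha : alive (Finset.range n) l (l + 1) = 1 :=
          le_antisymm ((alive_le _ _ _).trans (by omega))
            (alive_pos (i := l) (by simp; omega) le_rfl (by omega))
        rw [pow_zero]
        exact ⟨l, by simp, by simp [ha], fun _ => ⟨by simp; omega, le_rfl, by omega,
          fun i _ h1 h2 => Or.inr ⟨by congr 1; omega, by omega⟩⟩⟩
      | succ k =>
        have hk' := Nat.one_le_two_pow (n := k)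
        rw [pow_succ'] at *
        have hdk : 2 ^ k ∣ l := (Dvd.intro_left _ rfl).trans hdvd
        simp [segPost, wp, g0, g1, g2, hs]
        refine ⟨by omega, by omega, by omega, fun h => ⟨by omega, fun h' => by omega, fun h' => ?_⟩,
          fun h => fin _ (fun _ _ _ => rfl) (by omega)⟩
        refine wp_mono (wp_pull (y := y) (L := Finset.range n) (n := n) (l := l) (h := 2 ^ k) hB
          (by simpa using g0) (by simp) (by simp) Nat.one_le_two_pow h (by simpa using hin) ?_ ?_ ?_ ?_ ?_) ?_
        · intro c hc
          simp
          omega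
        · simp; omega
        · simp; omega
        · refine (j₁ l k hdk (by simp) (by omega) (by omega)).congr ?_ ?_ <;>
            simp only [St.setN_mem, St.withMem_mem] <;> rw [e₁ _ (by simp only [Set.mem_ofPred_eq]; omega)]
        · refine (j₂ (l + 2 ^ k) k ((Nat.dvd_add_right hdk).2 (dvd_refl _)) (by omega)
            (by omega) (by omega)).congr ?_ ?_ <;>
            simp only [St.setN_mem, St.withMem_mem] <;>
            rw [e₂ _ (by simp only [Set.mem_ofPred_eq]; omega)]
        · rintro τ ⟨h1, h2⟩
          exact fin _ h2 fun _ => h1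
  · rintro ⟨a, b⟩ _ _ hlt
    simp only at hlt ⊢
    have : b - a = 1 + ((a + b) / 2 - a) + (b - ((a + b) / 2 + 1)) := by omega
    rw [this]
    ring_nf
    omega
  · intro x; omega
  · rintro ⟨a, b⟩ _ _ hlt
    simp only at hlt ⊢
    obtain ⟨h1, h2⟩ := Nat.size_half hlt
    have h3 := max_le (Nat.mul_le_mul_right (overhead proHalf segPost) h1)
      (Nat.mul_le_mul_right (overhead proHalf segPost) h2)
    linarith
  · intro x; nlinarith
  · refine wp_proHalf_left C.one_lt_B ⟨?_, ?_, ?_, hy, by omega, by omega, fun _ =>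
      ⟨0, K, by simp, by simp, by simp [hS]⟩⟩
    · simpa using h0
    · simpa using h1
    · simpa using h3
  · refine wp_proHalf_right C.one_lt_B (by omega) ⟨?_, ?_, ?_, hy, ?_, by simp; omega,
      fun h => ?_⟩
    · simpa using h0
    · simpa using h3
    · simpa using h2
    · simp; omega
    · simp at h
  · ext; simp; omega
  · intro c hc
    simp only [Set.mem_ofPred_eq] at *
    omega
  · simp only [overhead]
    obtain ⟨j, hj⟩ : ∃ j, 2 * S = j + 1 := ⟨2 * S - 1, by omega⟩
    rw [hj]
    simp
    nlinarith
  · simp only [overhead]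
    simp
    nlinarith
  · intro c hc
    simp only [Set.mem_ofPred_eq] at *
    omega

end


/-! ## Searching in a segment tree -/

/-- Passes over the block of length `V 6` at `V 13`, if it has at most `V 17` elements. -/
def takeBlock (fail : Cmd) : Cmd :=
  .load 8 (4 * V 0 + 2 * (2 * V 13 + V 6) + 1) ;;
  .ite (.le (V 8) (V 17))
    (.ite (.le (V 8) 0) .skip (.load 7 (4 * V 0 + 2 * (2 * V 13 + V 6)) ;;
      .ite (.le (V 12) (V 17)) (.set 16 (V 7))
        (.loadK 0 (2 + 2 * V 16) ;; .loadK 1 (2 + 2 * V 7) ;;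
          .ite (.kle 0 1) (.set 16 (V 7)) .skip)) ;;
      .set 17 (V 17 - V 8) ;; .set 13 (V 13 + V 6))
    fail

def walkUp : Cmd :=
  .ite (.le 1 (V 13 / V 6 % 2)) (takeBlock (.set 9 0)) .skip ;; .set 6 (2 * V 6)

def walkDown : Cmd :=
  .set 6 (V 6 / 2) ;; .ite (.le (V 13 + V 6) (V 11)) (takeBlock .skip) .skip

/-- Moves from position `V 10` to the right until `V 12` elements have been passed and the
next one is reached, but not beyond `V 11`. The position is returned in variable `13`, and the
best element passed in variable `16`. -/
def walk : Cmd :=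
  (.set 13 (V 10) ;; .set 17 (V 12) ;; .set 6 1 ;; .set 9 (V 11) ;; .set 16 0) ;;
  .loop (.le (V 13 + V 6) (V 9)) walkUp ;; .loop (.le 2 (V 6)) walkDown

section
variable {α : Type u} [LinearOrder α] {C : Ctx} {n : ℕ} {y : ℕ → α} {L : Finset ℕ}

/-- The walk from `a` has passed `r₀ - r` elements and is at position `p`. -/
structure WalkInv (y : ℕ → α) (L : Finset ℕ) (n : ℕ) (m : Mem α) (a b r₀ p r : ℕ) (σ : St α) :
    Prop where
  mem : σ.mem = m
  h0 : σ.n 0 = n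
  h11 : σ.n 11 = b
  h12 : σ.n 12 = r₀
  h13 : σ.n 13 = p
  h17 : σ.n 17 = r
  ap : a ≤ p
  pb : p ≤ b
  count : r + alive L a p = r₀
  best : 0 < alive L a p → IsBest y L a p (σ.n 16)

theorem WalkInv.setN {m : Mem α} {a b r₀ p r : ℕ} {σ : St α} (h : WalkInv y L n m a b r₀ p r σ)
    {x v : ℕ} (hx : x ≠ 0 ∧ x ≠ 11 ∧ x ≠ 12 ∧ x ≠ 13 ∧ x ≠ 17 ∧ x ≠ 16) :
    WalkInv y L n m a b r₀ p r (σ.setN x v) := by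
  obtain ⟨h1, h2, h3, h4, h5, h6⟩ := hx
  have e : ∀ z, z ≠ x → (σ.setN x v).n z = σ.n z := fun z hz => by simp [hz]
  refine ⟨h.mem, ?_, ?_, ?_, ?_, ?_, h.ap, h.pb, h.count, ?_⟩ <;> rw [e _ (by omega)]
  · exact h.h0
  · exact h.h11
  · exact h.h12
  · exact h.h13
  · exact h.h17
  · exact h.best

theorem wp_takeBlock {R : Set ℕ} {fail : Cmd} {m : Mem α} {a b r₀ p r k : ℕ} {σ : St α}
    {Q : St α → Prop} (hB : 40 * (n + 1) ≤ C.B) (hr₀ : r₀ < C.B) (hb : b ≤ n)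
    (hR : ∀ c, c < 4 * n ∨ (4 * n + 4 * a + 2 ≤ c ∧ c < 4 * n + 4 * b) → c ∈ R)
    (hy : ∀ i < n, m (2 + 2 * i) = .key (y i)) (hT : SegOn y L n a b m)
    (h : WalkInv y L n m a b r₀ p r σ) (h6 : σ.n 6 = 2 ^ k) (hd : 2 ^ k ∣ p) (hp : p + 2 ^ k ≤ b)
    (hQ : ∀ σ' r', WalkInv y L n m a b r₀ (p + 2 ^ k) r' σ' → r = r' + alive L p (p + 2 ^ k) →
      σ'.n 6 = 2 ^ k → σ'.n 9 = σ.n 9 → Q σ')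
    (hQ' : r < alive L p (p + 2 ^ k) → ∀ σ', WalkInv y L n m a b r₀ p r σ' →
      σ'.n 6 = 2 ^ k → σ'.n 9 = σ.n 9 → wp C.B R ∅ fail Q σ') :
    wp C.B R ∅ (takeBlock fail) Q σ := by
  have hap := h.ap
  have hk := Nat.one_le_two_pow (n := k)
  obtain ⟨v, hv, hc, hbest⟩ := hT p k hd hap hp
  have hadd := alive_add L hap (show p ≤ p + 2 ^ k by omega)
  have hle := alive_le L p (p + 2 ^ k)
  have hcount := h.count
  simp [takeBlock, wp, h.h0, h.h13, h6, h.mem, hc, hv, h.h17, h.h12]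
  refine ⟨by omega, hR _ (by omega), fun hle => ⟨by omega, fun h0 => ⟨by omega, by omega, ?_⟩,
    fun hpos => ⟨by omega, hR _ (by omega), fun hr => ⟨by omega, by omega, ?_⟩, fun hr => ?_⟩⟩,
    fun hlt => hQ' hlt _ (h.setN (by simp)) (by simpa using h6) (by simp)⟩
  · refine hQ _ (r - alive L p (p + 2 ^ k)) ⟨h.mem, ?_, ?_, ?_, ?_, ?_, by omega, hp, by omega, ?_⟩
      (by omega) ?_ ?_
    · simp [h.h0]
    · simp [h.h11]
    · simp [h.h12]
    · simp [h.h13]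
    · simp [h0]
    · intro h'
      refine (?_ : IsBest y L a (p + 2 ^ k) (σ.n 16))
      refine (h.best (by omega)).merge_left (by omega) fun i hi h1 h2 => ?_
      have := alive_pos hi h1 h2
      omega
    · simp [h6]
    · simp
  · have : alive L a p = 0 := by omega
    refine hQ _ (r - alive L p (p + 2 ^ k)) ⟨h.mem, ?_, ?_, ?_, ?_, ?_, by omega, hp, by omega, ?_⟩
      (by omega) ?_ ?_
    · simp [h.h0]
    · simp [h.h11]
    · simp [h.h12]
    · simp [h.h13]
    · simp
    · intro h'
      simp
      refine (hbest hpos).merge_right hap fun i hi h1 h2 => ?_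
      have := alive_pos hi h1 h2
      omega
    · simp [h6]
    · simp
  · have b₁ := h.best (by omega)
    have b₂ := hbest hpos
    have l₁ := b₁.2.2.1
    have l₂ := b₂.2.2.1
    rw [hy _ (by omega), hy _ (by omega)]
    refine ⟨by omega, hR _ (by omega), by omega, hR _ (by omega), _, rfl, _, rfl,
      fun hyy => ⟨by omega, by omega, ?_⟩, fun hyy => ⟨by omega, by omega, ?_⟩⟩
    · refine hQ _ (r - alive L p (p + 2 ^ k)) ⟨?_, ?_, ?_, ?_, ?_, ?_, by omega, hp, by omega, ?_⟩
        (by omega) ?_ ?_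
      · simp [h.mem]
      · simp [h.h0]
      · simp [h.h11]
      · simp [h.h12]
      · simp [h.h13]
      · simp
      · intro _
        simp
        exact b₂.merge_right hap fun i hi h1 h2 => (b₁.le hi h1 h2).trans hyy
      · simp [h6]
      · simp
    · refine hQ _ (r - alive L p (p + 2 ^ k)) ⟨?_, ?_, ?_, ?_, ?_, ?_, by omega, hp, by omega, ?_⟩
        (by omega) ?_ ?_
      · simp [h.mem]
      · simp [h.h0]
      · simp [h.h11]
      · simp [h.h12]
      · simp [h.h13]
      · simp
      · intro _
        simp
        exact b₁.merge_left (by omega) fun i hi h1 h2 => (b₂.le hi h1 h2).trans_lt hyy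
      · simp [h6]
      · simp

theorem two_pow_le {d j : ℕ} (hj : j ≤ Nat.size d + 1) (hd : d ≤ n) : 2 ^ j ≤ 4 * n + 4 := by
  have h1 : 2 ^ j ≤ 2 ^ (Nat.size d + 1) := pow_le_pow_right₀ (by norm_num) hj
  rcases Nat.eq_zero_or_pos d with rfl | h
  · simp at h1; omega
  · obtain ⟨k, hk⟩ : ∃ k, Nat.size d = k + 1 := ⟨_, (Nat.succ_pred_eq_of_pos (Nat.size_pos.2 h)).symm⟩
    have h2 : 2 ^ k ≤ d := Nat.lt_size.1 (by omega)
    rw [hk, pow_succ, pow_succ] at h1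
    omega

/-- Bound for the cost of a walk over `d` positions. -/
def walkCost (d : ℕ) : ℕ := (Nat.size d + 1) * 400

theorem walkUp_tri {R : Set ℕ} {m : Mem α} {a b r₀ : ℕ} {σ : St α}
    (hB : 40 * (n + 1) ≤ C.B) (hr₀ : r₀ < C.B) (hb : b ≤ n)
    (hR : ∀ c, c < 4 * n ∨ (4 * n + 4 * a + 2 ≤ c ∧ c < 4 * n + 4 * b) → c ∈ R)
    (hy : ∀ i < n, m (2 + 2 * i) = .key (y i)) (hT : SegOn y L n a b m)
    (h : WalkInv y L n m a b r₀ a r₀ σ) (h6 : σ.n 6 = 1) (h9 : σ.n 9 = b) :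
    Tri C (.loop (.le (V 13 + V 6) (V 9)) walkUp) R ∅ ((Nat.size (b - a) + 1) * 107)
      ((Nat.size (b - a) + 1) * 107) σ fun σ' => ∃ p r j, WalkInv y L n m a b r₀ p r σ' ∧
        σ'.n 6 = 2 ^ j ∧ 2 ^ (j - 1) ∣ p ∧ j ≤ Nat.size (b - a) + 1 ∧
        (b < p + 2 ^ j ∨ r < alive L p (p + 2 ^ j)) := by
  have hlen : walkUp.len = 83 := by decide
  have hcond : (Cond.le (V 13 + V 6) (V 9)).code.length = 5 := by decide
  have hsz := Nat.lt_size_self (b - a)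
  refine (Tri.loop
    (I := fun f σ' => ∃ p r j, WalkInv y L n m a b r₀ p r σ' ∧ σ'.n 6 = 2 ^ j ∧
      2 ^ (j - 1) ∣ p ∧ j ≤ Nat.size (b - a) + 1 ∧
      ((σ'.n 9 = b ∧ 2 ^ j ∣ p ∧ Nat.size (b - a) ≤ f + j) ∨
        (σ'.n 9 = 0 ∧ r < alive L p (p + 2 ^ j))))
    (fun _ => walkUp.len) (fun _ => walkUp.len) ?_ ?_ ?_ ?_ (Nat.size (b - a))
    ⟨a, r₀, 0, h, by simpa using h6, by simp, by omega,
      Or.inl ⟨h9, by simp, by omega⟩⟩).conseq ?_ ?_ fun _ h _ _ _ => h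
  · rintro f σ' ⟨p, r, j, hw, h6, -, hj, -⟩
    have := hw.pb
    have hpow := two_pow_le (n := n) hj (by omega)
    simp [Cond.Ok, hw.h13, h6]
    omega
  · rintro f σ' ⟨p, r, j, hw, h6, -, hj, hor⟩ hc
    simp only [Cond.Holds, Expr.eval_add, Expr.eval_var, hw.h13, h6] at hc
    have hk := Nat.one_le_two_pow (n := j)
    obtain ⟨h9, hd, hf⟩ | ⟨h9, -⟩ := hor
    swap
    · omega
    have hpb := hw.pb
    have hap := hw.ap
    have hjs : j < Nat.size (b - a) := Nat.lt_size.2 (by omega)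
    obtain ⟨q, rfl⟩ := hd
    have hq : 2 ^ j * q / 2 ^ j = q := Nat.mul_div_cancel_left _ (by omega)
    have hqp : q ≤ 2 ^ j * q := Nat.le_mul_of_pos_left _ (by omega)
    refine Tri.basic ?_
    have hpow : 2 ^ (j + 1) = 2 * 2 ^ j := by rw [pow_succ, mul_comm]
    simp only [walkUp, wp, Expr.ok_div, Expr.ok_mod, Expr.ok_var, Expr.ok_ofNat, Expr.eval_div,
      Expr.eval_mod, Expr.eval_var, Expr.eval_ofNat, hw.h13, h6, hq]
    refine ⟨by omega, by simp; omega, fun hodd => ?_, fun heven => ?_⟩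
    · refine wp_takeBlock hB hr₀ hb hR hy hT hw h6 (Dvd.intro _ rfl) (by omega) ?_ ?_
      · intro σ₁ r' hw' hr' h6' h9'
        refine ⟨by simp [h6']; omega, _, r', j + 1, hw'.setN (by simp), by simp [h6', hpow], ?_,
          by omega, Or.inl ⟨by simp [h9', h9], ?_, by omega⟩⟩
        · exact ⟨q + 1, by simp; ring⟩
        · exact ⟨(q + 1) / 2, by rw [hpow, mul_comm 2, mul_assoc,
            show 2 * ((q + 1) / 2) = q + 1 by omega]; ring⟩
      · intro hlt σ₁ hw' h6' h9'
        refine ⟨by simp; omega, by simp [h6']; omega, _, r, j + 1, (hw'.setN (by simp)).setN (by simp),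
          by simp [h6', hpow], by simp, by omega, Or.inr ⟨by simp, ?_⟩⟩
        have := alive_add L (show 2 ^ j * q ≤ 2 ^ j * q + 2 ^ j by omega)
          (show 2 ^ j * q + 2 ^ j ≤ 2 ^ j * q + 2 ^ (j + 1) by omega)
        omega
    · refine ⟨by simp; omega, _, r, j + 1, hw.setN (by simp), by simp [h6, hpow], by simp, by omega,
        Or.inl ⟨by simp [h9], ?_, by omega⟩⟩
      exact ⟨q / 2, by rw [hpow, mul_comm 2, mul_assoc, show 2 * (q / 2) = q by omega]⟩
  · rintro σ' ⟨p, r, j, hw, h6, -, hj, hor⟩ hc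
    simp only [Cond.Holds, Expr.eval_add, Expr.eval_var, hw.h13, h6] at hc
    have hk := Nat.one_le_two_pow (n := j)
    obtain ⟨h9, hd, hf⟩ | ⟨h9, -⟩ := hor
    · have := hw.ap
      have h2 : 2 ^ Nat.size (b - a) ≤ 2 ^ j := pow_le_pow_right₀ (by norm_num) (by omega)
      omega
    · omega
  · rintro f σ' ⟨p, r, j, hw, h6, hd, hj, hor⟩ hc
    simp only [Cond.Holds, Expr.eval_add, Expr.eval_var, hw.h13, h6] at hc
    refine ⟨p, r, j, hw, h6, hd, hj, ?_⟩
    obtain ⟨h9, -⟩ | ⟨-, h⟩ := hor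
    · left; omega
    · exact Or.inr h
  all_goals
    simp only [Finset.sum_const, Finset.card_range, smul_eq_mul, hlen, hcond]
    omega

theorem walkDown_tri {R : Set ℕ} {m : Mem α} {a b r₀ p r j : ℕ} {σ : St α}
    (hB : 40 * (n + 1) ≤ C.B) (hr₀ : r₀ < C.B) (hb : b ≤ n)
    (hR : ∀ c, c < 4 * n ∨ (4 * n + 4 * a + 2 ≤ c ∧ c < 4 * n + 4 * b) → c ∈ R)
    (hy : ∀ i < n, m (2 + 2 * i) = .key (y i)) (hT : SegOn y L n a b m)
    (h : WalkInv y L n m a b r₀ p r σ) (h6 : σ.n 6 = 2 ^ j) (hd : 2 ^ (j - 1) ∣ p)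
    (hj : 2 ^ j ≤ 4 * n + 4) (hN : b < p + 2 ^ j ∨ r < alive L p (p + 2 ^ j)) :
    Tri C (.loop (.le 2 (V 6)) walkDown) R ∅ ((j + 1) * 107)
      ((j + 1) * 107) σ fun σ' => ∃ p r, WalkInv y L n m a b r₀ p r σ' ∧
        (p = b ∨ r < alive L p (p + 1)) := by
  have hlen : walkDown.len = 79 := by decide
  have hcond : (Cond.le 2 (V 6)).code.length = 3 := by decide
  refine (Tri.loop
    (I := fun f σ' => ∃ p r, WalkInv y L n m a b r₀ p r σ' ∧ σ'.n 6 = 2 ^ f ∧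
      2 ^ (f - 1) ∣ p ∧ 2 ^ f ≤ 4 * n + 4 ∧ (b < p + 2 ^ f ∨ r < alive L p (p + 2 ^ f)))
    (fun _ => walkDown.len) (fun _ => walkDown.len) ?_ ?_ ?_ ?_ j
    ⟨p, r, h, h6, hd, hj, hN⟩).conseq ?_ ?_ fun _ h _ _ _ => h
  · rintro f σ' ⟨p, r, hw, h6, -⟩
    simp [Cond.Ok]
    omega
  · rintro f σ' ⟨p, r, hw, h6, hd, hf, hN⟩ hc
    rw [Nat.add_sub_cancel] at hd
    have hpow : 2 ^ (f + 1) = 2 * 2 ^ f := by rw [pow_succ, mul_comm]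
    rw [hpow] at h6 hf hN
    have hk := Nat.one_le_two_pow (n := f)
    have hpb := hw.pb
    have hdd : 2 ^ (f - 1) ∣ 2 ^ f := pow_dvd_pow _ (by omega)
    have h6' : σ'.n 6 / 2 = 2 ^ f := by omega
    refine Tri.basic ?_
    simp [walkDown, wp, hw.h13, hw.h11, h6, h6']
    refine ⟨by omega, by omega, fun hle => ?_, fun hlt => ?_⟩
    · refine wp_takeBlock hB hr₀ hb hR hy hT (hw.setN (by simp)) (by simp) hd hle ?_ ?_
      · intro σ₁ r' hw' hr' h6' h9'
        refine ⟨_, r', hw', h6', hdd.trans (Nat.dvd_add hd dvd_rfl), by omega, ?_⟩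
        have := alive_add L (show p ≤ p + 2 ^ f by omega) (show p + 2 ^ f ≤ p + 2 * 2 ^ f by omega)
        rw [show p + 2 ^ f + 2 ^ f = p + 2 * 2 ^ f by ring]
        omega
      · intro hlt σ₁ hw' h6' h9'
        exact ⟨_, r, hw', h6', hdd.trans hd, by omega, Or.inr hlt⟩
    · exact ⟨_, r, hw.setN (by simp), hdd.trans hd, by omega, Or.inl hlt⟩
  · rintro σ' ⟨p, r, hw, h6, -⟩ hc
    simp [Cond.Holds, h6] at hc
  · rintro f σ' ⟨p, r, hw, h6, hd, hf, hN⟩ hc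
    simp [Cond.Holds, h6] at hc
    have hk := Nat.one_le_two_pow (n := f)
    have hpb := hw.pb
    rw [show 2 ^ f = 1 by omega] at hN
    exact ⟨p, r, hw, by omega⟩
  all_goals
    simp only [Finset.sum_const, Finset.card_range, smul_eq_mul, hlen, hcond]
    omega

theorem walk_tri {R : Set ℕ} {a b r₀ : ℕ} {σ : St α}
    (hB : 40 * (n + 1) ≤ C.B) (hr₀ : r₀ < C.B) (hab : a ≤ b) (hb : b ≤ n) (h0 : σ.n 0 = n)
    (h10 : σ.n 10 = a) (h11 : σ.n 11 = b) (h12 : σ.n 12 = r₀)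
    (hR : ∀ c, c < 4 * n ∨ (4 * n + 4 * a + 2 ≤ c ∧ c < 4 * n + 4 * b) → c ∈ R)
    (hy : ∀ i < n, σ.mem (2 + 2 * i) = .key (y i)) (hT : SegOn y L n a b σ.mem) :
    Tri C walk R ∅ (walkCost (b - a)) (walkCost (b - a)) σ fun σ' => ∃ p r,
      WalkInv y L n σ.mem a b r₀ p r σ' ∧ (p = b ∨ r < alive L p (p + 1)) := by
  refine (Tri.seq (Q := fun σ' => WalkInv y L n σ.mem a b r₀ a r₀ σ' ∧ σ'.n 6 = 1 ∧ σ'.n 9 = b)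
    (Tri.basic ?_) fun σ₀ hσ₀ _ _ _ => Tri.seq
      (walkUp_tri hB hr₀ hb hR hy hT hσ₀.1 hσ₀.2.1 hσ₀.2.2) (D₂ := (Nat.size (b - a) + 2) * 107)
      (T₂ := (Nat.size (b - a) + 2) * 107) ?_).conseq
      ?_ ?_ fun σ' h _ _ _ => h
  · have := C.one_lt_B
    simp [wp, this, h10, h11, h12]
    refine ⟨by omega, rfl, ?_, ?_, ?_, ?_, ?_, le_rfl, hab, ?_, ?_⟩
    · simp [h0]
    · simp [h11]
    · simp [h12]
    · simp
    · simp
    · simp [alive_self]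
    · simp [alive_self]
  · rintro σ' ⟨p, r, j, hw, h6, hd, hj, hN⟩ - - -
    refine (walkDown_tri hB hr₀ hb hR hy hT hw h6 hd ?_ hN).conseq ?_ ?_ fun _ h _ _ _ => h
    · exact two_pow_le hj (by omega)
    all_goals omega
  all_goals
    have h3 : (Cmd.set 13 (V 10) ;; .set 17 (V 12) ;; .set 6 1 ;; .set 9 (V 11) ;; .set 16 0).len
      = 10 := by decide
    simp only [h3, walkCost]
    omega

end


/-! ## Deletion from a segment tree -/

def deleteStep : Cmd :=
  .set 6 (2 * V 6) ;; .set 5 (V 18 / V 6 * V 6) ;;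
  .ite (.le (V 10) (V 5)) (.ite (.le (V 5 + V 6) (V 11)) pull (.set 19 0)) (.set 19 0)

/-- Deletes the element `V 18`; updates the blocks between `V 10` and `V 11`. -/
def delete : Cmd :=
  (.store (4 * V 0 + 2 * (2 * V 18 + 1) + 1) 0 ;; .set 6 1 ;; .set 19 1) ;;
  .loop (.le 1 (V 19)) deleteStep

theorem wp_frame {α : Type u} [LinearOrder α] {B : ℕ} {R W : Set ℕ} {c : Cmd} {Q : St α → Prop}
    {σ : St α} (h : wp B R W c Q σ) :
    wp B R W c (fun σ' => Q σ' ∧ ∀ v, v ∉ c.mods → σ'.n v = σ.n v) σ := by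
  induction c generalizing σ Q with
  | skip => exact ⟨h, fun _ _ => rfl⟩
  | set x e => exact ⟨h.1, h.2, fun v hv => by simp [Cmd.mods] at hv; simp [hv]⟩
  | setK x y => exact ⟨h, fun _ _ => rfl⟩
  | load x e =>
    obtain ⟨h1, h2, v, h3, h4⟩ := h
    exact ⟨h1, h2, v, h3, h4, fun v hv => by simp [Cmd.mods] at hv; simp [hv]⟩
  | loadK x e => exact ⟨h.1, h.2.1, h.2.2, fun _ _ => rfl⟩
  | store e e' => exact ⟨h.1, h.2.1, h.2.2.1, h.2.2.2, fun _ _ => rfl⟩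
  | storeK e x => exact ⟨h.1, h.2.1, h.2.2, fun _ _ => rfl⟩
  | seq c₁ c₂ ih₁ ih₂ =>
    refine wp_mono (c := c₁) (ih₁ h) fun σ' h' => wp_mono (ih₂ h'.1) fun σ'' h'' => ⟨h''.1, fun v hv => ?_⟩
    simp only [Cmd.mods, List.mem_append, not_or] at hv
    rw [h''.2 v hv.2, h'.2 v hv.1]
  | ite b c₁ c₂ ih₁ ih₂ =>
    have e₁ : ∀ v, v ∉ (Cmd.ite b c₁ c₂).mods → v ∉ c₁.mods := fun v hv => by
      simp only [Cmd.mods, List.mem_append, not_or] at hv; exact hv.1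
    have e₂ : ∀ v, v ∉ (Cmd.ite b c₁ c₂).mods → v ∉ c₂.mods := fun v hv => by
      simp only [Cmd.mods, List.mem_append, not_or] at hv; exact hv.2
    cases b with
    | le a b =>
      obtain ⟨h1, h2, h3, h4⟩ := h
      exact ⟨h1, h2, fun h => wp_mono (ih₁ (h3 h)) fun σ' h' => ⟨h'.1, fun v hv => h'.2 v (e₁ v hv)⟩,
        fun h => wp_mono (ih₂ (h4 h)) fun σ' h' => ⟨h'.1, fun v hv => h'.2 v (e₂ v hv)⟩⟩
    | kle a b =>
      obtain ⟨x, y, h1, h2, h3, h4⟩ := h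
      exact ⟨x, y, h1, h2,
        fun h => wp_mono (ih₁ (h3 h)) fun σ' h' => ⟨h'.1, fun v hv => h'.2 v (e₁ v hv)⟩,
        fun h => wp_mono (ih₂ (h4 h)) fun σ' h' => ⟨h'.1, fun v hv => h'.2 v (e₂ v hv)⟩⟩
  | loop b c ih => exact h.elim
  | fork d p => exact h.elim

theorem dyadic_code_lt {k k' l l' : ℕ} (hd' : 2 ^ k' ∣ l') (hd : 2 ^ k ∣ l) (h : k < k') :
    2 * l + 2 ^ k ≠ 2 * l' + 2 ^ k' := by
  intro heq
  have h1 : 2 ^ (k + 1) ∣ 2 * l' + 2 ^ k' :=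
    Nat.dvd_add ((pow_dvd_pow 2 h).trans (hd'.mul_left 2)) (pow_dvd_pow 2 h)
  have h2 : 2 ^ (k + 1) ∣ 2 * l := by
    rw [pow_succ, mul_comm]
    exact Nat.mul_dvd_mul_left 2 hd
  rw [← heq] at h1
  have h3 := Nat.le_of_dvd (by positivity) ((Nat.dvd_add_right h2).1 h1)
  rw [pow_succ] at h3
  have := Nat.one_le_two_pow (n := k)
  omega

theorem dyadic_code_inj {k k' l l' : ℕ} (hd : 2 ^ k ∣ l) (hd' : 2 ^ k' ∣ l')
    (h : 2 * l + 2 ^ k = 2 * l' + 2 ^ k') : k = k' ∧ l = l' := by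
  rcases lt_trichotomy k k' with hk | rfl | hk
  · exact absurd h (dyadic_code_lt hd' hd hk)
  · exact ⟨rfl, by omega⟩
  · exact absurd h.symm (dyadic_code_lt hd hd' hk)

theorem dyadic_sub {j k l v : ℕ} (hjk : j ≤ k) (hd : 2 ^ k ∣ l) (h1 : l ≤ v) (h2 : v < l + 2 ^ k) :
    l ≤ v / 2 ^ j * 2 ^ j ∧ v / 2 ^ j * 2 ^ j + 2 ^ j ≤ l + 2 ^ k := by
  obtain ⟨w, hw⟩ := pow_dvd_pow 2 hjk
  obtain ⟨t, rfl⟩ := (pow_dvd_pow 2 hjk).trans hd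
  have hpos := Nat.one_le_two_pow (n := j)
  rw [hw, ← Nat.mul_add] at *
  have h3 : t ≤ v / 2 ^ j := (Nat.le_div_iff_mul_le (by omega)).2 (by rwa [mul_comm])
  have h4 : v / 2 ^ j < t + w := (Nat.div_lt_iff_lt_mul (by omega)).2 (by rwa [mul_comm])
  constructor
  · rw [mul_comm]; exact Nat.mul_le_mul_right _ h3
  · rw [show v / 2 ^ j * 2 ^ j + 2 ^ j = 2 ^ j * (v / 2 ^ j + 1) by ring]
    exact Nat.mul_le_mul_left _ h4

/-- Bound for the cost of a deletion from `d` positions. -/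
def deleteCost (d : ℕ) : ℕ := (Nat.size d + 1) * 300

section
variable {α : Type u} [LinearOrder α] {C : Ctx} {n : ℕ} {y : ℕ → α} {L : Finset ℕ}

theorem delete_tri {R : Set ℕ} {a b v : ℕ} {σ : St α}
    (hB : 40 * (n + 1) ≤ C.B) (hav : a ≤ v) (hvb : v < b) (hb : b ≤ n) (h0 : σ.n 0 = n)
    (h10 : σ.n 10 = a) (h11 : σ.n 11 = b) (h18 : σ.n 18 = v)
    (hR : ∀ c, c < 4 * n ∨ (4 * n + 4 * a + 2 ≤ c ∧ c < 4 * n + 4 * b) → c ∈ R)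
    (hy : ∀ i < n, σ.mem (2 + 2 * i) = .key (y i)) (hT : SegOn y L n a b σ.mem) :
    Tri C delete R {c | 4 * n + 4 * a + 2 ≤ c ∧ c < 4 * n + 4 * b} (deleteCost (b - a))
      (deleteCost (b - a)) σ fun σ' => SegOn y (L.erase v) n a b σ'.mem := by
  have hsz := Nat.lt_size_self (b - a)
  let I : ℕ → St α → Prop := fun j σ' => σ'.n 0 = n ∧ σ'.n 10 = a ∧ σ'.n 11 = b ∧ σ'.n 18 = v ∧
    σ'.n 6 = 2 ^ j ∧ (∀ i < n, σ'.mem (2 + 2 * i) = .key (y i)) ∧ j ≤ Nat.size (b - a) + 1 ∧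
    ∀ l k, 2 ^ k ∣ l → a ≤ l → l + 2 ^ k ≤ b → (k ≤ j ∨ ¬ (l ≤ v ∧ v < l + 2 ^ k)) →
      Block y (L.erase v) n σ'.mem l (2 ^ k)
  refine (Tri.seq (Q := fun σ' => I 0 σ' ∧ σ'.n 19 = 1) (Tri.basic ?_) fun σ₀ hσ₀ _ _ _ =>
    (Tri.loop (I := fun f σ' => ∃ j, I j σ' ∧ ((σ'.n 19 = 1 ∧ 2 ^ j ≤ b - a ∧
        Nat.size (b - a) ≤ f + j) ∨ (σ'.n 19 = 0 ∧ SegOn y (L.erase v) n a b σ'.mem)))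
      (fun _ => deleteStep.len) (fun _ => deleteStep.len) ?_ ?_ ?_ ?_ (Nat.size (b - a))
      ⟨0, hσ₀.1, Or.inl ⟨hσ₀.2, by simp; omega, by omega⟩⟩)).conseq ?_ ?_ fun _ h _ _ _ => h
  · have hB1 := C.one_lt_B
    simp [wp, h0, h18]
    refine ⟨by omega, by omega, by omega, by omega, ⟨by simp [h0], by simp [h10], by simp [h11],
      by simp [h18], by simp, fun i hi => ?_, by omega, fun l k hd hl hr hk => ?_⟩⟩
    · simp only [St.setN_mem, St.store_mem]
      rw [if_neg (by omega), hy i hi]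
    · have hk1 := Nat.one_le_two_pow (n := k)
      obtain ⟨w, h1, h2, h3⟩ := hT l k hd hl hr
      by_cases hv : k = 0 ∧ l = v
      · obtain ⟨rfl, rfl⟩ := hv
        refine ⟨w, ?_, ?_, ?_⟩
        · simp only [St.setN_mem, St.store_mem]
          rw [if_neg (by omega)]
          exact h1
        · simp
          have : alive (L.erase l) l (l + 1) = 0 := by
            rw [alive, Finset.card_eq_zero, Finset.filter_eq_empty_iff]
            intro i hi h
            exact (Finset.mem_erase.1 hi).1 (by omega)
          rw [this]
        · intro hp
          obtain ⟨i, hi⟩ := Finset.card_pos.1 hp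
          simp at hi
          omega
      · have hnv : ¬ (l ≤ v ∧ v < l + 2 ^ k) := by
          rcases hk with hk | hk
          · obtain rfl : k = 0 := by omega
            simp at hv ⊢
            omega
          · exact hk
        have hmem : ∀ i, l ≤ i → i < l + 2 ^ k → (i ∈ L ↔ i ∈ L.erase v) := fun i h1 h2 => by
          rw [Finset.mem_erase, and_iff_right (by omega)]
        have hc : 2 * l + 2 ^ k ≠ 2 * v + 2 ^ 0 := fun h => by
          have := dyadic_code_inj hd (by simp) h
          exact hv this
        rw [pow_zero] at hc
        rw [alive_congr hmem] at h2 h3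
        refine ⟨w, ?_, ?_, fun hp => (h3 hp).congr hmem⟩
        · simp only [St.setN_mem, St.store_mem]
          rw [if_neg (by omega)]
          exact h1
        · simp only [St.setN_mem, St.store_mem]
          rw [if_neg (by omega)]
          exact h2
  · rintro f σ' ⟨j, hI, hor⟩
    have := C.one_lt_B
    simp [Cond.Ok, this]
  · rintro f σ' ⟨j, ⟨g0, g10, g11, g18, g6, gy, gj, gb⟩, hor⟩ hc
    simp [Cond.Holds] at hc
    obtain ⟨h19, hj, hf⟩ | ⟨h19, -⟩ := hor
    swap
    · omega
    have hjs : j < Nat.size (b - a) := Nat.lt_size.2 hj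
    have hpow : 2 ^ (j + 1) = 2 * 2 ^ j := by rw [pow_succ, mul_comm]
    have hk := Nat.one_le_two_pow (n := j)
    have hle : v / (2 * 2 ^ j) * (2 * 2 ^ j) ≤ v := Nat.div_mul_le_self _ _
    have hdv : v / (2 * 2 ^ j) ≤ v := Nat.div_le_self _ _
    have hlt : v < v / (2 * 2 ^ j) * (2 * 2 ^ j) + 2 * 2 ^ j := Nat.lt_div_mul_add (by omega)
    have hout : ¬ (a ≤ v / (2 * 2 ^ j) * (2 * 2 ^ j) ∧
        v / (2 * 2 ^ j) * (2 * 2 ^ j) + 2 * 2 ^ j ≤ b) → SegOn y (L.erase v) n a b σ'.mem := by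
      intro hno l k hd hl hr
      refine gb l k hd hl hr ?_
      by_contra hcon
      push Not at hcon
      have := dyadic_sub (j := j + 1) (by omega) hd hcon.2.1 hcon.2.2
      rw [hpow] at this
      omega
    refine Tri.basic ?_
    simp [deleteStep, wp, g0, g10, g11, g18, g6]
    refine ⟨by omega, by omega, fun ha => ⟨by omega, fun hr => ?_, fun hr => ?_⟩, fun ha => ?_⟩
    · have hd1 : 2 ^ (j + 1) ∣ v / (2 * 2 ^ j) * (2 * 2 ^ j) := hpow ▸ Dvd.intro_left _ rfl
      have hd0 : 2 ^ j ∣ v / (2 * 2 ^ j) * (2 * 2 ^ j) := (pow_dvd_pow 2 (by omega)).trans hd1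
      refine wp_mono (wp_frame (wp_pull (y := y) (L := L.erase v) (n := n) (l := v / (2 * 2 ^ j) * (2 * 2 ^ j))
        (h := 2 ^ j) hB (by simpa using g0) (by simp) (by simp) hk (by omega) (by simpa using gy)
        (fun c hc => hR c (by omega)) ?_ ?_ ?_ ?_)) ?_
      · simp; omega
      · simp; omega
      · exact gb _ j hd0 (by omega) (by omega) (Or.inl le_rfl)
      · exact gb _ j (Nat.dvd_add hd0 dvd_rfl) (by omega) (by omega) (Or.inl le_rfl)
      · rintro τ ⟨⟨h1, h2⟩, h3⟩
        have e : ∀ z, z ∉ pull.mods → z ≠ 5 → z ≠ 6 → τ.n z = σ'.n z := fun z hz z5 z6 => by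
          rw [h3 z hz]; simp [z5, z6]
        refine ⟨j + 1, ⟨?_, ?_, ?_, ?_, ?_, ?_, by omega, fun l k hd hl hr hor => ?_⟩, Or.inl ⟨?_, ?_, by omega⟩⟩
        · rw [e 0 (by decide) (by simp) (by simp)]; exact g0
        · rw [e 10 (by decide) (by simp) (by simp)]; exact g10
        · rw [e 11 (by decide) (by simp) (by simp)]; exact g11
        · rw [e 18 (by decide) (by simp) (by simp)]; exact g18
        · rw [h3 6 (by decide)]; simp [hpow]
        · intro i hi
          rw [h2 _ (by omega) (by omega)]
          exact gy i hi
        · by_cases hc : 2 * l + 2 ^ k = 2 * (v / (2 * 2 ^ j) * (2 * 2 ^ j)) + 2 ^ (j + 1)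
          · obtain ⟨rfl, rfl⟩ := dyadic_code_inj hd hd1 hc
            rw [hpow]
            exact h1
          · have hne : ¬ (k = j + 1 ∧ l ≤ v ∧ v < l + 2 ^ k) := by
              rintro ⟨rfl, h4, h5⟩
              have := dyadic_sub le_rfl hd h4 h5
              rw [hpow] at this
              apply hc
              omega
            rw [hpow] at hc
            exact (gb l k hd hl hr (by omega)).congr (h2 _ (by omega) (by omega))
              (h2 _ (by omega) (by omega))
        · rw [e 19 (by decide) (by simp) (by simp)]; exact h19
        · omega
    · have hS := hout (by omega)
      refine ⟨by omega, ⟨j + 1, by simpa using g0, by simpa using g10, by simpa using g11,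
        by simpa using g18, by simp [hpow], gy, by omega, fun l k hd hl hr _ => hS l k hd hl hr⟩, hS⟩
    · have hS := hout (by omega)
      refine ⟨by omega, ⟨j + 1, by simpa using g0, by simpa using g10, by simpa using g11,
        by simpa using g18, by simp [hpow], gy, by omega, fun l k hd hl hr _ => hS l k hd hl hr⟩, hS⟩
  · rintro σ' ⟨j, ⟨g0, g10, g11, g18, g6, gy, gj, gb⟩, hor⟩ hc
    simp [Cond.Holds] at hc
    obtain ⟨h19, hj, hf⟩ | ⟨h19, -⟩ := hor
    · have hjs : j < Nat.size (b - a) := Nat.lt_size.2 hj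
      omega
    · omega
  · rintro f σ' ⟨j, -, hor⟩ hc
    simp [Cond.Holds] at hc
    obtain ⟨h19, -⟩ | ⟨-, h⟩ := hor
    · omega
    · exact h
  all_goals
    have h1 : deleteStep.len = 145 := by decide
    have hcond : (Cond.le 1 (V 19)).code.length = 3 := by decide
    have h3 : (Cmd.store (4 * V 0 + 2 * (2 * V 18 + 1) + 1) 0 ;; .set 6 1 ;; .set 19 1).len
      = 19 := by decide
    simp only [Finset.sum_const, Finset.card_range, smul_eq_mul, h1, hcond, h3, deleteCost]
    omega

end


/-! ## Construction of priority search trees -/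

/-- The copy of a tree depends only on the cells that it occupies. -/
theorem Stored.congr {α β : Type u} {m m' : Mem α} {R R' : ℕ → β → Set ℕ → Prop} {p : ℕ}
    {t : BTree β} {G : Set ℕ} (h : Stored m R p t G) (hm : ∀ c ∈ G, m' c = m c)
    (hR : ∀ q v H, R q v H → H ⊆ G → R' q v H) : Stored m' R' p t G := by
  induction h with
  | nil => exact .nil
  | @node p pl pr v l r H Fl Fr hp hpl hpr hv hl hr hG hFl hFr ihl ihr =>
    refine .node hp ?_ ?_ (hR _ _ _ hv ?_) (ihl (fun c hc => hm c ?_) fun q v H h1 h2 => hR q v H h1 ?_)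
      (ihr (fun c hc => hm c ?_) fun q v H h1 h2 => hR q v H h1 ?_) hG hFl hFr
    · rw [hm _ (by simp), hpl]
    · rw [hm _ (by simp), hpr]
    · exact fun c hc => by simp [hc]
    · simp [hc]
    · exact h2.trans fun c hc => by simp [hc]
    · simp [hc]
    · exact h2.trans fun c hc => by simp [hc]

theorem Stored.congr_priority {α : Type u} {m m' : Mem α} {p : ℕ} {t : BTree (PriorityLabel α)}
    {G : Set ℕ} (h : Stored m (priorityLabelAt m) p t G) (hm : ∀ c ∈ G, m' c = m c) :
    Stored m' (priorityLabelAt m') p t G := by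
  refine h.congr hm fun q v H hv hH => ?_
  obtain ⟨h1, h2, h3, rfl⟩ := hv
  exact ⟨by rw [hm _ (hH (by simp)), h1], by rw [hm _ (hH (by simp)), h2],
    by rw [hm _ (hH (by simp)), h3], rfl⟩

/-- The points between two positions. -/
def points {α : Type u} (x y : ℕ → α) (L : Finset ℕ) (a b : ℕ) : Multiset (α × α) :=
  (L.filter fun i => a ≤ i ∧ i < b).val.map fun i => (x i, y i)

section points
variable {α : Type u} {x y : ℕ → α} {L : Finset ℕ} {a b c v : ℕ}

theorem card_points : (points x y L a b).card = alive L a b := by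
  rw [points, Multiset.card_map]; rfl

theorem mem_points {q : α × α} : q ∈ points x y L a b ↔
    ∃ i ∈ L, a ≤ i ∧ i < b ∧ (x i, y i) = q := by
  simp [points, and_assoc]

theorem points_add (h : a ≤ b) (h' : b ≤ c) :
    points x y L a c = points x y L a b + points x y L b c := by
  have hd : Disjoint (L.filter fun i => a ≤ i ∧ i < b) (L.filter fun i => b ≤ i ∧ i < c) := by
    rw [Finset.disjoint_filter]; omega
  rw [points, points, points, ← Multiset.map_add, ← Finset.disjUnion_val _ _ hd]
  congr 2
  ext i
  simp only [Finset.mem_filter, Finset.mem_disjUnion]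
  constructor
  · rintro ⟨h1, h2, h3⟩
    rcases lt_or_ge i b with h4 | h4
    · exact Or.inl ⟨h1, h2, h4⟩
    · exact Or.inr ⟨h1, h4, h3⟩
  · rintro (⟨h1, h2, h3⟩ | ⟨h1, h2, h3⟩)
    · exact ⟨h1, h2, by omega⟩
    · exact ⟨h1, by omega, h3⟩

theorem points_erase (hv : v ∈ L) (ha : a ≤ v) (hb : v < b) :
    points x y L a b = (x v, y v) ::ₘ points x y (L.erase v) a b := by
  have hn : v ∉ (L.erase v).filter fun i => a ≤ i ∧ i < b := by simp
  rw [points, points, ← Multiset.map_cons (fun i => (x i, y i)), ← Finset.cons_val hn]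
  congr 2
  ext i
  simp only [Finset.mem_filter, Finset.mem_cons, Finset.mem_erase]
  constructor
  · rintro ⟨h1, h2, h3⟩
    by_cases h : i = v
    · exact Or.inl h
    · exact Or.inr ⟨⟨h, h1⟩, h2, h3⟩
  · rintro (rfl | ⟨⟨h, h1⟩, h2, h3⟩)
    · exact ⟨hv, ha, hb⟩
    · exact ⟨h1, h2, h3⟩

theorem alive_erase (hv : v ∈ L) (ha : a ≤ v) (hb : v < b) :
    alive L a b = alive (L.erase v) a b + 1 := by
  have := congrArg Multiset.card (points_erase (x := id) (y := id) hv ha hb)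
  simpa only [card_points, Multiset.card_cons] using this

end points

section
variable {α : Type u} [LinearOrder α] {x y : ℕ → α} {L : Finset ℕ} {n a b c v k : ℕ}

/-- The point at position `v` and subtrees for the points to the left and right of position `c`
form a priority search tree. -/
theorem isPriorityTree_node (hx : ∀ i j, i ≤ j → j < n → x i ≤ x j) (hb : b ≤ n) (hac : a ≤ c)
    (hcb : c ≤ b) {q : ℕ} {l r : BTree (PriorityLabel α)} (hv : IsBest y L a b v)
    (hl : IsPriorityTree (points x y (L.erase v) a c) l)
    (hr : IsPriorityTree (points x y (L.erase v) c b) r)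
    (h1 : alive (L.erase v) a c ≤ alive (L.erase v) c b)
    (h2 : alive (L.erase v) c b ≤ alive (L.erase v) a c + 1)
    (hq : 0 < alive (L.erase v) a b → q = c ∧ c < b ∧ c ∈ L.erase v) :
    IsPriorityTree (points x y L a b) (.node ⟨x v, y v, x q⟩ l r) := by
  have hadd : points x y (L.erase v) a b = _ := points_add hac hcb
  have haddc := alive_add (L.erase v) hac hcb
  refine ⟨_, _, ?_, ?_, ?_, ?_, ?_, ?_, ?_, hl, hr⟩
  · rw [← hadd, points_erase hv.1 hv.2.1 hv.2.2.1]
  · intro p hp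
    rw [← hadd, mem_points] at hp
    obtain ⟨i, hi, hi1, hi2, rfl⟩ := hp
    exact hv.le (Finset.mem_of_mem_erase hi) hi1 hi2
  · intro hne
    rw [← hadd] at hne ⊢
    have hpos : 0 < alive (L.erase v) a b := by
      rw [← card_points (x := x) (y := y)]
      exact Multiset.card_pos.2 hne
    obtain ⟨rfl, hq1, hq2⟩ := hq hpos
    have hle : ∀ (p' : α → Prop) [DecidablePred p'] (d e : ℕ),
        (∀ i ∈ L.erase v, a ≤ i → i < b → p' (x i) → d ≤ i ∧ i < e) →
        ((points x y (L.erase v) a b).map Prod.fst).countP p' ≤ alive (L.erase v) d e := by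
      intro p' _ d e h
      rw [points, Multiset.map_map, Multiset.countP_map, alive]
      refine Multiset.card_le_card (Multiset.le_iff_subset ?_ |>.2 ?_)
      · exact Multiset.nodup_of_le (Multiset.filter_le _ _) (Finset.nodup _)
      · intro i hi
        simp only [Multiset.mem_filter, Finset.mem_val, Finset.mem_filter, Function.comp] at hi ⊢
        exact ⟨hi.1.1, h i hi.1.1 hi.1.2.1 hi.1.2.2 hi.2⟩
    have hsucc := alive_add (L.erase v) (show q ≤ q + 1 by omega) (show q + 1 ≤ b by omega)
    have hq3 := alive_pos hq2 le_rfl (show q < q + 1 by omega)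
    refine ⟨Multiset.mem_map.2 ⟨_, mem_points.2 ⟨q, hq2, hac, hq1, rfl⟩, rfl⟩, ?_, ?_⟩
    · rw [Multiset.card_map, card_points]
      have := hle (· < x q) a q fun i hi hi1 hi2 hlt => ⟨hi1, by
        by_contra hcon
        exact absurd (hx q i (by omega) (by omega)) (not_le.2 hlt)⟩
      dsimp only at this ⊢
      omega
    · rw [Multiset.card_map, card_points]
      have := hle (x q < ·) (q + 1) b fun i hi hi1 hi2 hlt => ⟨by
        by_contra hcon
        exact absurd (hx i q (by omega) (by omega)) (not_le.2 hlt), hi2⟩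
      dsimp only at this ⊢
      omega
  · intro p hp
    obtain ⟨i, hi, hi1, hi2, rfl⟩ := mem_points.1 hp
    obtain ⟨rfl, hq1, hq2⟩ := hq (alive_pos hi hi1 (by omega))
    exact hx _ _ hi2.le (by omega)
  · intro p hp
    obtain ⟨i, hi, hi1, hi2, rfl⟩ := mem_points.1 hp
    obtain ⟨rfl, hq1, hq2⟩ := hq (alive_pos hi (by omega) hi2)
    exact hx _ _ hi1 (by omega)
  · rw [card_points, card_points]; omega
  · rw [card_points, card_points]; omega

end


/-- Stores in cell `d` the pointer to the root of the tree with node numbers from `a` to `b`. -/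
def storePtr (d a b : Expr) : Cmd :=
  .ite (.le b a) (.store d 0) (.store d (12 * V 0 + 5 * ((a + b) / 2)))

def writePNode : Cmd :=
  .set 5 (12 * V 0 + 5 * V 3) ;; storePtr (V 5) (V 3 + 1) (V 2) ;; storePtr (V 5 + 1) (V 1) (V 3) ;;
  .loadK 0 (1 + 2 * V 18) ;; .storeK (V 5 + 2) 0 ;;
  .loadK 1 (2 + 2 * V 18) ;; .storeK (V 5 + 3) 1 ;;
  .ite (.le (V 2) (V 1 + 1)) .skip (.loadK 0 (1 + 2 * V 13)) ;; .storeK (V 5 + 4) 0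

/-- Finds and deletes the best point, finds the splitter, and writes the node. -/
def pstPre : Cmd :=
  .set 12 (V 0) ;; walk ;; .set 18 (V 16) ;; delete ;; .set 12 (V 2 - V 3 - 1) ;; walk ;; writePNode

def pstPro : Cmd :=
  .ite (.le (V 4) 1) (.set 2 (V 3) ;; .set 10 (V 13)) (.set 1 (V 3 + 1) ;; .set 11 (V 13))

/-- A node of the recursion: range of node numbers, range of positions, and remaining positions. -/
structure PNode where
  lo : ℕ
  hi : ℕ
  a : ℕ
  b : ℕ
  L : Finset ℕ

theorem exists_alive_eq {L : Finset ℕ} {a c k : ℕ} (h : k < alive L a c) :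
    ∃ p, a ≤ p ∧ p < c ∧ p ∈ L ∧ alive L a p = k := by
  induction c with
  | zero => have := alive_le L a 0; omega
  | succ c ih =>
    by_cases hk : k < alive L a c
    · obtain ⟨p, h1, h2, h3⟩ := ih hk
      exact ⟨p, h1, by omega, h3⟩
    have h1 := alive_le L a (c + 1)
    have h2 := alive_add L (show a ≤ c by omega) (show c ≤ c + 1 by omega)
    have h3 := alive_le L c (c + 1)
    obtain ⟨i, hi⟩ := Finset.card_pos.1 (show 0 < alive L c (c + 1) by omega)
    simp only [Finset.mem_filter] at hi
    obtain rfl : i = c := by omega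
    exact ⟨i, by omega, by omega, hi.1, by omega⟩

theorem Nat.size_le_self (n : ℕ) : Nat.size n ≤ n := Nat.size_le.2 Nat.lt_two_pow_self

theorem Nat.size_le_add_two {a b : ℕ} (h : b ≤ 2 * a + 2) : Nat.size b ≤ Nat.size a + 2 := by
  have := Nat.lt_size_self a
  refine Nat.size_le.2 ?_
  rw [pow_add]
  omega

theorem Nat.size_add_le {a : ℕ} (k : ℕ) (h : 0 < a) : Nat.size (a + k) ≤ Nat.size a + k := by
  induction k with
  | zero => simp
  | succ k ih =>
    have h1 : Nat.size (a + (k + 1)) ≤ Nat.size (a + k) + 1 := by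
      have := Nat.lt_size_self (a + k)
      refine Nat.size_le.2 ?_
      rw [pow_succ]
      omega
    omega

namespace PNode
variable {α : Type u} [LinearOrder α] (y : ℕ → α)

open Classical in
noncomputable def best (N : PNode) : ℕ :=
  if h : ∃ v, IsBest y N.L N.a N.b v then h.choose else 0

noncomputable def rest (N : PNode) : Finset ℕ := N.L.erase (N.best y)

def mid (N : PNode) : ℕ := (N.lo + N.hi) / 2

/-- `c` is a position of a remaining point, to the left of which there are `hi - mid - 1`. -/
def IsCut (N : PNode) (c : ℕ) : Prop :=
  N.a ≤ c ∧ c < N.b ∧ c ∈ N.rest y ∧ alive (N.rest y) N.a c = N.hi - N.mid - 1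

open Classical in
noncomputable def cut (N : PNode) : ℕ := if h : ∃ c, N.IsCut y c then h.choose else N.a

noncomputable def left (N : PNode) : PNode := ⟨N.lo, N.mid, N.cut y, N.b, N.rest y⟩

noncomputable def right (N : PNode) : PNode := ⟨N.mid + 1, N.hi, N.a, N.cut y, N.rest y⟩

/-- The remaining positions in the range are as many as there are node numbers. -/
structure Valid (n : ℕ) (N : PNode) : Prop where
  hi_le : N.hi ≤ n
  lo_le : N.lo ≤ n + 1
  b_le : N.b ≤ n
  a_le : N.a ≤ N.b
  count : alive N.L N.a N.b = N.hi - N.lo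

variable {y} {n : ℕ} {N : PNode}

theorem best_eq {v : ℕ} (h : IsBest y N.L N.a N.b v) : N.best y = v := by
  have : ∃ v, IsBest y N.L N.a N.b v := ⟨v, h⟩
  rw [best, dif_pos this]
  exact this.choose_spec.unique h

theorem Valid.isBest (h : N.Valid n) (hlt : N.lo < N.hi) : IsBest y N.L N.a N.b (N.best y) := by
  have : ∃ v, IsBest y N.L N.a N.b v := exists_isBest (by have := h.count; omega)
  rw [best, dif_pos this]
  exact this.choose_spec

theorem IsCut.unique {c c' : ℕ} (h : N.IsCut y c) (h' : N.IsCut y c') : c = c' := by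
  obtain ⟨h1, h2, h3, h4⟩ := h
  obtain ⟨g1, g2, g3, g4⟩ := h'
  by_contra hne
  rcases Nat.lt_or_gt_of_ne hne with hlt | hlt
  · have := alive_add (N.rest y) h1 hlt.le
    have := alive_pos h3 le_rfl hlt
    omega
  · have := alive_add (N.rest y) g1 hlt.le
    have := alive_pos g3 le_rfl hlt
    omega

theorem cut_eq {c : ℕ} (h : N.IsCut y c) : N.cut y = c := by
  have : ∃ c, N.IsCut y c := ⟨c, h⟩
  rw [cut, dif_pos this]
  exact this.choose_spec.unique h

theorem le_cut : N.a ≤ N.cut y := by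
  rw [cut]
  split_ifs with h
  · exact h.choose_spec.1
  · exact le_rfl

theorem Valid.cut_le (h : N.Valid n) : N.cut y ≤ N.b := by
  rw [cut]
  split_ifs with h'
  · exact h'.choose_spec.2.1.le
  · exact h.a_le

theorem Valid.count_rest (h : N.Valid n) (hlt : N.lo < N.hi) :
    alive (N.rest y) N.a N.b + 1 = N.hi - N.lo := by
  obtain ⟨h1, h2, h3, -⟩ := h.isBest (y := y) hlt
  have := alive_erase h1 h2 h3
  rw [← h.count, this]
  rfl

/-- The position where a walk stops. -/
theorem Valid.isCut_of_walk (h : N.Valid n) (hlt : N.lo + 1 < N.hi) {p r : ℕ} (hp : N.a ≤ p)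
    (hpb : p ≤ N.b) (hr : r + alive (N.rest y) N.a p = N.hi - N.mid - 1)
    (hs : p = N.b ∨ r < alive (N.rest y) p (p + 1)) : N.IsCut y p := by
  have hc := h.count_rest (y := y) (by omega)
  simp only [mid] at *
  have h1 := alive_le (N.rest y) p (p + 1)
  rcases hs with rfl | hs
  · omega
  have h2 : 0 < alive (N.rest y) p (p + 1) := by omega
  obtain ⟨i, hi⟩ := Finset.card_pos.1 h2
  simp only [Finset.mem_filter] at hi
  obtain rfl : i = p := by omega
  refine ⟨hp, ?_, hi.1, ?_⟩
  · by_contra hcon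
    obtain rfl : i = N.b := by omega
    omega
  · simp only [mid]; omega

theorem Valid.exists_cut (h : N.Valid n) (hlt : N.lo + 1 < N.hi) : N.IsCut y (N.cut y) := by
  have hc := h.count_rest (y := y) (by omega)
  have : ∃ c, N.IsCut y c := by
    obtain ⟨p, h1, h2, h3, h4⟩ := exists_alive_eq (L := N.rest y) (a := N.a) (c := N.b)
      (k := N.hi - N.mid - 1) (by simp only [mid]; omega)
    exact ⟨p, h1, h2, h3, h4⟩
  rw [cut, dif_pos this]
  exact this.choose_spec

theorem Valid.left (h : N.Valid n) (hlt : N.lo < N.hi) : (N.left y).Valid n := by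
  have hc := h.count_rest (y := y) hlt
  have hadd := alive_add (N.rest y) (le_cut (y := y) (N := N)) (h.cut_le (y := y))
  have h1 := h.hi_le
  have h2 := h.lo_le
  refine ⟨by simp only [PNode.left, mid]; omega, h2, h.b_le, h.cut_le, ?_⟩
  by_cases hm : N.lo + 1 < N.hi
  · have := (h.exists_cut (y := y) hm).2.2.2
    simp only [PNode.left, mid] at *
    omega
  · simp only [PNode.left, mid] at *
    omega

theorem Valid.right (h : N.Valid n) (hlt : N.lo < N.hi) : (N.right y).Valid n := by
  have hc := h.count_rest (y := y) hlt
  have hadd := alive_add (N.rest y) (le_cut (y := y) (N := N)) (h.cut_le (y := y))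
  have h1 := h.hi_le
  refine ⟨h1, by simp only [PNode.right, mid]; omega, (h.cut_le (y := y)).trans h.b_le,
    show N.a ≤ N.cut y from le_cut, ?_⟩
  by_cases hm : N.lo + 1 < N.hi
  · have := (h.exists_cut (y := y) hm).2.2.2
    simp only [PNode.right, mid] at *
    omega
  · simp only [PNode.right, mid] at *
    omega

theorem isRange : IsRange PNode.lo PNode.hi (PNode.left y) (PNode.right y) :=
  ⟨fun _ => rfl, fun _ => rfl, fun _ => rfl, fun _ => rfl⟩

/-- The cells of the nodes and of the segment tree. -/
def reg (n : ℕ) (N : PNode) : Set ℕ :=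
  {c | (4 * n + 4 * N.a + 2 ≤ c ∧ c < 4 * n + 4 * N.b) ∨
    (12 * n + 5 * N.lo ≤ c ∧ c < 12 * n + 5 * N.hi)}

/-- Positions that are not in use any more. -/
def holes (N : PNode) : ℕ := (N.b - N.a) - (N.hi - N.lo)

/-- Bound for the work below a node, if a call costs at most `o + t * (size + 1)`. -/
def work (o t : ℕ) (N : PNode) : ℕ :=
  2 * t * ((N.hi - N.lo) - Nat.size (N.hi - N.lo)) + (2 * o + 7 * t) * (N.hi - N.lo) + o +
    t * N.holes * (Nat.size (N.hi - N.lo) + 1)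

theorem Valid.work_le (h : N.Valid n) (hlt : N.lo < N.hi) (o t : ℕ) :
    o + (Nat.size (N.b - N.a) + 1) * t + work o t (N.left y) + work o t (N.right y) ≤
      work o t N := by
  have hl := (h.left (y := y) hlt).count
  have hr := (h.right (y := y) hlt).count
  have hc := h.count
  have l1 := alive_le N.L N.a N.b
  have l2 := alive_le (N.left y).L (N.left y).a (N.left y).b
  have l3 := alive_le (N.right y).L (N.right y).a (N.right y).b
  have c1 := le_cut (y := y) (N := N)
  have c2 := h.cut_le (y := y)
  obtain ⟨s1, s2⟩ := Nat.size_half hlt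
  have s3 := Nat.size_le_add_two (a := (N.lo + N.hi) / 2 - N.lo) (b := N.hi - N.lo) (by omega)
  have s4 := Nat.size_le_add_two (a := N.hi - ((N.lo + N.hi) / 2 + 1)) (b := N.hi - N.lo) (by omega)
  have s5 := Nat.size_le_self (N.hi - N.lo)
  have s6 := Nat.size_le_self ((N.lo + N.hi) / 2 - N.lo)
  have s7 := Nat.size_le_self (N.hi - ((N.lo + N.hi) / 2 + 1))
  have s8 : Nat.size (N.b - N.a) ≤ Nat.size (N.hi - N.lo) + N.holes := by
    have := Nat.size_add_le (a := N.hi - N.lo) N.holes (by omega)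
    have e : N.hi - N.lo + N.holes = N.b - N.a := by simp only [holes]; omega
    rwa [e] at this
  have hh : (N.left y).holes + (N.right y).holes = N.holes + 1 := by
    simp only [holes, PNode.left, PNode.right, mid] at *
    omega
  have hm : N.hi - N.lo = ((N.lo + N.hi) / 2 - N.lo) + (N.hi - ((N.lo + N.hi) / 2 + 1)) + 1 := by
    omega
  simp only [work, show (N.left y).lo = N.lo from rfl, show (N.left y).hi = (N.lo + N.hi) / 2 from rfl,
    show (N.right y).lo = (N.lo + N.hi) / 2 + 1 from rfl, show (N.right y).hi = N.hi from rfl]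
  generalize (N.left y).holes = hl at *
  generalize (N.right y).holes = hr at *
  generalize N.holes = h₀ at *
  generalize (N.lo + N.hi) / 2 - N.lo = ml at *
  generalize N.hi - ((N.lo + N.hi) / 2 + 1) = mr at *
  generalize N.hi - N.lo = m at *
  generalize Nat.size (N.b - N.a) = g at *
  generalize Nat.size ml = zl at *
  generalize Nat.size mr = zr at *
  generalize Nat.size m = z at *
  obtain ⟨d, rfl⟩ := Nat.exists_eq_add_of_le s5
  obtain ⟨dl, rfl⟩ := Nat.exists_eq_add_of_le s6
  obtain ⟨dr, rfl⟩ := Nat.exists_eq_add_of_le s7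
  simp only [Nat.add_sub_cancel_left]
  have e1 : t * hl * (zl + 1) ≤ t * hl * z := Nat.mul_le_mul_left _ s1
  have e2 : t * hr * (zr + 1) ≤ t * hr * z := Nat.mul_le_mul_left _ s2
  have e3 : t * hl * z + t * hr * z = t * h₀ * z + t * z := by
    rw [← Nat.add_mul, ← Nat.mul_add, hh]; ring
  have e4 : (g + 1) * t ≤ (z + h₀ + 1) * t := Nat.mul_le_mul_right _ (by omega)
  have e5 : 2 * t * (dl + dr + z) ≤ 2 * t * (d + 3) := Nat.mul_le_mul_left _ (by omega)
  rw [hm]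
  ring_nf at *
  omega

end PNode

/-- Pointer to the root of the tree with node numbers in `[lo, hi)`. -/
def pptr (n lo hi : ℕ) : ℕ := if hi ≤ lo then 0 else 12 * n + 5 * ((lo + hi) / 2)

section
variable {α : Type u} [LinearOrder α] {C : Ctx} {n : ℕ} {x y : ℕ → α}

/-- The input points. -/
def PInput (x y : ℕ → α) (n : ℕ) (m : Mem α) : Prop :=
  ∀ i < n, m (1 + 2 * i) = .key (x i) ∧ m (2 + 2 * i) = .key (y i)

/-- Precondition of a call. -/
structure PCall (x y : ℕ → α) (n : ℕ) (N : PNode) (σ : St α) : Prop where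
  valid : N.Valid n
  h0 : σ.n 0 = n
  h1 : σ.n 1 = N.lo
  h2 : σ.n 2 = N.hi
  input : PInput x y n σ.mem
  h10 : N.lo < N.hi → σ.n 10 = N.a
  h11 : N.lo < N.hi → σ.n 11 = N.b
  seg : N.lo < N.hi → SegOn y N.L n N.a N.b σ.mem

/-- The cells of a node. -/
structure PNodeAt (x y : ℕ → α) (n : ℕ) (N : PNode) (m : Mem α) : Prop where
  left : m (12 * n + 5 * N.mid) = .num (pptr n (N.mid + 1) N.hi)
  right : m (12 * n + 5 * N.mid + 1) = .num (pptr n N.lo N.mid)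
  coord : m (12 * n + 5 * N.mid + 2) = .key (x (N.best y))
  prio : m (12 * n + 5 * N.mid + 3) = .key (y (N.best y))
  split : m (12 * n + 5 * N.mid + 4) =
    .key (x (if N.lo + 1 < N.hi then N.cut y else N.best y))

theorem wp_storePtr {R W : Set ℕ} {σ : St α} {d a b : Expr} {Q : St α → Prop}
    (hB : 40 * (n + 1) ≤ C.B) (h0 : σ.n 0 = n) (hd : d.Ok C.B σ.n) (ha : a.Ok C.B σ.n)
    (hb : b.Ok C.B σ.n) (hbn : b.eval σ.n ≤ n) (hW : d.eval σ.n ∈ W)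
    (hQ : Q (σ.store (d.eval σ.n) (.num (pptr n (a.eval σ.n) (b.eval σ.n))))) :
    wp C.B R W (storePtr d a b) Q σ := by
  simp only [storePtr, wp, h0, hd, ha, hb, Expr.ok_add, Expr.ok_mul, Expr.ok_div, Expr.ok_ofNat,
    Expr.eval_add, Expr.eval_mul, Expr.eval_div, Expr.eval_ofNat, Expr.ok_var, Expr.eval_var, true_and]
  refine ⟨fun h => ⟨by omega, hW, ?_⟩, fun h => ⟨by omega, hW, ?_⟩⟩
  · rwa [pptr, if_pos h] at hQ
  · rwa [pptr, if_neg (by omega)] at hQ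

theorem wp_writePNode {R W : Set ℕ} {N : PNode} {σ : St α} (hB : 40 * (n + 1) ≤ C.B)
    (hv : N.Valid n) (hlt : N.lo < N.hi) (h0 : σ.n 0 = n) (h1 : σ.n 1 = N.lo) (h2 : σ.n 2 = N.hi)
    (h3 : σ.n 3 = N.mid) (h18 : σ.n 18 = N.best y) (h13 : N.lo + 1 < N.hi → σ.n 13 = N.cut y)
    (hin : PInput x y n σ.mem) (hR : ∀ c < 4 * n, c ∈ R)
    (hW : ∀ c, 12 * n + 5 * N.mid ≤ c → c < 12 * n + 5 * (N.mid + 1) → c ∈ W) :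
    wp C.B R W writePNode (fun σ' => PNodeAt x y n N σ'.mem) σ := by
  have hb := (hv.isBest (y := y) hlt).2.2.1
  have hbn := hv.b_le
  have hhi := hv.hi_le
  have hm : N.mid = (N.lo + N.hi) / 2 := rfl
  have hc := hv.exists_cut (y := y)
  obtain ⟨i1, i2⟩ := hin (N.best y) (by omega)
  refine ⟨?_, ?_⟩
  · simp [h0, h3]; omega
  refine wp_storePtr (n := n) hB (by simpa using h0) (by simp) (by simp [h3]; omega) (by simp)
    (by simpa [h2] using hhi) (hW _ (by simp [h0, h3]) (by simp [h0, h3])) ?_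
  refine wp_storePtr (n := n) hB (by simpa using h0) (by simp [h0, h3]; omega) (by simp) (by simp)
    (by simp [h3]; omega) (hW _ (by simp [h0, h3]) (by simp [h0, h3]; omega)) ?_
  have d1 : ∀ k, ¬ 1 + 2 * N.best y = 12 * n + 5 * N.mid + k := by omega
  have d2 : ∀ k, ¬ 2 + 2 * N.best y = 12 * n + 5 * N.mid + k := by omega
  have d10 := d1 0
  have d20 := d2 0
  rw [Nat.add_zero] at d10 d20
  have m1 : 1 + 2 * N.best y ∈ R := hR _ (by omega)
  have m2 : 2 + 2 * N.best y ∈ R := hR _ (by omega)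
  simp [wp, h0, h1, h2, h3, h18, i1, i2, d1, d2, d10, d20, m1, m2]
  refine ⟨by omega, by omega, hW _ (by omega) (by omega), by omega, by omega,
    hW _ (by omega) (by omega), by omega, fun h => ⟨by omega, hW _ (by omega) (by omega), ?_⟩,
    fun h => ?_⟩
  · refine ⟨by simp, by simp, by simp, by simp, ?_⟩
    rw [if_neg (by omega)]
    simp
  · have hcut := hc h
    have := hcut.2.1
    rw [h13 h]
    refine ⟨by omega, hR _ (by omega), by omega, hW _ (by omega) (by omega), ?_⟩
    refine ⟨by simp, by simp, by simp, by simp, ?_⟩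
    obtain ⟨j1, j2⟩ := hin (N.cut y) (by omega)
    simp [h, j1]
    iterate 4 rw [if_neg (by omega)]

/-- Factor in the cost of a node. -/
def pstFactor : ℕ := 1300

theorem pstPre_tri {F : Set ℕ} {N : PNode} {σ : St α} (hB : 40 * (n + 1) ≤ C.B)
    (hF : ∀ c < 4 * n, c ∉ F) (h : PCall x y n N σ) (hlt : N.lo < N.hi) :
    Tri C pstPre (Fᶜ ∪ N.reg n) (N.reg n) ((Nat.size (N.b - N.a) + 1) * pstFactor)
      ((Nat.size (N.b - N.a) + 1) * pstFactor) (σ.setN 3 ((N.lo + N.hi) / 2)) fun σ' =>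
        (∀ v, v = 0 ∨ v = 1 ∨ v = 2 ∨ v = 10 ∨ v = 11 → σ'.n v = σ.n v) ∧ σ'.n 3 = N.mid ∧
        (N.lo + 1 < N.hi → σ'.n 13 = N.cut y) ∧ SegOn y (N.rest y) n N.a N.b σ'.mem ∧
        PNodeAt x y n N σ'.mem ∧ PInput x y n σ'.mem := by
  obtain ⟨hv, h0, h1, h2, hin, h10, h11, hseg⟩ := h
  specialize h10 hlt
  specialize h11 hlt
  specialize hseg hlt
  have hbest := hv.isBest (y := y) hlt
  have hbn := hv.b_le
  have hab := hv.a_le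
  have hhi := hv.hi_le
  have hcount := hv.count
  have hR : ∀ c, c < 4 * n ∨ (4 * n + 4 * N.a + 2 ≤ c ∧ c < 4 * n + 4 * N.b) →
      c ∈ Fᶜ ∪ N.reg n := by
    rintro c (hc | hc)
    · exact Or.inl (hF c hc)
    · exact Or.inr (Or.inl hc)
  have hy : ∀ i < n, σ.mem (2 + 2 * i) = .key (y i) := fun i hi => (hin i hi).2
  have hreg : ∀ c < 4 * n, c ∉ N.reg n := by
    rintro c hc (h | h) <;> omega
  refine (Tri.seq (Q := fun σ₁ => σ₁ = (σ.setN 3 ((N.lo + N.hi) / 2)).setN 12 n)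
    (Tri.set (by simp) (by simp [h0])) ?_).conseq
    (T := 2 + (walkCost (N.b - N.a) + (2 + (deleteCost (N.b - N.a) + (6 +
      (walkCost (N.b - N.a) + 150))))))
    (D := 2 + (walkCost (N.b - N.a) + (2 + (deleteCost (N.b - N.a) + (6 +
      (walkCost (N.b - N.a) + 150)))))) ?_ ?_ fun _ h _ _ _ => h
  · rintro _ rfl - - -
    refine Tri.seq ((walk_tri (y := y) (L := N.L) (n := n) (a := N.a) (b := N.b) (r₀ := n) hB
      (by omega) hab hbn (by simp [h0]) (by simp [h10]) (by simp [h11]) (by simp) hR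
      (by simpa using hy) (by simpa using hseg)).mono le_rfl le_rfl subset_rfl
      (Set.empty_subset _) fun _ h _ _ _ => h) ?_
    rintro σ₂ ⟨p, r, hw, hp⟩ fn₂ - -
    have hpb : p = N.b := by
      rcases hp with hp | hp
      · exact hp
      · by_contra hne
        have h1 := alive_le N.L p (p + 1)
        have h2 := hw.count
        have h3 := hw.ap
        have h4 := hw.pb
        have h5 := alive_le N.L N.a p
        omega
    subst hpb
    have h16 := PNode.best_eq (hw.best (by omega))
    refine Tri.seq (Q := fun σ₃ => σ₃ = σ₂.setN 18 (N.best y))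
      (Tri.set (by simp) (by simp [h16])) ?_
    rintro _ rfl - - -
    refine Tri.seq (Q := fun σ₄ => SegOn y (N.rest y) n N.a N.b σ₄.mem ∧
      ∀ c, c ∉ {c | 4 * n + 4 * N.a + 2 ≤ c ∧ c < 4 * n + 4 * N.b} → σ₄.mem c = σ₂.mem c)
      ((delete_tri (y := y) (L := N.L) (n := n) (a := N.a) (b := N.b)
      (v := N.best y) hB hbest.2.1 hbest.2.2.1 hbn (by simp [hw.h0])
      (by simp; rw [fn₂ 10 (by decide)]; simp [h10]) (by simp [hw.h11]) (by simp) hR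
      (by simpa [hw.mem] using hy) (by simpa [hw.mem] using hseg)).mono le_rfl le_rfl subset_rfl
      (fun c hc => Or.inl hc) fun _ h _ _ hf => ⟨h, hf⟩) ?_
    rintro σ₄ ⟨hs₄, hf₄⟩ fn₄ - -
    have fn₄' : ∀ v, v ∉ delete.mods → v ≠ 18 → v ∉ walk.mods → v ≠ 12 → v ≠ 3 →
        σ₄.n v = σ.n v := by
      intro v g1 g2 g3 g4 g5
      rw [fn₄ v g1]
      simp [g2]
      rw [fn₂ v g3]
      simp [g4, g5]
    have e0 := (fn₄' 0 (by decide) (by decide) (by decide) (by decide) (by decide)).trans h0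
    have e1 := (fn₄' 1 (by decide) (by decide) (by decide) (by decide) (by decide)).trans h1
    have e2 := (fn₄' 2 (by decide) (by decide) (by decide) (by decide) (by decide)).trans h2
    have e10 := (fn₄' 10 (by decide) (by decide) (by decide) (by decide) (by decide)).trans h10
    have e11 := (fn₄' 11 (by decide) (by decide) (by decide) (by decide) (by decide)).trans h11
    have e3 : σ₄.n 3 = N.mid := by
      rw [fn₄ 3 (by decide)]
      simp
      rw [fn₂ 3 (by decide)]
      simp [PNode.mid]
    have e18 : σ₄.n 18 = N.best y := by
      rw [fn₄ 18 (by decide)]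
      simp
    have hin₄ : PInput x y n σ₄.mem := by
      intro i hi
      have hm : ∀ c < 4 * n, σ₄.mem c = σ.mem c := fun c hc => by
        rw [hf₄ c (by simp; omega)]
        simp [hw.mem]
      rw [hm _ (by omega), hm _ (by omega)]
      exact hin i hi
    refine Tri.seq (Q := fun σ₅ => σ₅ = σ₄.setN 12 (N.hi - N.mid - 1)) (Tri.set ?_ ?_) ?_
    · simp [e2, e3, PNode.mid]
      omega
    · simp [e2, e3]
    rintro _ rfl - - -
    refine Tri.seq ((walk_tri (y := y) (L := N.rest y) (n := n) (a := N.a) (b := N.b)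
      (r₀ := N.hi - N.mid - 1) hB
      (by omega) hab hbn (by simp [e0]) (by simp [e10]) (by simp [e11]) (by simp) hR
      (by simpa using fun i hi => (hin₄ i hi).2) (by simpa using hs₄)).mono le_rfl le_rfl subset_rfl
      (Set.empty_subset _) fun _ h _ _ _ => h) ?_
    rintro σ₆ ⟨p, r, hw₆, hp⟩ fn₆ - -
    have fn₆' : ∀ v, v ∉ walk.mods → v ≠ 12 → σ₆.n v = σ₄.n v := by
      intro v g1 g2
      rw [fn₆ v g1]
      simp [g2]
    have m₆ : σ₆.mem = σ₄.mem := hw₆.mem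
    have hcut : N.lo + 1 < N.hi → σ₆.n 13 = N.cut y := fun hlt' => by
      rw [hw₆.h13]
      exact (PNode.cut_eq (hv.isCut_of_walk hlt' hw₆.ap hw₆.pb hw₆.count hp)).symm
    refine (Tri.basic (R := Fᶜ ∪ N.reg n)
      (W := {c | 12 * n + 5 * N.mid ≤ c ∧ c < 12 * n + 5 * (N.mid + 1)})
      (wp_frame (wp_writePNode (x := x) (y := y) (n := n) (N := N) hB hv hlt ?_ ?_ ?_ ?_ ?_ hcut
      ?_ (fun c hc => hR c (Or.inl hc)) fun c c1 c2 => ⟨c1, c2⟩))).mono (by decide) (by decide)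
      subset_rfl ?_ ?_
    · rw [fn₆' 0 (by decide) (by decide), e0]
    · rw [fn₆' 1 (by decide) (by decide), e1]
    · rw [fn₆' 2 (by decide) (by decide), e2]
    · rw [fn₆' 3 (by decide) (by decide), e3]
    · rw [fn₆' 18 (by decide) (by decide), e18]
    · rw [m₆]; exact hin₄
    · rintro c ⟨c1, c2⟩
      refine Or.inr ⟨?_, ?_⟩ <;> simp only [PNode.mid] at * <;> omega
    · rintro σ₇ ⟨hn, fn₇⟩ - - fm₇
      have hmem : ∀ c < 12 * n, σ₇.mem c = σ₄.mem c := fun c hc => by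
        rw [fm₇ c (by simp; omega), m₆]
      have fn₇' : ∀ v, v ∉ writePNode.mods → v ∉ walk.mods → v ≠ 12 → σ₇.n v = σ₄.n v :=
        fun v g1 g2 g3 => by rw [fn₇ v g1, fn₆' v g2 g3]
      refine ⟨?_, ?_, ?_, ?_, hn, ?_⟩
      · rintro v (rfl | rfl | rfl | rfl | rfl)
        · rw [fn₇' _ (by decide) (by decide) (by decide), e0, h0]
        · rw [fn₇' _ (by decide) (by decide) (by decide), e1, h1]
        · rw [fn₇' _ (by decide) (by decide) (by decide), e2, h2]
        · rw [fn₇' _ (by decide) (by decide) (by decide), e10, h10]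
        · rw [fn₇' _ (by decide) (by decide) (by decide), e11, h11]
      · rw [fn₇' _ (by decide) (by decide) (by decide), e3]
      · intro h
        rw [fn₇ 13 (by decide)]
        exact hcut h
      · exact hs₄.congr fun c c1 c2 => hmem c (by omega)
      · intro i hi
        rw [hmem _ (by omega), hmem _ (by omega)]
        exact hin₄ i hi
  all_goals
    simp only [walkCost, deleteCost, pstFactor]
    omega

end


/-- Computes in variable 20 the least power of two that is at least variable 21, and in variable 22
its exponent. -/
def doubling : Cmd :=
  .set 20 1 ;; .set 22 0 ;;
    .loop (.le (V 20 + 1) (V 21)) (.set 20 (2 * V 20) ;; .set 22 (V 22 + 1))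

section
variable {α : Type u} [LinearOrder α] {C : Ctx} {n : ℕ} {x y : ℕ → α}

theorem doubling_tri {R W : Set ℕ} {M : ℕ} {σ : St α} (hM : 1 ≤ M) (hB : 4 * M ≤ C.B)
    (h21 : σ.n 21 = M) :
    Tri C doubling R W ((Nat.size M + 1) * 50) ((Nat.size M + 1) * 50) σ fun σ' =>
      σ'.mem = σ.mem ∧ ∃ K, σ'.n 20 = 2 ^ K ∧ σ'.n 22 = K ∧ M ≤ 2 ^ K ∧ 2 ^ K < 2 * M := by
  have hB1 := C.one_lt_B
  have hlen : (Cmd.set 20 1).len + (Cmd.set 22 0).len = 4 := by decide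
  have hb : (Cmd.set 20 (2 * V 20) ;; .set 22 (V 22 + 1)).len + ((Cond.le (V 20 + 1) (V 21)).code.length + 2)
    = 15 := by decide
  have hb2 : (Cond.le (V 20 + 1) (V 21)).code.length + 2 = 7 := by decide
  refine (Tri.seq (Q := fun τ => τ = σ.setN 20 1) (Tri.set (by simp; omega) (by simp)) ?_
    (T₂ := (Cmd.set 22 0).len + (∑ i ∈ Finset.range (Nat.size M), 15 + 7))
    (D₂ := (Cmd.set 22 0).len + (∑ i ∈ Finset.range (Nat.size M), 15 + 7))).conseq ?_ ?_
    fun _ h _ _ _ => h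
  · rintro _ rfl - - -
    refine Tri.seq (Q := fun τ => τ = (σ.setN 20 1).setN 22 0) (Tri.set (by simp; omega) (by simp)) ?_
    rintro _ rfl - - -
    rw [← hb, ← hb2]
    refine Tri.loop (fun k τ => τ.mem = σ.mem ∧ τ.n 21 = M ∧ ∃ K, τ.n 20 = 2 ^ K ∧ τ.n 22 = K ∧
      2 ^ K < 2 * M ∧ Nat.size M ≤ K + k) (fun _ => _) (fun _ => _) ?_ ?_ ?_ ?_ (Nat.size M) ?_
    · rintro k τ ⟨-, h1, K, h2, -, h3, -⟩
      simp [Cond.Ok, h1, h2]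
      omega
    · rintro k τ ⟨h0, h1, K, h2, h3, h4, h5⟩ h
      simp [Cond.Holds, h1, h2] at h
      have hK := Nat.lt_two_pow_self (n := K)
      refine Tri.basic ?_
      simp [wp, h1, h2, h3]
      have hp : 2 ^ (K + 1) = 2 * 2 ^ K := pow_succ' ..
      have hK' : K + 1 < C.B := by omega
      simp [h0, h1, h3, hK', hB1]
      omega
    · rintro τ ⟨h0, h1, K, h2, h3, h4, h5⟩ h
      simp [Cond.Holds, h1, h2] at h
      have := Nat.size_le.1 h5
      simp at this
      omega
    · rintro k τ ⟨h0, h1, K, h2, h3, h4, h5⟩ h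
      simp [Cond.Holds, h1, h2] at h
      exact ⟨h0, K, h2, h3, by omega, h4⟩
    · exact ⟨rfl, by simpa using h21, 0, by simp, by simp, by simp; omega, by simp⟩
  all_goals
    simp only [Finset.sum_const, Finset.card_range, smul_eq_mul]
    omega

/-- Postcondition of a call. -/
def PDone (x y : ℕ → α) (n : ℕ) (N : PNode) (m : Mem α) : Prop :=
  ∃ t G, Stored m (priorityLabelAt m) (pptr n N.lo N.hi) t G ∧
    G ⊆ {c | 12 * n + 5 * N.lo ≤ c ∧ c < 12 * n + 5 * N.hi} ∧
    IsPriorityTree (points x y N.L N.a N.b) t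

theorem PDone.of_empty {N : PNode} {m : Mem α} (hv : N.Valid n) (h : N.hi ≤ N.lo) :
    PDone x y n N m := by
  refine ⟨.nil, ∅, ?_, by simp, ?_⟩
  · rw [pptr, if_pos h]
    exact .nil
  · rw [IsPriorityTree, ← Multiset.card_eq_zero, card_points, hv.count]
    omega

theorem PDone.node {N : PNode} {m₁ m₂ m m' : Mem α} (hx : ∀ i j, i ≤ j → j < n → x i ≤ x j)
    (hv : N.Valid n) (hlt : N.lo < N.hi) (h₁ : PDone x y n (N.left y) m₁)
    (h₂ : PDone x y n (N.right y) m₂) (hN : PNodeAt x y n N m)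
    (e₁ : ∀ c, c ∉ (N.right y).reg n → m' c = m₁ c) (e₂ : ∀ c, c ∉ (N.left y).reg n → m' c = m₂ c)
    (e₃ : ∀ c, c ∉ (N.left y).reg n → c ∉ (N.right y).reg n → m' c = m c) : PDone x y n N m' := by
  have hbn := hv.b_le
  have hab := hv.a_le
  have hhi := hv.hi_le
  have hb := hv.isBest (y := y) hlt
  have hcb := hv.cut_le (y := y)
  have hac := PNode.le_cut (y := y) (N := N)
  have hml : N.lo ≤ N.mid := by simp only [PNode.mid]; omega
  have hmh : N.mid < N.hi := by simp only [PNode.mid]; omega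
  have hm : N.mid = (N.lo + N.hi) / 2 := rfl
  have hcl := (hv.left (y := y) hlt).count
  have hcr := (hv.right (y := y) hlt).count
  have hcount := hv.count_rest (y := y) hlt
  obtain ⟨tr, Gr, sr, gr, pr⟩ := h₁
  obtain ⟨tl, Gl, sl, gl, pl⟩ := h₂
  simp only [PNode.left, PNode.right, PNode.reg, Set.mem_ofPred_eq] at *
  have sr' : Stored m' (priorityLabelAt m') _ _ _ := sr.congr_priority fun c hc => e₁ c (by
    have := gr hc; simp only [Set.mem_ofPred_eq] at this; omega)
  have sl' : Stored m' (priorityLabelAt m') _ _ _ := sl.congr_priority fun c hc => e₂ c (by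
    have := gl hc; simp only [Set.mem_ofPred_eq] at this; omega)
  have hnode : ∀ k < 5, m' (12 * n + 5 * N.mid + k) = m (12 * n + 5 * N.mid + k) := fun k hk =>
    e₃ _ (by omega) (by omega)
  have dl : ∀ k < 5, 12 * n + 5 * N.mid + k ∉ Gl := fun k hk hc => by
    have := gl hc; simp at this; omega
  have dr : ∀ k < 5, 12 * n + 5 * N.mid + k ∉ Gr := fun k hk hc => by
    have := gr hc; simp at this
  refine ⟨.node ⟨x (N.best y), y (N.best y), x (if N.lo + 1 < N.hi then N.cut y else N.best y)⟩ tl tr,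
    _, .node (G := {12 * n + 5 * N.mid + 2, 12 * n + 5 * N.mid + 2 + 1, 12 * n + 5 * N.mid + 2 + 2})
      ?_ (pl := pptr n (N.mid + 1) N.hi) (pr := pptr n N.lo N.mid) ?_ ?_ ?_ sl' sr' ?_ ?_ ?_, ?_, ?_⟩
  · rw [pptr, if_neg (by omega)]
    generalize (N.lo + N.hi) / 2 = z at *
    omega
  · rw [pptr, if_neg (by omega), ← hm, ← hN.left]
    exact hnode 0 (by omega)
  · rw [pptr, if_neg (by omega), ← hm, ← hN.right]
    exact hnode 1 (by omega)
  · rw [pptr, if_neg (by omega), ← hm]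
    exact ⟨(hnode 2 (by omega)).trans hN.coord, (hnode 3 (by omega)).trans hN.prio,
      (hnode 4 (by omega)).trans hN.split, rfl⟩
  · rw [pptr, if_neg (by omega), ← hm, Set.disjoint_left]
    simp [add_assoc]
  · rw [pptr, if_neg (by omega), ← hm, Set.disjoint_left]
    simp only [Set.mem_union, Set.mem_insert_iff, Set.mem_singleton_iff]
    rintro c ((rfl | rfl) | (rfl | rfl | rfl))
    exacts [dl 0 (by omega), dl 1 (by omega), dl 2 (by omega), dl 3 (by omega), dl 4 (by omega)]
  · rw [pptr, if_neg (by omega), ← hm, Set.disjoint_left]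
    simp only [Set.mem_union, Set.mem_insert_iff, Set.mem_singleton_iff]
    rintro c (((rfl | rfl) | (rfl | rfl | rfl)) | hc)
    · exact dr 0 (by omega)
    · exact dr 1 (by omega)
    · exact dr 2 (by omega)
    · exact dr 3 (by omega)
    · exact dr 4 (by omega)
    · intro hc'
      have h1 := gl hc
      have h2 := gr hc'
      simp at h1 h2
      omega
  · rw [pptr, if_neg (by omega), ← hm]
    rintro c (((hc | hc) | hc) | hc)
    · simp at hc ⊢
      omega
    · simp at hc ⊢
      omega
    · have := gl hc
      simp at this ⊢
      omega
    · have := gr hc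
      simp at this ⊢
      omega
  · refine isPriorityTree_node hx hbn hac hcb hb pl pr ?_ ?_ ?_
    · change alive (N.rest y) _ _ ≤ alive (N.rest y) _ _
      omega
    · change alive (N.rest y) _ _ ≤ alive (N.rest y) _ _ + 1
      omega
    · intro h
      change 0 < alive (N.rest y) _ _ at h
      have hlt' : N.lo + 1 < N.hi := by omega
      rw [if_pos hlt']
      have := hv.exists_cut (y := y) hlt'
      exact ⟨rfl, this.2.1, this.2.2.1⟩

theorem pst_tri (hp : C.Γ[2]? = some (rangeProc 2 pstPro pstPre .skip)) (hB : 40 * (n + 1) ≤ C.B)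
    (hx : ∀ i j, i ≤ j → j < n → x i ≤ x j) {σ : St α} (h0 : σ.n 0 = n) (h1 : σ.n 1 = 0)
    (h2 : σ.n 2 = n) (h3 : σ.n 3 = n) (h11 : σ.n 11 = n) (h13 : σ.n 13 = 0)
    (hin : PInput x y n σ.mem) (hs : SegOn y (Finset.range n) n 0 n σ.mem) :
    Tri C (.fork 4 2) Set.univ {c | 4 * n ≤ c}
      (PNode.work (overhead pstPro .skip) pstFactor ⟨0, n, 0, n, Finset.range n⟩ +
        PNode.work (overhead pstPro .skip) pstFactor ⟨n + 1, n, 0, 0, ∅⟩ + (2 * pstPro.len + 3))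
      ((Nat.size n + 2) * ((Nat.size n + 1) * pstFactor + overhead pstPro .skip)) σ
      fun σ' => ∃ m', σ' = σ.withMem m' ∧ PDone x y n ⟨0, n, 0, n, Finset.range n⟩ m' := by
  have hB1 := C.one_lt_B
  have hov : pstPro.len + 2 ≤ overhead pstPro .skip := by decide
  have hv1 : (⟨0, n, 0, n, Finset.range n⟩ : PNode).Valid n := by
    refine ⟨le_rfl, by simp, le_rfl, by simp, ?_⟩
    simp only [alive]
    rw [Finset.filter_true_of_mem (by simp)]
    simp
  have hv2 : (⟨n + 1, n, 0, 0, ∅⟩ : PNode).Valid n :=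
    ⟨le_rfl, le_rfl, by simp, le_rfl, by simp [alive]⟩
  refine (Tri.rangeFork (lo := PNode.lo) (hi := PNode.hi) (l := PNode.left y) (r := PNode.right y)
    (F := {c | 4 * n ≤ c}) hp PNode.isRange (PCall x y n) (PDone x y n) (PNode.reg n)
    (fun N => (Nat.size (N.b - N.a) + 1) * pstFactor) (fun N => (Nat.size n + 1) * pstFactor)
    (PNode.work (overhead pstPro .skip) pstFactor)
    (fun N => (Nat.size (N.hi - N.lo) + 1) *
      ((Nat.size n + 1) * pstFactor + overhead pstPro .skip))
    ?_ ?_ ?_ ?_ ?_ ?_ ?_ ?_ ?_ ⟨0, n, 0, n, Finset.range n⟩ ⟨n + 1, n, 0, 0, ∅⟩ σ ?_ ?_ ?_ ?_).mono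
    le_rfl ?_ (Set.subset_univ _) ?_ fun _ h _ _ _ => h
  · intro N τ h
    have := h.valid.hi_le
    have := h.valid.lo_le
    exact ⟨h.h1, h.h2, by omega⟩
  · rintro N τ h c (hc | hc) <;> simp <;> omega
  · intro N τ h hlt
    have c1 := PNode.le_cut (y := y) (N := N)
    have c2 := h.valid.cut_le (y := y)
    have c3 := h.valid.b_le
    refine ⟨?_, ?_, ?_⟩
    · rintro c hc
      simp only [PNode.reg, PNode.left, PNode.mid, Set.mem_ofPred_eq] at hc ⊢
      omega
    · rintro c hc
      simp only [PNode.reg, PNode.right, PNode.mid, Set.mem_ofPred_eq] at hc ⊢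
      omega
    · rw [Set.disjoint_left]
      intro c hc hc'
      simp only [PNode.reg, PNode.right, PNode.left, PNode.mid, Set.mem_ofPred_eq] at hc hc'
      omega
  · intro N τ h hlt
    exact .of_empty h.valid hlt
  · intro N τ h hlt
    have hv := h.valid
    have c1 := PNode.le_cut (y := y) (N := N)
    have c2 := hv.cut_le (y := y)
    have c3 := hv.hi_le
    have hsz : Nat.size (N.b - N.a) ≤ Nat.size n := Nat.size_le_size (by have := hv.b_le; omega)
    refine (pstPre_tri (F := {c | 4 * n ≤ c}) hB (by simp) h hlt).conseq le_rfl
      (Nat.mul_le_mul_right _ (by omega)) ?_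
    rintro τ' ⟨f, f3, f13, fs, fN, fin⟩ - - -
    have f0 := (f 0 (by simp)).trans h.h0
    have f1 := (f 1 (by simp)).trans h.h1
    have f2 := (f 2 (by simp)).trans h.h2
    have f10 := (f 10 (by simp)).trans (h.h10 hlt)
    have f11 := (f 11 (by simp)).trans (h.h11 hlt)
    refine ⟨?_, ?_, ?_⟩
    · simp [pstPro, wp]
      refine ⟨by omega, hv.left hlt, by simpa using f0, f1, f3, fin,
        fun hl => ?_, fun hl => f11, fun hl => fs.mono c1 le_rfl⟩
      simp only [PNode.left, PNode.mid] at hl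
      exact f13 (by omega)
    · simp [pstPro, wp]
      refine ⟨by omega, by simp only [f3, PNode.mid]; omega, hv.right hlt, by simpa using f0,
        congrArg (· + 1) f3, f2, fin, fun hl => f10, fun hl => ?_, fun hl => fs.mono le_rfl c2⟩
      simp only [PNode.right, PNode.mid] at hl
      exact f13 (by omega)
    · intro m₁ m₂ m' j₁ j₂ e₁ e₂ e₃
      exact PDone.node hx hv hlt j₁ j₂ fN e₁ e₂ e₃
  · intro N τ h hlt
    exact h.valid.work_le hlt _ _
  · intro N
    simp only [PNode.work]
    omega
  · intro N τ h hlt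
    obtain ⟨s1, s2⟩ := Nat.size_half hlt
    have h3 := max_le
      (Nat.mul_le_mul_right ((Nat.size n + 1) * pstFactor + overhead pstPro .skip) s1)
      (Nat.mul_le_mul_right ((Nat.size n + 1) * pstFactor + overhead pstPro .skip) s2)
    simp only [PNode.left, PNode.right, PNode.mid]
    linarith
  · intro N
    exact (Nat.le_add_left _ _).trans (Nat.le_mul_of_pos_left _ (by omega))
  · simp [pstPro, wp]
    refine ⟨by omega, hv1, by simpa using h0, by simpa using h1, by simpa using h3, hin, ?_, ?_,
      fun _ => hs⟩
    · exact fun _ => by simpa using h13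
    · exact fun _ => by simpa using h11
  · simp [pstPro, wp]
    refine ⟨by omega, by omega, hv2, by simpa using h0, by simpa using h3, by simpa using h2, hin,
      ?_, ?_, ?_⟩ <;> simp
  · ext c
    simp [PNode.reg]
    omega
  · rintro c (hc | hc) <;> simp <;> omega
  · simp
    generalize (Nat.size n + 1) * pstFactor = u at *
    rw [max_eq_left (Nat.le_mul_of_pos_left _ (by omega))]
    ring_nf
    omega
  · rintro c (hc | hc) <;> simp <;> omega

def pstMain : Cmd :=
  .ite (.le (V 0) 0) (.store 0 0) (.set 21 (V 0) ;; doubling ;;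
    .set 1 1 ;; .set 2 (2 * V 20) ;; .set 3 (2 * V 20) ;; .fork 4 1 ;;
    .set 1 0 ;; .set 2 (V 0) ;; .set 3 (V 0) ;; .set 11 (V 0) ;; .set 13 0 ;; .fork 4 2 ;;
    .store 0 (12 * V 0 + 5 * (V 0 / 2)))

def pstProcs : List Cmd := [pstMain, segProc 1, rangeProc 2 pstPro pstPre .skip]

theorem SegIn.segOn {m : Mem α} {S : ℕ} (h : SegIn y n 1 (2 * S) m) (hS : n ≤ S) :
    SegOn y (Finset.range n) n 0 n m := by
  intro l k hd h1 h2
  have := Nat.one_le_two_pow (n := k)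
  exact h l k hd (by omega) (by omega) (by omega)

/-- The value of an extension of `f`, which is not constant only below `n`. -/
def extend (hn : 1 ≤ n) (f : Fin n → α) (i : ℕ) : α := f ⟨min i (n - 1), by omega⟩

theorem extend_val (hn : 1 ≤ n) (f : Fin n → α) (i : Fin n) : extend hn f i = f i := by
  rw [extend]
  congr 1
  ext
  simp
  omega

theorem points_extend (hn : 1 ≤ n) (f g : Fin n → α) :
    points (extend hn f) (extend hn g) (Finset.range n) 0 n =
      Finset.univ.val.map fun i => (f i, g i) := by
  rw [points, Finset.filter_true_of_mem (by simp)]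
  have : (Finset.univ : Finset (Fin n)).val.map Fin.val = (Finset.range n).val := by
    have := congrArg Finset.val (Fin.map_valEmbedding_univ (n := n))
    rwa [Nat.Iio_eq_range] at this
  rw [← this, Multiset.map_map]
  refine Multiset.map_congr rfl fun i _ => ?_
  simp only [Function.comp, extend_val]

/-- Bounds for the cost of the program, up to constant factors. -/
def pstTime (n : ℕ) : ℕ :=
  (Nat.size n + 1) * 50 + (4 * n * (3 * overhead proHalf segPost)) +
    PNode.work (overhead pstPro .skip) pstFactor ⟨0, n, 0, n, Finset.range n⟩ +
    PNode.work (overhead pstPro .skip) pstFactor ⟨n + 1, n, 0, 0, ∅⟩ + (2 * pstPro.len + 3) + 100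

def pstDepth (n : ℕ) : ℕ :=
  (Nat.size n + 1) * 50 + (Nat.size n + 4) * (2 * overhead proHalf segPost) +
    (Nat.size n + 2) * ((Nat.size n + 1) * pstFactor + overhead pstPro .skip) + 100

theorem pstMain_tri (hΓ : C.Γ = pstProcs) (hB : 40 * (n + 1) ≤ C.B) {f g : Fin n → α} {m : Mem α}
    (h : HoldsSortedPoints m f g) :
    Tri C pstMain Set.univ Set.univ (pstTime n) (pstDepth n) (initSt n m) fun σ =>
      HoldsPriorityTree f g σ.mem := by
  have hB1 := C.one_lt_B
  have hB2 : 0 < C.B ∧ 12 * n < C.B ∧ 12 < C.B ∧ 12 * n + 5 * (n / 2) < C.B ∧ 5 * (n / 2) < C.B ∧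
        2 < C.B ∧ 5 < C.B ∧ n / 2 < C.B := by omega
  have h0 : (initSt n m).n 0 = n := rfl
  unfold pstMain
  rcases Nat.eq_zero_or_pos n with rfl | hn
  · refine (Tri.ite (T := (Cmd.store 0 0).len) (D := (Cmd.store 0 0).len) ?_ (fun _ => ?_)
      (fun h => ?_)).conseq ?_ ?_ fun _ h _ _ _ => h
    · simp [Cond.Ok]; omega
    · refine Tri.store (by simp; omega) (by simp; omega) (by simp) ?_
      refine ⟨0, .nil, ∅, by simp, .nil, by simp, ?_⟩
      simp [IsPriorityTree]
    · simp [Cond.Holds, h0] at h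
    · rw [show (Cond.le (V 0) 0).code.length + 2 = 5 by decide]
      simp only [pstTime]
      have : (Cmd.store 0 0).len = 3 := by decide
      omega
    · rw [show (Cond.le (V 0) 0).code.length + 2 = 5 by decide]
      simp only [pstDepth]
      have : (Cmd.store 0 0).len = 3 := by decide
      omega
  obtain ⟨hmono, hin⟩ := h
  have hin' : PInput (extend hn f) (extend hn g) n m := fun i hi => by
    have := hin ⟨i, hi⟩
    rw [← extend_val hn f, ← extend_val hn g] at this
    exact this
  have hx : ∀ i j, i ≤ j → j < n → extend hn f i ≤ extend hn f j := fun i j hij hj => by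
    refine hmono (Fin.mk_le_mk.2 ?_)
    omega
  refine (Tri.ite (by simp [Cond.Ok]; omega) (fun h => ?_)
    (fun _ => Tri.seq (Tri.set (Q := fun σ => σ = (initSt n m).setN 21 n) (by simp) (by simp [h0])) ?_
      (T₂ := (Nat.size n + 1) * 50 + (2 + (4 + (4 + (4 * n * (3 * overhead proHalf segPost) +
        (2 + (2 + (2 + (2 + (2 + (PNode.work (overhead pstPro .skip) pstFactor ⟨0, n, 0, n, Finset.range n⟩ +
    PNode.work (overhead pstPro .skip) pstFactor ⟨n + 1, n, 0, 0, ∅⟩ + (2 * pstPro.len + 3) + 11)))))))))))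
      (D₂ := (Nat.size n + 1) * 50 + (2 + (4 + (4 + ((Nat.size n + 4) * (2 * overhead proHalf segPost) +
        (2 + (2 + (2 + (2 + (2 + ((Nat.size n + 2) * ((Nat.size n + 1) * pstFactor + overhead pstPro .skip) +
          11)))))))))))
      )).conseq ?_ ?_ fun _ h _ _ _ => h
  · simp [Cond.Holds, h0] at h
    omega
  · rintro _ rfl - - -
    refine Tri.seq (doubling_tri (M := n) hn (by omega) (by simp)) ?_
    rintro σ₂ ⟨m₂, K, h20, -, hK1, hK2⟩ fn₂ - -
    have h0₂ : σ₂.n 0 = n := by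
      rw [fn₂ 0 (by decide)]
      simpa using h0
    have hin₂ : PInput (extend hn f) (extend hn g) n σ₂.mem := by
      rw [m₂]; exact hin'
    refine Tri.seq (Q := fun τ => τ = σ₂.setN 1 1) (Tri.set (by simp; omega) (by simp)) ?_
    rintro _ rfl - - -
    refine Tri.seq (Q := fun τ => τ = (σ₂.setN 1 1).setN 2 (2 * 2 ^ K))
      (Tri.set (by simp; omega) (by simp [h20])) ?_
    rintro _ rfl - - -
    refine Tri.seq (Q := fun τ => τ = ((σ₂.setN 1 1).setN 2 (2 * 2 ^ K)).setN 3 (2 * 2 ^ K))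
      (Tri.set (by simp; omega) (by simp [h20])) ?_
    rintro _ rfl - - -
    refine Tri.seq (((segTree (y := extend hn g) (n := n) (K := K) (S := 2 ^ K) (p := 1)
      (σ := ((σ₂.setN 1 1).setN 2 (2 * 2 ^ K)).setN 3 (2 * 2 ^ K)) (by rw [hΓ]; rfl) hB hn
      rfl (by omega) (by simpa using h0₂) (by simp) (by simp) (by simp) ?_)).mono (T' := 4 * n * (3 * overhead proHalf segPost)) (D' := (Nat.size n + 4) * (2 * overhead proHalf segPost)) ?_ ?_ (Set.subset_univ _)
        (Set.subset_univ _) fun _ h _ _ hf => (⟨h, hf⟩ :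
          _ ∧ ∀ c, c ∉ {c | 4 * n ≤ c ∧ c < 12 * n} → _)) ?_
    · exact fun i hi => (hin₂ i hi).2
    · refine Nat.mul_le_mul_right _ ?_
      omega
    · refine Nat.mul_le_mul_right _ ?_
      have := Nat.size_le_size (show 2 * 2 ^ K - 1 ≤ 2 * (2 * n) + 2 by omega)
      have h3 : Nat.size (2 * 2 ^ K - 1) ≤ Nat.size n + 2 := by
        have := Nat.lt_size_self n
        refine Nat.size_le.2 ?_
        rw [pow_add]
        omega
      omega
    rintro _ ⟨⟨m₃, rfl, hseg⟩, hf₃⟩ - - -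
    have hin₃ : PInput (extend hn f) (extend hn g) n m₃ := by
      intro i hi
      have e : ∀ c < 4 * n, m₃ c = σ₂.mem c := fun c hc => by
        have := hf₃ c (by simp only [Set.mem_ofPred_eq]; omega)
        simpa using this
      rw [e _ (by omega), e _ (by omega)]
      exact hin₂ i hi
    refine Tri.seq (Q := fun τ => τ.n 0 = n ∧ τ.n 1 = 0 ∧ τ.mem = m₃)
      (Tri.set (by simp; omega) (by simp [h0₂])) ?_
    rintro τ₁ ⟨a0, a1, am⟩ - - -
    refine Tri.seq (Q := fun τ => τ.n 0 = n ∧ τ.n 1 = 0 ∧ τ.n 2 = n ∧ τ.mem = m₃)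
      (Tri.set (by simp) (by simp [a0, a1, am])) ?_
    rintro τ₂ ⟨b0, b1, b2, bm⟩ - - -
    refine Tri.seq (Q := fun τ => τ.n 0 = n ∧ τ.n 1 = 0 ∧ τ.n 2 = n ∧ τ.n 3 = n ∧ τ.mem = m₃)
      (Tri.set (by simp) (by simp [b0, b1, b2, bm])) ?_
    rintro τ₃ ⟨c0, c1, c2, c3, cm⟩ - - -
    refine Tri.seq (Q := fun τ => τ.n 0 = n ∧ τ.n 1 = 0 ∧ τ.n 2 = n ∧ τ.n 3 = n ∧ τ.n 11 = n ∧
      τ.mem = m₃) (Tri.set (by simp) (by simp [c0, c1, c2, c3, cm])) ?_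
    rintro τ₄ ⟨d0, d1, d2, d3, d11, dm⟩ - - -
    refine Tri.seq (Q := fun τ => τ.n 0 = n ∧ τ.n 1 = 0 ∧ τ.n 2 = n ∧ τ.n 3 = n ∧ τ.n 11 = n ∧
      τ.n 13 = 0 ∧ τ.mem = m₃) (Tri.set (by simp; omega) (by simp [d0, d1, d2, d3, d11, dm])) ?_
    rintro τ₅ ⟨e0, e1, e2, e3, e11, e13, em⟩ - - -
    refine Tri.seq ((pst_tri (C := C) (x := extend hn f) (y := extend hn g) (σ := τ₅) (by rw [hΓ]; rfl) hB hx
      e0 e1 e2 e3 e11 e13 (em ▸ hin₃) (em ▸ hseg.segOn hK1)).mono le_rfl le_rfl subset_rfl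
      (Set.subset_univ _) fun _ h _ _ _ => h) ?_
    rintro _ ⟨m₄, rfl, t, G, hst, hG, htree⟩ - - -
    refine (Tri.store ?_ ?_ (by simp) ?_).conseq (by decide) (by decide) fun _ h _ _ _ => h
    · simp [hB2]
    · simp [e0, hB2]
    simp [e0]
    have hG0 : 0 ∉ G := fun h => by
      have := (hG h).1
      simp at this
      exact hn.ne' this
    refine ⟨12 * n + 5 * (n / 2), t, G, by simp, ?_, hG0, ?_⟩
    · have : pptr n 0 n = 12 * n + 5 * (n / 2) := by rw [pptr, if_neg (by simpa using hn.ne'), Nat.zero_add]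
      simp only [this] at hst
      refine hst.congr_priority fun c hc => ?_
      simp
      rintro rfl
      exact absurd hc hG0
    · rw [← points_extend hn]
      exact htree
  · rw [show (Cond.le (V 0) 0).code.length + 2 = 5 by decide, show (Cmd.set 21 (V 0)).len = 2 by decide]
    simp only [pstTime]
    generalize PNode.work (overhead pstPro .skip) pstFactor ⟨0, n, 0, n, Finset.range n⟩ = w₁
    generalize PNode.work (overhead pstPro .skip) pstFactor ⟨n + 1, n, 0, 0, ∅⟩ = w₂
    generalize 4 * n * (3 * overhead proHalf segPost) = w₃
    generalize (Nat.size n + 1) * 50 = w₄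
    clear h0 hB hB1 hB2
    omega
  · rw [show (Cond.le (V 0) 0).code.length + 2 = 5 by decide, show (Cmd.set 21 (V 0)).len = 2 by decide]
    simp only [pstDepth]
    generalize (Nat.size n + 2) * ((Nat.size n + 1) * pstFactor + overhead pstPro .skip) = w₁
    generalize (Nat.size n + 4) * (2 * overhead proHalf segPost) = w₃
    generalize (Nat.size n + 1) * 50 = w₄
    clear h0 hB hB1 hB2
    omega

theorem le_two_pow_of_log {k n w : ℕ} (h : k * (Nat.log 2 n + 1) ≤ w) (hk : 10 ≤ k) :
    2 ^ (k - 1) * (n + 1) ≤ 2 ^ w := by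
  have h1 : n < 2 ^ (Nat.log 2 n + 1) := Nat.lt_pow_succ_log_self (by norm_num) n
  calc 2 ^ (k - 1) * (n + 1) ≤ 2 ^ (k - 1) * 2 ^ (Nat.log 2 n + 1) := Nat.mul_le_mul_left _ h1
    _ = 2 ^ (k - 1 + (Nat.log 2 n + 1)) := (pow_add ..).symm
    _ ≤ 2 ^ w := pow_le_pow_right₀ (by norm_num) (by nlinarith [Nat.sub_add_cancel (show 1 ≤ k by omega)])

theorem Nat.size_le_log_add_one (n : ℕ) : Nat.size n ≤ Nat.log 2 n + 1 :=
  Nat.size_le.2 (Nat.lt_pow_succ_log_self (by norm_num) n)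

theorem exists_pst_program : ∃ (P : Program) (k s : ℕ) (K : ℝ),
    ∀ (α : Type u) [LinearOrder α] (n : ℕ) (x y : Fin n → α) (m : Mem α),
      HoldsSortedPoints m x y → BuildsWithin P k s K n m (HoldsPriorityTree x y) := by
  refine ⟨link pstProcs, 10, 0, (100000 : ℕ), fun α _ n x y m h => ?_⟩
  refine buildsWithin_of_tri (main := pstMain) rfl (by norm_num) fun C hΓ hw =>
    ⟨_, _, _, _, pstMain_tri hΓ ?_ h, fun hn => ?_⟩
  · have := le_two_pow_of_log hw le_rfl
    simp only [Ctx.B]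
    omega
  have h1 : overhead proHalf segPost = 217 := by decide
  have h2 : overhead pstPro .skip = 60 := by decide
  have h3 : pstPro.len = 15 := by decide
  have h4 := Nat.size_le_self n
  have h5 := Nat.size_le_log_add_one n
  have h6 : 1 ≤ Nat.log 2 n := Nat.log_pos (by norm_num) hn
  have h7 : n - (n + 1) = 0 := by omega
  constructor
  · simp only [pstTime, PNode.work, PNode.holes, h1, h2, h3, h7, pstFactor]
    simp
    omega
  · simp only [pstDepth, h1, h2, pstFactor]
    generalize Nat.log 2 n = q at *
    obtain ⟨r, rfl⟩ := Nat.exists_eq_add_of_le h6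
    generalize Nat.size n = z at *
    have : (z + 2) * (z + 1) ≤ (r + 4) * (r + 3) := Nat.mul_le_mul (by omega) (by omega)
    nlinarith

end


/-- The registers that are constant during parallel loops have the values `e`. -/
def Env (e ν : ℕ → ℕ) : Prop := ∀ v, v = 0 ∨ 20 ≤ v → ν v = e v

/-- Runs procedure `p` on the range from `0` to the value of variable `r`. -/
def parFor (p r : ℕ) : Cmd := .set 1 0 ;; .set 2 (V r) ;; .set 3 (V r) ;; .fork 4 p

section
variable {α : Type u} [LinearOrder α] {C : Ctx} {m m' : Mem α} {b k : ℕ} {f : ℕ → ℕ}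

/-- The array of length `k` at address `b` has the entries `f`. -/
def Nums (m : Mem α) (b k : ℕ) (f : ℕ → ℕ) : Prop := ∀ i < k, m (b + i) = .num (f i)

theorem Nums.congr (h : Nums m b k f) (hm : ∀ c, b ≤ c → c < b + k → m' c = m c) :
    Nums m' b k f := fun i hi => by
  rw [hm _ (by omega) (by omega), h i hi]

theorem Env.frame {e ν ν' : ℕ → ℕ} {l : List ℕ} (h : Env e ν) (hν : ∀ v, v ∉ l → ν' v = ν v)
    (hl : ∀ v ∈ l, v ≠ 0 ∧ v < 20) : Env e ν' := fun v hv => by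
  rw [hν v fun h => by have := hl v h; omega, h v hv]

theorem Env.setN {e : ℕ → ℕ} {σ : St α} {x v : ℕ} (h : Env e σ.n) (hx : x ≠ 0 ∧ x < 20) :
    Env e (σ.setN x v).n := fun y hy => by
  rw [St.setN_n, if_neg (by omega), h y hy]

/-- A parallel loop in which the iteration `i` writes to `cells i`, so as to satisfy `Post i`. -/
theorem Tri.parFor {p r N : ℕ} {body : Cmd} (hp : C.Γ[p]? = some (rangeProc p proHalf body .skip))
    (hmods : ∀ v ∈ body.mods, 5 ≤ v ∧ v < 20) (hr : 20 ≤ r)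
    {e : ℕ → ℕ} (Post : ℕ → Mem α → Prop) (cells : ℕ → Set ℕ) (F : Set ℕ) (f : ℕ → ℕ) (Dp : ℕ)
    (hN : 2 * N + 4 ≤ C.B) (hdis : ∀ i j, i < N → j < N → i ≠ j → Disjoint (cells i) (cells j))
    (hF : ∀ i, i < N → cells i ⊆ F)
    (hloc : ∀ i < N, ∀ m m', (∀ y ∈ cells i, m' y = m y) → Post i m → Post i m') {σ : St α}
    (he : Env e σ.n) (hrN : e r = N)
    (hbody : ∀ i < N, ∀ τ : St α, τ.n 3 = i → Env e τ.n →
      (∀ y, y ∉ F ∨ y ∈ cells i → τ.mem y = σ.mem y) →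
      Tri C body (Fᶜ ∪ cells i) (cells i) (f i) Dp τ fun τ' => Post i τ'.mem) :
    Tri C (parFor p r) Set.univ {y | ∃ i < N, y ∈ cells i}
      (∑ i ∈ Finset.range N, (f i + 104) + 200) ((Nat.size N + 2 + 1) * (Dp + 52)) σ
      fun σ' => ∀ i < N, Post i σ'.mem := by
  have hB := C.one_lt_B
  have hov : overhead proHalf .skip = 52 := by decide
  have hrN' : σ.n r = N := (he r (by omega)).trans hrN
  refine (Tri.seq (Q := fun τ => τ = σ.setN 1 0) (Tri.set (by simp; omega) (by simp)) ?_
    (T₂ := 2 + (2 + (∑ i ∈ Finset.range N, (f i + 104) + 156)))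
    (D₂ := 2 + (2 + (Nat.size N + 2) * (Dp + 52)))).conseq ?_ ?_ fun _ h _ _ _ => h
  rotate_left
  · rw [show (Cmd.set 1 0).len = 2 by decide]
    omega
  · rw [show (Cmd.set 1 0).len = 2 by decide, Nat.add_mul (Nat.size N + 2) 1]
    omega
  rintro _ rfl - - -
  refine Tri.seq (Q := fun τ => τ = (σ.setN 1 0).setN 2 N) (Tri.set (by simp) ?_) ?_
  · simp [hrN', show r ≠ 1 by omega]
  rintro _ rfl - - -
  refine Tri.seq (Q := fun τ => τ = ((σ.setN 1 0).setN 2 N).setN 3 N) (Tri.set (by simp) ?_) ?_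
  · simp [hrN', show r ≠ 1 by omega, show r ≠ 2 by omega]
  rintro _ rfl - - -
  refine (Tri.rangeTree (C := C) (X := ℕ × ℕ) (F := F) hp isRange_pair
    (fun x ν _ => ν 1 = x.1 ∧ ν 2 = x.2 ∧ x.1 ≤ N + 1 ∧ x.2 ≤ N ∧ Env e ν)
    (fun x m => Post ((x.1 + x.2) / 2) m) cells N σ.mem f Dp hN ?_ hdis hF ?_ ?_ (0, N) (N + 1, N) _
    ?_ ?_ (by simp) le_rfl ?_).mono ?_ ?_ (Set.subset_univ _) ?_ ?_
  · rintro x ν κ ⟨h1, h2, h3, h4, -⟩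
    exact ⟨h1, h2, h3, h4⟩
  · rintro ⟨a, b⟩ m m' hlt hb hm h
    simp only at hlt hb
    exact hloc _ (by simp only; omega) m m' hm h
  · rintro ⟨a, b⟩ τ ⟨h1, h2, h3, h4, h5⟩ hlt hm
    simp only at hlt h1 h2 h3 h4
    refine (hbody ((a + b) / 2) (by omega) (τ.setN 3 ((a + b) / 2)) (by simp) (h5.setN (by simp))
      (by simpa using hm)).conseq le_rfl le_rfl ?_
    rintro τ' hP hn - -
    have e1 : τ'.n 1 = a := by
      rw [hn 1 fun h => by have := hmods 1 h; omega]
      simpa using h1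
    have e2 : τ'.n 2 = b := by
      rw [hn 2 fun h => by have := hmods 2 h; omega]
      simpa using h2
    have e3 : τ'.n 3 = (a + b) / 2 := by
      rw [hn 3 fun h => by have := hmods 3 h; omega]
      simp
    have he' : Env e τ'.n := (h5.setN (x := 3) (v := (a + b) / 2) (by simp)).frame hn
      fun v hv => by have := hmods v hv; omega
    refine ⟨wp_proHalf_left hB ⟨⟨?_, ?_, h3, by simp; omega, ?_⟩, rfl⟩,
      wp_proHalf_right hB (by rw [e3]; omega) ⟨⟨?_, ?_, by simp; omega, h4, ?_⟩, rfl⟩, hP⟩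
    · simpa using e1
    · simpa using e3
    · exact (he'.setN (by simp)).setN (by simp)
    · simpa using e3
    · simpa using e2
    · exact (he'.setN (by simp)).setN (by simp)
  · refine wp_proHalf_left hB ⟨⟨?_, ?_, by simp, le_rfl, ?_⟩, rfl⟩
    · simp
    · simp
    · exact ((((he.setN (by simp)).setN (by simp)).setN (by simp)).setN (by simp)).setN (by simp)
  · refine wp_proHalf_right hB (by simp; omega) ⟨⟨?_, ?_, le_rfl, le_rfl, ?_⟩, rfl⟩
    · simp
    · simp
    · exact ((((he.setN (by simp)).setN (by simp)).setN (by simp)).setN (by simp)).setN (by simp)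
  · intro y _
    rfl
  · simp only [hov]
    rw [← Finset.range_eq_Ico]
  · simp [hov]
  · rintro y ⟨i, -, h2, h3⟩
    exact ⟨i, h2, h3⟩
  · rintro _ ⟨m', rfl, h⟩ - - - i hi
    exact h.of_index isRange_pair (Q := fun i => Post i m') (Nat.zero_le i) hi

end


/-! ## Lowest common ancestors in a complete binary search tree -/

theorem div_eq_of_xor_lt {a b h : ℕ} : a ^^^ b < 2 ^ h ↔ a / 2 ^ h = b / 2 ^ h := by
  rw [← Nat.div_eq_zero_iff_lt (Nat.two_pow_pos h), ← Nat.shiftRight_eq_div_pow,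
    ← Nat.shiftRight_eq_div_pow, ← Nat.shiftRight_eq_div_pow, Nat.shiftRight_xor_distrib,
    Nat.xor_eq_zero_iff]

/-- Height of the lowest common ancestor of `a` and `b`. -/
def lcaHeight (a b : ℕ) : ℕ := Nat.log 2 ((a - 1) ^^^ b)

/-- Lowest common ancestor of `a` and `b`. -/
def lca (a b : ℕ) : ℕ := b / 2 ^ lcaHeight a b * 2 ^ lcaHeight a b

theorem xor_pos {a b : ℕ} (ha : 1 ≤ a) (hab : a ≤ b) : 0 < (a - 1) ^^^ b :=
  Nat.pos_of_ne_zero fun h => by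
    have := Nat.xor_eq_zero_iff.1 h
    omega

theorem lca_spec {a b : ℕ} (ha : 1 ≤ a) (hab : a ≤ b) :
    ∃ l, lca a b = (2 * l + 1) * 2 ^ lcaHeight a b ∧ (a - 1) / 2 ^ (lcaHeight a b + 1) = l ∧
      b / 2 ^ (lcaHeight a b + 1) = l ∧ lca a b - 2 ^ lcaHeight a b < a ∧ a ≤ lca a b ∧
      lca a b ≤ b ∧ b < lca a b + 2 ^ lcaHeight a b := by
  have hz := xor_pos ha hab
  have h1 : 2 ^ lcaHeight a b ≤ (a - 1) ^^^ b := Nat.pow_log_le_self 2 hz.ne'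
  have h2 : (a - 1) ^^^ b < 2 ^ (lcaHeight a b + 1) := Nat.lt_pow_succ_log_self (by norm_num) _
  rw [lca]
  generalize lcaHeight a b = h at *
  rw [div_eq_of_xor_lt] at h2
  rw [← not_lt, div_eq_of_xor_lt] at h1
  have hp := Nat.two_pow_pos h
  have e1 := Nat.div_add_mod (a - 1) (2 ^ h)
  have e2 := Nat.div_add_mod b (2 ^ h)
  have l1 := Nat.mod_lt (a - 1) hp
  have l2 := Nat.mod_lt b hp
  have hle : (a - 1) / 2 ^ h ≤ b / 2 ^ h := Nat.div_le_div_right (by omega)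
  have hlt : (a - 1) / 2 ^ h < b / 2 ^ h := lt_of_le_of_ne hle h1
  rw [pow_succ, ← Nat.div_div_eq_div_mul, ← Nat.div_div_eq_div_mul] at *
  refine ⟨b / 2 ^ h / 2, ?_, h2, rfl, ?_⟩
  · congr 1
    omega
  have e3 : b / 2 ^ h = (a - 1) / 2 ^ h + 1 := by omega
  rw [e3] at e2 ⊢
  rw [Nat.add_mul, Nat.one_mul]
  rw [Nat.mul_add, Nat.mul_one] at e2
  rw [Nat.mul_comm] at e1 e2
  omega

theorem lca_eq {a b g l : ℕ} (ha : 1 ≤ a) (h1 : 2 * l * 2 ^ g < a) (h2 : a ≤ (2 * l + 1) * 2 ^ g)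
    (h3 : (2 * l + 1) * 2 ^ g ≤ b) (h4 : b < (2 * l + 2) * 2 ^ g) :
    lcaHeight a b = g ∧ lca a b = (2 * l + 1) * 2 ^ g := by
  have hp := Nat.two_pow_pos g
  have e1 : (a - 1) / 2 ^ g = 2 * l :=
    Nat.div_eq_of_lt_le (by omega) (by show a - 1 < (2 * l + 1) * 2 ^ g; omega)
  have e2 : b / 2 ^ g = 2 * l + 1 := Nat.div_eq_of_lt_le h3 h4
  have hh : lcaHeight a b = g := by
    refine (Nat.log_eq_iff (Or.inr ⟨by norm_num, (xor_pos ha (h2.trans h3)).ne'⟩)).2 ⟨?_, ?_⟩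
    · rw [← not_lt, div_eq_of_xor_lt, e1, e2]
      omega
    · rw [div_eq_of_xor_lt, pow_succ, ← Nat.div_div_eq_div_mul, ← Nat.div_div_eq_div_mul, e1, e2]
      omega
  exact ⟨hh, by rw [lca, hh, e2]⟩

theorem odd_mul_two_pow_inj {l l' h h' : ℕ} (e : (2 * l + 1) * 2 ^ h = (2 * l' + 1) * 2 ^ h') :
    h = h' := by
  have key : ∀ {l l' h h' : ℕ}, (2 * l + 1) * 2 ^ h = (2 * l' + 1) * 2 ^ h' → ¬ h < h' := by
    intro l l' h h' e hlt
    obtain ⟨d, rfl⟩ := Nat.exists_eq_add_of_lt hlt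
    have : 2 ^ (h + d + 1) = 2 ^ h * (2 * 2 ^ d) := by ring
    rw [this, Nat.mul_comm, Nat.mul_left_comm] at e
    have := Nat.eq_of_mul_eq_mul_left (Nat.two_pow_pos h) e
    rw [Nat.mul_left_comm] at this
    omega
  have := key e
  have := key e.symm
  omega

/-! ## The search tree -/

/-- A node of the search tree: range of ranks, code, and half of the range of codes. -/
structure TNode where
  a : ℕ
  b : ℕ
  c : ℕ
  s : ℕ

namespace TNode

def mid (T : TNode) : ℕ := (T.a + T.b) / 2
def left (T : TNode) : TNode := ⟨T.a, (T.a + T.b) / 2, T.c - T.s / 2, T.s / 2⟩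
def right (T : TNode) : TNode := ⟨(T.a + T.b) / 2 + 1, T.b, T.c + T.s / 2, T.s / 2⟩

theorem isRange : IsRange TNode.a TNode.b TNode.left TNode.right :=
  ⟨fun _ => rfl, fun _ => rfl, fun _ => rfl, fun _ => rfl⟩

variable {α : Type u} [LinearOrder α] {kk : ℕ → α} {N : ℕ} {x y : α}

/-- The code of the node where a search for `x` ends. -/
def code (kk : ℕ → α) (x : α) (T : TNode) : ℕ :=
  if _h : T.a < T.b then
    if x < kk T.mid then code kk x T.left
    else if kk T.mid < x then code kk x T.right else T.c
  else 0
termination_by T.b - T.a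
decreasing_by
  all_goals
    simp only [left, right]
    omega

theorem code_lt {T : TNode} (h : T.a < T.b) (hx : x < kk T.mid) :
    code kk x T = code kk x T.left := by
  rw [code, dif_pos h, if_pos hx]

theorem code_gt {T : TNode} (h : T.a < T.b) (hx : kk T.mid < x) :
    code kk x T = code kk x T.right := by
  rw [code, dif_pos h, if_neg hx.asymm, if_pos hx]

theorem code_eq {T : TNode} (h : T.a < T.b) : code kk (kk T.mid) T = T.c := by
  rw [code, dif_pos h, if_neg (lt_irrefl _), if_neg (lt_irrefl _)]

/-- The range of codes is large enough. -/
def Sized (T : TNode) : Prop :=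
  T.a < T.b → T.b - T.a < 2 * T.s ∧ ∃ h l, T.s = 2 ^ h ∧ T.c = (2 * l + 1) * 2 ^ h

theorem Sized.le {T : TNode} (h : T.Sized) (hlt : T.a < T.b) : 1 ≤ T.s ∧ T.s ≤ T.c := by
  obtain ⟨-, g, l, h1, h2⟩ := h hlt
  rw [h1, h2]
  exact ⟨Nat.one_le_two_pow, Nat.le_mul_of_pos_left _ (by omega)⟩

theorem Sized.left {T : TNode} (h : T.Sized) : T.left.Sized := by
  intro hlt
  simp only [TNode.left] at hlt ⊢
  obtain ⟨h0, g, l, h1, h2⟩ := h (by omega)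
  cases g with
  | zero => rw [h1] at h0; omega
  | succ g =>
    rw [pow_succ] at h1 h2
    refine ⟨by omega, g, 2 * l, by omega, ?_⟩
    have : T.s / 2 = 2 ^ g := by omega
    rw [this, h2]
    ring_nf
    omega

theorem Sized.right {T : TNode} (h : T.Sized) : T.right.Sized := by
  intro hlt
  simp only [TNode.right] at hlt ⊢
  obtain ⟨h0, g, l, h1, h2⟩ := h (by omega)
  cases g with
  | zero => rw [h1] at h0; omega
  | succ g =>
    rw [pow_succ] at h1 h2
    refine ⟨by omega, g, 2 * l + 1, by omega, ?_⟩
    have : T.s / 2 = 2 ^ g := by omega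
    rw [this, h2]
    ring

theorem Sized.half {T : TNode} (h : T.Sized) (hlt : T.a + 1 < T.b) : T.s / 2 + T.s / 2 = T.s := by
  obtain ⟨h0, g, l, h1, h2⟩ := h (by omega)
  cases g with
  | zero => rw [h1] at h0; omega
  | succ g => rw [pow_succ] at h1; omega

/-- The key `x` occurs in the range of the node. -/
def Has (kk : ℕ → α) (T : TNode) (x : α) : Prop := ∃ j, T.a ≤ j ∧ j < T.b ∧ kk j = x

variable (hk : ∀ i j, i ≤ j → j < N → kk i ≤ kk j)
include hk

theorem Has.left {T : TNode} (hb : T.b ≤ N) (h : T.Has kk x) (hx : x < kk T.mid) :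
    T.left.Has kk x := by
  obtain ⟨j, h1, h2, rfl⟩ := h
  exact ⟨j, h1, lt_of_not_ge fun hge => not_le.2 hx (hk _ _ hge (by omega)), rfl⟩

theorem Has.right {T : TNode} (hb : T.b ≤ N) (h : T.Has kk x) (hx : kk T.mid < x) :
    T.right.Has kk x := by
  obtain ⟨j, h1, h2, rfl⟩ := h
  refine ⟨j, lt_of_not_ge fun hge => not_le.2 hx (hk _ _ hge ?_), h2, rfl⟩
  simp only [mid]
  omega

theorem code_mem {T : TNode} (hT : T.Sized) (hb : T.b ≤ N) (h : T.Has kk x) :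
    T.c - T.s < code kk x T ∧ code kk x T < T.c + T.s := by
  induction hs : T.b - T.a using Nat.strong_induction_on generalizing T with
  | _ n ih =>
    have hlt : T.a < T.b := by obtain ⟨j, h1, h2, -⟩ := h; omega
    have hs' := hT.le hlt
    rcases lt_trichotomy x (kk T.mid) with hx | rfl | hx
    · rw [code_lt hlt hx]
      have hl := h.left hk hb hx
      obtain ⟨j, h1, h2, -⟩ := hl
      simp only [TNode.left] at h1 h2
      have := ih _ (by simp only [TNode.left]; omega) hT.left (by simp only [TNode.left]; omega) (h.left hk hb hx) rfl
      have := hT.half (by omega)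
      simp only [TNode.left] at *
      omega
    · rw [code_eq hlt]
      omega
    · rw [code_gt hlt hx]
      have hl := h.right hk hb hx
      obtain ⟨j, h1, h2, -⟩ := hl
      simp only [TNode.right] at h1 h2
      have := ih _ (by simp only [TNode.right]; omega) hT.right (by simp only [TNode.right]; omega) (h.right hk hb hx) rfl
      have := hT.half (by omega)
      simp only [TNode.right] at *
      omega

theorem code_left {T : TNode} (hT : T.Sized) (hb : T.b ≤ N) (h : T.Has kk x) (hx : x < kk T.mid) :
    T.c - T.s < code kk x T ∧ code kk x T < T.c := by
  have hlt : T.a < T.b := by obtain ⟨j, h1, h2, -⟩ := h; omega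
  have hs' := hT.le hlt
  rw [code_lt hlt hx]
  have hl := h.left hk hb hx
  obtain ⟨j, h1, h2, -⟩ := hl
  simp only [TNode.left] at h1 h2
  have := code_mem hk hT.left (by simp only [TNode.left]; omega) (h.left hk hb hx)
  have := hT.half (by omega)
  simp only [TNode.left] at *
  omega

theorem code_right {T : TNode} (hT : T.Sized) (hb : T.b ≤ N) (h : T.Has kk x) (hx : kk T.mid < x) :
    T.c < code kk x T ∧ code kk x T < T.c + T.s := by
  have hlt : T.a < T.b := by obtain ⟨j, h1, h2, -⟩ := h; omega
  have hs' := hT.le hlt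
  rw [code_gt hlt hx]
  have hl := h.right hk hb hx
  obtain ⟨j, h1, h2, -⟩ := hl
  simp only [TNode.right] at h1 h2
  have := code_mem hk hT.right (by simp only [TNode.right]; omega) (h.right hk hb hx)
  have := hT.half (by omega)
  simp only [TNode.right] at *
  omega

theorem code_lt_code {T : TNode} (hT : T.Sized) (hb : T.b ≤ N) (hx : T.Has kk x) (hy : T.Has kk y)
    (hxy : x < y) : code kk x T < code kk y T := by
  induction hs : T.b - T.a using Nat.strong_induction_on generalizing T with
  | _ n ih =>
    have hlt : T.a < T.b := by obtain ⟨j, h1, h2, -⟩ := hx; omega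
    rcases lt_trichotomy x (kk T.mid) with h | h | h <;>
      rcases lt_trichotomy y (kk T.mid) with h' | h' | h'
    · rw [code_lt hlt h, code_lt hlt h']
      exact ih _ (by simp only [TNode.left]; omega) hT.left (by simp only [TNode.left]; omega)
        (hx.left hk hb h) (hy.left hk hb h') rfl
    · have := code_left hk hT hb hx h
      rw [h', code_eq hlt]
      exact this.2
    · exact (code_left hk hT hb hx h).2.trans (code_right hk hT hb hy h').1
    · exact absurd hxy (h ▸ h'.asymm)
    · exact absurd hxy (by rw [h, h']; exact lt_irrefl _)
    · have := code_right hk hT hb hy h'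
      rw [h, code_eq hlt]
      exact this.1
    · exact absurd hxy (h'.trans h).asymm
    · exact absurd hxy (h' ▸ h.asymm)
    · rw [code_gt hlt h, code_gt hlt h']
      exact ih _ (by simp only [TNode.right]; omega) hT.right (by simp only [TNode.right]; omega)
        (hx.right hk hb h) (hy.right hk hb h') rfl

theorem code_mono {T : TNode} (hT : T.Sized) (hb : T.b ≤ N) (hx : T.Has kk x) (hy : T.Has kk y)
    (hxy : x ≤ y) : code kk x T ≤ code kk y T := by
  rcases hxy.lt_or_eq with h | rfl
  · exact (code_lt_code hk hT hb hx hy h).le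
  · exact le_rfl

omit hk

/-- Properties of the nodes in the tree with root `T₀`. -/
structure Below (kk : ℕ → α) (N : ℕ) (T₀ T : TNode) : Prop where
  a_le : T.a ≤ N + 1
  b_le : T.b ≤ N
  sized : T.Sized
  codes : T.a < T.b → T₀.c - T₀.s ≤ T.c - T.s ∧ T.c + T.s ≤ T₀.c + T₀.s
  path : ∀ x, (0 < T.a → kk (T.a - 1) < x) → (T.b < N → x < kk T.b) → code kk x T₀ = code kk x T
  has : T.a < T.b → ∀ j < N, T.c - T.s < code kk (kk j) T₀ → code kk (kk j) T₀ < T.c + T.s →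
    code kk (kk j) T₀ = code kk (kk j) T ∧ T.Has kk (kk j)

theorem Below.root {T₀ : TNode} (h : T₀.Sized) (ha : T₀.a = 0) (hb : T₀.b = N) :
    T₀.Below kk N T₀ :=
  ⟨by omega, hb.le, h, fun _ => ⟨le_rfl, le_rfl⟩, fun _ _ _ => rfl,
    fun _ j hj _ _ => ⟨rfl, j, by omega, by omega, rfl⟩⟩

include hk

theorem Below.left {T₀ T : TNode} (h : T₀.Below kk N T) (hlt : T.a < T.b) : T₀.Below kk N T.left := by
  have hb := h.b_le
  have hs := h.sized.le hlt
  have hc := h.codes hlt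
  refine ⟨h.a_le, by simp only [TNode.left]; omega, h.sized.left, fun hl => ?_, fun x h1 h2 => ?_,
    fun hl j hj h1 h2 => ?_⟩
  · simp only [TNode.left] at *
    have := h.sized.half (by omega)
    omega
  · simp only [TNode.left] at h1 h2
    have hx : x < kk T.mid := h2 (by omega)
    rw [h.path x h1 fun h3 => hx.trans_le (hk _ _ (by simp only [mid]; omega) h3), code_lt hlt hx]
  · simp only [TNode.left] at hl h1 h2
    have hh := h.sized.half (by omega)
    obtain ⟨g1, g2⟩ := h.has hlt j hj (by omega) (by omega)
    rcases lt_trichotomy (kk j) (kk T.mid) with hx | hx | hx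
    · exact ⟨g1.trans (code_lt hlt hx), g2.left hk hb hx⟩
    · have g3 : code kk (kk j) T = T.c := by rw [hx, code_eq hlt]
      omega
    · have := code_right hk h.sized hb g2 hx
      omega

theorem Below.right {T₀ T : TNode} (h : T₀.Below kk N T) (hlt : T.a < T.b) :
    T₀.Below kk N T.right := by
  have hb := h.b_le
  have hs := h.sized.le hlt
  have hc := h.codes hlt
  refine ⟨by simp only [TNode.right]; omega, hb, h.sized.right, fun hl => ?_, fun x h1 h2 => ?_,
    fun hl j hj h1 h2 => ?_⟩
  · simp only [TNode.right] at *
    have := h.sized.half (by omega)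
    omega
  · simp only [TNode.right] at h1 h2
    have hx : kk T.mid < x := h1 (by omega)
    rw [h.path x (fun h3 => (hk _ _ (by simp only [mid]; omega) (by simp only [mid]; omega)).trans_lt hx) h2,
      code_gt hlt hx]
  · simp only [TNode.right] at hl h1 h2
    have hh := h.sized.half (by omega)
    obtain ⟨g1, g2⟩ := h.has hlt j hj (by omega) (by omega)
    rcases lt_trichotomy (kk j) (kk T.mid) with hx | hx | hx
    · have := code_left hk h.sized hb g2 hx
      omega
    · have g3 : code kk (kk j) T = T.c := by rw [hx, code_eq hlt]
      omega
    · exact ⟨g1.trans (code_gt hlt hx), g2.right hk hb hx⟩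

/-- Comparison of codes amounts to comparison of keys. -/
theorem Below.sep {T₀ T : TNode} (h : T₀.Below kk N T) (hlt : T.a < T.b) {j : ℕ} (hj : j < N)
    (h1 : T.c - T.s < code kk (kk j) T₀) (h2 : code kk (kk j) T₀ < T.c + T.s) :
    (code kk (kk j) T₀ < T.c ↔ kk j < kk T.mid) ∧ (T.c < code kk (kk j) T₀ ↔ kk T.mid < kk j) := by
  obtain ⟨g1, g2⟩ := h.has hlt j hj h1 h2
  rw [g1]
  rcases lt_trichotomy (kk j) (kk T.mid) with hx | hx | hx
  · have := code_left hk h.sized h.b_le g2 hx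
    exact ⟨⟨fun _ => hx, fun _ => this.2⟩, fun h => by omega, fun h => absurd h hx.asymm⟩
  · rw [hx, code_eq hlt]
    simp
  · have := code_right hk h.sized h.b_le g2 hx
    exact ⟨⟨fun h => by omega, fun h => absurd h hx.asymm⟩, fun _ => hx, fun _ => this.1⟩

end TNode


/-! ## The nodes of the endpoints -/

/-- The input: `n` intervals, where `key e` is the endpoint number `e` and `eid j` is the number of
the endpoint of rank `j`. -/
structure Ints (α : Type u) [LinearOrder α] where
  n : ℕ
  K : ℕ
  key : ℕ → α
  eid : ℕ → ℕ
  eid_lt : ∀ j < 2 * n, eid j < 2 * n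
  eid_inj : ∀ i < 2 * n, ∀ j < 2 * n, eid i = eid j → i = j
  eid_surj : ∀ e < 2 * n, ∃ j < 2 * n, eid j = e
  mono : ∀ i j, i ≤ j → j < 2 * n → key (eid i) ≤ key (eid j)
  le : ∀ i < n, key (2 * i) ≤ key (2 * i + 1)
  one_le : 1 ≤ n
  lt_pow : n < 2 ^ K
  pow_le : 2 ^ K ≤ 2 * n + 1

namespace Ints
variable {α : Type u} [LinearOrder α] (I : Ints α)

/-- Distance of the arrays in memory. -/
def Z : ℕ := 16 * I.n + 8

/-- Number of blocks. -/
def NB : ℕ := 2 * I.n / (I.K + 1) + 1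

/-- Number of counters. -/
def M : ℕ := 2 * (I.K + 1) * I.NB

/-- The constants of the program. -/
def env : ℕ → ℕ
  | 0 => I.n
  | 20 => 2 ^ I.K
  | 21 => I.n + 1
  | 22 => I.K
  | 23 => I.Z
  | 24 => 2 * I.n
  | 25 => I.K + 1
  | 26 => I.NB
  | 27 => I.M
  | 28 => 2 * 2 ^ I.K
  | _ => 0

theorem env_facts {I : Ints α} {ν : ℕ → ℕ} (h : Env I.env ν) : ν 0 = I.n ∧ ν 20 = 2 ^ I.K ∧
    ν 22 = I.K ∧ ν 23 = I.Z ∧ ν 24 = 2 * I.n ∧ ν 25 = I.K + 1 ∧ ν 26 = I.NB ∧ ν 27 = I.M ∧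
    ν 28 = 2 * 2 ^ I.K :=
  ⟨h 0 (by simp), h 20 (by simp), h 22 (by simp), h 23 (by simp), h 24 (by simp), h 25 (by simp),
    h 26 (by simp), h 27 (by simp), h 28 (by simp)⟩

/-- The input is in memory. -/
structure Input (m : Mem α) : Prop where
  key : ∀ e < 2 * I.n, m (1 + e) = .key (I.key e)
  eid : Nums m (1 + 2 * I.n) (2 * I.n) I.eid

variable {I}

theorem Input.congr {m m' : Mem α} (h : I.Input m) (hm : ∀ c < I.Z, m' c = m c) : I.Input m' :=
  ⟨fun e he => by rw [hm _ (by rw [Z]; omega), h.key e he],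
    h.eid.congr fun c _ hc => hm _ (by rw [Z]; omega)⟩

end Ints

/-- Stores the logarithm of `V 3` and initializes the bounds of the groups. -/
def logPre : Cmd :=
  .store (V 23 + V 3) (V 10 - 1) ;; .store (9 * V 23 + 2 * V 3) 0 ;; .store (9 * V 23 + 2 * V 3 + 1) 0 ;;
  .store (10 * V 23 + 2 * V 3) 0 ;; .store (10 * V 23 + 2 * V 3 + 1) 0

def logPro : Cmd :=
  .ite (.le (V 4) 1) (.set 2 (V 3) ;; .ite (.le (V 1) 1) (.set 10 (V 10 - 1)) .skip) (.set 1 (V 3 + 1))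

def logProc (p : ℕ) : Cmd := rangeProc p logPro logPre .skip

def logRun (p : ℕ) : Cmd :=
  .set 1 1 ;; .set 2 (V 28) ;; .set 3 (V 28) ;; .set 10 (V 25 + 1) ;; .fork 4 p

section
variable {α : Type u} [LinearOrder α] {C : Ctx} {I : Ints α}

structure Ints.Logs (I : Ints α) (x : ℕ) (m : Mem α) : Prop where
  log : m (I.Z + x) = .num (Nat.log 2 x)
  s0 : m (9 * I.Z + 2 * x) = .num 0
  s1 : m (9 * I.Z + 2 * x + 1) = .num 0
  e0 : m (10 * I.Z + 2 * x) = .num 0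
  e1 : m (10 * I.Z + 2 * x + 1) = .num 0

def Ints.logCells (I : Ints α) (x : ℕ) : Set ℕ :=
  {I.Z + x, 9 * I.Z + 2 * x, 9 * I.Z + 2 * x + 1, 10 * I.Z + 2 * x, 10 * I.Z + 2 * x + 1}

theorem logRun_tri {p : ℕ} (hp : C.Γ[p]? = some (logProc p)) (hB : 1000 * (I.n + 1) ≤ C.B)
    {σ : St α} (he : Env I.env σ.n) :
    Tri C (logRun p) Set.univ {c | I.Z ≤ c ∧ c < 2 * I.Z ∨ 9 * I.Z ≤ c ∧ c < 11 * I.Z}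
      (2 * 2 ^ I.K * 300 + 500) ((Nat.size (2 * 2 ^ I.K) + 3) * 300) σ
      fun σ' => ∀ x, 1 ≤ x → x < 2 * 2 ^ I.K → I.Logs x σ'.mem := by
  have hB1 := C.one_lt_B
  have hZ : I.Z = 16 * I.n + 8 := rfl
  have hK1 := I.lt_pow
  have hK2 := I.pow_le
  obtain ⟨-, -, -, -, -, h25, -, -, h28⟩ := Ints.env_facts he
  have hK3 : I.K + 1 ≤ 2 ^ I.K := Nat.lt_two_pow_self
  obtain ⟨S, hS⟩ : ∃ S, S = 2 ^ I.K := ⟨_, rfl⟩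
  rw [← hS] at h28 hK1 hK2 hK3 ⊢
  have hov : overhead logPro .skip = 70 := by decide
  refine (Tri.seq (Q := fun τ => τ = σ.setN 1 1) (Tri.set (by simp; omega) (by simp)) ?_
    (T₂ := 2 + (2 + (4 + (2 * S * 300 + 450))))
    (D₂ := 2 + (2 + (4 + (Nat.size (2 * S) + 2) * 300)))).conseq ?_ ?_ fun _ h _ _ _ => h
  rotate_left
  · rw [show (Cmd.set 1 1).len = 2 by decide]
    exact (by omega : ∀ z, 2 + (2 + (2 + (4 + (z + 450)))) ≤ z + 500) _
  · rw [show (Cmd.set 1 1).len = 2 by decide]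
    omega
  rintro _ rfl - - -
  refine Tri.seq (Q := fun τ => τ = (σ.setN 1 1).setN 2 (2 * S)) (Tri.set (by simp) (by simp [h28])) ?_
  rintro _ rfl - - -
  refine Tri.seq (Q := fun τ => τ = ((σ.setN 1 1).setN 2 (2 * S)).setN 3 (2 * S))
    (Tri.set (by simp) (by simp [h28])) ?_
  rintro _ rfl - - -
  refine Tri.seq (Q := fun τ => τ = (((σ.setN 1 1).setN 2 (2 * S)).setN 3 (2 * S)).setN 10 (I.K + 2))
    (Tri.set (by simp [h25]; omega) (by simp [h25])) ?_
  rintro _ rfl - - -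
  have he' := (((he.setN (x := 1) (v := 1) (by simp)).setN (x := 2) (v := 2 * S) (by simp)).setN
    (x := 3) (v := 2 * S) (by simp)).setN (x := 10) (v := I.K + 2) (by simp)
  have hX : IsRange (X := ℕ × ℕ × ℕ) (fun x => x.1) (fun x => x.2.1)
      (fun x => (x.1, (x.1 + x.2.1) / 2, if x.1 ≤ 1 then x.2.2 - 1 else x.2.2))
      (fun x => ((x.1 + x.2.1) / 2 + 1, x.2.1, x.2.2)) :=
    ⟨fun _ => rfl, fun _ => rfl, fun _ => rfl, fun _ => rfl⟩
  refine (Tri.rangeTree (C := C) (X := ℕ × ℕ × ℕ) (F := {c | I.Z ≤ c}) hp hX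
    (fun x ν _ => ν 1 = x.1 ∧ ν 2 = x.2.1 ∧ 1 ≤ x.1 ∧ x.1 ≤ 2 * S + 1 ∧ x.2.1 ≤ 2 * S ∧ Env I.env ν ∧
      (x.1 < x.2.1 → ν 10 = x.2.2 + 1 ∧ (x.1 = 1 ∧ x.2.1 = 2 ^ (x.2.2 + 1) ∨
        2 ^ x.2.2 ≤ x.1 ∧ x.2.1 ≤ 2 ^ (x.2.2 + 1)) ∧ x.2.2 ≤ I.K))
    (fun x m => I.Logs ((x.1 + x.2.1) / 2) m) I.logCells (2 * S) σ.mem (fun _ => 60) 60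
    (by omega) ?_ ?_ ?_ ?_ ?_ (1, 2 * S, I.K) (2 * S + 1, 2 * S, 0) _
    ?_ ?_ (by simp) le_rfl ?_).mono ?_ ?_ (Set.subset_univ _) ?_ ?_
  · rintro x ν κ ⟨h1, h2, -, h3, h4, -⟩
    exact ⟨h1, h2, h3, h4⟩
  · intro i j hi hj hij
    rw [Set.disjoint_left]
    simp only [Ints.logCells, Set.mem_insert_iff, Set.mem_singleton_iff]
    omega
  · intro i hi c hc
    simp only [Ints.logCells, Set.mem_insert_iff, Set.mem_singleton_iff] at hc
    simp only [Set.mem_ofPred_eq]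
    omega
  · rintro x m m' hlt hb hm h
    simp only [Ints.logCells, Set.mem_insert_iff, Set.mem_singleton_iff] at hm
    exact ⟨by rw [hm _ (by simp), h.log], by rw [hm _ (by simp), h.s0], by rw [hm _ (by simp), h.s1],
      by rw [hm _ (by simp), h.e0], by rw [hm _ (by simp), h.e1]⟩
  · rintro ⟨a, b, h⟩ τ ⟨h1, h2, h3, h4, h5, h6, h7⟩ hlt hm
    simp only at hlt h1 h2 h3 h4 h5 h7 ⊢
    obtain ⟨h10, hor, hhK⟩ := h7 hlt
    have h23 := (Ints.env_facts h6).2.2.2.1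
    obtain ⟨P, hP⟩ : ∃ P, P = 2 ^ h := ⟨_, rfl⟩
    have hp1 : 2 ^ (h + 1) = 2 * P := by rw [pow_succ', hP]
    have hP1 : 1 ≤ P := hP ▸ Nat.one_le_two_pow
    rw [hp1, ← hP] at hor
    have hmid : P ≤ (a + b) / 2 ∧ (a + b) / 2 < 2 * P := by omega
    have hlog : Nat.log 2 ((a + b) / 2) = h := by
      refine (Nat.log_eq_iff (Or.inr ⟨by norm_num, by omega⟩)).2 ⟨by rw [← hP]; omega, by rw [hp1]; omega⟩
    have hin : ∀ c, c ∈ I.logCells ((a + b) / 2) ↔ c = I.Z + (a + b) / 2 ∨ c = 9 * I.Z + 2 * ((a + b) / 2) ∨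
      c = 9 * I.Z + 2 * ((a + b) / 2) + 1 ∨ c = 10 * I.Z + 2 * ((a + b) / 2) ∨
      c = 10 * I.Z + 2 * ((a + b) / 2) + 1 := by
      intro c
      simp [Ints.logCells]
    refine (Tri.basic (wp_frame (Q := fun τ => I.Logs ((a + b) / 2) τ.mem) ?_)).conseq (by decide) (by decide) ?_
    · generalize (a + b) / 2 = i at *
      simp [logPre, wp, h23, h10, hin]
      refine ⟨by omega, by omega, by omega, by omega, by omega, by omega, by omega, by omega, by omega,
        by omega, ?_⟩
      rw [← hlog]
      refine ⟨?_, ?_, ?_, ?_, ?_⟩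
      · simp [show ¬ I.Z + i = 10 * I.Z + 2 * i + 1 by omega, show ¬ I.Z + i = 10 * I.Z + 2 * i by omega,
          show ¬ I.Z + i = 9 * I.Z + 2 * i + 1 by omega, show ¬ I.Z + i = 9 * I.Z + 2 * i by omega]
      · simp [show ¬ 9 * I.Z + 2 * i = 10 * I.Z + 2 * i + 1 by omega,
          show ¬ 9 * I.Z + 2 * i = 10 * I.Z + 2 * i by omega]
      · simp [show ¬ 9 * I.Z + 2 * i + 1 = 10 * I.Z + 2 * i by omega]
      · simp
      · simp
    · rintro τ' ⟨hL, -⟩ hn - -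
      have e1 : τ'.n 1 = a := by rw [hn 1 (by decide)]; simpa using h1
      have e2 : τ'.n 2 = b := by rw [hn 2 (by decide)]; simpa using h2
      have e3 : τ'.n 3 = (a + b) / 2 := by rw [hn 3 (by decide)]; simp
      have e10 : τ'.n 10 = h + 1 := by rw [hn 10 (by decide)]; simpa using h10
      have ee : Env I.env τ'.n := (h6.setN (x := 3) (v := (a + b) / 2) (by simp)).frame hn (by decide)
      have f4 : ∀ v, Env I.env (τ'.setN 4 v).n := fun v => ee.setN (by simp)
      refine ⟨?_, ?_, hL⟩
      · simp [logPro, wp, e1, e3, e10]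
        refine ⟨hB1, fun ha => ⟨by omega, ⟨h3, h4, by omega, ?_, fun hl => ?_⟩⟩,
          fun ha => ⟨h3, h4, by omega, ?_, fun hl => ?_⟩⟩
        · exact ((f4 1).setN (by simp)).setN (by simp)
        · simp only [ha, if_true]
          obtain ⟨h', rfl⟩ : ∃ h', h = h' + 1 := by
            cases h with
            | zero => simp at hP; omega
            | succ h' => exact ⟨h', rfl⟩
          have : 2 ^ (h' + 1) = 2 * 2 ^ h' := pow_succ' ..
          simp
          omega
        · exact (f4 1).setN (by simp)
        · rw [if_neg (by omega), if_neg (by omega), ← hP, hp1]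
          omega
      · simp [logPro, wp, e2, e3, e10]
        refine ⟨hB1, by omega, by omega, h5, (f4 2).setN (by simp), fun hl => ?_⟩
        rw [← hP, hp1]
        omega
  · simp [logPro, wp]
    refine ⟨hB1, ⟨hB1, by omega⟩, ?_, fun _ => ?_⟩
    · exact ((he'.setN (by simp)).setN (by simp)).setN (by simp)
    · left
      rw [hS, pow_succ']
  · simp [logPro, wp]
    refine ⟨hB1, ⟨hB1, by omega⟩, ?_⟩
    exact (he'.setN (by simp)).setN (by simp)
  · intro y _
    rfl
  · simp [hov]
    omega
  · simp only [hov]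
    have := Nat.size_le_size (show 2 * S - 1 ≤ 2 * S by omega)
    calc _ ≤ (Nat.size (2 * S) + 2) * (60 + 70) := Nat.mul_le_mul_right _ (by omega)
      _ ≤ _ := Nat.mul_le_mul_left _ (by omega)
  · rintro c ⟨i, -, h2, h3⟩
    simp only [Ints.logCells, Set.mem_insert_iff, Set.mem_singleton_iff] at h3
    simp only [Set.mem_ofPred_eq] at *
    omega
  · rintro _ ⟨m', rfl, h⟩ - - - x hx hx'
    exact h.of_index hX (Q := fun i => I.Logs i m') hx hx'

end


/-- Finds the code of the highest node with the same key as node `V 3`, where variables `10` to `13`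
hold the code of the node, half the range of codes, and the codes for the keys before and after the
range, which are in key variables `1` and `2`. -/
def topPre : Cmd :=
  .load 15 (1 + V 24 + V 3) ;; .loadK 0 (1 + V 15) ;; .set 14 (V 10) ;;
  .ite (.le (V 24) (V 2)) .skip (.ite (.kle 2 0) (.set 14 (V 13)) .skip) ;;
  .ite (.le (V 1) 0) .skip (.ite (.kle 0 1) (.set 14 (V 12)) .skip) ;;
  .store (2 * V 23 + V 15) (V 14)

def topPro : Cmd :=
  .ite (.le (V 4) 1)
    (.set 2 (V 3) ;; .set 11 (V 11 / 2) ;; .set 10 (V 10 - V 11) ;; .set 13 (V 14) ;; .setK 2 0)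
    (.set 1 (V 3 + 1) ;; .set 11 (V 11 / 2) ;; .set 10 (V 10 + V 11) ;; .set 12 (V 14) ;; .setK 1 0)

def topProc (p : ℕ) : Cmd := rangeProc p topPro topPre .skip

def topRun (p : ℕ) : Cmd :=
  .set 1 0 ;; .set 2 (V 24) ;; .set 3 (V 24) ;; .set 10 (V 28) ;; .set 11 (V 28) ;; .fork 4 p

namespace Ints
variable {α : Type u} [LinearOrder α] (I : Ints α)

/-- The key of rank `j`. -/
def rkey (j : ℕ) : α := I.key (I.eid j)

def root : TNode := ⟨0, 2 * I.n, 2 ^ I.K, 2 ^ I.K⟩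

/-- The code of the highest node with the same key as endpoint `e`. -/
def top (e : ℕ) : ℕ := TNode.code I.rkey (I.key e) I.root

theorem root_sized : I.root.Sized := fun _ =>
  ⟨by have := I.lt_pow; simp only [root]; omega, I.K, 0, rfl, by simp [root]⟩

theorem root_below : I.root.Below I.rkey (2 * I.n) I.root := .root I.root_sized rfl rfl

end Ints

section
variable {α : Type u} [LinearOrder α] {C : Ctx} {I : Ints α}

/-- Precondition of a call. -/
structure TopCall (I : Ints α) (T : TNode) (ν : ℕ → ℕ) (κ : ℕ → Val α) : Prop where
  h1 : ν 1 = T.a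
  h2 : ν 2 = T.b
  a_le : T.a ≤ 2 * I.n + 1
  b_le : T.b ≤ 2 * I.n
  env : Env I.env ν
  below : T.a < T.b → I.root.Below I.rkey (2 * I.n) T
  h10 : T.a < T.b → ν 10 = T.c
  h11 : T.a < T.b → ν 11 = T.s
  h12 : T.a < T.b → 0 < T.a → ν 12 = I.top (I.eid (T.a - 1)) ∧ κ 1 = .key (I.rkey (T.a - 1))
  h13 : T.a < T.b → T.b < 2 * I.n → ν 13 = I.top (I.eid T.b) ∧ κ 2 = .key (I.rkey T.b)

theorem Ints.mono' (I : Ints α) : ∀ i j, i ≤ j → j < 2 * I.n → I.rkey i ≤ I.rkey j := I.mono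

theorem Ints.top_mem (I : Ints α) {e : ℕ} (he : e < 2 * I.n) :
    1 ≤ I.top e ∧ I.top e < 2 * 2 ^ I.K := by
  obtain ⟨j, hj, rfl⟩ := I.eid_surj e he
  have := TNode.code_mem I.mono' I.root_sized le_rfl (x := I.rkey j) ⟨j, by simp [root], hj, rfl⟩
  simp only [root, ← two_mul] at this
  exact ⟨by simp only [top, root, rkey] at *; omega, this.2⟩

theorem TopCall.top_mid {T : TNode} {ν : ℕ → ℕ} {κ : ℕ → Val α} (h : TopCall I T ν κ)
    (hlt : T.a < T.b) (h1 : 0 < T.a → I.rkey (T.a - 1) < I.rkey T.mid)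
    (h2 : T.b < 2 * I.n → I.rkey T.mid < I.rkey T.b) : I.top (I.eid T.mid) = T.c :=
  ((h.below hlt).path _ h1 h2).trans (TNode.code_eq hlt)

theorem topPre_wp {R W : Set ℕ} (hB : 1000 * (I.n + 1) ≤ C.B) {T : TNode} {σ : St α}
    (h : TopCall I T σ.n σ.k) (hlt : T.a < T.b) (h3 : σ.n 3 = T.mid) (hin : I.Input σ.mem)
    (hR : ∀ c < I.Z, c ∈ R) (hW : 2 * I.Z + I.eid T.mid ∈ W) :
    wp C.B R W topPre (fun σ' => σ'.mem (2 * I.Z + I.eid T.mid) = .num (I.top (I.eid T.mid)) ∧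
      σ'.n 14 = I.top (I.eid T.mid) ∧ σ'.k 0 = .key (I.rkey T.mid) ∧ σ'.k 1 = σ.k 1 ∧ σ'.k 2 = σ.k 2) σ := by
  have hB1 := C.one_lt_B
  have hZ : I.Z = 16 * I.n + 8 := rfl
  obtain ⟨-, -, -, h23, h24, -⟩ := Ints.env_facts h.env
  have hb := h.b_le
  have hmid : T.a ≤ T.mid ∧ T.mid < T.b := by simp only [TNode.mid]; omega
  have he := I.eid_lt T.mid (by omega)
  have hm1 := hin.eid T.mid (by omega)
  have hm2 := hin.key (I.eid T.mid) he
  obtain ⟨ht1, ht2⟩ := I.top_mem he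
  have hK2 := I.pow_le
  have r1 : 1 + 2 * I.n + T.mid ∈ R := hR _ (by omega)
  have r2 : 1 + I.eid T.mid ∈ R := hR _ (by omega)
  have fin : ∀ τ : St α, τ.n 15 = I.eid T.mid → τ.n 14 = I.top (I.eid T.mid) → τ.n 23 = I.Z →
      τ.k 0 = .key (I.rkey T.mid) → τ.k 1 = σ.k 1 → τ.k 2 = σ.k 2 →
      wp C.B R W (.store (2 * V 23 + V 15) (V 14)) (fun σ' =>
        σ'.mem (2 * I.Z + I.eid T.mid) = .num (I.top (I.eid T.mid)) ∧
        σ'.n 14 = I.top (I.eid T.mid) ∧ σ'.k 0 = .key (I.rkey T.mid) ∧ σ'.k 1 = σ.k 1 ∧ σ'.k 2 = σ.k 2) τ := by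
    intro τ g1 g2 g3 g4 g5 g6
    simp [wp, g1, g2, g3, g4, g5, g6, hW]
    omega
  have fin2 : ∀ τ : St α, τ.n 1 = T.a → τ.n 12 = σ.n 12 → τ.n 15 = I.eid T.mid →
      ((0 < T.a → I.rkey (T.a - 1) < I.rkey T.mid) → τ.n 14 = I.top (I.eid T.mid)) → τ.n 23 = I.Z →
      τ.k 0 = .key (I.rkey T.mid) → τ.k 1 = σ.k 1 → τ.k 2 = σ.k 2 →
      wp C.B R W (.ite (.le (V 1) 0) .skip (.ite (.kle 0 1) (.set 14 (V 12)) .skip) ;;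
        .store (2 * V 23 + V 15) (V 14)) (fun σ' =>
        σ'.mem (2 * I.Z + I.eid T.mid) = .num (I.top (I.eid T.mid)) ∧
        σ'.n 14 = I.top (I.eid T.mid) ∧ σ'.k 0 = .key (I.rkey T.mid) ∧ σ'.k 1 = σ.k 1 ∧ σ'.k 2 = σ.k 2) τ := by
    intro τ g0 g12 g1 g2 g3 g4 g5 g6
    refine ⟨by simp, by simp; omega, fun ha => ?_, fun ha => ?_⟩
    · simp [g0] at ha
      exact fin τ g1 (g2 fun h => by omega) g3 g4 g5 g6
    · simp [g0] at ha
      obtain ⟨k1, k2⟩ := h.h12 hlt ha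
      refine ⟨I.rkey T.mid, I.rkey (T.a - 1), g4, g5.trans k2, fun hle => ?_, fun hgt => ?_⟩
      · have : I.rkey T.mid = I.rkey (T.a - 1) :=
          le_antisymm hle (I.mono' _ _ (by omega) (by omega))
        refine ⟨by simp, fin _ (by simpa using g1) ?_ (by simpa using g3) g4 g5 g6⟩
        simp only [Ints.rkey] at this
        simp [g12, k1, Ints.top, this]
      · exact fin τ g1 (g2 fun _ => hgt) g3 g4 g5 g6
  have fin3 : ∀ τ : St α, τ.n 1 = T.a → τ.n 2 = T.b → τ.n 24 = 2 * I.n → τ.n 12 = σ.n 12 → τ.n 13 = σ.n 13 →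
      τ.n 15 = I.eid T.mid → τ.n 14 = T.c → τ.n 23 = I.Z →
      τ.k 0 = .key (I.rkey T.mid) → τ.k 1 = σ.k 1 → τ.k 2 = σ.k 2 →
      wp C.B R W (.ite (.le (V 24) (V 2)) .skip (.ite (.kle 2 0) (.set 14 (V 13)) .skip) ;;
        .ite (.le (V 1) 0) .skip (.ite (.kle 0 1) (.set 14 (V 12)) .skip) ;;
        .store (2 * V 23 + V 15) (V 14)) (fun σ' =>
        σ'.mem (2 * I.Z + I.eid T.mid) = .num (I.top (I.eid T.mid)) ∧
        σ'.n 14 = I.top (I.eid T.mid) ∧ σ'.k 0 = .key (I.rkey T.mid) ∧ σ'.k 1 = σ.k 1 ∧ σ'.k 2 = σ.k 2) τ := by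
    intro τ g0 gb g24 g12 g13 g1 g2 g3 g4 g5 g6
    refine ⟨by simp, by simp, fun hb' => ?_, fun hb' => ?_⟩
    · simp [g24, gb] at hb'
      refine fin2 τ g0 g12 g1 (fun hl => ?_) g3 g4 g5 g6
      rw [g2, h.top_mid hlt hl fun hr => by omega]
    · simp [g24, gb] at hb'
      obtain ⟨k1, k2⟩ := h.h13 hlt hb'
      refine ⟨I.rkey T.b, I.rkey T.mid, g6.trans k2, g4, fun hle => ?_, fun hgt => ?_⟩
      · have : I.rkey T.mid = I.rkey T.b := le_antisymm (I.mono' _ _ (by omega) (by omega)) hle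
        refine ⟨by simp, fin2 _ (by simpa using g0) (by simpa using g12) (by simpa using g1) (fun _ => ?_)
          (by simpa using g3) g4 g5 g6⟩
        simp only [Ints.rkey] at this
        simp [g13, k1, Ints.top, this]
      · refine fin2 τ g0 g12 g1 (fun hl => ?_) g3 g4 g5 g6
        rw [g2, h.top_mid hlt hl fun _ => hgt]
  have e1 : Expr.eval σ.n (1 + V 24 + V 3) = 1 + 2 * I.n + T.mid := by simp [h24, h3]
  refine ⟨?_, e1 ▸ r1, I.eid T.mid, e1 ▸ hm1, ?_, ?_, ?_, fin3 _ ?_ ?_ ?_ ?_ ?_ ?_ ?_ ?_ ?_ ?_ ?_⟩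
  · simp [h24, h3]
    omega
  · simp
    omega
  · simpa using r2
  · simp
  all_goals simp [h.h1, h.h2, h24, h.h10 hlt, h23, hm2, Ints.rkey]

theorem topRun_tri {p : ℕ} (hp : C.Γ[p]? = some (topProc p)) (hB : 1000 * (I.n + 1) ≤ C.B)
    {σ : St α} (he : Env I.env σ.n) (hin : I.Input σ.mem) :
    Tri C (topRun p) Set.univ {c | 2 * I.Z ≤ c ∧ c < 3 * I.Z}
      (2 * I.n * 400 + 700) ((Nat.size (2 * I.n) + 3) * 400) σ
      fun σ' => Nums σ'.mem (2 * I.Z) (2 * I.n) I.top := by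
  have hB1 := C.one_lt_B
  have hZ : I.Z = 16 * I.n + 8 := rfl
  have hK2 := I.pow_le
  obtain ⟨-, -, -, -, h24, -, -, -, h28⟩ := Ints.env_facts he
  have hov : overhead topPro .skip = 96 := by decide
  refine (Tri.seq (Q := fun τ => τ = σ.setN 1 0) (Tri.set (by simp; omega) (by simp)) ?_
    (T₂ := 2 + (2 + (2 + (2 + (2 * I.n * 400 + 690)))))
    (D₂ := 2 + (2 + (2 + (2 + (Nat.size (2 * I.n) + 2) * 400))))).conseq ?_ ?_ fun _ h _ _ _ => h
  rotate_left
  · rw [show (Cmd.set 1 0).len = 2 by decide]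
    exact (by omega : ∀ z, 2 + (2 + (2 + (2 + (2 + (z + 690))))) ≤ z + 700) _
  · rw [show (Cmd.set 1 0).len = 2 by decide]
    omega
  rintro _ rfl - - -
  refine Tri.seq (Q := fun τ => τ = (σ.setN 1 0).setN 2 (2 * I.n)) (Tri.set (by simp) (by simp [h24])) ?_
  rintro _ rfl - - -
  refine Tri.seq (Q := fun τ => τ = ((σ.setN 1 0).setN 2 (2 * I.n)).setN 3 (2 * I.n))
    (Tri.set (by simp) (by simp [h24])) ?_
  rintro _ rfl - - -
  refine Tri.seq (Q := fun τ => τ = (((σ.setN 1 0).setN 2 (2 * I.n)).setN 3 (2 * I.n)).setN 10 (2 * 2 ^ I.K))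
    (Tri.set (by simp) (by simp [h28])) ?_
  rintro _ rfl - - -
  refine Tri.seq (Q := fun τ => τ = ((((σ.setN 1 0).setN 2 (2 * I.n)).setN 3 (2 * I.n)).setN 10
    (2 * 2 ^ I.K)).setN 11 (2 * 2 ^ I.K)) (Tri.set (by simp) (by simp [h28])) ?_
  rintro _ rfl - - -
  have he' := ((((he.setN (x := 1) (v := 0) (by simp)).setN (x := 2) (v := 2 * I.n) (by simp)).setN
    (x := 3) (v := 2 * I.n) (by simp)).setN (x := 10) (v := 2 * 2 ^ I.K) (by simp)).setN
    (x := 11) (v := 2 * 2 ^ I.K) (by simp)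
  have hcell : ∀ i < 2 * I.n, ∀ c ∈ ({2 * I.Z + I.eid i} : Set ℕ), 2 * I.Z ≤ c ∧ c < 3 * I.Z := by
    intro i hi c hc
    have := I.eid_lt i hi
    simp only [Set.mem_singleton_iff] at hc
    omega
  refine (Tri.rangeTree (C := C) (F := {c | I.Z ≤ c}) hp TNode.isRange (TopCall I)
    (fun T m => m (2 * I.Z + I.eid ((T.a + T.b) / 2)) = .num (I.top (I.eid ((T.a + T.b) / 2))))
    (fun i => {2 * I.Z + I.eid i}) (2 * I.n) σ.mem (fun _ => 80) 80
    (by omega) ?_ ?_ ?_ ?_ ?_ I.root ⟨2 * I.n + 1, 2 * I.n, 0, 0⟩ _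
    ?_ ?_ (by simp) le_rfl ?_).mono ?_ ?_ (Set.subset_univ _) ?_ ?_
  · rintro T ν κ h
    exact ⟨h.h1, h.h2, h.a_le, h.b_le⟩
  · intro i j hi hj hij
    rw [Set.disjoint_singleton]
    exact fun h => hij (I.eid_inj i hi j hj (by omega))
  · intro i hi c hc
    have := hcell i hi c hc
    simp only [Set.mem_ofPred_eq]
    omega
  · rintro T m m' hlt hb hm h
    rw [hm _ rfl, h]
  · intro T τ h hlt hm
    have hmid : T.mid = (T.a + T.b) / 2 := rfl
    rw [← hmid]
    have hb := h.below hlt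
    have hsz := hb.sized.le hlt
    have hcod := hb.codes hlt
    simp only [Ints.root] at hcod
    have h' : TopCall I T (τ.setN 3 T.mid).n (τ.setN 3 T.mid).k :=
      ⟨by simpa using h.h1, by simpa using h.h2, h.a_le, h.b_le, h.env.setN (by simp), h.below,
        by simpa using h.h10, by simpa using h.h11, by simpa using h.h12, by simpa using h.h13⟩
    refine (Tri.basic (wp_frame (topPre_wp hB h' hlt (by simp) ?_ ?_ (Set.mem_singleton _)))).conseq (T' := 80) (D' := 80) (by decide) (by decide) ?_
    · refine hin.congr fun c hc => ?_
      rw [St.setN_mem, hm c (Or.inl (by simp; omega))]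
    · intro c hc
      left
      simp
      omega
    rintro τ' ⟨⟨p1, p2, p3, p4, p5⟩, -⟩ hn - -
    have f1 : τ'.n 1 = T.a := by rw [hn 1 (by decide)]; simpa using h.h1
    have f2 : τ'.n 2 = T.b := by rw [hn 2 (by decide)]; simpa using h.h2
    have f3 : τ'.n 3 = T.mid := by rw [hn 3 (by decide)]; simp
    have f10 : τ'.n 10 = T.c := by rw [hn 10 (by decide)]; simpa using h.h10 hlt
    have f11 : τ'.n 11 = T.s := by rw [hn 11 (by decide)]; simpa using h.h11 hlt
    have f12 : τ'.n 12 = τ.n 12 := by rw [hn 12 (by decide)]; simp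
    have f13 : τ'.n 13 = τ.n 13 := by rw [hn 13 (by decide)]; simp
    have ee : Env I.env τ'.n := (h.env.setN (x := 3) (v := T.mid) (by simp)).frame hn (by decide)
    have hTb := h.b_le
    simp only [St.setN_k] at p4 p5
    refine ⟨?_, ?_, p1⟩
    · simp [topPro, wp, f3, f10, f11, p2]
      refine ⟨by omega, ⟨by omega, by omega⟩, ⟨by omega, by omega⟩,
        ⟨f1, by simp [TNode.left]; rfl, h.a_le, by simp only [TNode.left]; omega,
          ?_, fun _ => hb.left I.mono' hlt, fun _ => by simp [TNode.left],
          fun _ => by simp [TNode.left], fun _ ha => ?_, fun _ _ => ?_⟩⟩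
      · exact ((((ee.setN (by simp)).setN (by simp)).setN (by simp)).setN (by simp)).setN (by simp)
      · simpa [f12, p4, TNode.left] using h.h12 hlt ha
      · simp [TNode.left, p3]
        exact ⟨rfl, rfl⟩
    · simp [topPro, wp, f3, f10, f11, p2]
      refine ⟨by omega, by omega, ⟨by omega, by omega⟩, by omega,
        ⟨by simp [TNode.right]; rfl, f2, by simp only [TNode.right]; omega, h.b_le,
          ?_, fun _ => hb.right I.mono' hlt, fun _ => by simp [TNode.right],
          fun _ => by simp [TNode.right], fun _ _ => ?_, fun _ hb' => ?_⟩⟩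
      · exact ((((ee.setN (by simp)).setN (by simp)).setN (by simp)).setN (by simp)).setN (by simp)
      · simp [TNode.right, p3]
        exact ⟨rfl, rfl⟩
      · simpa [f13, p5, TNode.right] using h.h13 hlt hb'
  · simp [topPro, wp]
    refine ⟨by omega, ⟨by omega, by omega⟩, by omega, ⟨by simp [Ints.root], by simp [Ints.root],
      by simp [Ints.root], by simp [Ints.root],
      ?_, fun _ => I.root_below, fun _ => by simp [Ints.root]; omega,
          fun _ => by simp [Ints.root], fun _ ha => ?_, fun _ hb => ?_⟩⟩
    · exact ((((he'.setN (by simp)).setN (by simp)).setN (by simp)).setN (by simp)).setN (by simp)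
    · simp [Ints.root] at ha
    · simp [Ints.root] at hb
  · simp [topPro, wp]
    refine ⟨by omega, by omega, ⟨by omega, by omega⟩, by omega, ⟨by simp, by simp, by simp, by simp,
      ?_, ?_, ?_, ?_, ?_, ?_⟩⟩
    · exact ((((he'.setN (by simp)).setN (by simp)).setN (by simp)).setN (by simp)).setN (by simp)
    all_goals
      intro h
      simp only at h
      omega
  · intro y _
    rfl
  · simp only [hov, Ints.root]
    simp
    omega
  · simp only [hov, Ints.root]
    exact Nat.mul_le_mul (by simp) (by omega)
  · rintro c ⟨i, -, h2, h3⟩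
    exact hcell i h2 c h3
  · rintro _ ⟨m', rfl, h⟩ - - - e he
    obtain ⟨j, hj, rfl⟩ := I.eid_surj e he
    exact h.of_index TNode.isRange (Q := fun i => m' (2 * I.Z + I.eid i) = .num (I.top (I.eid i)))
      (Nat.zero_le _) hj

end


/-- Stores level and group of the endpoint of rank `V 3`. -/
def levBody : Cmd :=
  .load 5 (1 + V 24 + V 3) ;; .load 6 (2 * V 23 + 2 * (V 5 / 2)) ;; .load 7 (2 * V 23 + 2 * (V 5 / 2) + 1) ;;
  .load 8 (V 23 + .bin .xor (V 6 - 1) (V 7)) ;; .store (3 * V 23 + V 3) (2 * V 8 + V 5 % 2) ;;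
  .store (4 * V 23 + V 3) (2 * .bin .shl (.bin .shr (V 7) (V 8)) (V 8) + V 5 % 2)

namespace Ints
variable {α : Type u} [LinearOrder α] (I : Ints α)

/-- Height of the node of interval `i`. -/
def height (i : ℕ) : ℕ := lcaHeight (I.top (2 * i)) (I.top (2 * i + 1))

/-- Code of the node of interval `i`. -/
def node (i : ℕ) : ℕ := lca (I.top (2 * i)) (I.top (2 * i + 1))

def lev (j : ℕ) : ℕ := 2 * I.height (I.eid j / 2) + I.eid j % 2

def grp (j : ℕ) : ℕ := 2 * I.node (I.eid j / 2) + I.eid j % 2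

variable {I}

theorem has_rkey {j : ℕ} (hj : j < 2 * I.n) : I.root.Has I.rkey (I.rkey j) :=
  ⟨j, Nat.zero_le _, hj, rfl⟩

theorem top_mono {i j : ℕ} (hij : i ≤ j) (hj : j < 2 * I.n) : I.top (I.eid i) ≤ I.top (I.eid j) :=
  TNode.code_mono I.mono' I.root_sized le_rfl (has_rkey (by omega)) (has_rkey hj) (I.mono' i j hij hj)

theorem top_le {i : ℕ} (hi : i < I.n) : I.top (2 * i) ≤ I.top (2 * i + 1) := by
  obtain ⟨j, hj, e⟩ := I.eid_surj (2 * i) (by omega)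
  obtain ⟨j', hj', e'⟩ := I.eid_surj (2 * i + 1) (by omega)
  have h1 := has_rkey hj
  have h2 := has_rkey hj'
  simp only [rkey, e, e'] at h1 h2
  exact TNode.code_mono I.mono' I.root_sized le_rfl h1 h2 (I.le i hi)

theorem node_spec {i : ℕ} (hi : i < I.n) : ∃ l, I.node i = (2 * l + 1) * 2 ^ I.height i ∧
    (I.top (2 * i) - 1) / 2 ^ (I.height i + 1) = l ∧ I.top (2 * i + 1) / 2 ^ (I.height i + 1) = l ∧
    I.node i - 2 ^ I.height i < I.top (2 * i) ∧ I.top (2 * i) ≤ I.node i ∧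
    I.node i ≤ I.top (2 * i + 1) ∧ I.top (2 * i + 1) < I.node i + 2 ^ I.height i :=
  lca_spec (I.top_mem (by omega)).1 (top_le hi)

theorem xor_top {i : ℕ} (hi : i < I.n) : 1 ≤ (I.top (2 * i) - 1) ^^^ I.top (2 * i + 1) ∧
    (I.top (2 * i) - 1) ^^^ I.top (2 * i + 1) < 2 * 2 ^ I.K := by
  have h1 := I.top_mem (e := 2 * i) (by omega)
  have h2 := I.top_mem (e := 2 * i + 1) (by omega)
  refine ⟨xor_pos h1.1 (top_le hi), ?_⟩
  have hp : 2 ^ (I.K + 1) = 2 * 2 ^ I.K := pow_succ' ..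
  rw [← hp]
  rw [← hp] at h1 h2
  exact Nat.xor_lt_two_pow (by omega) h2.2

theorem height_le {i : ℕ} (hi : i < I.n) : I.height i ≤ I.K := by
  have := xor_top hi
  rw [height, lcaHeight, ← Nat.lt_succ_iff]
  refine Nat.log_lt_of_lt_pow (Nat.pos_iff_ne_zero.1 this.1) ?_
  rw [pow_succ']
  exact this.2

theorem lev_lt {j : ℕ} (hj : j < 2 * I.n) : I.lev j < 2 * (I.K + 1) := by
  have h1 := I.eid_lt j hj
  have := height_le (I := I) (i := I.eid j / 2) (by omega)
  rw [lev]
  omega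

theorem grp_lt {j : ℕ} (hj : j < 2 * I.n) : 2 ≤ I.grp j ∧ I.grp j < 4 * 2 ^ I.K := by
  have h1 := I.eid_lt j hj
  obtain ⟨l, h2, -, -, -, h5, h6, -⟩ := node_spec (I := I) (i := I.eid j / 2) (by omega)
  have h3 := I.top_mem (e := 2 * (I.eid j / 2)) (by omega)
  have h4 := I.top_mem (e := 2 * (I.eid j / 2) + 1) (by omega)
  rw [grp]
  omega

theorem lev_eq_of_grp_eq {i j : ℕ} (hi : i < 2 * I.n) (hj : j < 2 * I.n) (h : I.grp i = I.grp j) :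
    I.lev i = I.lev j := by
  have h1 := I.eid_lt i hi
  have h2 := I.eid_lt j hj
  obtain ⟨l, h3, -⟩ := node_spec (I := I) (i := I.eid i / 2) (by omega)
  obtain ⟨l', h4, -⟩ := node_spec (I := I) (i := I.eid j / 2) (by omega)
  simp only [grp, lev] at *
  have : I.node (I.eid i / 2) = I.node (I.eid j / 2) := by omega
  rw [h3, h4] at this
  have := odd_mul_two_pow_inj this
  omega

theorem grp_mono {i j : ℕ} (hij : i ≤ j) (hj : j < 2 * I.n) (h : I.lev i = I.lev j) :
    I.grp i ≤ I.grp j := by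
  have h1 := I.eid_lt i (by omega)
  have h2 := I.eid_lt j hj
  have ht := top_mono hij hj
  obtain ⟨l, h3, h4, h5, -⟩ := node_spec (I := I) (i := I.eid i / 2) (by omega)
  obtain ⟨l', g3, g4, g5, -⟩ := node_spec (I := I) (i := I.eid j / 2) (by omega)
  simp only [grp, lev] at *
  have hh : I.height (I.eid i / 2) = I.height (I.eid j / 2) := by omega
  have hle : l ≤ l' := by
    rcases Nat.mod_two_eq_zero_or_one (I.eid i) with hs | hs
    · rw [← h4, ← g4, hh, show 2 * (I.eid i / 2) = I.eid i by omega,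
        show 2 * (I.eid j / 2) = I.eid j by omega]
      exact Nat.div_le_div_right (by omega)
    · rw [← h5, ← g5, hh, show 2 * (I.eid i / 2) + 1 = I.eid i by omega,
        show 2 * (I.eid j / 2) + 1 = I.eid j by omega]
      exact Nat.div_le_div_right ht
  rw [h3, g3, hh]
  have : (2 * l + 1) * 2 ^ I.height (I.eid j / 2) ≤ (2 * l' + 1) * 2 ^ I.height (I.eid j / 2) :=
    Nat.mul_le_mul_right _ (by omega)
  omega

end Ints

section
variable {α : Type u} [LinearOrder α] {C : Ctx} {I : Ints α}

theorem levRun_tri {p : ℕ} (hp : C.Γ[p]? = some (rangeProc p proHalf levBody .skip))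
    (hB : 1000 * (I.n + 1) ≤ C.B) {σ : St α} (he : Env I.env σ.n) (hin : I.Input σ.mem)
    (hlog : ∀ x, 1 ≤ x → x < 2 * 2 ^ I.K → I.Logs x σ.mem)
    (htop : Nums σ.mem (2 * I.Z) (2 * I.n) I.top) :
    Tri C (parFor p 24) Set.univ {c | 3 * I.Z ≤ c ∧ c < 5 * I.Z}
      (2 * I.n * 400 + 700) ((Nat.size (2 * I.n) + 3) * 400) σ
      fun σ' => Nums σ'.mem (3 * I.Z) (2 * I.n) I.lev ∧ Nums σ'.mem (4 * I.Z) (2 * I.n) I.grp := by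
  have hZ : I.Z = 16 * I.n + 8 := rfl
  have hK2 := I.pow_le
  have hcell : ∀ i < 2 * I.n, ∀ c ∈ ({3 * I.Z + i, 4 * I.Z + i} : Set ℕ), 3 * I.Z ≤ c ∧ c < 5 * I.Z := by
    intro i hi c hc
    simp only [Set.mem_insert_iff, Set.mem_singleton_iff] at hc
    omega
  refine (Tri.parFor hp (by decide) (by norm_num) (e := I.env)
    (fun j m => m (3 * I.Z + j) = .num (I.lev j) ∧ m (4 * I.Z + j) = .num (I.grp j))
    (fun j => {3 * I.Z + j, 4 * I.Z + j}) {c | 3 * I.Z ≤ c} (fun _ => 100) 100 (by omega) ?_ ?_ ?_ he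
    (N := 2 * I.n) rfl ?_).mono ?_ (Nat.mul_le_mul_left _ (by norm_num)) subset_rfl ?_
    fun σ' h _ _ _ => ⟨fun i hi => (h i hi).1, fun i hi => (h i hi).2⟩
  · intro i j hi hj hij
    rw [Set.disjoint_left]
    simp only [Set.mem_insert_iff, Set.mem_singleton_iff]
    omega
  · intro i hi c hc
    exact (hcell i hi c hc).1
  · rintro i hi m m' hm ⟨h1, h2⟩
    exact ⟨by rw [hm _ (by simp), h1], by rw [hm _ (by simp), h2]⟩
  · intro j hj τ h3 hτ hm
    obtain ⟨-, -, -, h23, h24, -⟩ := Ints.env_facts hτ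
    have hR : ∀ c < 3 * I.Z, c ∈ {c | 3 * I.Z ≤ c}ᶜ ∪ ({3 * I.Z + j, 4 * I.Z + j} : Set ℕ) :=
      fun c hc => Or.inl (by simpa using hc)
    have hm' : ∀ c < 3 * I.Z, τ.mem c = σ.mem c := fun c hc => hm c (Or.inl (by simpa using hc))
    have hlt := I.eid_lt j hj
    have m1 := hin.eid j hj
    rw [← hm' _ (by omega)] at m1
    have m2 := htop (2 * (I.eid j / 2)) (by omega)
    rw [← hm' _ (by omega)] at m2
    have m3 := htop (2 * (I.eid j / 2) + 1) (by omega)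
    rw [← hm' _ (by omega)] at m3
    obtain ⟨x1, x2⟩ := Ints.xor_top (I := I) (i := I.eid j / 2) (by omega)
    have m4 := (hlog _ x1 x2).log
    rw [← hm' _ (by omega)] at m4
    have t1 := I.top_mem (e := 2 * (I.eid j / 2)) (by omega)
    have t2 := I.top_mem (e := 2 * (I.eid j / 2) + 1) (by omega)
    obtain ⟨-, -, -, -, -, -, hn, -⟩ := Ints.node_spec (I := I) (i := I.eid j / 2) (by omega)
    have hK3 : I.K + 1 ≤ 2 ^ I.K := Nat.lt_two_pow_self
    have hh := Ints.height_le (I := I) (i := I.eid j / 2) (by omega)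
    have hsh : I.top (2 * (I.eid j / 2) + 1) >>> I.height (I.eid j / 2) <<< I.height (I.eid j / 2) =
        I.node (I.eid j / 2) := by
      rw [Nat.shiftRight_eq_div_pow, Nat.shiftLeft_eq]
      rfl
    have hsh' : I.top (2 * (I.eid j / 2) + 1) >>> I.height (I.eid j / 2) ≤ I.top (2 * (I.eid j / 2) + 1) := by
      rw [Nat.shiftRight_eq_div_pow]
      exact Nat.div_le_self _ _
    have hl : I.lev j = 2 * I.height (I.eid j / 2) + I.eid j % 2 := rfl
    have hg : I.grp j = 2 * I.node (I.eid j / 2) + I.eid j % 2 := rfl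
    change τ.mem _ = .num (I.height (I.eid j / 2)) at m4
    rw [← Nat.add_assoc] at m3
    refine (Tri.basic ?_).conseq (T := levBody.len) (D := levBody.len) (by decide) (by decide) fun _ h _ _ _ => h
    rw [hl, hg]
    have r1 := hR (1 + 2 * I.n + j) (by omega)
    have r2 := hR (2 * I.Z + 2 * (I.eid j / 2)) (by omega)
    have r3 := hR (2 * I.Z + 2 * (I.eid j / 2) + 1) (by omega)
    have r4 := hR (I.Z + ((I.top (2 * (I.eid j / 2)) - 1) ^^^ I.top (2 * (I.eid j / 2) + 1))) (by omega)
    generalize {c | 3 * I.Z ≤ c}ᶜ ∪ ({3 * I.Z + j, 4 * I.Z + j} : Set ℕ) = R at *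
    generalize hA : I.top (2 * (I.eid j / 2)) = A at *
    generalize hBB : I.top (2 * (I.eid j / 2) + 1) = B at *
    generalize hH : I.height (I.eid j / 2) = H at *
    generalize I.node (I.eid j / 2) = c at *
    simp [levBody, wp, h3, h23, h24, m1, m2, m3, m4, r1, r2, r3, r4, Op.ideal, Op.Dom]
    simp only [hsh]
    refine ⟨by omega, by omega, by omega, ?_⟩
    generalize (A - 1) ^^^ B = y at *
    refine ⟨?_, ?_, ?_, ?_, ?_, ?_, trivial⟩ <;> omega
  · simp
    omega
  · rintro c ⟨i, h2, h3⟩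
    exact hcell i h2 c h3

end


/-! ## Prefix sums -/

/-- Stores the sum of the counters in the range from `V 1` to `V 2`. -/
def upPost : Cmd :=
  .load 5 (5 * V 23 + V 3) ;;
  .ite (.le (V 3) (V 1)) .skip (.load 6 (6 * V 23 + (V 1 + V 3) / 2) ;; .set 5 (V 5 + V 6)) ;;
  .ite (.le (V 2) (V 3 + 1)) .skip
    (.load 6 (6 * V 23 + (V 3 + 1 + V 2) / 2) ;; .set 5 (V 5 + V 6)) ;;
  .store (6 * V 23 + V 3) (V 5)

def upProc (p : ℕ) : Cmd := rangeProc p proHalf .skip upPost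

def upRun (p : ℕ) : Cmd := .set 1 0 ;; .set 2 (V 27) ;; .set 3 (V 27) ;; .fork 4 p

/-- Stores the sum of the counters before `V 3`, where variable `10` holds the sum of those before
the range. -/
def downPre : Cmd :=
  .set 11 (V 10) ;;
  .ite (.le (V 3) (V 1)) .skip (.load 6 (6 * V 23 + (V 1 + V 3) / 2) ;; .set 11 (V 11 + V 6)) ;;
  .store (7 * V 23 + V 3) (V 11) ;; .load 6 (5 * V 23 + V 3) ;; .set 12 (V 11 + V 6)

def downPro : Cmd := .ite (.le (V 4) 1) (.set 2 (V 3)) (.set 1 (V 3 + 1) ;; .set 10 (V 12))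

def downProc (p : ℕ) : Cmd := rangeProc p downPro downPre .skip

def downRun (p : ℕ) : Cmd :=
  .set 1 0 ;; .set 2 (V 27) ;; .set 3 (V 27) ;; .set 10 0 ;; .set 12 0 ;; .fork 4 p

section
variable {α : Type u} [LinearOrder α] {C : Ctx} {I : Ints α} {f : ℕ → ℕ}

/-- The sums of the counters for all nodes of the recursion tree. -/
def SumTree (I : Ints α) (f : ℕ → ℕ) (x : ℕ × ℕ) (m : Mem α) : Prop :=
  TreeAll (X := ℕ × ℕ) Prod.fst Prod.snd (fun x => (x.1, (x.1 + x.2) / 2))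
    (fun x => ((x.1 + x.2) / 2 + 1, x.2))
    (fun x => m (6 * I.Z + (x.1 + x.2) / 2) = .num (∑ i ∈ Finset.Ico x.1 x.2, f i)) x

theorem SumTree.congr {x : ℕ × ℕ} {m m' : Mem α} (h : SumTree I f x m)
    (hm : ∀ c, 6 * I.Z + x.1 ≤ c → c < 6 * I.Z + x.2 → m' c = m c) : SumTree I f x m' := by
  refine TreeAll.mono isRange_pair h fun y h1 h2 h3 hy => ?_
  rw [hm _ (by omega) (by omega), hy]

theorem SumTree.val {a b : ℕ} {m : Mem α} (h : SumTree I f (a, b) m) (hab : a < b) :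
    m (6 * I.Z + (a + b) / 2) = .num (∑ i ∈ Finset.Ico a b, f i) := by
  cases h with
  | empty h => simp only at h; omega
  | node _ h _ _ => exact h

theorem Ints.M_le : I.M ≤ 8 * I.n + 2 := by
  have h1 := I.pow_le
  have hK : I.K + 1 ≤ 2 ^ I.K := Nat.lt_two_pow_self
  have h2 := Nat.div_mul_le_self (2 * I.n) (I.K + 1)
  have h3 : I.M = 2 * (2 * I.n / (I.K + 1) * (I.K + 1)) + 2 * (I.K + 1) := by
    rw [M, NB]
    ring
  omega

theorem upRun_tri {p : ℕ} (hp : C.Γ[p]? = some (upProc p)) (hB : 1000 * (I.n + 1) ≤ C.B)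
    {σ : St α} (he : Env I.env σ.n) (hf : Nums σ.mem (5 * I.Z) I.M f)
    (hsum : ∑ i ∈ Finset.range I.M, f i ≤ 2 * I.n) :
    Tri C (upRun p) Set.univ {c | 6 * I.Z ≤ c ∧ c < 7 * I.Z}
      (I.M * 400 + 700) ((Nat.size I.M + 3) * 400) σ
      fun σ' => SumTree I f (0, I.M) σ'.mem := by
  have hB1 := C.one_lt_B
  have hZ : I.Z = 16 * I.n + 8 := rfl
  have hM := I.M_le
  obtain ⟨-, -, -, -, -, -, -, h27, -⟩ := Ints.env_facts he
  have hov : overhead proHalf upPost = 107 := by decide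
  have hlen : proHalf.len = 11 := by decide
  refine (Tri.seq (Q := fun τ => τ = σ.setN 1 0) (Tri.set (by simp; omega) (by simp)) ?_
    (T₂ := 2 + (2 + (I.M * 400 + 690)))
    (D₂ := 2 + (2 + (Nat.size I.M + 2) * 400))).conseq ?_ ?_ fun _ h _ _ _ => h
  rotate_left
  · rw [show (Cmd.set 1 0).len = 2 by decide]
    exact (by omega : ∀ z, 2 + (2 + (2 + (z + 690))) ≤ z + 700) _
  · rw [show (Cmd.set 1 0).len = 2 by decide]
    omega
  rintro _ rfl - - -
  refine Tri.seq (Q := fun τ => τ = (σ.setN 1 0).setN 2 I.M) (Tri.set (by simp) (by simp [h27])) ?_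
  rintro _ rfl - - -
  refine Tri.seq (Q := fun τ => τ = ((σ.setN 1 0).setN 2 I.M).setN 3 I.M)
    (Tri.set (by simp) (by simp [h27])) ?_
  rintro _ rfl - - -
  refine (Tri.rangeFork (X := ℕ × ℕ) (F := {c | 6 * I.Z ≤ c}) hp isRange_pair
    (I := fun x (τ : St α) => τ.n 1 = x.1 ∧ τ.n 2 = x.2 ∧ Env I.env τ.n ∧
      Nums τ.mem (5 * I.Z) I.M f ∧ x.1 ≤ I.M + 1 ∧ x.2 ≤ I.M)
    (J := SumTree I f) (reg := fun x => {c | 6 * I.Z + x.1 ≤ c ∧ c < 6 * I.Z + x.2})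
    (Tp := fun _ => 0) (Dp := fun _ => 0)
    (Tot := fun x => (x.2 - x.1) * 400 + 200)
    (Dep := fun x => (Nat.size (x.2 - x.1) + 1) * 200)
    ?_ ?_ ?_ ?_ ?_ ?_ ?_ ?_ ?_ (0, I.M) (I.M + 1, I.M) _ ?_ ?_ ?_ ?_).mono ?_ ?_
      (Set.subset_univ _) ?_ ?_
  · rintro ⟨a, b⟩ τ ⟨g1, g2, -, -, ga, gb⟩
    exact ⟨g1, g2, by dsimp only at *; omega⟩
  · rintro ⟨a, b⟩ τ - c ⟨hc, hc'⟩
    simp only [Set.mem_ofPred_eq] at *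
    omega
  · rintro ⟨a, b⟩ τ - hlt
    simp only at hlt
    refine ⟨fun c hc => ?_, fun c hc => ?_, Set.disjoint_left.2 fun c hc hc' => ?_⟩ <;>
    · simp only [Set.mem_ofPred_eq] at *
      omega
  · exact fun x τ _ h => .empty h
  · rintro ⟨a, b⟩ τ ⟨g1, g2, ge, gm, ga, gb⟩ hlt
    simp only at ga gb hlt g1 g2
    refine Tri.skip ⟨?_, ?_, ?_⟩
    · exact wp_proHalf_left hB1 ⟨by simpa using g1, by simp,
        ((ge.setN (by simp)).setN (by simp)).setN (by simp), gm, by simpa using ga, by simp; omega⟩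
    · exact wp_proHalf_right hB1 (by simp; omega) ⟨by simp, by simpa using g2,
        ((ge.setN (by simp)).setN (by simp)).setN (by simp), gm, by simp; omega, by simpa using gb⟩
    · intro m₁ m₂ m' j₁ j₂ e₁ e₂ e₃
      obtain ⟨-, -, -, h23, -⟩ := Ints.env_facts ge
      simp only [Set.mem_ofPred_eq, St.setN_mem] at e₁ e₂ e₃
      have s₁ : SumTree I f (a, (a + b) / 2) m' := j₁.congr fun c _ h => e₁ c (by simp only at h; omega)
      have s₂ : SumTree I f ((a + b) / 2 + 1, b) m' := j₂.congr fun c h _ => e₂ c (by simp only at h; omega)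
      have v₁ := s₁.val
      have v₂ := s₂.val
      have hmid : (a + b) / 2 < b ∧ a ≤ (a + b) / 2 := by omega
      have v₀ : m' (5 * I.Z + (a + b) / 2) = .num (f ((a + b) / 2)) := by
        rw [e₃ _ (by omega) (by omega), gm _ (by omega)]
      have e : ∑ i ∈ Finset.Ico a b, f i = ∑ i ∈ Finset.Ico a ((a + b) / 2), f i + f ((a + b) / 2) +
          ∑ i ∈ Finset.Ico ((a + b) / 2 + 1) b, f i := by
        rw [← Finset.sum_Ico_succ_top hmid.2, Finset.sum_Ico_consecutive f (by omega) (by omega)]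
      have hle : ∑ i ∈ Finset.Ico a b, f i ≤ 2 * I.n := by
        refine le_trans (Finset.sum_le_sum_of_subset fun i hi => ?_) hsum
        simp only [Finset.mem_Ico, Finset.mem_range] at *
        omega
      have fin : ∀ v, v = ∑ i ∈ Finset.Ico a b, f i →
          ∀ ρ : St α, ρ.mem = m' → SumTree I f (a, b) (ρ.store (6 * I.Z + (a + b) / 2) (.num v)).mem := by
        intro v hv ρ hρ
        refine .node hlt ?_ (s₁.congr fun c h1 h2 => ?_) (s₂.congr fun c h1 h2 => ?_)
        · simp [hv]
        all_goals
          simp only at h1 h2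
          rw [St.store_mem, if_neg (by omega), hρ]
      have z₁ : b ≤ (a + b) / 2 + 1 → ∑ i ∈ Finset.Ico ((a + b) / 2 + 1) b, f i = 0 := fun h => by
        rw [Finset.Ico_eq_empty (by omega), Finset.sum_empty]
      have z₂ : (a + b) / 2 ≤ a → ∑ i ∈ Finset.Ico a ((a + b) / 2), f i = 0 := fun h => by
        rw [Finset.Ico_eq_empty (by omega), Finset.sum_empty]
      generalize ∑ i ∈ Finset.Ico a ((a + b) / 2), f i = S₁ at *
      generalize ∑ i ∈ Finset.Ico ((a + b) / 2 + 1) b, f i = S₂ at *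
      generalize ∑ i ∈ Finset.Ico a b, f i = S at *
      simp [upPost, wp, g1, g2, h23, v₀]
      refine ⟨by omega, by omega, fun h => ⟨by omega, fun h' => ⟨by omega, by omega,
        fin _ (by omega) _ rfl⟩, fun h' => ⟨by omega, by omega, _, v₂ h', by omega, by omega, by omega,
        fin _ (by omega) _ rfl⟩⟩, fun h => ⟨by omega, by omega, _, v₁ h, by omega, by omega,
        fun h' => ⟨by omega, by omega, fin _ (by omega) _ rfl⟩, fun h' => ⟨by omega, by omega, _, v₂ h',
        by omega, by omega, by omega, fin _ (by omega) _ rfl⟩⟩⟩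
  · rintro ⟨a, b⟩ _ _ hlt
    simp only [hov] at hlt ⊢
    omega
  · intro x
    simp only [hov]
    omega
  · rintro ⟨a, b⟩ _ _ hlt
    simp only [hov] at hlt ⊢
    obtain ⟨h1, h2⟩ := Nat.size_half hlt
    omega
  · intro x
    simp only [hov]
    omega
  · exact wp_proHalf_left hB1 ⟨by simp, by simp, (((((he.setN (by simp)).setN (by simp)).setN
      (by simp)).setN (by simp)).setN (by simp)), hf, by simp, by simp⟩
  · exact wp_proHalf_right hB1 (by simp; omega) ⟨by simp, by simp, (((((he.setN (by simp)).setN (by simp)).setN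
      (by simp)).setN (by simp)).setN (by simp)), hf, by simp, by simp⟩
  · ext; simp; omega
  · intro c hc
    simp only [Set.mem_ofPred_eq] at *
    omega
  · simp [hlen]
  · simp [hlen]
    omega
  · intro c hc
    simp only [Set.mem_ofPred_eq] at *
    omega
  · rintro _ ⟨m', rfl, h⟩ - - -
    exact h

theorem downRun_tri {p : ℕ} (hp : C.Γ[p]? = some (downProc p)) (hB : 1000 * (I.n + 1) ≤ C.B)
    {σ : St α} (he : Env I.env σ.n) (hf : Nums σ.mem (5 * I.Z) I.M f)
    (hsum : ∑ i ∈ Finset.range I.M, f i ≤ 2 * I.n) (ht : SumTree I f (0, I.M) σ.mem) :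
    Tri C (downRun p) Set.univ {c | 7 * I.Z ≤ c ∧ c < 8 * I.Z}
      (I.M * 400 + 700) ((Nat.size I.M + 3) * 400) σ
      fun σ' => Nums σ'.mem (7 * I.Z) I.M fun c => ∑ i ∈ Finset.range c, f i := by
  have hB1 := C.one_lt_B
  have hZ : I.Z = 16 * I.n + 8 := rfl
  have hM := I.M_le
  obtain ⟨-, -, -, -, -, -, -, h27, -⟩ := Ints.env_facts he
  have hov : overhead downPro .skip = 56 := by decide
  refine (Tri.seq (Q := fun τ => τ = σ.setN 1 0) (Tri.set (by simp; omega) (by simp)) ?_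
    (T₂ := 2 + (2 + (2 + (2 + (I.M * 400 + 680)))))
    (D₂ := 2 + (2 + (2 + (2 + (Nat.size I.M + 2) * 400))))).conseq ?_ ?_ fun _ h _ _ _ => h
  rotate_left
  · rw [show (Cmd.set 1 0).len = 2 by decide]
    exact (by omega : ∀ z, 2 + (2 + (2 + (2 + (2 + (z + 680))))) ≤ z + 700) _
  · rw [show (Cmd.set 1 0).len = 2 by decide]
    omega
  rintro _ rfl - - -
  refine Tri.seq (Q := fun τ => τ = (σ.setN 1 0).setN 2 I.M) (Tri.set (by simp) (by simp [h27])) ?_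
  rintro _ rfl - - -
  refine Tri.seq (Q := fun τ => τ = ((σ.setN 1 0).setN 2 I.M).setN 3 I.M)
    (Tri.set (by simp) (by simp [h27])) ?_
  rintro _ rfl - - -
  refine Tri.seq (Q := fun τ => τ = (((σ.setN 1 0).setN 2 I.M).setN 3 I.M).setN 10 0)
    (Tri.set (by simp; omega) (by simp)) ?_
  rintro _ rfl - - -
  refine Tri.seq (Q := fun τ => τ = ((((σ.setN 1 0).setN 2 I.M).setN 3 I.M).setN 10 0).setN 12 0)
    (Tri.set (by simp; omega) (by simp)) ?_
  rintro _ rfl - - -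
  have he' := ((((he.setN (x := 1) (v := 0) (by simp)).setN (x := 2) (v := I.M) (by simp)).setN
    (x := 3) (v := I.M) (by simp)).setN (x := 10) (v := 0) (by simp)).setN
    (x := 12) (v := 0) (by simp)
  refine (Tri.rangeTree (C := C) (X := ℕ × ℕ) (F := {c | 7 * I.Z ≤ c}) hp isRange_pair
    (fun x ν _ => ν 1 = x.1 ∧ ν 2 = x.2 ∧ x.1 ≤ I.M + 1 ∧ x.2 ≤ I.M ∧ Env I.env ν ∧
      (x.1 < x.2 → ν 10 = ∑ i ∈ Finset.range x.1, f i) ∧ SumTree I f x σ.mem)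
    (fun x m => m (7 * I.Z + (x.1 + x.2) / 2) = .num (∑ i ∈ Finset.range ((x.1 + x.2) / 2), f i))
    (fun c => {7 * I.Z + c}) I.M σ.mem (fun _ => 40) 40
    (by omega) ?_ ?_ ?_ ?_ ?_ (0, I.M) (I.M + 1, I.M) _
    ?_ ?_ (by simp) le_rfl ?_).mono ?_ ?_ (Set.subset_univ _) ?_ ?_
  · rintro x ν κ ⟨h1, h2, h3, h4, -⟩
    exact ⟨h1, h2, h3, h4⟩
  · intro i j hi hj hij
    rw [Set.disjoint_singleton]
    omega
  · intro i hi c hc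
    simp only [Set.mem_singleton_iff, Set.mem_ofPred_eq] at *
    omega
  · rintro x m m' hlt hb hm h
    rw [hm _ rfl, h]
  · rintro ⟨a, b⟩ τ ⟨g1, g2, ga, gb, ge, g10, gt⟩ hlt hm
    simp only at ga gb hlt g1 g2 g10
    specialize g10 hlt
    obtain ⟨-, -, -, h23, -⟩ := Ints.env_facts ge
    have hmid : (a + b) / 2 < b ∧ a ≤ (a + b) / 2 := by omega
    have hm' : ∀ c < 7 * I.Z, τ.mem c = σ.mem c := fun c hc => hm c (Or.inl (by simpa using hc))
    have v₀ : τ.mem (5 * I.Z + (a + b) / 2) = .num (f ((a + b) / 2)) := by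
      rw [hm' _ (by omega), hf _ (by omega)]
    obtain ⟨gl, gr⟩ : SumTree I f (a, (a + b) / 2) σ.mem ∧ SumTree I f ((a + b) / 2 + 1, b) σ.mem := by
      cases gt with
      | empty h => simp only at h; omega
      | node _ _ h h' => exact ⟨h, h'⟩
    have v₁ := gl.val
    have e₁ : ∑ i ∈ Finset.range ((a + b) / 2), f i = ∑ i ∈ Finset.range a, f i +
        ∑ i ∈ Finset.Ico a ((a + b) / 2), f i := (Finset.sum_range_add_sum_Ico f hmid.2).symm
    have e₂ : ∑ i ∈ Finset.range ((a + b) / 2 + 1), f i = ∑ i ∈ Finset.range ((a + b) / 2), f i +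
        f ((a + b) / 2) := Finset.sum_range_succ ..
    have hle : ∑ i ∈ Finset.range ((a + b) / 2 + 1), f i ≤ 2 * I.n := by
      refine le_trans (Finset.sum_le_sum_of_subset fun i hi => ?_) hsum
      simp only [Finset.mem_range] at *
      omega
    have z₁ : (a + b) / 2 ≤ a → ∑ i ∈ Finset.Ico a ((a + b) / 2), f i = 0 := fun h => by
      rw [Finset.Ico_eq_empty (by omega), Finset.sum_empty]
    have v₁' : a < (a + b) / 2 → τ.mem (6 * I.Z + (a + (a + b) / 2) / 2) =
        .num (∑ i ∈ Finset.Ico a ((a + b) / 2), f i) := fun h => by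
      rw [hm' _ (by omega), v₁ h]
    refine (Tri.basic (?_ : wp _ _ _ _ (fun τ' => τ'.n 11 = ∑ i ∈ Finset.range ((a + b) / 2), f i ∧
      τ'.n 12 = ∑ i ∈ Finset.range ((a + b) / 2 + 1), f i ∧
      τ'.mem (7 * I.Z + (a + b) / 2) = .num (∑ i ∈ Finset.range ((a + b) / 2), f i)) _)).conseq
      (T' := 40) (D' := 40) (by decide) (by decide) ?_
    · generalize ∑ i ∈ Finset.Ico a ((a + b) / 2), f i = S₁ at *
      generalize ∑ i ∈ Finset.range ((a + b) / 2), f i = S₂ at *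
      generalize ∑ i ∈ Finset.range ((a + b) / 2 + 1), f i = S₃ at *
      generalize ∑ i ∈ Finset.range a, f i = S₀ at *
      simp [downPre, wp, g1, g2, h23, g10, v₀, show I.Z ≠ 0 by omega]
      refine ⟨fun h => ⟨by omega, by omega, by omega, by omega, by omega, by omega, by omega⟩,
        fun h => ⟨by omega, by omega, _, v₁' h, by omega, by omega, by omega, by omega, by omega,
          by omega, by omega, by omega⟩⟩
    · rintro τ' ⟨p11, p12, hP⟩ hn - -
      have f1 : τ'.n 1 = a := by rw [hn 1 (by decide)]; simpa using g1
      have f2 : τ'.n 2 = b := by rw [hn 2 (by decide)]; simpa using g2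
      have f3 : τ'.n 3 = (a + b) / 2 := by rw [hn 3 (by decide)]; simp
      have f10 : τ'.n 10 = ∑ i ∈ Finset.range a, f i := by rw [hn 10 (by decide)]; simpa using g10
      have ee : Env I.env τ'.n := (ge.setN (x := 3) (v := (a + b) / 2) (by simp)).frame hn (by decide)
      refine ⟨?_, ?_, hP⟩
      · simp [downPro, wp, f3]
        refine ⟨by omega, f1, by omega, by omega, (ee.setN (by simp)).setN (by simp), fun _ => f10, gl⟩
      · simp [downPro, wp, f3]
        refine ⟨by omega, by omega, f2, by omega, by omega,
          ((ee.setN (by simp)).setN (by simp)).setN (by simp), fun _ => p12, gr⟩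
  · simp [downPro, wp]
    refine ⟨by omega, ?_, ht⟩
    exact ((he'.setN (by simp)).setN (by simp))
  · simp [downPro, wp]
    refine ⟨by omega, by omega, ((he'.setN (by simp)).setN (by simp)).setN (by simp), .empty ?_⟩
    simp
  · intro y _
    rfl
  · simp only [hov]
    simp
    omega
  · simp only [hov]
    exact Nat.mul_le_mul (by simp) (by omega)
  · rintro c ⟨i, -, h2, h3⟩
    simp only [Set.mem_singleton_iff, Set.mem_ofPred_eq] at *
    omega
  · rintro _ ⟨m', rfl, h⟩ - - - c hc
    exact h.of_index isRange_pair (Q := fun c => m' (7 * I.Z + c) = .num (∑ i ∈ Finset.range c, f i))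
      (Nat.zero_le _) hc

end


/-! ## The order of the endpoints by level -/

/-- Rank of `j < N` with respect to the key `f`. -/
def rank (f : ℕ → ℕ) (N j : ℕ) : ℕ := ((Finset.range N).filter fun i => f i < f j).card

theorem rank_lt_rank {f : ℕ → ℕ} {N i j : ℕ} (hi : i < N) (h : f i < f j) : rank f N i < rank f N j := by
  refine Finset.card_lt_card ⟨fun k hk => ?_, fun hk => ?_⟩
  · simp only [Finset.mem_filter, Finset.mem_range] at *
    omega
  · have := @hk i (by simp; omega)
    simp at this

theorem rank_lt {f : ℕ → ℕ} {N j : ℕ} (hj : j < N) : rank f N j < N := by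
  conv_rhs => rw [← Finset.card_range N]
  refine Finset.card_lt_card ⟨Finset.filter_subset _ _, fun hk => ?_⟩
  have := @hk j (by simp; omega)
  simp at this

theorem exists_rank {f : ℕ → ℕ} {N : ℕ} (hf : ∀ i < N, ∀ j < N, f i = f j → i = j) {p : ℕ} (hp : p < N) :
    ∃ j < N, rank f N j = p := by
  have := Finset.surj_on_of_inj_on_of_card_le (s := Finset.range N) (t := Finset.range N)
    (fun j _ => rank f N j) (fun j hj => by simpa using rank_lt (by simpa using hj)) ?_ le_rfl p (by simpa using hp)
  · obtain ⟨j, hj, h⟩ := this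
    exact ⟨j, by simpa using hj, h.symm⟩
  · intro i j hi hj h
    simp only [Finset.mem_range] at hi hj
    rcases lt_trichotomy (f i) (f j) with h' | h' | h'
    · exact absurd h (rank_lt_rank hi h').ne
    · exact hf i hi j hj h'
    · exact absurd h (rank_lt_rank hj h').ne'

namespace Ints
variable {α : Type u} [LinearOrder α] (I : Ints α)

/-- Number of the counter for the endpoint of rank `j`, which depends on its level and block. -/
def code (j : ℕ) : ℕ := I.lev j * I.NB + j / (I.K + 1)

def cnt (c : ℕ) : ℕ := ((Finset.range (2 * I.n)).filter fun j => I.code j = c).card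

/-- Number of endpoints of level `q` and rank less than `i` in block `b` and later blocks. -/
def blk (q b i : ℕ) : ℕ := ((Finset.range i).filter fun j => b * (I.K + 1) ≤ j ∧ I.lev j = q).card

/-- Position of the endpoint of rank `j` in the order by level and rank. -/
def pos (j : ℕ) : ℕ := rank (fun j => I.lev j * (2 * I.n) + j) (2 * I.n) j

variable {I}

theorem lex_lt {N a b i j : ℕ} (hi : i < N) (hj : j < N) :
    a * N + i < b * N + j ↔ a < b ∨ a = b ∧ i < j := by
  rcases lt_trichotomy a b with h | rfl | h
  · have : (a + 1) * N ≤ b * N := Nat.mul_le_mul_right _ h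
    rw [Nat.succ_mul] at this
    omega
  · omega
  · have : (b + 1) * N ≤ a * N := Nat.mul_le_mul_right _ h
    rw [Nat.succ_mul] at this
    omega

theorem div_lt_NB {j : ℕ} (hj : j < 2 * I.n) : j / (I.K + 1) < I.NB :=
  Nat.lt_succ_of_le (Nat.div_le_div_right hj.le)

theorem code_eq_iff {q b j : ℕ} (hb : b < I.NB) (hj : j < 2 * I.n) :
    I.code j = q * I.NB + b ↔ I.lev j = q ∧ j / (I.K + 1) = b := by
  have h1 := lex_lt (a := I.lev j) (b := q) (div_lt_NB hj) hb
  have h2 := lex_lt (a := q) (b := I.lev j) hb (div_lt_NB hj)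
  rw [code]
  omega

theorem code_lt {j : ℕ} (hj : j < 2 * I.n) : I.code j < I.M := by
  have h2 : (I.lev j + 1) * I.NB ≤ I.M := Nat.mul_le_mul_right I.NB (lev_lt hj)
  have h3 := div_lt_NB hj
  rw [Nat.succ_mul] at h2
  rw [code]
  omega

theorem sum_cnt_le : ∑ c ∈ Finset.range I.M, I.cnt c ≤ 2 * I.n := by
  have := Finset.card_eq_sum_card_fiberwise (s := Finset.range (2 * I.n)) (t := Finset.range I.M)
    (f := I.code) fun j hj => by simpa using code_lt (by simpa using hj)
  rw [Finset.card_range] at this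
  exact this.ge

theorem mem_block {b j : ℕ} : j / (I.K + 1) = b ↔ b * (I.K + 1) ≤ j ∧ j < (b + 1) * (I.K + 1) := by
  rw [Nat.div_eq_iff (by omega), Nat.succ_mul]
  omega

theorem cnt_eq {q b : ℕ} (hb : b < I.NB) :
    I.cnt (q * I.NB + b) = I.blk q b (min ((b + 1) * (I.K + 1)) (2 * I.n)) := by
  refine congrArg Finset.card (Finset.ext fun j => ?_)
  simp only [Finset.mem_filter, Finset.mem_range]
  constructor
  · rintro ⟨h1, h2⟩
    obtain ⟨h3, h4⟩ := (code_eq_iff hb h1).1 h2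
    rw [mem_block] at h4
    omega
  · rintro ⟨h1, h2, h3⟩
    exact ⟨by omega, (code_eq_iff hb (by omega)).2 ⟨h3, mem_block.2 (by omega)⟩⟩

theorem pos_eq {j : ℕ} (hj : j < 2 * I.n) :
    I.pos j = ∑ c ∈ Finset.range (I.code j), I.cnt c + I.blk (I.lev j) (j / (I.K + 1)) j := by
  have h1 : ∑ c ∈ Finset.range (I.code j), I.cnt c =
      ((Finset.range (2 * I.n)).filter fun i => I.code i < I.code j).card := by
    rw [Finset.card_eq_sum_card_fiberwise (t := Finset.range (I.code j)) (f := I.code)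
      fun i hi => by simp at hi ⊢; exact hi.2]
    refine Finset.sum_congr rfl fun c hc => congrArg Finset.card (Finset.ext fun i => ?_)
    simp only [Finset.mem_filter, Finset.mem_range] at *
    omega
  rw [h1, pos, rank, blk, ← Finset.card_union_of_disjoint]
  · refine congrArg Finset.card (Finset.ext fun i => ?_)
    simp only [Finset.mem_filter, Finset.mem_range, Finset.mem_union]
    by_cases hi : i < 2 * I.n
    · rw [lex_lt hi hj, code, code, lex_lt (div_lt_NB hi) (div_lt_NB hj)]
      have h3 := mem_block (I := I) (b := j / (I.K + 1)) (j := i)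
      have h4 := (mem_block (I := I) (b := j / (I.K + 1)) (j := j)).1 rfl
      have h5 : i ≤ j → i / (I.K + 1) ≤ j / (I.K + 1) := fun h => Nat.div_le_div_right h
      have h6 : j ≤ i → j / (I.K + 1) ≤ i / (I.K + 1) := fun h => Nat.div_le_div_right h
      generalize j / (I.K + 1) * (I.K + 1) = x at *
      generalize (j / (I.K + 1) + 1) * (I.K + 1) = y at *
      omega
    · omega
  · rw [Finset.disjoint_left]
    intro i
    simp only [Finset.mem_filter, Finset.mem_range]
    rintro ⟨h2, h3⟩ ⟨h4, h5, h6⟩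
    rw [code, code, h6] at h3
    have := Nat.div_le_div_right (c := I.K + 1) h5
    rw [Nat.mul_div_cancel _ (by omega)] at this
    omega

theorem pos_lt {j : ℕ} (hj : j < 2 * I.n) : I.pos j < 2 * I.n := rank_lt hj

theorem exists_pos {p : ℕ} (hp : p < 2 * I.n) : ∃ j < 2 * I.n, I.pos j = p := by
  refine exists_rank (fun i hi j hj h => ?_) hp
  have h1 := lex_lt (a := I.lev i) (b := I.lev j) hi hj
  have h2 := lex_lt (a := I.lev j) (b := I.lev i) hj hi
  omega

theorem pos_lt_pos {i j : ℕ} (hi : i < 2 * I.n) (hj : j < 2 * I.n) :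
    I.pos i < I.pos j ↔ I.lev i < I.lev j ∨ I.lev i = I.lev j ∧ i < j := by
  rw [← lex_lt hi hj]
  constructor
  · intro h
    by_contra hle
    rcases (not_lt.1 hle).lt_or_eq with h' | h'
    · exact absurd h (rank_lt_rank hj h').not_gt
    · rw [pos, pos, rank, rank, h'] at h
      exact h.false
  · exact fun h => rank_lt_rank hi h

theorem pos_inj {i j : ℕ} (hi : i < 2 * I.n) (hj : j < 2 * I.n) (h : I.pos i = I.pos j) : i = j := by
  have h1 := pos_lt_pos hi hj
  have h2 := pos_lt_pos hj hi
  omega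

open Classical in
/-- The rank of the endpoint at position `p`. -/
noncomputable def out (I : Ints α) (p : ℕ) : ℕ :=
  if h : ∃ j < 2 * I.n, I.pos j = p then h.choose else 0

theorem out_spec {p : ℕ} (hp : p < 2 * I.n) : I.out p < 2 * I.n ∧ I.pos (I.out p) = p := by
  have h := exists_pos hp
  rw [out, dif_pos h]
  exact h.choose_spec

theorem out_pos {j : ℕ} (hj : j < 2 * I.n) : I.out (I.pos j) = j :=
  pos_inj (out_spec (pos_lt hj)).1 hj (out_spec (pos_lt hj)).2

theorem grp_between {p r q : ℕ} (hpr : p ≤ r) (hrq : r ≤ q) (hq : q < 2 * I.n)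
    (h : I.grp (I.out p) = I.grp (I.out q)) : I.grp (I.out r) = I.grp (I.out p) ∧
    I.out p ≤ I.out r ∧ (p < r → I.out p < I.out r) := by
  obtain ⟨p1, p2⟩ := out_spec (I := I) (p := p) (by omega)
  obtain ⟨r1, r2⟩ := out_spec (I := I) (p := r) (by omega)
  obtain ⟨q1, q2⟩ := out_spec (I := I) (p := q) (by omega)
  have h1 := lev_eq_of_grp_eq p1 q1 h
  have h2 := pos_lt_pos r1 p1
  have h3 := pos_lt_pos q1 r1
  have h4 := pos_lt_pos p1 r1
  have h5 := grp_mono (I := I) (i := I.out p) (j := I.out r) (by omega) r1 (by omega)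
  have h6 := grp_mono (I := I) (i := I.out r) (j := I.out q) (by omega) q1 (by omega)
  omega

/-- First position of the group `g`, or `0` if it is empty. -/
noncomputable def start (I : Ints α) (g : ℕ) : ℕ := sInf {p | p < 2 * I.n ∧ I.grp (I.out p) = g}

/-- Position after the group `g`, or `0` if it is empty. -/
noncomputable def finish (I : Ints α) (g : ℕ) : ℕ :=
  ((Finset.range (2 * I.n)).filter fun p => I.grp (I.out p) = g).sup (· + 1)

theorem finish_le (g : ℕ) : I.finish g ≤ 2 * I.n := by
  refine Finset.sup_le fun p hp => ?_
  simp at hp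
  omega

theorem mem_group {g p : ℕ} : p < 2 * I.n ∧ I.grp (I.out p) = g ↔ I.start g ≤ p ∧ p < I.finish g := by
  constructor
  · intro h
    refine ⟨Nat.sInf_le h, ?_⟩
    have := Finset.le_sup (f := (· + 1)) (s := (Finset.range (2 * I.n)).filter fun p => I.grp (I.out p) = g)
      (b := p) (by simpa using h)
    exact this
  · rintro ⟨h1, h2⟩
    rw [finish, Finset.lt_sup_iff] at h2
    obtain ⟨q, hq, h3⟩ := h2
    simp only [Finset.mem_filter, Finset.mem_range] at hq
    obtain ⟨s1, s2⟩ : I.start g < 2 * I.n ∧ I.grp (I.out (I.start g)) = g := 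
      Nat.sInf_mem (s := {p | p < 2 * I.n ∧ I.grp (I.out p) = g}) ⟨q, hq⟩
    refine ⟨by omega, ?_⟩
    rw [(grp_between h1 (by omega) hq.1 (by rw [s2, hq.2])).1, s2]

theorem start_le_finish (g : ℕ) : I.start g ≤ I.finish g := by
  by_cases h : ∃ p, p < 2 * I.n ∧ I.grp (I.out p) = g
  · obtain ⟨p, hp⟩ := h
    have := mem_group.1 hp
    omega
  · rw [start, Set.eq_empty_of_forall_notMem (s := {p | p < 2 * I.n ∧ I.grp (I.out p) = g})
      fun p hp => h ⟨p, hp⟩]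
    simp

end Ints


/-! ## Counting sort -/

/-- Puts the bounds of block `V 3` into `V 5` and `V 6`. -/
def blockInit : Cmd :=
  .set 5 (V 3 * V 25) ;; .set 6 (V 5 + V 25) ;; .ite (.le (V 24) (V 6)) (.set 6 (V 24)) .skip

def clearStep : Cmd := .store (5 * V 23 + (V 5 * V 26 + V 3)) 0 ;; .set 5 (V 5 + 1)

def countStep : Cmd :=
  .load 7 (3 * V 23 + V 5) ;; .load 8 (5 * V 23 + (V 7 * V 26 + V 3)) ;;
  .store (5 * V 23 + (V 7 * V 26 + V 3)) (V 8 + 1) ;; .set 5 (V 5 + 1)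

/-- Counts the endpoints of block `V 3` by level. -/
def countBody : Cmd :=
  .set 5 0 ;; .loop (.le (V 5 + 1) (2 * V 25)) clearStep ;;
  blockInit ;; .loop (.le (V 5 + 1) (V 6)) countStep

def placeStep : Cmd :=
  .load 7 (3 * V 23 + V 5) ;; .load 8 (7 * V 23 + (V 7 * V 26 + V 3)) ;; .store (8 * V 23 + V 8) (V 5) ;;
  .store (7 * V 23 + (V 7 * V 26 + V 3)) (V 8 + 1) ;; .set 5 (V 5 + 1)

/-- Moves the endpoints of block `V 3` to their positions. -/
def placeBody : Cmd := blockInit ;; .loop (.le (V 5 + 1) (V 6)) placeStep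

/-- Stores `V 11` in the cell `V 10 + V 6` unless position `V 9 - 1` is in group `V 6`. -/
def edge : Cmd :=
  .set 8 0 ;; .ite (.le (V 9) 0) .skip (.load 7 (8 * V 23 + (V 9 - 1)) ;; .load 8 (4 * V 23 + V 7)) ;;
  .ite (.le (.bin .xor (V 6) (V 8)) 0) .skip (.store (V 10 + V 6) (V 11))

/-- Stores position `V 3` if it is at the start or at the end of a group. -/
def boundBody : Cmd :=
  .load 5 (8 * V 23 + V 3) ;; .load 6 (4 * V 23 + V 5) ;;
  .set 9 (V 3) ;; .set 10 (9 * V 23) ;; .set 11 (V 3) ;; edge ;;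
  .ite (.le (V 24) (V 3 + 1)) (.set 9 0) (.set 9 (V 3 + 2)) ;; .set 10 (10 * V 23) ;;
  .set 11 (V 3 + 1) ;; edge

namespace Ints
variable {α : Type u} [LinearOrder α] {I : Ints α}

/-- Cells for the counters of block `b` in the array number `r`. -/
def col (I : Ints α) (r b : ℕ) : Set ℕ := {c | ∃ q < 2 * (I.K + 1), c = r * I.Z + (q * I.NB + b)}

theorem idx_lt {q b : ℕ} (hq : q < 2 * (I.K + 1)) (hb : b < I.NB) : q * I.NB + b < I.M := by
  have h2 : (q + 1) * I.NB ≤ I.M := Nat.mul_le_mul_right I.NB hq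
  rw [Nat.succ_mul] at h2
  omega

theorem idx_inj {q q' b b' : ℕ} (hb : b < I.NB) (hb' : b' < I.NB) :
    q * I.NB + b = q' * I.NB + b' ↔ q = q' ∧ b = b' := by
  have h1 := lex_lt (a := q) (b := q') hb hb'
  have h2 := lex_lt (a := q') (b := q) hb' hb
  omega

theorem col_subset {r b c : ℕ} (hb : b < I.NB) (hc : c ∈ I.col r b) :
    r * I.Z ≤ c ∧ c < r * I.Z + I.M := by
  obtain ⟨q, hq, rfl⟩ := hc
  have := idx_lt hq hb
  omega

theorem exists_idx {c : ℕ} (hc : c < I.M) : ∃ q b, q < 2 * (I.K + 1) ∧ b < I.NB ∧ c = q * I.NB + b := by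
  have h : 0 < I.NB := Nat.succ_pos _
  exact ⟨c / I.NB, c % I.NB, (Nat.div_lt_iff_lt_mul h).2 hc, Nat.mod_lt _ h,
    by rw [Nat.mul_comm]; exact (Nat.div_add_mod _ _).symm⟩

theorem blk_zero (q b : ℕ) {i : ℕ} (hi : i ≤ b * (I.K + 1)) : I.blk q b i = 0 := by
  rw [blk, Finset.card_eq_zero, Finset.filter_eq_empty_iff]
  intro j hj
  simp at hj
  omega

theorem blk_succ {q b i : ℕ} (hi : b * (I.K + 1) ≤ i) :
    I.blk q b (i + 1) = I.blk q b i + if I.lev i = q then 1 else 0 := by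
  rw [blk, Finset.range_add_one, Finset.filter_insert]
  split_ifs with h1 h2 h2
  · rw [Finset.card_insert_of_notMem (by simp), blk]
  · exact absurd h1.2 h2
  · exact absurd ⟨hi, h2⟩ h1
  · rfl

theorem blk_le (q b i : ℕ) : I.blk q b i ≤ i := (Finset.card_filter_le _ _).trans (Finset.card_range i).le

theorem block_le {b : ℕ} (hb : b < I.NB) : b * (I.K + 1) ≤ 2 * I.n :=
  (Nat.mul_le_mul_right _ (Nat.le_of_lt_succ hb)).trans (Nat.div_mul_le_self _ _)

end Ints

section
variable {α : Type u} [LinearOrder α] {C : Ctx} {I : Ints α} {b : ℕ} {τ : St α} {R : Set ℕ}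

theorem wp_blockInit {W : Set ℕ} {Q : St α → Prop} (hB : 1000 * (I.n + 1) ≤ C.B) (he : Env I.env τ.n)
    (h3 : τ.n 3 = b) (hb : b < I.NB)
    (hQ : ∀ τ' : St α, τ'.mem = τ.mem → Env I.env τ'.n → τ'.n 3 = b → τ'.n 5 = b * (I.K + 1) →
      τ'.n 6 = min ((b + 1) * (I.K + 1)) (2 * I.n) → Q τ') : wp C.B R W blockInit Q τ := by
  obtain ⟨-, -, -, -, h24, h25, -⟩ := Ints.env_facts he
  have h1 := I.pow_le
  have hK : I.K + 1 ≤ 2 ^ I.K := Nat.lt_two_pow_self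
  have hbl := Ints.block_le hb
  have e : (b + 1) * (I.K + 1) = b * (I.K + 1) + (I.K + 1) := Nat.succ_mul ..
  simp [blockInit, wp, h3, h24, h25]
  refine ⟨by omega, by omega, fun h => hQ _ rfl ?_ ?_ ?_ ?_, fun h => hQ _ rfl ?_ ?_ ?_ ?_⟩
  · exact ((he.setN (by simp)).setN (by simp)).setN (by simp)
  · simpa using h3
  · simp
  · simp
    omega
  · exact (he.setN (by simp)).setN (by simp)
  · simpa using h3
  · simp
  · simp
    omega

theorem countBody_tri (hB : 1000 * (I.n + 1) ≤ C.B) (he : Env I.env τ.n)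
    (h3 : τ.n 3 = b) (hb : b < I.NB) (hl : Nums τ.mem (3 * I.Z) (2 * I.n) I.lev)
    (hR : ∀ c < 5 * I.Z, c ∈ R) (hR' : I.col 5 b ⊆ R) :
    Tri C countBody R (I.col 5 b) ((I.K + 1) * 200) ((I.K + 1) * 200) τ fun τ' =>
      ∀ q < 2 * (I.K + 1), τ'.mem (5 * I.Z + (q * I.NB + b)) = .num (I.cnt (q * I.NB + b)) := by
  have hB1 := C.one_lt_B
  have hZ : I.Z = 16 * I.n + 8 := rfl
  have hM := I.M_le
  have h1 := I.pow_le
  have hK : I.K + 1 ≤ 2 ^ I.K := Nat.lt_two_pow_self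
  have hNB : I.NB ≠ 0 := by omega
  have hc1 : clearStep.len + ((Cond.le (V 5 + 1) (2 * V 25)).code.length + 2) = 24 := by decide
  have hc2 : (Cond.le (V 5 + 1) (2 * V 25)).code.length + 2 = 9 := by decide
  have hc3 : countStep.len + ((Cond.le (V 5 + 1) (V 6)).code.length + 2) = 40 := by decide
  have hc4 : (Cond.le (V 5 + 1) (V 6)).code.length + 2 = 7 := by decide
  refine (Tri.seq (Q := fun ρ => ρ = τ.setN 5 0) (Tri.set (by simp; omega) (by simp)) ?_
    (T₂ := (∑ i ∈ Finset.range (2 * (I.K + 1)), 24 + 9) + (25 + (∑ i ∈ Finset.range (I.K + 1), 40 + 7)))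
    (D₂ := (∑ i ∈ Finset.range (2 * (I.K + 1)), 24 + 9) + (25 + (∑ i ∈ Finset.range (I.K + 1), 40 + 7)))).conseq
    ?_ ?_ fun _ h _ _ _ => h
  rotate_left
  · simp [show (Cmd.set 5 0).len = 2 by decide]
    omega
  · simp [show (Cmd.set 5 0).len = 2 by decide]
    omega
  rintro _ rfl - - -
  refine Tri.seq (Q := fun ρ => Env I.env ρ.n ∧ ρ.n 3 = b ∧
    (∀ q < 2 * (I.K + 1), ρ.mem (5 * I.Z + (q * I.NB + b)) = .num 0) ∧
    ∀ c < 5 * I.Z, ρ.mem c = τ.mem c) ?_ ?_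
  · rw [← hc1, ← hc2]
    refine Tri.loop (fun k ρ => ρ.n 5 + k = 2 * (I.K + 1) ∧ Env I.env ρ.n ∧ ρ.n 3 = b ∧
      (∀ q < ρ.n 5, ρ.mem (5 * I.Z + (q * I.NB + b)) = .num 0) ∧
      ∀ c < 5 * I.Z, ρ.mem c = τ.mem c) (fun _ => _) (fun _ => _) ?_ ?_ ?_ ?_ (2 * (I.K + 1)) ?_
    · rintro k ρ ⟨g1, ge, -⟩
      obtain ⟨-, -, -, h23, h24, h25, h26, -⟩ := Ints.env_facts ge
      simp [Cond.Ok, h25]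
      omega
    · rintro k ρ ⟨g1, ge, g3, g4, g5⟩ -
      obtain ⟨-, -, -, h23, h24, h25, h26, -⟩ := Ints.env_facts ge
      have hq : ρ.n 5 < 2 * (I.K + 1) := by omega
      have hlt := Ints.idx_lt hq hb
      refine Tri.basic ?_
      simp [clearStep, wp, h23, h26, g3, hNB]
      refine ⟨by omega, by omega, ⟨_, hq, rfl⟩, by omega, by omega, ge.setN (by simp), fun q hq' => ?_, fun c hc => ?_⟩
      · exact fun h => g4 q (by omega)
      · rw [if_neg (by omega), g5 c hc]
    · rintro ρ ⟨g1, ge, -⟩ h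
      obtain ⟨-, -, -, h23, h24, h25, h26, -⟩ := Ints.env_facts ge
      simp [Cond.Holds, h25] at h
      omega
    · rintro k ρ ⟨g1, ge, g3, g4, g5⟩ h
      obtain ⟨-, -, -, h23, h24, h25, h26, -⟩ := Ints.env_facts ge
      simp [Cond.Holds, h25] at h
      exact ⟨ge, g3, fun q hq => g4 q (by omega), g5⟩
    · exact ⟨by simp, he.setN (by simp), by simpa using h3, by simp, fun c _ => rfl⟩
  rintro ρ ⟨ge, g3, g4, g5⟩ - - -
  refine Tri.seq (Q := fun ρ' => ρ'.mem = ρ.mem ∧ Env I.env ρ'.n ∧ ρ'.n 3 = b ∧ ρ'.n 5 = b * (I.K + 1) ∧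
    ρ'.n 6 = min ((b + 1) * (I.K + 1)) (2 * I.n)) ((Tri.basic (wp_blockInit hB ge g3 hb
    fun ρ' f1 f2 f3 f4 f5 => ⟨f1, f2, f3, f4, f5⟩)).conseq (by decide) (by decide) fun _ h _ _ _ => h) ?_
  rintro ρ' ⟨f1, f2, f3, f4, f5⟩ - - -
  have hbl := Ints.block_le hb
  have e : (b + 1) * (I.K + 1) = b * (I.K + 1) + (I.K + 1) := Nat.succ_mul ..
  obtain ⟨k, hk, hk'⟩ : ∃ k, b * (I.K + 1) + k = min ((b + 1) * (I.K + 1)) (2 * I.n) ∧ k ≤ I.K + 1 :=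
    ⟨min ((b + 1) * (I.K + 1)) (2 * I.n) - b * (I.K + 1), by omega, by omega⟩
  have hw := Tri.loop (C := C) (R := R) (W := I.col 5 b) (b := .le (V 5 + 1) (V 6)) (c := countStep)
    (σ := ρ') (Q := fun τ' =>
      ∀ q < 2 * (I.K + 1), τ'.mem (5 * I.Z + (q * I.NB + b)) = .num (I.cnt (q * I.NB + b)))
    (fun k ρ => b * (I.K + 1) ≤ ρ.n 5 ∧ ρ.n 5 + k = min ((b + 1) * (I.K + 1)) (2 * I.n) ∧
      ρ.n 6 = min ((b + 1) * (I.K + 1)) (2 * I.n) ∧ Env I.env ρ.n ∧ ρ.n 3 = b ∧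
      (∀ q < 2 * (I.K + 1), ρ.mem (5 * I.Z + (q * I.NB + b)) = .num (I.blk q b (ρ.n 5))) ∧
      ∀ c < 5 * I.Z, ρ.mem c = τ.mem c) (fun _ => countStep.len) (fun _ => countStep.len) ?_ ?_ ?_ ?_ k ?_
  · refine hw.conseq ?_ ?_ fun _ h _ _ _ => h <;>
    · rw [hc3, hc4]
      simp only [Finset.sum_const, Finset.card_range, smul_eq_mul]
      omega
  · rintro k ρ ⟨g0, g1, g2, -⟩
    simp [Cond.Ok, g2]
    omega
  · rintro k ρ ⟨g0, g1, g2, ge, g3, g4, g5⟩ -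
    obtain ⟨-, -, -, h23, h24, h25, h26, -⟩ := Ints.env_facts ge
    have hj : ρ.n 5 < 2 * I.n := by omega
    have hq := Ints.lev_lt hj
    have hlt := Ints.idx_lt hq hb
    have v1 : ρ.mem (3 * I.Z + ρ.n 5) = .num (I.lev (ρ.n 5)) := by rw [g5 _ (by omega), hl _ hj]
    have v2 := g4 _ hq
    have hbk := I.blk_le (I.lev (ρ.n 5)) b (ρ.n 5)
    refine Tri.basic ?_
    simp [countStep, wp, h23, h26, g3, v1, v2, hNB]
    refine ⟨by omega, hR _ (by omega), by omega, hR' ⟨_, hq, rfl⟩, by omega, by omega, ⟨_, hq, rfl⟩, by omega, by omega,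
      by omega, g2, ((ge.setN (by simp)).setN (by simp)).setN (by simp), fun q hq' => ?_, fun c hc => ?_⟩
    · rw [Ints.blk_succ g0]
      split_ifs with h h' h'
      · rw [h]
      · exact absurd h.symm h'
      · exact absurd h'.symm h
      · exact g4 q hq'
    · rw [if_neg (by omega), g5 c hc]
  · rintro ρ ⟨g0, g1, g2, -⟩ h
    simp [Cond.Holds, g2] at h
    omega
  · rintro k ρ ⟨g0, g1, g2, ge, g3, g4, g5⟩ h q hq
    simp [Cond.Holds, g2] at h
    rw [g4 q hq, Ints.cnt_eq hb, show ρ.n 5 = min ((b + 1) * (I.K + 1)) (2 * I.n) by omega]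
  · refine ⟨f4.ge, by rw [f4, hk], f5, f2, f3, fun q hq => ?_, fun c hc => by rw [f1, g5 c hc]⟩
    rw [f1, g4 q hq, f4, Ints.blk_zero _ _ le_rfl]

theorem placeBody_tri (hB : 1000 * (I.n + 1) ≤ C.B) (he : Env I.env τ.n)
    (h3 : τ.n 3 = b) (hb : b < I.NB) (hl : Nums τ.mem (3 * I.Z) (2 * I.n) I.lev)
    (hs : ∀ q < 2 * (I.K + 1), τ.mem (7 * I.Z + (q * I.NB + b)) =
      .num (∑ c ∈ Finset.range (q * I.NB + b), I.cnt c))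
    (hR : ∀ c < 5 * I.Z, c ∈ R) {W : Set ℕ} (hW : I.col 7 b ⊆ W) (hWR : W ⊆ R)
    (hW' : ∀ j < 2 * I.n, j / (I.K + 1) = b → 8 * I.Z + I.pos j ∈ W) :
    Tri C placeBody R W ((I.K + 1) * 200) ((I.K + 1) * 200) τ fun τ' =>
      ∀ j < 2 * I.n, j / (I.K + 1) = b → τ'.mem (8 * I.Z + I.pos j) = .num j := by
  have hB1 := C.one_lt_B
  have hZ : I.Z = 16 * I.n + 8 := rfl
  have hM := I.M_le
  have h1 := I.pow_le
  have hK : I.K + 1 ≤ 2 ^ I.K := Nat.lt_two_pow_self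
  have hNB : I.NB ≠ 0 := by omega
  have hc3 : placeStep.len + ((Cond.le (V 5 + 1) (V 6)).code.length + 2) = 47 := by decide
  have hc4 : (Cond.le (V 5 + 1) (V 6)).code.length + 2 = 7 := by decide
  refine (Tri.seq (Q := fun ρ' => ρ'.mem = τ.mem ∧ Env I.env ρ'.n ∧ ρ'.n 3 = b ∧ ρ'.n 5 = b * (I.K + 1) ∧
    ρ'.n 6 = min ((b + 1) * (I.K + 1)) (2 * I.n)) ((Tri.basic (wp_blockInit hB he h3 hb
    fun ρ' f1 f2 f3 f4 f5 => ⟨f1, f2, f3, f4, f5⟩)).conseq (T' := 25) (D' := 25) (by decide) (by decide)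
    fun _ h _ _ _ => h) ?_ (T₂ := ∑ i ∈ Finset.range (I.K + 1), 47 + 7)
    (D₂ := ∑ i ∈ Finset.range (I.K + 1), 47 + 7)).conseq ?_ ?_ fun _ h _ _ _ => h
  rotate_left
  · simp
    omega
  · simp
    omega
  rintro ρ' ⟨f1, f2, f3, f4, f5⟩ - - -
  have hbl := Ints.block_le hb
  have e : (b + 1) * (I.K + 1) = b * (I.K + 1) + (I.K + 1) := Nat.succ_mul ..
  obtain ⟨k, hk, hk'⟩ : ∃ k, b * (I.K + 1) + k = min ((b + 1) * (I.K + 1)) (2 * I.n) ∧ k ≤ I.K + 1 :=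
    ⟨min ((b + 1) * (I.K + 1)) (2 * I.n) - b * (I.K + 1), by omega, by omega⟩
  have hw := Tri.loop (C := C) (R := R) (W := W) (b := .le (V 5 + 1) (V 6)) (c := placeStep)
    (σ := ρ') (Q := fun τ' =>
      ∀ j < 2 * I.n, j / (I.K + 1) = b → τ'.mem (8 * I.Z + I.pos j) = .num j)
    (fun k ρ => b * (I.K + 1) ≤ ρ.n 5 ∧ ρ.n 5 + k = min ((b + 1) * (I.K + 1)) (2 * I.n) ∧
      ρ.n 6 = min ((b + 1) * (I.K + 1)) (2 * I.n) ∧ Env I.env ρ.n ∧ ρ.n 3 = b ∧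
      (∀ q < 2 * (I.K + 1), ρ.mem (7 * I.Z + (q * I.NB + b)) =
        .num (∑ c ∈ Finset.range (q * I.NB + b), I.cnt c + I.blk q b (ρ.n 5))) ∧
      (∀ j, b * (I.K + 1) ≤ j → j < ρ.n 5 → ρ.mem (8 * I.Z + I.pos j) = .num j) ∧
      ∀ c < 5 * I.Z, ρ.mem c = τ.mem c) (fun _ => placeStep.len) (fun _ => placeStep.len) ?_ ?_ ?_ ?_ k ?_
  · refine hw.conseq ?_ ?_ fun _ h _ _ _ => h <;>
    · rw [hc3, hc4]
      simp only [Finset.sum_const, Finset.card_range, smul_eq_mul]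
      omega
  · rintro k ρ ⟨g0, g1, g2, -⟩
    simp [Cond.Ok, g2]
    omega
  · rintro k ρ ⟨g0, g1, g2, ge, g3, g4, g6, g5⟩ -
    obtain ⟨-, -, -, h23, h24, h25, h26, -⟩ := Ints.env_facts ge
    have hj : ρ.n 5 < 2 * I.n := by omega
    have hjb : ρ.n 5 / (I.K + 1) = b := Ints.mem_block.2 (by omega)
    have hq := Ints.lev_lt hj
    have hlt := Ints.idx_lt hq hb
    have v1 : ρ.mem (3 * I.Z + ρ.n 5) = .num (I.lev (ρ.n 5)) := by rw [g5 _ (by omega), hl _ hj]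
    have v2 := g4 _ hq
    have hpos := Ints.pos_eq hj
    rw [Ints.code, hjb] at hpos
    rw [← hpos] at v2
    have hpl := Ints.pos_lt hj
    refine Tri.basic ?_
    have w1 := hW ⟨_, hq, rfl⟩
    have w2 := hW' _ hj hjb
    have r1 := hR (3 * I.Z + ρ.n 5) (by omega)
    have r2 := hWR w1
    simp [placeStep, wp, h23, h26, g3, v1, v2, hNB, w1, w2, r1, r2]
    refine ⟨by omega, by omega, by omega, by omega, by omega, by omega, by omega, by omega, g2,
      ((ge.setN (by simp)).setN (by simp)).setN (by simp), fun q hq' => ?_, fun j hj1 hj2 => ?_, fun c hc => ?_⟩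
    · have := Ints.idx_lt hq' hb
      rw [Ints.blk_succ g0, if_neg (show 7 * I.Z + (q * I.NB + b) ≠ 8 * I.Z + I.pos (ρ.n 5) by omega)]
      split_ifs with h h' h'
      · rw [h, hpos]
        rfl
      · exact absurd h.symm h'
      · exact absurd h'.symm h
      · exact g4 q hq'
    · rw [if_neg (by omega)]
      split_ifs with h
      · rw [Ints.pos_inj (by omega) hj h]
      · refine g6 j hj1 (lt_of_le_of_ne (by omega) ?_)
        rintro rfl
        exact h rfl
    · rw [if_neg (by omega), if_neg (by omega), g5 c hc]
  · rintro ρ ⟨g0, g1, g2, -⟩ h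
    simp [Cond.Holds, g2] at h
    omega
  · rintro k ρ ⟨g0, g1, g2, ge, g3, g4, g6, g5⟩ h j hj hjb
    simp [Cond.Holds, g2] at h
    rw [Ints.mem_block] at hjb
    exact g6 j hjb.1 (by omega)
  · refine ⟨f4.ge, by rw [f4, hk], f5, f2, f3, fun q hq => ?_, fun j h1 h2 => by omega,
      fun c hc => by rw [f1]⟩
    rw [f1, hs q hq, f4, Ints.blk_zero _ _ le_rfl, Nat.add_zero]

/-- Cells written for position `p`. -/
def Ints.boundCells (I : Ints α) (p : ℕ) : Set ℕ :=
  {c | c = 9 * I.Z + I.grp (I.out p) ∧ I.start (I.grp (I.out p)) = p ∨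
    c = 10 * I.Z + I.grp (I.out p) ∧ I.finish (I.grp (I.out p)) = p + 1}

def Ints.Bound (I : Ints α) (p : ℕ) (m : Mem α) : Prop :=
  (I.start (I.grp (I.out p)) = p → m (9 * I.Z + I.grp (I.out p)) = .num p) ∧
  (I.finish (I.grp (I.out p)) = p + 1 → m (10 * I.Z + I.grp (I.out p)) = .num (p + 1))

theorem wp_edge {W : Set ℕ} {g k w v : ℕ} {Q : St α → Prop} (hB : 1000 * (I.n + 1) ≤ C.B)
    (h23 : τ.n 23 = I.Z) (h6 : τ.n 6 = g) (h9 : τ.n 9 = k) (h10 : τ.n 10 = w) (h11 : τ.n 11 = v)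
    (hg2 : 2 ≤ g) (hgn : g < 8 * I.n + 4) (hk : k ≤ 2 * I.n) (hw : w ≤ 10 * I.Z)
    (ho : Nums τ.mem (8 * I.Z) (2 * I.n) I.out)
    (hg : Nums τ.mem (4 * I.Z) (2 * I.n) I.grp) (hR : ∀ c < 9 * I.Z, c ∈ R)
    (hW : k = 0 ∨ I.grp (I.out (k - 1)) ≠ g → w + g ∈ W)
    (hQ : ∀ τ' : St α, (∀ x, x ≠ 7 → x ≠ 8 → τ'.n x = τ.n x) →
      (∀ c, c ≠ w + g → τ'.mem c = τ.mem c) →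
      (k = 0 ∨ I.grp (I.out (k - 1)) ≠ g → τ'.mem (w + g) = .num v) →
      (¬ (k = 0 ∨ I.grp (I.out (k - 1)) ≠ g) → τ'.mem (w + g) = τ.mem (w + g)) → Q τ') :
    wp C.B R W edge Q τ := by
  have hB1 := C.one_lt_B
  have hZ : I.Z = 16 * I.n + 8 := rfl
  have h1 := I.pow_le
  have hout : ∀ q < 2 * I.n, I.out q < 2 * I.n := fun q hq => (Ints.out_spec hq).1
  have hgrp : ∀ q < 2 * I.n, 2 ≤ I.grp (I.out q) ∧ I.grp (I.out q) < 8 * I.n + 4 := fun q hq => by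
    have := Ints.grp_lt (hout q hq)
    omega
  have hx : ∀ h, h < 8 * I.n + 4 → g ^^^ h < C.B := fun h hh => by
    have h2 : g < 2 ^ Nat.size (8 * I.n + 4) := hgn.trans (Nat.lt_size_self _)
    have h3 : h < 2 ^ Nat.size (8 * I.n + 4) := hh.trans (Nat.lt_size_self _)
    refine (Nat.xor_lt_two_pow h2 h3).trans_le ?_
    have h4 : 2 ^ (Nat.size (8 * I.n + 4) - 1) ≤ 8 * I.n + 4 :=
      Nat.lt_size.1 (Nat.sub_lt (Nat.size_pos.2 (by omega)) one_pos)
    have h5 : 2 ^ Nat.size (8 * I.n + 4) = 2 * 2 ^ (Nat.size (8 * I.n + 4) - 1) := by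
      rw [← pow_succ', Nat.sub_add_cancel (Nat.size_pos.2 (by omega))]
    omega
  have fin : ∀ (ρ : St α) (h : ℕ), h < 8 * I.n + 4 → ρ.n 6 = g → ρ.n 8 = h → ρ.n 10 = w → ρ.n 11 = v →
      (h ≠ g ↔ k = 0 ∨ I.grp (I.out (k - 1)) ≠ g) → (∀ x, x ≠ 7 → x ≠ 8 → ρ.n x = τ.n x) →
      ρ.mem = τ.mem → wp C.B R W (.ite (.le (.bin .xor (V 6) (V 8)) 0) .skip (.store (V 10 + V 6) (V 11))) Q ρ := by
    intro ρ h hh r6 r8 r10 r11 hiff hn hm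
    simp [wp, r6, r8, r10, r11, Op.ideal, Op.Dom]
    refine ⟨hx h hh, by omega, fun e => ?_, fun e => ⟨by omega, ?_⟩⟩
    · have hno : ¬ (k = 0 ∨ I.grp (I.out (k - 1)) ≠ g) := fun h' => hiff.2 h' e.symm
      exact hQ _ hn (fun c _ => by rw [hm]) (fun h' => absurd h' hno) fun _ => by rw [hm]
    · have hyes : k = 0 ∨ I.grp (I.out (k - 1)) ≠ g := hiff.1 fun h' => by simp [h'] at e
      refine ⟨hW hyes, hQ _ hn (fun c hc => ?_) (fun _ => by simp) fun h' => absurd hyes h'⟩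
      rw [St.store_mem, if_neg hc, hm]
  unfold edge
  generalize Cmd.ite (.le (.bin .xor (V 6) (V 8)) 0) .skip (.store (V 10 + V 6) (V 11)) = last at *
  rcases Nat.eq_zero_or_pos k with rfl | hk0
  · simp only [wp]
    simp only [Expr.ok_ofNat, Expr.ok_var, Expr.eval_var, Expr.eval_ofNat, St.setN_n, h9]
    refine ⟨by omega, trivial, by omega, fun _ => fin _ 0 (by omega) ?_ ?_ ?_ ?_ (by simp; omega) ?_ rfl,
      fun h => by simp at h⟩
    · simpa using h6
    · simp
    · simpa using h10
    · simpa using h11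
    · intro x _ h8
      simp [h8]
  · have g1 := hgrp (k - 1) (by omega)
    have o1 := hout (k - 1) (by omega)
    have v1 := ho (k - 1) (by omega)
    have v2 := hg _ o1
    have r1 := hR (8 * I.Z + (k - 1)) (by omega)
    have r2 := hR (4 * I.Z + I.out (k - 1)) (by omega)
    simp [wp, h9, h23, v1, v2, r1, r2]
    refine ⟨by omega, fun h => by omega, fun _ => ⟨by omega, by omega, fin _ (I.grp (I.out (k - 1))) g1.2
      ?_ ?_ ?_ ?_ (by omega) ?_ rfl⟩⟩
    · simpa using h6
    · simp
    · simpa using h10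
    · simpa using h11
    · intro x h7 h8
      simp [h7, h8]

theorem boundBody_tri {p : ℕ} (hB : 1000 * (I.n + 1) ≤ C.B) (he : Env I.env τ.n)
    (h3 : τ.n 3 = p) (hp : p < 2 * I.n) (ho : Nums τ.mem (8 * I.Z) (2 * I.n) I.out)
    (hg : Nums τ.mem (4 * I.Z) (2 * I.n) I.grp) (hR : ∀ c < 9 * I.Z, c ∈ R) :
    Tri C boundBody R (I.boundCells p) 200 200 τ fun τ' => I.Bound p τ'.mem := by
  have hB1 := C.one_lt_B
  have hZ : I.Z = 16 * I.n + 8 := rfl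
  have h1 := I.pow_le
  obtain ⟨-, -, -, h23, h24, -⟩ := Ints.env_facts he
  have hout : ∀ q < 2 * I.n, I.out q < 2 * I.n := fun q hq => (Ints.out_spec hq).1
  have hgrp : ∀ q < 2 * I.n, 2 ≤ I.grp (I.out q) ∧ I.grp (I.out q) < 8 * I.n + 4 := fun q hq => by
    have := Ints.grp_lt (hout q hq)
    omega
  have g0 := hgrp p hp
  have o0 := hout p hp
  have v1 := ho p hp
  have v2 := hg _ o0
  have hm := Ints.mem_group (I := I) (g := I.grp (I.out p)) (p := p)
  have hm1 := Ints.mem_group (I := I) (g := I.grp (I.out p)) (p := p - 1)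
  have hm2 := Ints.mem_group (I := I) (g := I.grp (I.out p)) (p := p + 1)
  have hst : I.start (I.grp (I.out p)) = p ↔ p = 0 ∨ I.grp (I.out (p - 1)) ≠ I.grp (I.out p) := by omega
  have hsp := Ints.finish_le (I := I) (I.grp (I.out p))
  have hen : I.finish (I.grp (I.out p)) = p + 1 ↔ 2 * I.n ≤ p + 1 ∨
      I.grp (I.out (p + 1)) ≠ I.grp (I.out p) := by omega
  have w1 : I.start (I.grp (I.out p)) = p → 9 * I.Z + I.grp (I.out p) ∈ I.boundCells p :=
    fun h => Or.inl ⟨rfl, h⟩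
  have w2 : I.finish (I.grp (I.out p)) = p + 1 → 10 * I.Z + I.grp (I.out p) ∈ I.boundCells p :=
    fun h => Or.inr ⟨rfl, h⟩
  refine (Tri.basic ?_).conseq (by decide) (by decide) fun _ h _ _ _ => h
  simp only [boundBody, wp]
  simp [h3, h23, h24, v1, v2]
  refine ⟨by omega, hR _ (by omega), by omega, hR _ (by omega), by omega, wp_edge hB ?_ ?_ ?_ ?_ ?_ g0.1
    g0.2 (k := p) (by omega) (w := 9 * I.Z) (v := p) (by omega) ho hg hR (fun h => w1 (hst.2 h)) ?_⟩
  · simpa using h23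
  · simp
  · simp
  · simp
  · simp
  intro ρ hn hc hy _
  simp only [St.setN_mem] at hc
  have n3 : ρ.n 3 = p := by rw [hn 3 (by simp) (by simp)]; simpa using h3
  have n6 : ρ.n 6 = I.grp (I.out p) := by rw [hn 6 (by simp) (by simp)]; simp
  have n23 : ρ.n 23 = I.Z := by rw [hn 23 (by simp) (by simp)]; simpa using h23
  have n24 : ρ.n 24 = 2 * I.n := by rw [hn 24 (by simp) (by simp)]; simpa using h24
  have ho' : Nums ρ.mem (8 * I.Z) (2 * I.n) I.out := ho.congr fun c _ _ => hc c (by omega)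
  have hg' : Nums ρ.mem (4 * I.Z) (2 * I.n) I.grp := hg.congr fun c _ _ => hc c (by omega)
  have fin : ∀ τ' : St α, (∀ c, c ≠ 10 * I.Z + I.grp (I.out p) → τ'.mem c = ρ.mem c) →
      (I.finish (I.grp (I.out p)) = p + 1 → τ'.mem (10 * I.Z + I.grp (I.out p)) = .num (p + 1)) →
      I.Bound p τ'.mem := fun τ' k1 k2 =>
    ⟨fun h => by rw [k1 _ (by omega), hy (hst.1 h)], k2⟩
  simp only [n3, n23, n24]
  refine ⟨by omega, fun h => ⟨by omega, by omega, by omega, wp_edge hB ?_ ?_ ?_ ?_ ?_ g0.1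
    g0.2 (k := 0) (by omega) (w := 10 * I.Z) (v := p + 1) (by omega) ho' hg' hR
    (fun _ => w2 (hen.2 (Or.inl h))) ?_⟩, fun h => ⟨by omega, by omega, by omega, wp_edge hB ?_ ?_ ?_ ?_ ?_ g0.1
    g0.2 (k := p + 2) (by omega) (w := 10 * I.Z) (v := p + 1) (by omega) ho' hg' hR
    (fun h' => w2 (hen.2 (Or.inr (by simpa using h')))) ?_⟩⟩
  · simpa using n23
  · simpa using n6
  · simp
  · simp
  · simp
  · exact fun τ' _ k1 k2 _ => fin τ' k1 fun _ => k2 (Or.inl rfl)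
  · simpa using n23
  · simpa using n6
  · simp
  · simp
  · simp
  · exact fun τ' _ k1 k2 _ => fin τ' k1 fun h' => k2 (Or.inr ((hen.1 h').resolve_left (by omega)))

end


section
variable {α : Type u} [LinearOrder α] {C : Ctx} {I : Ints α} {p : ℕ} {σ : St α}

theorem Ints.NB_le : (I.K + 1) * I.NB ≤ 4 * I.n + 1 := by
  have h1 := I.M_le
  rw [M, Nat.mul_assoc] at h1
  omega

theorem Ints.NB_le' : I.NB ≤ 4 * I.n + 1 := (Nat.le_mul_of_pos_left _ (by omega)).trans I.NB_le

theorem countRun_tri (hp : C.Γ[p]? = some (rangeProc p proHalf countBody .skip))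
    (hB : 1000 * (I.n + 1) ≤ C.B) (he : Env I.env σ.n) (hl : Nums σ.mem (3 * I.Z) (2 * I.n) I.lev) :
    Tri C (parFor p 26) Set.univ {c | 5 * I.Z ≤ c ∧ c < 6 * I.Z}
      ((4 * I.n + 1) * 400 + 200) ((Nat.size (4 * I.n + 1) + 3) * ((I.K + 1) * 300)) σ
      fun σ' => Nums σ'.mem (5 * I.Z) I.M I.cnt := by
  have hZ : I.Z = 16 * I.n + 8 := rfl
  have hM := I.M_le
  have hNB := I.NB_le
  have hNB' := I.NB_le'
  have hcol : ∀ b < I.NB, ∀ c ∈ I.col 5 b, 5 * I.Z ≤ c ∧ c < 6 * I.Z := fun b hb c hc => by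
    have := Ints.col_subset hb hc
    omega
  refine (Tri.parFor hp (by decide) (by norm_num) (e := I.env)
    (fun b m => ∀ q < 2 * (I.K + 1), m (5 * I.Z + (q * I.NB + b)) = .num (I.cnt (q * I.NB + b)))
    (I.col 5) {c | 5 * I.Z ≤ c} (fun _ => (I.K + 1) * 200) ((I.K + 1) * 200) (by omega) ?_ ?_ ?_ he
    (N := I.NB) rfl ?_).mono ?_ ?_ subset_rfl ?_ ?_
  · intro i j hi hj hij
    rw [Set.disjoint_left]
    rintro c ⟨q, -, rfl⟩ ⟨q', -, h⟩
    exact hij ((Ints.idx_inj hi hj).1 (Nat.add_left_cancel h)).2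
  · exact fun i hi c hc => (hcol i hi c hc).1
  · rintro i hi m m' hm h q hq
    rw [hm _ ⟨q, hq, rfl⟩, h q hq]
  · intro b hb τ h3 hτ hm
    refine countBody_tri hB hτ h3 hb (fun i hi => ?_) (fun c hc => Or.inl ?_) Set.subset_union_right
    · rw [hm _ (Or.inl (by simp; omega)), hl i hi]
    · simpa using hc
  · simp only [Finset.sum_const, Finset.card_range, smul_eq_mul]
    have : I.NB * ((I.K + 1) * 200 + 104) ≤ ((I.K + 1) * I.NB) * 400 := by nlinarith
    refine (Nat.add_le_add_right this _).trans ?_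
    exact Nat.add_le_add_right (Nat.mul_le_mul_right _ hNB) _
  · refine Nat.mul_le_mul ?_ (by omega)
    have := Nat.size_le_size hNB'
    omega
  · rintro c ⟨i, h2, h3⟩
    exact hcol i h2 c h3
  · rintro σ' h - - - c hc
    obtain ⟨q, b, hq, hb, rfl⟩ := Ints.exists_idx hc
    exact h b hb q hq

theorem placeRun_tri (hp : C.Γ[p]? = some (rangeProc p proHalf placeBody .skip))
    (hB : 1000 * (I.n + 1) ≤ C.B) (he : Env I.env σ.n) (hl : Nums σ.mem (3 * I.Z) (2 * I.n) I.lev)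
    (hs : Nums σ.mem (7 * I.Z) I.M fun c => ∑ i ∈ Finset.range c, I.cnt i) :
    Tri C (parFor p 26) Set.univ {c | 7 * I.Z ≤ c ∧ c < 9 * I.Z}
      ((4 * I.n + 1) * 400 + 200) ((Nat.size (4 * I.n + 1) + 3) * ((I.K + 1) * 300)) σ
      fun σ' => Nums σ'.mem (8 * I.Z) (2 * I.n) I.out := by
  have hZ : I.Z = 16 * I.n + 8 := rfl
  have hM := I.M_le
  have hNB := I.NB_le
  have hNB' := I.NB_le'
  have hcell : ∀ b < I.NB, ∀ c ∈ I.col 7 b ∪ {c | ∃ j < 2 * I.n, j / (I.K + 1) = b ∧ c = 8 * I.Z + I.pos j},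
      7 * I.Z ≤ c ∧ c < 9 * I.Z := by
    rintro b hb c (hc | ⟨j, hj, -, rfl⟩)
    · have := Ints.col_subset hb hc
      omega
    · have := Ints.pos_lt hj
      omega
  refine (Tri.parFor hp (by decide) (by norm_num) (e := I.env)
    (fun b m => ∀ j < 2 * I.n, j / (I.K + 1) = b → m (8 * I.Z + I.pos j) = .num j)
    (fun b => I.col 7 b ∪ {c | ∃ j < 2 * I.n, j / (I.K + 1) = b ∧ c = 8 * I.Z + I.pos j})
    {c | 7 * I.Z ≤ c} (fun _ => (I.K + 1) * 200) ((I.K + 1) * 200) (by omega) ?_ ?_ ?_ he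
    (N := I.NB) rfl ?_).mono ?_ ?_ subset_rfl ?_ ?_
  · intro i j hi hj hij
    rw [Set.disjoint_left]
    rintro c (⟨q, hq, rfl⟩ | ⟨k, hk, hki, rfl⟩) (⟨q', hq', h⟩ | ⟨k', hk', hkj, h⟩)
    · exact hij ((Ints.idx_inj hi hj).1 (Nat.add_left_cancel h)).2
    · have := Ints.idx_lt hq hi
      omega
    · have := Ints.col_subset hj ⟨q', hq', h⟩
      omega
    · have := Ints.pos_inj hk hk' (by omega)
      rw [this] at hki
      omega
  · exact fun i hi c hc => (hcell i hi c hc).1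
  · rintro i hi m m' hm h j hj hji
    rw [hm _ (Or.inr ⟨j, hj, hji, rfl⟩), h j hj hji]
  · intro b hb τ h3 hτ hm
    refine placeBody_tri hB hτ h3 hb (fun i hi => ?_) (fun q hq => ?_) (fun c hc => Or.inl ?_)
      Set.subset_union_left Set.subset_union_right fun j hj hjb => Or.inr ⟨j, hj, hjb, rfl⟩
    · rw [hm _ (Or.inl (by simp; omega)), hl i hi]
    · rw [hm _ (Or.inr (Or.inl ⟨q, hq, rfl⟩)), hs _ (Ints.idx_lt hq hb)]
    · simp
      omega
  · simp only [Finset.sum_const, Finset.card_range, smul_eq_mul]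
    have : I.NB * ((I.K + 1) * 200 + 104) ≤ ((I.K + 1) * I.NB) * 400 := by nlinarith
    refine (Nat.add_le_add_right this _).trans ?_
    exact Nat.add_le_add_right (Nat.mul_le_mul_right _ hNB) _
  · refine Nat.mul_le_mul ?_ (by omega)
    have := Nat.size_le_size hNB'
    omega
  · rintro c ⟨i, h2, h3⟩
    exact hcell i h2 c h3
  · rintro σ' h - - - p hp
    obtain ⟨h1, h2⟩ := Ints.out_spec hp
    have := h _ (Ints.div_lt_NB h1) _ h1 rfl
    rwa [h2] at this

theorem boundRun_tri (hp : C.Γ[p]? = some (rangeProc p proHalf boundBody .skip))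
    (hB : 1000 * (I.n + 1) ≤ C.B) (he : Env I.env σ.n) (ho : Nums σ.mem (8 * I.Z) (2 * I.n) I.out)
    (hg : Nums σ.mem (4 * I.Z) (2 * I.n) I.grp)
    (hs : ∀ g, 2 ≤ g → g < 4 * 2 ^ I.K →
      σ.mem (9 * I.Z + g) = .num 0 ∧ σ.mem (10 * I.Z + g) = .num 0) :
    Tri C (parFor p 24) Set.univ {c | 9 * I.Z ≤ c ∧ c < 11 * I.Z}
      (2 * I.n * 400 + 700) ((Nat.size (2 * I.n) + 3) * 400) σ
      fun σ' => ∀ g, 2 ≤ g → g < 4 * 2 ^ I.K →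
        σ'.mem (9 * I.Z + g) = .num (I.start g) ∧ σ'.mem (10 * I.Z + g) = .num (I.finish g) := by
  have hZ : I.Z = 16 * I.n + 8 := rfl
  have hK := I.pow_le
  have hgrp : ∀ q < 2 * I.n, I.grp (I.out q) < 8 * I.n + 4 := fun q hq => by
    have := Ints.grp_lt (Ints.out_spec hq).1
    omega
  have hcell : ∀ i < 2 * I.n, ∀ c ∈ I.boundCells i, 9 * I.Z ≤ c ∧ c < 11 * I.Z := by
    rintro i hi c (⟨rfl, -⟩ | ⟨rfl, -⟩) <;>
    · have := hgrp i hi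
      omega
  refine (Tri.parFor hp (by decide) (by norm_num) (e := I.env) I.Bound I.boundCells
    {c | 9 * I.Z ≤ c} (fun _ => 200) 200 (by omega) ?_ ?_ ?_ he (N := 2 * I.n) rfl ?_).mono ?_ ?_
    subset_rfl ?_ ?_
  · intro i j hi hj hij
    have := hgrp i hi
    have := hgrp j hj
    rw [Set.disjoint_left]
    rintro c (⟨rfl, h1⟩ | ⟨rfl, h1⟩) (⟨h2, h3⟩ | ⟨h2, h3⟩)
    · rw [show I.grp (I.out i) = I.grp (I.out j) by omega] at h1
      omega
    · omega
    · omega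
    · rw [show I.grp (I.out i) = I.grp (I.out j) by omega] at h1
      omega
  · exact fun i hi c hc => (hcell i hi c hc).1
  · rintro i hi m m' hm ⟨h1, h2⟩
    exact ⟨fun h => by rw [hm _ (Or.inl ⟨rfl, h⟩), h1 h], fun h => by rw [hm _ (Or.inr ⟨rfl, h⟩), h2 h]⟩
  · intro i hi τ h3 hτ hm
    refine boundBody_tri hB hτ h3 hi (ho.congr fun c _ _ => hm c (Or.inl ?_))
      (hg.congr fun c _ _ => hm c (Or.inl ?_)) (fun c hc => Or.inl ?_)
    all_goals
      simp
      omega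
  · simp
    omega
  · exact Nat.mul_le_mul le_rfl (by norm_num)
  · rintro c ⟨i, h2, h3⟩
    exact hcell i h2 c h3
  · rintro σ' h - - hm g hg2 hgK
    by_cases hex : ∃ q, q < 2 * I.n ∧ I.grp (I.out q) = g
    · obtain ⟨q, hq⟩ := hex
      have h1 := Ints.mem_group.1 hq
      obtain ⟨a1, a2⟩ := Ints.mem_group.2 ⟨le_refl (I.start g), h1.1.trans_lt h1.2⟩
      obtain ⟨b1, b2⟩ := Ints.mem_group.2 (show I.start g ≤ I.finish g - 1 ∧ I.finish g - 1 < I.finish g by omega)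
      have ha := (h _ a1).1
      have hb := (h _ b1).2
      rw [a2] at ha
      rw [b2] at hb
      refine ⟨ha rfl, ?_⟩
      rw [hb (by omega)]
      congr 1
      omega
    · have h1 : I.start g = 0 := by
        rw [Ints.start, Set.eq_empty_of_forall_notMem
          (s := {p | p < 2 * I.n ∧ I.grp (I.out p) = g}) fun p hp => hex ⟨p, hp⟩]
        simp
      have h2 : I.finish g = 0 := by
        rw [Ints.finish, Finset.filter_eq_empty_iff.2 fun p hp hp' => hex ⟨p, by simpa using hp, hp'⟩]
        rfl
      rw [h1, h2]
      refine ⟨?_, ?_⟩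
      · rw [hm _ ?_]
        · exact (hs g hg2 hgK).1
        · rintro ⟨i, hi, ⟨h3, -⟩ | ⟨h3, -⟩⟩
          · exact hex ⟨i, hi, by omega⟩
          · have := hgrp i hi
            omega
      · rw [hm _ ?_]
        · exact (hs g hg2 hgK).2
        · rintro ⟨i, hi, ⟨h3, -⟩ | ⟨h3, -⟩⟩
          · have := hgrp i hi
            omega
          · exact hex ⟨i, hi, by omega⟩

end


/-! ## Inner trees -/

/-- Pointer to the root of the tree with node numbers in `[lo, hi)`. -/
def tptr (base lo hi : ℕ) : ℕ := if hi ≤ lo then 0 else base + 5 * ((lo + hi) / 2)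

/-- Stores in cell `d` the pointer to the root of the tree with node numbers from `a` to `b`, the
nodes of which are stored from `e` on. -/
def storeRoot (e d a b : Expr) : Cmd :=
  .ite (.le b a) (.store d 0) (.store d (e + 5 * ((a + b) / 2)))

/-- Writes the node number `V 3` of an inner tree. -/
def innerPre : Cmd :=
  .load 5 (8 * V 23 + V 3) ;; .load 6 (1 + V 24 + V 5) ;; .loadK 0 (1 + V 6) ;;
  .set 7 (12 * V 23 + 5 * V 3) ;; .set 8 (V 6 / 2) ;; .set 9 0 ;; .ite (.le (V 12) 1) (.set 9 1) .skip ;;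
  storeRoot (12 * V 23) (V 7) (V 1) (V 3) ;; storeRoot (12 * V 23) (V 7 + 1) (V 3 + 1) (V 2) ;;
  .storeK (V 7 + 2) 0 ;; .store (V 7 + 3) (V 8) ;; .store (V 7 + 4) (V 9)

def innerPro : Cmd :=
  .ite (.le (V 4) 1) (.set 2 (V 3)) (.set 1 (V 3 + 1)) ;; .set 12 (V 12 - 1)

def innerProc (p : ℕ) : Cmd := rangeProc p innerPro innerPre .skip

/-- Builds the inner tree for group `V 13` and stores the pointer to its root in cell `V 17`. -/
def innerRun (p : ℕ) : Cmd :=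
  .load 1 (9 * V 23 + V 13) ;; .load 2 (10 * V 23 + V 13) ;; .load 12 (V 23 + (V 2 - V 1 + 1)) ;;
  .set 12 (V 12 + 2) ;; storeRoot (12 * V 23) (V 17) (V 1) (V 2) ;; .set 3 (V 2) ;; .fork 4 p

/-- A range of positions and one plus the number of full levels of the tree. -/
structure INode where
  lo : ℕ
  hi : ℕ
  k : ℕ

namespace INode

def left (x : INode) : INode := ⟨x.lo, (x.lo + x.hi) / 2, x.k - 1⟩
def right (x : INode) : INode := ⟨(x.lo + x.hi) / 2 + 1, x.hi, x.k - 1⟩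

theorem isRange : IsRange INode.lo INode.hi INode.left INode.right :=
  ⟨fun _ => rfl, fun _ => rfl, fun _ => rfl, fun _ => rfl⟩

def Valid (x : INode) : Prop :=
  (x.k = 0 ∧ x.hi ≤ x.lo) ∨ (1 ≤ x.k ∧ 2 ^ x.k ≤ 2 * (x.hi - x.lo + 1) ∧ x.hi - x.lo + 1 ≤ 2 ^ x.k)

theorem Valid.one_le {x : INode} (h : x.Valid) (hlt : x.lo < x.hi) : 1 ≤ x.k := by
  rcases h with ⟨-, h⟩ | h
  · omega
  · exact h.1

theorem Valid.children {x : INode} (h : x.Valid) (hlt : x.lo < x.hi) : x.left.Valid ∧ x.right.Valid := by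
  rcases h with ⟨-, h⟩ | ⟨h1, h2, h3⟩
  · omega
  · obtain ⟨j, hj⟩ : ∃ j, x.k = j + 1 := ⟨x.k - 1, by omega⟩
    rw [hj, pow_succ'] at h2 h3
    simp only [Valid, left, right, hj, Nat.add_sub_cancel]
    rcases Nat.eq_zero_or_pos j with rfl | hj0
    · simp at h2 h3
      omega
    · obtain ⟨i, rfl⟩ : ∃ i, j = i + 1 := ⟨j - 1, by omega⟩
      rw [pow_succ'] at h2 h3 ⊢
      omega

end INode

section
variable {α : Type u} [LinearOrder α] {C : Ctx} {I : Ints α} {σ : St α}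

/-- The arrays that are used in the construction of the tree. -/
structure Ints.Ready (I : Ints α) (m : Mem α) : Prop where
  input : I.Input m
  log : ∀ x, 1 ≤ x → x < 2 * 2 ^ I.K → m (I.Z + x) = .num (Nat.log 2 x)
  out : Nums m (8 * I.Z) (2 * I.n) I.out
  start : ∀ g, 2 ≤ g → g < 4 * 2 ^ I.K → m (9 * I.Z + g) = .num (I.start g)
  finish : ∀ g, 2 ≤ g → g < 4 * 2 ^ I.K → m (10 * I.Z + g) = .num (I.finish g)

theorem Ints.Ready.congr {m m' : Mem α} (h : I.Ready m) (hm : ∀ c < 11 * I.Z, m' c = m c) : I.Ready m' := by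
  have hZ : I.Z = 16 * I.n + 8 := rfl
  have hK := I.pow_le
  exact ⟨h.input.congr fun c hc => hm c (by omega), fun x h1 h2 => by rw [hm _ (by omega), h.log x h1 h2],
    h.out.congr fun c _ _ => hm c (by omega), fun g h1 h2 => by rw [hm _ (by omega), h.start g h1 h2],
    fun g h1 h2 => by rw [hm _ (by omega), h.finish g h1 h2]⟩

theorem wp_storeRoot {R W : Set ℕ} {e d a b : Expr} {Q : St α → Prop}
    (he : (e + 5 * ((a + b) / 2)).Ok C.B σ.n) (hB : 0 < C.B) (hd : d.Ok C.B σ.n) (ha : a.Ok C.B σ.n)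
    (hb : b.Ok C.B σ.n) (hW : d.eval σ.n ∈ W)
    (hQ : Q (σ.store (d.eval σ.n) (.num (tptr (e.eval σ.n) (a.eval σ.n) (b.eval σ.n))))) :
    wp C.B R W (storeRoot e d a b) Q σ := by
  simp only [storeRoot, wp]
  refine ⟨hb, ha, fun h => ⟨hd, hB, hW, ?_⟩, fun h => ⟨hd, he, hW, ?_⟩⟩
  · rwa [tptr, if_pos h] at hQ
  · rw [tptr, if_neg (by omega)] at hQ
    simpa using hQ

/-- The cells of a node of an inner tree. -/
structure Ints.InnerAt (I : Ints α) (x : INode) (m : Mem α) : Prop where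
  left : m (12 * I.Z + 5 * ((x.lo + x.hi) / 2)) = .num (tptr (12 * I.Z) x.lo ((x.lo + x.hi) / 2))
  right : m (12 * I.Z + 5 * ((x.lo + x.hi) / 2) + 1) =
    .num (tptr (12 * I.Z) ((x.lo + x.hi) / 2 + 1) x.hi)
  key : m (12 * I.Z + 5 * ((x.lo + x.hi) / 2) + 2) = .key (I.rkey (I.out ((x.lo + x.hi) / 2)))
  idx : m (12 * I.Z + 5 * ((x.lo + x.hi) / 2) + 3) = .num (I.eid (I.out ((x.lo + x.hi) / 2)) / 2)
  red : m (12 * I.Z + 5 * ((x.lo + x.hi) / 2) + 4) = .num (if x.k ≤ 1 then 1 else 0)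

/-- The cells of the nodes of inner trees with numbers in `[lo, hi)`. -/
def Ints.innerCells (I : Ints α) (lo hi : ℕ) : Set ℕ := {c | 12 * I.Z + 5 * lo ≤ c ∧ c < 12 * I.Z + 5 * hi}

/-- An inner tree is stored for the positions in `[lo, hi)`. -/
def Ints.InnerDone (I : Ints α) (x : INode) (m : Mem α) : Prop :=
  ∃ t F cl, Stored m (innerLabelAt m) (tptr (12 * I.Z) x.lo x.hi) t F ∧ F ⊆ I.innerCells x.lo x.hi ∧
    RedBlackAux t cl (x.k - 1) ∧ (2 ≤ x.k ∨ x.hi ≤ x.lo → cl = false) ∧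
    t.toList.map (fun v => (v.idx, v.key)) =
      (List.range' x.lo (x.hi - x.lo)).map fun p => (I.eid (I.out p) / 2, I.rkey (I.out p))

theorem Ints.InnerDone.of_treeAll {x : INode} {m : Mem α} (hv : x.Valid)
    (h : TreeAll INode.lo INode.hi INode.left INode.right (I.InnerAt · m) x) : I.InnerDone x m := by
  have hZ : I.Z = 16 * I.n + 8 := rfl
  induction h with
  | @empty x h =>
    have hk : x.k - 1 = 0 := by
      rcases hv with ⟨h1, -⟩ | ⟨h1, h2, -⟩
      · omega
      · have h3 : 2 ^ x.k ≤ 2 ^ 1 := by omega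
        have := (Nat.pow_le_pow_iff_right (by norm_num)).1 h3
        omega
    refine ⟨.nil, ∅, false, ?_, by simp, ?_, fun _ => rfl, ?_⟩
    · rw [tptr, if_pos h]
      exact .nil
    · rw [hk]
      exact .nil
    · simp [BTree.toList, show x.hi - x.lo = 0 by omega]
  | @node x hlt hx _ _ ihl ihr =>
    obtain ⟨vl, vr⟩ := hv.children hlt
    obtain ⟨tl, Fl, cl, sl, fl, rl, el, pl⟩ := ihl vl
    obtain ⟨tr, Fr, cr, sr, fr, rr, er, pr⟩ := ihr vr
    have hk := hv.one_le hlt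
    obtain ⟨M, hM⟩ : ∃ M, (x.lo + x.hi) / 2 = M := ⟨_, rfl⟩
    have hlo : x.lo ≤ M ∧ M < x.hi := by omega
    have h1 := hx.left
    have h2 := hx.right
    have h3 := hx.key
    have h4 := hx.idx
    have h5 := hx.red
    simp only [INode.left, INode.right, hM] at fl fr rl rr el er pl pr sl sr h1 h2 h3 h4 h5
    have dl : ∀ j < 5, 12 * I.Z + 5 * M + j ∉ Fl := fun j hj hc => by
      have := fl hc
      simp only [innerCells, Set.mem_ofPred_eq] at this
      omega
    have dr : ∀ j < 5, 12 * I.Z + 5 * M + j ∉ Fr := fun j hj hc => by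
      have := fr hc
      simp only [innerCells, Set.mem_ofPred_eq] at this
      omega
    refine ⟨.node ⟨decide (x.k ≤ 1), I.rkey (I.out M), I.eid (I.out M) / 2⟩ tl tr,
      {12 * I.Z + 5 * M, 12 * I.Z + 5 * M + 1} ∪
        {12 * I.Z + 5 * M + 2, 12 * I.Z + 5 * M + 2 + 1, 12 * I.Z + 5 * M + 2 + 2} ∪ Fl ∪ Fr,
      decide (x.k ≤ 1), ?_, ?_, ?_, ?_, ?_⟩
    · rw [tptr, if_neg (by omega), hM]
      refine .node (G := {12 * I.Z + 5 * M + 2, 12 * I.Z + 5 * M + 2 + 1, 12 * I.Z + 5 * M + 2 + 2})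
        (by omega) h1 h2 ⟨h3, h4, ?_, rfl⟩ sl sr ?_ ?_ ?_
      · rw [Nat.add_assoc, h5]
        simp
      · rw [Set.disjoint_left]
        simp
        omega
      · rw [Set.disjoint_left]
        rintro c hc
        simp only [Set.mem_union, Set.mem_insert_iff, Set.mem_singleton_iff] at hc
        obtain ⟨j, hj, rfl⟩ : ∃ j < 5, c = 12 * I.Z + 5 * M + j :=
          ⟨c - (12 * I.Z + 5 * M), by omega, by omega⟩
        exact dl j hj
      · rw [Set.disjoint_left]
        rintro c (hc | hc)
        · simp only [Set.mem_union, Set.mem_insert_iff, Set.mem_singleton_iff] at hc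
          obtain ⟨j, hj, rfl⟩ : ∃ j < 5, c = 12 * I.Z + 5 * M + j :=
            ⟨c - (12 * I.Z + 5 * M), by omega, by omega⟩
          exact dr j hj
        · intro hc'
          have := fl hc
          have := fr hc'
          simp only [innerCells, Set.mem_ofPred_eq] at *
          omega
    · rintro c ((hc | hc) | hc)
      · simp only [Set.mem_union, Set.mem_insert_iff, Set.mem_singleton_iff, innerCells, Set.mem_ofPred_eq] at *
        omega
      · have := fl hc
        simp only [innerCells, Set.mem_ofPred_eq] at *
        omega
      · have := fr hc
        simp only [innerCells, Set.mem_ofPred_eq] at *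
        omega
    · by_cases h : x.k ≤ 1
      · have hs : x.hi = x.lo + 1 := by
          rcases hv with ⟨h1, -⟩ | ⟨-, -, h3⟩
          · omega
          · rw [show x.k = 1 by omega] at h3
            omega
        rw [el (Or.inr (by omega))] at rl
        rw [er (Or.inr (by omega))] at rr
        rw [decide_eq_true h, show x.k - 1 = 0 by omega]
        rw [show x.k - 1 - 1 = 0 by omega] at rl rr
        exact .red rfl rl rr
      · rw [decide_eq_false h, show x.k - 1 = x.k - 1 - 1 + 1 by omega]
        exact .black rfl rl rr
    · rintro (h | h)
      · simp
        omega
      · omega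
    · rw [BTree.toList, List.map_append, List.map_cons, pl, pr]
      have e : List.range' x.lo (x.hi - x.lo) = List.range' x.lo (M - x.lo) ++ M :: List.range' (M + 1) (x.hi - (M + 1)) := by
        rw [show x.hi - x.lo = (M - x.lo) + (x.hi - (M + 1) + 1) by omega, ← List.range'_append_1, List.range'_succ,
          show x.lo + (M - x.lo) = M by omega]
      rw [e, List.map_append, List.map_cons]

/-- Precondition of a call. -/
structure InnerCall (I : Ints α) (x : INode) (ν : ℕ → ℕ) : Prop where
  h1 : ν 1 = x.lo
  h2 : ν 2 = x.hi
  lo_le : x.lo ≤ 2 * I.n + 1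
  hi_le : x.hi ≤ 2 * I.n
  env : Env I.env ν
  h12 : x.lo < x.hi → ν 12 = x.k ∧ x.Valid

theorem innerPre_wp {R W : Set ℕ} (hB : 1000 * (I.n + 1) ≤ C.B) {x : INode}
    (h : InnerCall I x σ.n) (hlt : x.lo < x.hi) (h3 : σ.n 3 = (x.lo + x.hi) / 2) (hr : I.Ready σ.mem)
    (hR : ∀ c < 11 * I.Z, c ∈ R) (hW : ∀ j < 5, 12 * I.Z + 5 * ((x.lo + x.hi) / 2) + j ∈ W) :
    wp C.B R W innerPre (fun σ' => I.InnerAt x σ'.mem) σ := by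
  have hB1 := C.one_lt_B
  have hZ : I.Z = 16 * I.n + 8 := rfl
  obtain ⟨-, -, -, h23, h24, -⟩ := Ints.env_facts h.env
  have hb := h.hi_le
  obtain ⟨k1, k2⟩ := h.h12 hlt
  have f1 := h.h1
  have f2 := h.h2
  obtain ⟨M, hM⟩ : ∃ M, (x.lo + x.hi) / 2 = M := ⟨_, rfl⟩
  have hlo : x.lo ≤ M ∧ M < x.hi := by omega
  rw [hM] at h3 hW
  have ho := (Ints.out_spec (I := I) (p := M) (by omega)).1
  have he := I.eid_lt _ ho
  have m1 := hr.out M (by omega)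
  have m2 := hr.input.eid _ ho
  have m3 := hr.input.key _ he
  have w0 := hW 0 (by omega)
  have w1 := hW 1 (by omega)
  have w2 := hW 2 (by omega)
  have w3 := hW 3 (by omega)
  have w4 := hW 4 (by omega)
  have r1 := hR (8 * I.Z + M) (by omega)
  have r2 := hR (1 + 2 * I.n + I.out M) (by omega)
  have r3 := hR (1 + I.eid (I.out M)) (by omega)
  have key : I.rkey (I.out M) = I.key (I.eid (I.out M)) := rfl
  have fin : ∀ τ : St α, τ.n 1 = x.lo → τ.n 2 = x.hi → τ.n 3 = M → τ.n 7 = 12 * I.Z + 5 * M → τ.n 23 = I.Z →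
      τ.n 8 = I.eid (I.out M) / 2 → τ.n 9 = (if x.k ≤ 1 then 1 else 0) → τ.k 0 = .key (I.rkey (I.out M)) →
      wp C.B R W (storeRoot (12 * V 23) (V 7) (V 1) (V 3) ;; storeRoot (12 * V 23) (V 7 + 1) (V 3 + 1) (V 2) ;;
        .storeK (V 7 + 2) 0 ;; .store (V 7 + 3) (V 8) ;; .store (V 7 + 4) (V 9))
        (fun σ' => I.InnerAt x σ'.mem) τ := by
    intro τ g1 g2 g3 g7 g23 g8 g9 g0
    have hk : (if x.k ≤ 1 then 1 else 0) < C.B := by split_ifs <;> omega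
    generalize hkk : (if x.k ≤ 1 then 1 else 0) = kk at hk g9
    refine wp_storeRoot ?_ (by omega) ?_ ?_ ?_ ?_ (wp_storeRoot ?_ (by omega) ?_ ?_ ?_ ?_ ?_)
    all_goals try simp [g1, g2, g3, g7, g23]
    all_goals try first | omega | exact w0 | exact w1
    simp [wp, g1, g2, g3, g7, g8, g9, g23, w2, w3, w4]
    refine ⟨by omega, by omega, by omega, ⟨?_, ?_, ?_, ?_, ?_⟩⟩ <;> simp [hM, g0, hkk]
  unfold innerPre
  generalize (storeRoot (12 * V 23) (V 7) (V 1) (V 3) ;; _ : Cmd) = last at fin ⊢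
  simp [wp, h23, h24, h3, m1, m2, m3, r1, r2, r3, k1]
  refine ⟨by omega, by omega, by omega, by omega, by omega, by omega, hB1,
    fun hk => ⟨hB1, fin _ ?_ ?_ ?_ ?_ ?_ ?_ ?_ ?_⟩, fun hk => fin _ ?_ ?_ ?_ ?_ ?_ ?_ ?_ ?_⟩
  all_goals simp [f1, f2, h3, h23, key]
  · exact hk
  · exact hk

/-- Number of levels of the tree on `s` keys, plus one. -/
def levels (s : ℕ) : ℕ := Nat.log 2 (s + 1) + 1

theorem INode.valid_levels (a b : ℕ) : INode.Valid ⟨a, b, levels (b - a)⟩ := by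
  right
  have h1 := Nat.lt_pow_succ_log_self (b := 2) (by norm_num) (b - a + 1)
  have h2 := Nat.pow_log_le_self 2 (x := b - a + 1) (by omega)
  simp only [levels]
  rw [pow_succ'] at h1 ⊢
  omega

theorem innerRun_tri {p : ℕ} (hp : C.Γ[p]? = some (innerProc p)) (hB : 1000 * (I.n + 1) ≤ C.B)
    {g d : ℕ} (he : Env I.env σ.n) (h13 : σ.n 13 = g) (h17 : σ.n 17 = d) (hr : I.Ready σ.mem)
    (hg : 2 ≤ g) (hg' : g < 4 * 2 ^ I.K) (hd : 11 * I.Z ≤ d) (hd' : d < 12 * I.Z) :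
    Tri C (innerRun p) ({c | c < 11 * I.Z} ∪ ({d} ∪ I.innerCells (I.start g) (I.finish g)))
      ({d} ∪ I.innerCells (I.start g) (I.finish g))
      ((I.finish g - I.start g) * 221 + 300) ((Nat.size (I.finish g - I.start g) + 2) * 161 + 120) σ
      fun σ' => σ'.mem d = .num (tptr (12 * I.Z) (I.start g) (I.finish g)) ∧
        I.InnerDone ⟨I.start g, I.finish g, levels (I.finish g - I.start g)⟩ σ'.mem := by
  have hB1 := C.one_lt_B
  have hZ : I.Z = 16 * I.n + 8 := rfl
  have hK2 := I.pow_le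
  obtain ⟨-, -, -, h23, h24, -, -, -, h28⟩ := Ints.env_facts he
  have hov : overhead innerPro .skip = 60 := by decide
  have hlen : innerPre.len = 101 := by decide
  have hv := INode.valid_levels (I.start g) (I.finish g)
  have m1 := hr.start g hg hg'
  have m2 := hr.finish g hg hg'
  have hse := I.start_le_finish g
  have hst := I.finish_le g
  obtain ⟨a, ha⟩ : ∃ a, I.start g = a := ⟨_, rfl⟩
  obtain ⟨b, hb⟩ : ∃ b, I.finish g = b := ⟨_, rfl⟩
  rw [ha, hb] at hv hse ⊢
  rw [ha] at m1
  rw [hb] at m2 hst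
  have m3 := hr.log (b - a + 1) (by omega) (by have := I.lt_pow; omega)
  have hlg : Nat.log 2 (b - a + 1) ≤ b - a + 1 := Nat.log_le_self ..
  unfold innerRun
  have r1 : 9 * I.Z + g < 11 * I.Z := by omega
  have r2 : 10 * I.Z + g < 11 * I.Z := by omega
  refine (Tri.seq (Q := fun τ => τ = σ.setN 1 a) (Tri.load (v := a) ?_ ?_ ?_ rfl) ?_
    (T₂ := 6 + (8 + (4 + (21 + (2 + ((b - a) * 221 + 180))))))
    (D₂ := 6 + (8 + (4 + (21 + (2 + ((Nat.size (b - a) + 2) * 161))))))).conseq ?_ ?_ fun _ h _ _ _ => h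
  · simp [h23, h13]; omega
  · left; simpa [h23, h13] using r1
  · simpa [h23, h13] using m1
  rotate_left
  · rw [show (Cmd.load 1 (9 * V 23 + V 13)).len = 6 by decide]
    omega
  · rw [show (Cmd.load 1 (9 * V 23 + V 13)).len = 6 by decide]
    exact (by omega : ∀ z, 6 + (6 + (8 + (4 + (21 + (2 + z))))) ≤ z + 120) _
  rintro _ rfl - - -
  refine Tri.seq (Q := fun τ => τ = (σ.setN 1 a).setN 2 b) (Tri.load (v := b) ?_ ?_ ?_ rfl) ?_
  · simp [h23, h13]; omega
  · left; simpa [h23, h13] using r2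
  · simpa [h23, h13] using m2
  rintro _ rfl - - -
  refine Tri.seq (Q := fun τ => τ = ((σ.setN 1 a).setN 2 b).setN 12 (Nat.log 2 (b - a + 1)))
    (Tri.load (v := Nat.log 2 (b - a + 1)) ?_ ?_ ?_ rfl) ?_
  · simp [h23]; omega
  · left; simp [h23]; omega
  · simpa [h23] using m3
  rintro _ rfl - - -
  obtain ⟨L, hL⟩ : ∃ L, Nat.log 2 (b - a + 1) = L := ⟨_, rfl⟩
  rw [hL] at hlg ⊢
  refine Tri.seq (Q := fun τ => τ = (((σ.setN 1 a).setN 2 b).setN 12 L).setN 12 (L + 2))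
    (Tri.set (by simp; omega) (by simp)) ?_
  rintro _ rfl - - -
  obtain ⟨σ₁, hσ₁⟩ : ∃ τ, (((σ.setN 1 a).setN 2 b).setN 12 L).setN 12 (L + 2) = τ := ⟨_, rfl⟩
  have e1 : σ₁.n 1 = a := by rw [← hσ₁]; simp
  have e2 : σ₁.n 2 = b := by rw [← hσ₁]; simp
  have e12 : σ₁.n 12 = L + 2 := by rw [← hσ₁]; simp
  have e17 : σ₁.n 17 = d := by rw [← hσ₁]; simpa using h17
  have e23 : σ₁.n 23 = I.Z := by rw [← hσ₁]; simpa using h23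
  have em : σ₁.mem = σ.mem := by rw [← hσ₁]; rfl
  have ee : Env I.env σ₁.n := by
    rw [← hσ₁]
    exact (((he.setN (by simp)).setN (by simp)).setN (by simp)).setN (by simp)
  rw [hσ₁]
  refine Tri.seq (Q := fun τ => τ = σ₁.store d (.num (tptr (12 * I.Z) a b)))
    (Tri.basic (wp_storeRoot ?_ (by omega) ?_ ?_ ?_ ?_ ?_)) ?_
  · simp [e23, e1, e2]; omega
  · simp
  · simp
  · simp
  · simp [e17]
  · simp [e17, e23, e1, e2]
  rintro _ rfl - - -
  refine Tri.seq (Q := fun τ => τ = (σ₁.store d (.num (tptr (12 * I.Z) a b))).setN 3 b)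
    (Tri.set (by simp) (by simp [e2])) ?_
  rintro _ rfl - - -
  have hcell : ∀ i c, (∃ j < 5, c = 12 * I.Z + 5 * i + j) → a ≤ i → i < b → c ∈ I.innerCells a b := by
    rintro i c ⟨j, hj, rfl⟩ h1 h2
    simp only [Ints.innerCells, Set.mem_ofPred_eq]
    omega
  have hreg : regionOf INode.lo INode.hi (fun i => {c | ∃ j < 5, c = 12 * I.Z + 5 * i + j}) ⟨a, b, L + 1⟩ ⊆
      I.innerCells a b := by
    rintro c ⟨i, h1, h2, h3⟩
    exact hcell i c h3 h1 h2
  refine ((Tri.rangeTree (C := C) (F := {c | 11 * I.Z ≤ c}) hp INode.isRange (fun x ν _ => InnerCall I x ν)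
    (fun x m => I.InnerAt x m)
    (fun i => {c | ∃ j < 5, c = 12 * I.Z + 5 * i + j}) (2 * I.n)
    (σ₁.store d (.num (tptr (12 * I.Z) a b))).mem (fun _ => 101) 101
    (by omega) ?_ ?_ ?_ ?_ ?_ ⟨a, b, L + 1⟩ ⟨b + 1, b, 0⟩
    ((σ₁.store d (.num (tptr (12 * I.Z) a b))).setN 3 b)
    ?_ ?_ (by simp) hst fun _ _ => rfl)).mono ?_ ?_ ?_ ?_ ?_
  · rintro x ν κ h
    exact ⟨h.h1, h.h2, h.lo_le, h.hi_le⟩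
  · intro i j hi hj hij
    rw [Set.disjoint_left]
    rintro c ⟨u, hu, rfl⟩ ⟨v, hv, h⟩
    omega
  · rintro i hi c ⟨u, hu, rfl⟩
    simp only [Set.mem_ofPred_eq]
    omega
  · rintro x m m' hlt hb hm h
    have q : ∀ j < 5, m' (12 * I.Z + 5 * ((x.lo + x.hi) / 2) + j) = m (12 * I.Z + 5 * ((x.lo + x.hi) / 2) + j) :=
      fun j hj => hm _ ⟨j, hj, rfl⟩
    exact ⟨(q 0 (by omega)).trans h.left, (q 1 (by omega)).trans h.right, (q 2 (by omega)).trans h.key,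
      (q 3 (by omega)).trans h.idx, (q 4 (by omega)).trans h.red⟩
  · intro x τ h hlt hm
    have hb := h.hi_le
    obtain ⟨k1, k2⟩ := h.h12 hlt
    have hk := k2.one_le hlt
    have hk' : x.k < C.B := by
      have := Nat.lt_two_pow_self (n := x.k)
      rcases k2 with k2 | k2 <;> omega
    have h' : InnerCall I x (τ.setN 3 ((x.lo + x.hi) / 2)).n :=
      ⟨by simpa using h.h1, by simpa using h.h2, h.lo_le, h.hi_le, h.env.setN (by simp),
        by simpa using h.h12⟩
    refine (Tri.basic (wp_frame (innerPre_wp hB h' hlt (by simp) ?_ ?_ fun j hj => ?_))).conseq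
      (T' := 101) (D' := 101) hlen.le hlen.le ?_
    · refine hr.congr fun c hc => ?_
      rw [St.setN_mem, hm c (Or.inl (by simp; omega)), St.store_mem, if_neg (by omega), em]
    · intro c hc
      left
      simpa using hc
    · exact ⟨j, hj, rfl⟩
    rintro τ' ⟨p1, -⟩ hn - -
    have f1 : τ'.n 1 = x.lo := by rw [hn 1 (by decide)]; simpa using h.h1
    have f2 : τ'.n 2 = x.hi := by rw [hn 2 (by decide)]; simpa using h.h2
    have f3 : τ'.n 3 = (x.lo + x.hi) / 2 := by rw [hn 3 (by decide)]; simp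
    have f12 : τ'.n 12 = x.k := by rw [hn 12 (by decide)]; simpa using k1
    have ee : Env I.env τ'.n := (h.env.setN (x := 3) (v := (x.lo + x.hi) / 2) (by simp)).frame hn (by decide)
    obtain ⟨v1, v2⟩ := k2.children hlt
    have hle := h.lo_le
    refine ⟨?_, ?_, p1⟩
    · simp [innerPro, wp, f3, f12]
      refine ⟨by omega, by omega, ⟨f1, by simp [INode.left], h.lo_le, by simp only [INode.left]; omega,
          ?_, fun _ => ⟨by simp [INode.left], v1⟩⟩⟩
      exact ((ee.setN (by simp)).setN (by simp)).setN (by simp)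
    · simp [innerPro, wp, f3, f12]
      refine ⟨by omega, by omega, by omega, ⟨by simp [INode.right], f2,
        by simp only [INode.right]; omega, h.hi_le, ?_, fun _ => ⟨by simp [INode.right], v2⟩⟩⟩
      exact ((ee.setN (by simp)).setN (by simp)).setN (by simp)
  · simp [innerPro, wp, e12]
    refine ⟨by omega, by omega, ⟨e1, by simp, by simp only; omega, by simp only; omega,
          ?_, fun _ => ⟨by simp, ?_⟩⟩⟩
    · exact (((ee.setN (by simp)).setN (by simp)).setN (by simp)).setN (by simp)
    · rw [levels, hL] at hv
      exact hv
  · simp [innerPro, wp, e12]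
    refine ⟨by omega, by omega, by omega, ⟨by simp, e2, by simp only; omega, by simp only; omega,
          ?_, fun h => ?_⟩⟩
    · exact (((ee.setN (by simp)).setN (by simp)).setN (by simp)).setN (by simp)
    · simp only at h
      omega
  · simp only [hov]
    simp
  · simp only [hov]
    exact le_rfl
  · refine Set.union_subset_union ?_ (hreg.trans Set.subset_union_right)
    intro c hc
    simpa using hc
  · exact hreg.trans Set.subset_union_right
  · rintro _ ⟨m', rfl, h⟩ - - hm
    refine ⟨(hm d fun hd => ?_).trans (by simp), ?_⟩
    · have := hreg hd
      simp only [Ints.innerCells, Set.mem_ofPred_eq] at this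
      omega
    · rw [levels, hL] at hv ⊢
      exact .of_treeAll hv h

end


/-! ## The outer tree -/

def outHead : Cmd :=
  .set 14 (V 1) ;; .set 15 (V 2) ;; .set 16 (V 3) ;; .set 18 (11 * V 23 + 5 * V 3) ;;
  .set 13 (2 * V 10) ;; .set 17 (V 18 + 3)

def outMid : Cmd := .set 13 (2 * V 10 + 1) ;; .set 17 (V 18 + 4)

def outTail : Cmd :=
  .set 1 (V 14) ;; .set 2 (V 15) ;; .set 3 (V 16) ;; .load 5 (1 + V 24 + V 3) ;; .loadK 0 (1 + V 5) ;;
  .storeK (V 18 + 2) 0 ;; storeRoot (11 * V 23) (V 18) (V 1) (V 3) ;;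
  storeRoot (11 * V 23) (V 18 + 1) (V 3 + 1) (V 2)

/-- Writes the node number `V 3`, where variables `10` and `11` hold its code and half the range of
codes. -/
def outPre (p : ℕ) : Cmd := outHead ;; innerRun p ;; outMid ;; innerRun p ;; outTail

def outPro : Cmd :=
  .ite (.le (V 4) 1) (.set 2 (V 3) ;; .set 11 (V 11 / 2) ;; .set 10 (V 10 - V 11))
    (.set 1 (V 3 + 1) ;; .set 11 (V 11 / 2) ;; .set 10 (V 10 + V 11))

def outProc (p p' : ℕ) : Cmd := rangeProc p outPro (outPre p') .skip

def outRun (p : ℕ) : Cmd :=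
  .set 1 0 ;; .set 2 (V 24) ;; .set 3 (V 24) ;; .set 10 (V 28) ;; .set 11 (V 28) ;; .fork 4 p

section
variable {α : Type u} [LinearOrder α] {C : Ctx} {I : Ints α} {σ : St α}

theorem Stored.congr_inner {m m' : Mem α} {p : ℕ} {t : BTree (InnerLabel α)} {G : Set ℕ}
    (h : Stored m (innerLabelAt m) p t G) (hm : ∀ c ∈ G, m' c = m c) : Stored m' (innerLabelAt m') p t G := by
  refine h.congr hm fun q v H hv hH => ?_
  obtain ⟨h1, h2, h3, rfl⟩ := hv
  exact ⟨by rw [hm _ (hH (by simp)), h1], by rw [hm _ (hH (by simp)), h2],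
    by rw [hm _ (hH (by simp)), h3], rfl⟩

namespace Ints
variable (I)

/-- The code of the node with number `i`. -/
def own (i : ℕ) : ℕ := TNode.code (fun j => j) i I.root

/-- The number of endpoints in group `g`. -/
noncomputable def size (g : ℕ) : ℕ := I.finish g - I.start g

/-- The cells of the inner tree for group `g`. -/
def groupCells (g : ℕ) : Set ℕ := I.innerCells (I.start g) (I.finish g)

/-- The pointer to the inner tree for group `g`. -/
noncomputable def gptr (g : ℕ) : ℕ := tptr (12 * I.Z) (I.start g) (I.finish g)

/-- The inner tree for group `g` is stored. -/
def GroupDone (g : ℕ) (m : Mem α) : Prop := I.InnerDone ⟨I.start g, I.finish g, levels (I.size g)⟩ m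

variable {I}

theorem GroupDone.congr {g : ℕ} {m m' : Mem α} (h : I.GroupDone g m) (hm : ∀ c ∈ I.groupCells g, m' c = m c) :
    I.GroupDone g m' := by
  obtain ⟨t, F, cl, h1, h2, h3⟩ := h
  exact ⟨t, F, cl, h1.congr_inner fun c hc => hm c (h2 hc), h2, h3⟩

theorem own_lt {i j : ℕ} (hij : i < j) (hj : j < 2 * I.n) : I.own i < I.own j :=
  TNode.code_lt_code (N := 2 * I.n) (fun _ _ h _ => h) I.root_sized le_rfl ⟨i, Nat.zero_le _, by simp [root]; omega, rfl⟩
    ⟨j, Nat.zero_le _, by simpa [root] using hj, rfl⟩ hij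

theorem own_inj {i j : ℕ} (hi : i < 2 * I.n) (hj : j < 2 * I.n) (h : I.own i = I.own j) : i = j := by
  rcases lt_trichotomy i j with hlt | rfl | hlt
  · have := own_lt hlt hj
    omega
  · rfl
  · have := own_lt hlt hi
    omega

theorem own_mem {i : ℕ} (hi : i < 2 * I.n) : 1 ≤ I.own i ∧ I.own i < 2 * 2 ^ I.K := by
  have := TNode.code_mem (kk := fun j => j) (N := 2 * I.n) (fun _ _ h _ => h) I.root_sized le_rfl (x := i)
    ⟨i, by simp [root], by simpa [root] using hi, rfl⟩
  simp only [root, ← two_mul] at this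
  exact ⟨by simp only [own, root] at *; omega, this.2⟩

theorem groupCells_disjoint {g h : ℕ} (hgh : g ≠ h) : Disjoint (I.groupCells g) (I.groupCells h) := by
  rw [Set.disjoint_left]
  intro c h1 h2
  simp only [groupCells, innerCells, Set.mem_ofPred_eq] at h1 h2
  have e1 := (mem_group (I := I) (g := g) (p := (c - 12 * I.Z) / 5)).2 (by omega)
  have e2 := (mem_group (I := I) (g := h) (p := (c - 12 * I.Z) / 5)).2 (by omega)
  exact hgh (e1.2.symm.trans e2.2)

theorem groupCells_le {g c : ℕ} (h : c ∈ I.groupCells g) : 12 * I.Z ≤ c ∧ c < 12 * I.Z + 10 * I.n := by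
  simp only [groupCells, innerCells, Set.mem_ofPred_eq] at h
  have := I.finish_le g
  omega

theorem size_eq (g : ℕ) : I.size g = ((Finset.range (2 * I.n)).filter fun p => I.grp (I.out p) = g).card := by
  have : (Finset.range (2 * I.n)).filter (fun p => I.grp (I.out p) = g) = Finset.Ico (I.start g) (I.finish g) := by
    ext p
    rw [Finset.mem_filter, Finset.mem_range, Finset.mem_Ico, mem_group]
  rw [this, Nat.card_Ico, size]

theorem sum_size_le : ∑ i ∈ Finset.range (2 * I.n), (I.size (2 * I.own i) + I.size (2 * I.own i + 1)) ≤ 2 * I.n := by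
  have h1 : ∀ i, I.size (2 * I.own i) + I.size (2 * I.own i + 1) =
      ((Finset.range (2 * I.n)).filter fun p => I.grp (I.out p) / 2 = I.own i).card := by
    intro i
    rw [size_eq, size_eq, ← Finset.card_union_of_disjoint]
    · congr 1
      ext p
      simp only [Finset.mem_union, Finset.mem_filter, Finset.mem_range]
      omega
    · rw [Finset.disjoint_left]
      intro p
      simp only [Finset.mem_filter]
      omega
  rw [Finset.sum_congr rfl fun i _ => h1 i, ← Finset.card_biUnion]
  · refine (Finset.card_le_card ?_).trans (Finset.card_range _).le
    intro p
    simp only [Finset.mem_biUnion, Finset.mem_filter]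
    rintro ⟨_, _, h, _⟩
    exact h
  · intro i hi j hj hij
    rw [Finset.mem_coe, Finset.mem_range] at hi hj
    refine Finset.disjoint_left.2 fun p => ?_
    simp only [Finset.mem_filter]
    rintro ⟨_, h⟩ ⟨_, h'⟩
    exact hij (own_inj hi hj (h.symm.trans h'))

end Ints

/-- The cells of a node of the outer tree. -/
structure Ints.OutAt (I : Ints α) (T : TNode) (m : Mem α) : Prop where
  left : m (11 * I.Z + 5 * T.mid) = .num (tptr (11 * I.Z) T.a T.mid)
  right : m (11 * I.Z + 5 * T.mid + 1) = .num (tptr (11 * I.Z) (T.mid + 1) T.b)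
  key : m (11 * I.Z + 5 * T.mid + 2) = .key (I.rkey T.mid)
  pl : m (11 * I.Z + 5 * T.mid + 3) = .num (I.gptr (2 * I.own T.mid))
  pr : m (11 * I.Z + 5 * T.mid + 4) = .num (I.gptr (2 * I.own T.mid + 1))
  gl : I.GroupDone (2 * I.own T.mid) m
  gr : I.GroupDone (2 * I.own T.mid + 1) m

/-- The cells that are written for node number `i`. -/
def Ints.outCells (I : Ints α) (i : ℕ) : Set ℕ :=
  {c | ∃ j < 5, c = 11 * I.Z + 5 * i + j} ∪ I.groupCells (2 * I.own i) ∪ I.groupCells (2 * I.own i + 1)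

theorem Ints.outCells_disjoint {i j : ℕ} (hi : i < 2 * I.n) (hj : j < 2 * I.n) (hij : i ≠ j) :
    Disjoint (I.outCells i) (I.outCells j) := by
  have hZ : I.Z = 16 * I.n + 8 := rfl
  have hij' : I.own i ≠ I.own j := fun h => hij (Ints.own_inj hi hj h)
  have key : ∀ g h c, c ∈ I.groupCells g → c ∈ I.groupCells h → g = h := fun g h c h1 h2 =>
    by_contra fun hn => Set.disjoint_left.1 (Ints.groupCells_disjoint hn) h1 h2
  rw [Set.disjoint_left]
  rintro c ((⟨u, hu, rfl⟩ | hc) | hc) ((⟨v, hv, h⟩ | hd) | hd)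
  · omega
  · have := Ints.groupCells_le hd
    omega
  · have := Ints.groupCells_le hd
    omega
  · have := Ints.groupCells_le hc
    omega
  · have := key _ _ _ hc hd
    omega
  · have := key _ _ _ hc hd
    omega
  · have := Ints.groupCells_le hc
    omega
  · have := key _ _ _ hc hd
    omega
  · have := key _ _ _ hc hd
    omega

theorem Ints.OutAt.congr {T : TNode} {m m' : Mem α} (h : I.OutAt T m) (hm : ∀ c ∈ I.outCells T.mid, m' c = m c) :
    I.OutAt T m' := by
  have q : ∀ j < 5, m' (11 * I.Z + 5 * T.mid + j) = m (11 * I.Z + 5 * T.mid + j) :=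
    fun j hj => hm _ (Or.inl (Or.inl ⟨j, hj, rfl⟩))
  exact ⟨(q 0 (by omega)).trans h.left, (q 1 (by omega)).trans h.right, (q 2 (by omega)).trans h.key,
    (q 3 (by omega)).trans h.pl, (q 4 (by omega)).trans h.pr, h.gl.congr fun c hc => hm c (Or.inl (Or.inr hc)),
    h.gr.congr fun c hc => hm c (Or.inr hc)⟩

/-- Precondition of a call. -/
structure OutCall (I : Ints α) (T : TNode) (ν : ℕ → ℕ) : Prop where
  h1 : ν 1 = T.a
  h2 : ν 2 = T.b
  a_le : T.a ≤ 2 * I.n + 1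
  b_le : T.b ≤ 2 * I.n
  env : Env I.env ν
  below : T.a < T.b → I.root.Below (fun j => j) (2 * I.n) T
  h10 : T.a < T.b → ν 10 = T.c
  h11 : T.a < T.b → ν 11 = T.s

theorem OutCall.own {T : TNode} {ν : ℕ → ℕ} (h : OutCall I T ν) (hlt : T.a < T.b) : I.own T.mid = T.c :=
  ((h.below hlt).path _ (fun _ => by simp only [TNode.mid]; omega)
    fun _ => by simp only [TNode.mid]; omega).trans (TNode.code_eq (kk := fun j => j) hlt)

theorem innerRun_group {p : ℕ} (hp : C.Γ[p]? = some (innerProc p)) (hB : 1000 * (I.n + 1) ≤ C.B)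
    {g d : ℕ} (he : Env I.env σ.n) (h13 : σ.n 13 = g) (h17 : σ.n 17 = d) (hr : I.Ready σ.mem)
    (hg : 2 ≤ g) (hg' : g < 4 * 2 ^ I.K) (hd : 11 * I.Z ≤ d) (hd' : d < 12 * I.Z) {R W : Set ℕ}
    (hR : ∀ c < 11 * I.Z, c ∈ R) (hRd : d ∈ R) (hRg : I.groupCells g ⊆ R) (hWd : d ∈ W)
    (hWg : I.groupCells g ⊆ W) :
    Tri C (innerRun p) R W (I.size g * 221 + 300) ((Nat.size (2 * I.n) + 2) * 161 + 120) σ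
      fun σ' => σ'.mem d = .num (I.gptr g) ∧ I.GroupDone g σ'.mem ∧
        ∀ c, c ≠ d → c ∉ I.groupCells g → σ'.mem c = σ.mem c := by
  refine (innerRun_tri hp hB he h13 h17 hr hg hg' hd hd').mono le_rfl ?_ ?_ ?_ ?_
  · have h1 := I.finish_le g
    have := Nat.size_le_size (show I.finish g - I.start g ≤ 2 * I.n by omega)
    exact Nat.add_le_add_right (Nat.mul_le_mul_right _ (by omega)) _
  · rintro c (hc | rfl | hc)
    · exact hR c hc
    · exact hRd
    · exact hRg hc
  · rintro c (rfl | hc)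
    · exact hWd
    · exact hWg hc
  · rintro σ' ⟨h1, h2⟩ - - hm
    exact ⟨h1, h2, fun c h3 h4 => hm c (by rintro (h | h); exacts [h3 h, h4 h])⟩

theorem outTail_wp {R W : Set ℕ} (hB : 1000 * (I.n + 1) ≤ C.B) {T : TNode} (hlt : T.a < T.b)
    (hb : T.b ≤ 2 * I.n) (he : Env I.env σ.n) (h14 : σ.n 14 = T.a) (h15 : σ.n 15 = T.b) (h16 : σ.n 16 = T.mid)
    (h18 : σ.n 18 = 11 * I.Z + 5 * T.mid) (hin : I.Input σ.mem)
    (hR : ∀ c < 11 * I.Z, c ∈ R) (hW : ∀ j < 5, 11 * I.Z + 5 * T.mid + j ∈ W)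
    (pl : σ.mem (11 * I.Z + 5 * T.mid + 3) = .num (I.gptr (2 * I.own T.mid)))
    (pr : σ.mem (11 * I.Z + 5 * T.mid + 4) = .num (I.gptr (2 * I.own T.mid + 1)))
    (gl : I.GroupDone (2 * I.own T.mid) σ.mem) (gr : I.GroupDone (2 * I.own T.mid + 1) σ.mem) :
    wp C.B R W outTail (fun σ' => I.OutAt T σ'.mem ∧ σ'.n 1 = T.a ∧ σ'.n 2 = T.b ∧ σ'.n 3 = T.mid) σ := by
  have hB1 := C.one_lt_B
  have hZ : I.Z = 16 * I.n + 8 := rfl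
  obtain ⟨-, -, -, h23, h24, -⟩ := Ints.env_facts he
  have hmid : T.a ≤ T.mid ∧ T.mid < T.b := by simp only [TNode.mid]; omega
  have hmid' : (T.a + T.b) / 2 = T.mid := rfl
  have hei := I.eid_lt T.mid (by omega)
  have m1 := hin.eid T.mid (by omega)
  have m2 := hin.key (I.eid T.mid) hei
  have w0 := hW 0 (by omega)
  have w1 := hW 1 (by omega)
  have w2 := hW 2 (by omega)
  have r1 := hR (1 + 2 * I.n + T.mid) (by omega)
  have r2 := hR (1 + I.eid T.mid) (by omega)
  have fin : ∀ τ : St α, τ.n 1 = T.a → τ.n 2 = T.b → τ.n 3 = T.mid → τ.n 18 = 11 * I.Z + 5 * T.mid →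
      τ.n 23 = I.Z → τ.mem = Function.update σ.mem (11 * I.Z + 5 * T.mid + 2) (.key (I.rkey T.mid)) →
      wp C.B R W (storeRoot (11 * V 23) (V 18) (V 1) (V 3) ;; storeRoot (11 * V 23) (V 18 + 1) (V 3 + 1) (V 2))
        (fun σ' => I.OutAt T σ'.mem ∧ σ'.n 1 = T.a ∧ σ'.n 2 = T.b ∧ σ'.n 3 = T.mid) τ := by
    intro τ g1 g2 g3 g18 g23 gm
    refine wp_storeRoot ?_ (by omega) ?_ ?_ ?_ ?_ (wp_storeRoot ?_ (by omega) ?_ ?_ ?_ ?_ ?_)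
    all_goals try simp [g1, g2, g3, g18, g23]
    all_goals try first | omega | exact w0 | exact w1
    refine ⟨?_, ?_, ?_, ?_, ?_, gl.congr fun c hc => ?_, gr.congr fun c hc => ?_⟩
    all_goals try simp [gm, pl, pr]
    all_goals
      have := Ints.groupCells_le hc
      rw [if_neg (by omega), if_neg (by omega), Function.update_of_ne (by omega)]
  unfold outTail
  generalize (storeRoot (11 * V 23) (V 18) (V 1) (V 3) ;; _ : Cmd) = last at fin ⊢
  simp [wp, h23, h24, h14, h15, h16, h18, m1, m2, r1, r2, w2]
  refine ⟨by omega, by omega, by omega, fin _ ?_ ?_ ?_ ?_ ?_ ?_⟩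
  all_goals first | rfl | simp [h14, h15, h16, h18, h23]

theorem outPre_tri {p : ℕ} (hp : C.Γ[p]? = some (innerProc p)) (hB : 1000 * (I.n + 1) ≤ C.B)
    {T : TNode} (h : OutCall I T σ.n) (hlt : T.a < T.b) (h3 : σ.n 3 = T.mid) (hr : I.Ready σ.mem)
    {R : Set ℕ} (hR : ∀ c < 11 * I.Z, c ∈ R) (hRc : I.outCells T.mid ⊆ R) :
    Tri C (outPre p) R (I.outCells T.mid)
      ((I.size (2 * I.own T.mid) + I.size (2 * I.own T.mid + 1)) * 221 + 702)
      (2 * ((Nat.size (2 * I.n) + 2) * 161) + 342) σ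
      fun σ' => I.OutAt T σ'.mem ∧ σ'.n 1 = T.a ∧ σ'.n 2 = T.b ∧ σ'.n 3 = T.mid := by
  have hB1 := C.one_lt_B
  have hZ : I.Z = 16 * I.n + 8 := rfl
  have hb := h.b_le
  have hmid : T.a ≤ T.mid ∧ T.mid < T.b := by simp only [TNode.mid]; omega
  have hown := I.own_mem (i := T.mid) (by omega)
  have h10 := h.h10 hlt
  rw [← h.own hlt] at h10
  have f1 := h.h1
  have f2 := h.h2
  have hcj : ∀ j < 5, 11 * I.Z + 5 * T.mid + j ∈ I.outCells T.mid := fun j hj => Or.inl (Or.inl ⟨j, hj, rfl⟩)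
  have hgl : I.groupCells (2 * I.own T.mid) ⊆ I.outCells T.mid := fun c hc => Or.inl (Or.inr hc)
  have hgr : I.groupCells (2 * I.own T.mid + 1) ⊆ I.outCells T.mid := fun c hc => Or.inr hc
  have h23 := (Ints.env_facts h.env).2.2.2.1
  have hpow := I.pow_le
  have hl1 : outHead.len = 22 := by decide
  have hl2 : outMid.len = 10 := by decide
  have hl3 : outTail.len = 70 := by decide
  refine (Tri.seq (Q := fun τ => τ.mem = σ.mem ∧ τ.n 14 = T.a ∧ τ.n 15 = T.b ∧ τ.n 16 = T.mid ∧
      τ.n 18 = 11 * I.Z + 5 * T.mid ∧ τ.n 13 = 2 * I.own T.mid ∧ τ.n 17 = 11 * I.Z + 5 * T.mid + 3)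
    (Tri.basic ?_) ?_
    (T₂ := (I.size (2 * I.own T.mid) * 221 + 300) + (10 + ((I.size (2 * I.own T.mid + 1) * 221 + 300) + 70)))
    (D₂ := ((Nat.size (2 * I.n) + 2) * 161 + 120) + (10 + (((Nat.size (2 * I.n) + 2) * 161 + 120) + 70)))).conseq
      ?_ ?_ fun _ h _ _ _ => h
  · simp [outHead, wp, f1, f2, h3, h23, h10]
    omega
  rotate_left
  · rw [hl1]
    exact (by omega : ∀ a b, 22 + (a * 221 + 300 + (10 + (b * 221 + 300 + 70))) ≤ (a + b) * 221 + 702) _ _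
  · rw [hl1]
    exact (by omega : ∀ z, 22 + (z + 120 + (10 + (z + 120 + 70))) ≤ 2 * z + 342) _
  rintro τ₁ ⟨em, e14, e15, e16, e18, e13, e17⟩ fn₁ - -
  have en₁ : Env I.env τ₁.n := h.env.frame fn₁ (by decide)
  have e10 : τ₁.n 10 = I.own T.mid := by rw [fn₁ 10 (by decide), h10]
  have hr₁ : I.Ready τ₁.mem := em ▸ hr
  refine Tri.seq (innerRun_group (σ := τ₁) hp hB en₁ e13 e17 hr₁ (by omega) (by omega) (by omega) (by omega) hR
    (hRc (hcj 3 (by omega))) (hgl.trans hRc) (hcj 3 (by omega)) hgl) ?_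
  rintro τ₂ ⟨d₂, g₂, o₂⟩ fn₂ - -
  have en₂ : Env I.env τ₂.n := en₁.frame fn₂ (by simp [innerRun, storeRoot, Cmd.mods])
  have k₂ : ∀ v, v ∈ ([10, 14, 15, 16, 18] : List ℕ) → τ₂.n v = τ₁.n v := fun v hv =>
    fn₂ v (by revert v; simp [innerRun, storeRoot, Cmd.mods])
  have hr₂ : I.Ready τ₂.mem := hr₁.congr fun c hc => o₂ c (by omega) fun hc' => by
    have := Ints.groupCells_le hc'
    omega
  refine Tri.seq (T₁ := 10) (D₁ := 10) (Q := fun τ => τ.mem = τ₂.mem ∧ τ.n 13 = 2 * I.own T.mid + 1 ∧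
    τ.n 17 = 11 * I.Z + 5 * T.mid + 4) (hl2 ▸ Tri.basic ?_) ?_
  · simp [outMid, wp, k₂, e10, e18]
    omega
  rintro τ₃ ⟨em₃, e13₃, e17₃⟩ fn₃ - -
  have en₃ : Env I.env τ₃.n := en₂.frame fn₃ (by decide)
  have hr₃ : I.Ready τ₃.mem := em₃ ▸ hr₂
  refine Tri.seq (innerRun_group (σ := τ₃) hp hB en₃ e13₃ e17₃ hr₃ (by omega) (by omega) (by omega) (by omega) hR
    (hRc (hcj 4 (by omega))) (hgr.trans hRc) (hcj 4 (by omega)) hgr) ?_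
  rintro τ₄ ⟨d₄, g₄, o₄⟩ fn₄ - -
  have en₄ : Env I.env τ₄.n := en₃.frame fn₄ (by simp [innerRun, storeRoot, Cmd.mods])
  have k₄ : ∀ v, v ∈ ([10, 14, 15, 16, 18] : List ℕ) → τ₄.n v = τ₁.n v := fun v hv => by
    rw [← k₂ v hv, ← fn₃ v (by revert v; decide)]
    exact fn₄ v (by revert v; simp [innerRun, storeRoot, Cmd.mods])
  have hr₄ : I.Ready τ₄.mem := hr₃.congr fun c hc => o₄ c (by omega) fun hc' => by
    have := Ints.groupCells_le hc'
    omega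
  refine (hl3 ▸ Tri.basic (outTail_wp hB hlt hb en₄ (by rw [k₄ 14 (by decide), e14]) (by rw [k₄ 15 (by decide), e15])
    (by rw [k₄ 16 (by decide), e16]) (by rw [k₄ 18 (by decide), e18]) hr₄.input hR hcj ?_ d₄ ?_ g₄) : Tri ..)
  · rw [o₄ _ (by omega) fun hc' => ?_, em₃, d₂]
    have := Ints.groupCells_le hc'
    omega
  · refine g₂.congr fun c hc => ?_
    have := Ints.groupCells_le hc
    rw [o₄ _ (by omega) (Set.disjoint_left.1 (Ints.groupCells_disjoint (by omega)) hc), em₃]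

theorem outRun_tri {p p' : ℕ} (hp : C.Γ[p]? = some (outProc p p')) (hp' : C.Γ[p']? = some (innerProc p'))
    (hB : 1000 * (I.n + 1) ≤ C.B) (he : Env I.env σ.n) (hr : I.Ready σ.mem) :
    Tri C (outRun p) Set.univ {c | 11 * I.Z ≤ c}
      (2 * I.n * 1100 + 300) ((Nat.size (2 * I.n) + 3) * ((Nat.size (2 * I.n) + 3) * 400)) σ
      fun σ' => TreeAll TNode.a TNode.b TNode.left TNode.right (I.OutAt · σ'.mem) I.root := by
  have hB1 := C.one_lt_B
  have hZ : I.Z = 16 * I.n + 8 := rfl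
  have hK2 := I.pow_le
  obtain ⟨-, -, -, -, h24, -, -, -, h28⟩ := Ints.env_facts he
  have hov : overhead outPro .skip = 84 := by decide
  refine (Tri.seq (Q := fun τ => τ = σ.setN 1 0) (Tri.set (by simp; omega) (by simp)) ?_
    (T₂ := 2 + (2 + (2 + (2 + (2 * I.n * 1100 + 290)))))
    (D₂ := 2 + (2 + (2 + (2 + (Nat.size (2 * I.n) + 2) * ((Nat.size (2 * I.n) + 3) * 400)))))).conseq ?_ ?_ fun _ h _ _ _ => h
  rotate_left
  · rw [show (Cmd.set 1 0).len = 2 by decide]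
    exact (by omega : ∀ z, 2 + (2 + (2 + (2 + (2 + (z + 290))))) ≤ z + 300) _
  · rw [show (Cmd.set 1 0).len = 2 by decide]
    generalize Nat.size (2 * I.n) = y
    have e : (y + 3) * ((y + 3) * 400) = (y + 2) * ((y + 3) * 400) + (y + 3) * 400 := by ring
    rw [e]
    generalize (y + 2) * ((y + 3) * 400) = z
    clear e
    omega
  rintro _ rfl - - -
  refine Tri.seq (Q := fun τ => τ = (σ.setN 1 0).setN 2 (2 * I.n)) (Tri.set (by simp) (by simp [h24])) ?_
  rintro _ rfl - - -
  refine Tri.seq (Q := fun τ => τ = ((σ.setN 1 0).setN 2 (2 * I.n)).setN 3 (2 * I.n))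
    (Tri.set (by simp) (by simp [h24])) ?_
  rintro _ rfl - - -
  refine Tri.seq (Q := fun τ => τ = (((σ.setN 1 0).setN 2 (2 * I.n)).setN 3 (2 * I.n)).setN 10 (2 * 2 ^ I.K))
    (Tri.set (by simp) (by simp [h28])) ?_
  rintro _ rfl - - -
  refine Tri.seq (Q := fun τ => τ = ((((σ.setN 1 0).setN 2 (2 * I.n)).setN 3 (2 * I.n)).setN 10
    (2 * 2 ^ I.K)).setN 11 (2 * 2 ^ I.K)) (Tri.set (by simp) (by simp [h28])) ?_
  rintro _ rfl - - -
  have he' := ((((he.setN (x := 1) (v := 0) (by simp)).setN (x := 2) (v := 2 * I.n) (by simp)).setN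
    (x := 3) (v := 2 * I.n) (by simp)).setN (x := 10) (v := 2 * 2 ^ I.K) (by simp)).setN
    (x := 11) (v := 2 * 2 ^ I.K) (by simp)
  have hcell : ∀ i, I.outCells i ⊆ {c | 11 * I.Z ≤ c} := by
    rintro i c ((⟨j, hj, rfl⟩ | hc) | hc)
    · simp only [Set.mem_ofPred_eq]
      omega
    all_goals
      have := Ints.groupCells_le hc
      simp only [Set.mem_ofPred_eq]
      omega
  refine (Tri.rangeTree (C := C) (F := {c | 11 * I.Z ≤ c}) hp TNode.isRange (fun T ν _ => OutCall I T ν)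
    (fun T m => I.OutAt T m) I.outCells (2 * I.n) σ.mem
    (fun i => (I.size (2 * I.own i) + I.size (2 * I.own i + 1)) * 221 + 702)
    (2 * ((Nat.size (2 * I.n) + 2) * 161) + 342)
    (by omega) ?_ ?_ (fun i _ => hcell i) ?_ ?_ I.root ⟨2 * I.n + 1, 2 * I.n, 0, 0⟩
    (((((σ.setN 1 0).setN 2 (2 * I.n)).setN 3 (2 * I.n)).setN 10 (2 * 2 ^ I.K)).setN 11 (2 * 2 ^ I.K))
    ?_ ?_ (by simp) le_rfl fun _ _ => rfl).mono ?_ ?_ (Set.subset_univ _) ?_ ?_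
  · rintro T ν κ h
    exact ⟨h.h1, h.h2, h.a_le, h.b_le⟩
  · exact fun i j => Ints.outCells_disjoint
  · rintro T m m' hlt hb hm h
    exact h.congr hm
  · intro T τ h hlt hm
    have hmid : T.mid = (T.a + T.b) / 2 := rfl
    rw [← hmid]
    have hb := h.below hlt
    have hsz := hb.sized.le hlt
    have hcod := hb.codes hlt
    simp only [Ints.root] at hcod
    have h' : OutCall I T (τ.setN 3 T.mid).n :=
      ⟨by simpa using h.h1, by simpa using h.h2, h.a_le, h.b_le, h.env.setN (by simp), h.below,
        by simpa using h.h10, by simpa using h.h11⟩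
    refine (outPre_tri hp' hB h' hlt (by simp) ?_ ?_ ?_).conseq le_rfl le_rfl ?_
    · refine hr.congr fun c hc => ?_
      rw [St.setN_mem, hm c (Or.inl (by simp; omega))]
    · intro c hc
      left
      simpa using hc
    · exact fun c hc => Or.inr hc
    rintro τ' ⟨p1, f1, f2, f3⟩ hn - -
    have f10 : τ'.n 10 = T.c := by
      rw [hn 10 (by simp [outPre, outHead, outMid, outTail, innerRun, storeRoot, Cmd.mods])]
      simpa using h.h10 hlt
    have f11 : τ'.n 11 = T.s := by
      rw [hn 11 (by simp [outPre, outHead, outMid, outTail, innerRun, storeRoot, Cmd.mods])]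
      simpa using h.h11 hlt
    have ee : Env I.env τ'.n := (h.env.setN (x := 3) (v := T.mid) (by simp)).frame hn
      (by simp [outPre, outHead, outMid, outTail, innerRun, storeRoot, Cmd.mods])
    have hTb := h.b_le
    refine ⟨?_, ?_, p1⟩
    · simp [outPro, wp, f3, f10, f11]
      refine ⟨by omega, by omega, by omega,
        ⟨f1, by simp [TNode.left]; rfl, h.a_le, by simp only [TNode.left]; omega,
          ?_, fun _ => hb.left (fun _ _ h _ => h) hlt, fun _ => by simp [TNode.left],
          fun _ => by simp [TNode.left]⟩⟩
      exact (((ee.setN (by simp)).setN (by simp)).setN (by simp)).setN (by simp)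
    · simp [outPro, wp, f3, f10, f11]
      refine ⟨by omega, by omega, ⟨by omega, by omega⟩, by omega,
        ⟨by simp [TNode.right]; rfl, f2, by simp only [TNode.right]; omega, h.b_le,
          ?_, fun _ => hb.right (fun _ _ h _ => h) hlt, fun _ => by simp [TNode.right],
          fun _ => by simp [TNode.right]⟩⟩
      exact (((ee.setN (by simp)).setN (by simp)).setN (by simp)).setN (by simp)
  · simp [outPro, wp]
    refine ⟨by omega, by omega, by omega, ⟨by simp [Ints.root], by simp [Ints.root],
      by simp [Ints.root], by simp [Ints.root],
      ?_, fun _ => .root I.root_sized rfl rfl, fun _ => by simp [Ints.root]; omega,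
          fun _ => by simp [Ints.root]⟩⟩
    exact (((he'.setN (by simp)).setN (by simp)).setN (by simp)).setN (by simp)
  · simp [outPro, wp]
    refine ⟨by omega, by omega, by omega, by omega, ⟨by simp, by simp, by simp, by simp,
      ?_, ?_, ?_, ?_⟩⟩
    · exact (((he'.setN (by simp)).setN (by simp)).setN (by simp)).setN (by simp)
    all_goals
      intro h
      simp only at h
      omega
  · simp only [hov, Ints.root]
    have := I.sum_size_le
    simp only [Nat.Ico_zero_eq_range, Finset.sum_add_distrib, ← Finset.sum_mul, Finset.sum_const, Finset.card_range,
      smul_eq_mul] at this ⊢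
    omega
  · simp only [hov, Ints.root]
    exact Nat.mul_le_mul (by simp) (by omega)
  · rintro c ⟨i, -, -, h3⟩
    exact hcell i h3
  · rintro _ ⟨m', rfl, h⟩ - - -
    exact h

end


/-! ## Correctness -/

namespace Ints
variable {α : Type u} [LinearOrder α] {I : Ints α} {m : Mem α}

theorem GroupDone.isInnerTree {c s : ℕ} (hs : s < 2) {e : Fin I.n → α}
    (he : ∀ i : Fin I.n, e i = I.key (2 * i + s)) {S : Finset (Fin I.n)}
    (hS : ∀ i : Fin I.n, i ∈ S ↔ I.node i = c) (h : I.GroupDone (2 * c + s) m) :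
    ∃ t F, Stored m (innerLabelAt m) (I.gptr (2 * c + s)) t F ∧ F ⊆ I.groupCells (2 * c + s) ∧
      IsInnerTree e S t := by
  obtain ⟨t, F, cl, h1, h2, h3, h4, h5⟩ := h
  simp only at h1 h2 h4 h5
  have hmem : ∀ p, p ∈ List.range' (I.start (2 * c + s)) (I.finish (2 * c + s) - I.start (2 * c + s)) ↔
      p < 2 * I.n ∧ I.grp (I.out p) = 2 * c + s := by
    intro p
    rw [mem_group, List.mem_range'_1]
    omega
  have hgrp : ∀ p, p < 2 * I.n → I.grp (I.out p) = 2 * c + s →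
      I.eid (I.out p) = 2 * (I.eid (I.out p) / 2) + s ∧ I.node (I.eid (I.out p) / 2) = c ∧
        I.eid (I.out p) / 2 < I.n := by
    intro p hp hg
    have := I.eid_lt _ (out_spec hp).1
    simp only [grp] at hg
    omega
  refine ⟨t, F, h1, h2, ?_, ?_, ?_⟩
  · refine ⟨_, (h4 ?_) ▸ h3⟩
    rcases Nat.lt_or_ge (I.start (2 * c + s)) (I.finish (2 * c + s)) with h | h
    · left
      have := Nat.log_pos (b := 2) (by norm_num) (show 2 ≤ I.size (2 * c + s) + 1 by rw [size]; omega)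
      rw [levels]
      omega
    · exact Or.inr h
  · have e1 : t.toList.map InnerLabel.key = (t.toList.map fun v => (v.idx, v.key)).map Prod.snd := by
      rw [List.map_map]; rfl
    rw [e1, h5, List.map_map, List.pairwise_map]
    refine List.Pairwise.imp_of_mem ?_ (List.pairwise_lt_range' ..)
    intro p q hp hq hpq
    rw [hmem] at hp hq
    exact I.mono' _ _ (grp_between hpq.le le_rfl hq.1 (hp.2.trans hq.2.symm)).2.1 (out_spec hq.1).1
  · rw [h5, List.perm_ext_iff_of_nodup]
    · rintro ⟨x, y⟩
      simp only [List.mem_map, hmem, Finset.mem_toList, hS, Prod.mk.injEq]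
      constructor
      · rintro ⟨p, ⟨hp, hg⟩, rfl, rfl⟩
        obtain ⟨g1, g2, g3⟩ := hgrp p hp hg
        exact ⟨⟨_, g3⟩, g2, rfl, by rw [he, ← g1]; rfl⟩
      · rintro ⟨i, hi, rfl, rfl⟩
        obtain ⟨j, hj, ej⟩ := I.eid_surj (2 * i + s) (by have := i.2; omega)
        have ej' : I.eid j / 2 = i := by omega
        refine ⟨I.pos j, ⟨pos_lt hj, ?_⟩, ?_, ?_⟩
        · rw [out_pos hj, grp, ej', hi]
          omega
        · rw [out_pos hj, ej']
        · rw [out_pos hj, he, ← ej]; rfl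
    · refine List.Nodup.map_on ?_ List.nodup_range'
      intro p hp q hq hpq
      rw [hmem] at hp hq
      have e1 := (hgrp p hp.1 hp.2).1
      have e2 := (hgrp q hq.1 hq.2).1
      rw [(Prod.mk.inj hpq).1, ← e2] at e1
      have := I.eid_inj _ (out_spec hp.1).1 _ (out_spec hq.1).1 e1
      rw [← (out_spec hp.1).2, this, (out_spec hq.1).2]
    · refine List.Nodup.map ?_ S.nodup_toList
      intro i j hij
      exact Fin.ext (Prod.mk.inj hij).1

/-- The keys of the ranks in `[a, b)`. -/
def keys (I : Ints α) (a b : ℕ) : Multiset α := (Finset.Ico a b).val.map I.rkey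

theorem card_keys (a b : ℕ) : (I.keys a b).card = b - a := by simp [keys]

theorem keys_split {a b c : ℕ} (h1 : a ≤ c) (h2 : c < b) :
    I.keys a b = I.rkey c ::ₘ (I.keys a c + I.keys (c + 1) b) := by
  have e1 : (Finset.Ico a b).val = (Finset.Ico a c).val + (Finset.Ico c b).val :=
    (Multiset.Ico_add_Ico_eq_Ico h1 h2.le).symm
  have e2 : (Finset.Ico c b).val = c ::ₘ (Finset.Ico (c + 1) b).val := (Multiset.Ioo_cons_left h2).symm
  rw [keys, e1, e2, Multiset.map_add, Multiset.map_cons, Multiset.add_cons]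
  rfl

theorem countP_keys_le {P : α → Prop} [DecidablePred P] {a b d e : ℕ}
    (h : ∀ i, a ≤ i → i < b → P (I.rkey i) → d ≤ i ∧ i < e) : (I.keys a b).countP P ≤ e - d := by
  rw [keys, Multiset.countP_map, ← Nat.card_Ico]
  refine Multiset.card_le_card (Multiset.le_iff_subset ?_ |>.2 ?_)
  · exact Multiset.nodup_of_le (Multiset.filter_le _ _) (Finset.nodup _)
  · intro i hi
    simp only [Multiset.mem_filter, Finset.mem_val, Finset.mem_Ico] at hi ⊢
    exact h i hi.1.1 hi.1.2 hi.2

theorem isMedian_keys {T : TNode} (hlt : T.a < T.b) (hb : T.b ≤ 2 * I.n) :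
    IsMedian (I.rkey T.mid) (I.keys T.a T.b) := by
  have hmid : T.mid = (T.a + T.b) / 2 := rfl
  rw [IsMedian, card_keys]
  refine ⟨?_, ?_, ?_⟩
  · exact Multiset.mem_map.2 ⟨T.mid, (Finset.mem_Ico (a := T.a) (b := T.b)).2 ⟨by omega, by omega⟩, rfl⟩
  · have := countP_keys_le (I := I) (P := (· < I.rkey T.mid)) (a := T.a) (b := T.b) (d := T.a) (e := T.mid)
      fun i h1 h2 h3 => ⟨h1, lt_of_not_ge fun h => not_le.2 h3 (I.mono' T.mid i h (by omega))⟩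
    omega
  · have := countP_keys_le (I := I) (P := (I.rkey T.mid < ·)) (a := T.a) (b := T.b) (d := T.mid + 1) (e := T.b)
      fun i h1 h2 h3 => ⟨lt_of_not_ge fun h => not_le.2 h3 (I.mono' i T.mid (by omega) (by omega)), h2⟩
    omega

/-- The intervals that are stored in the subtree with root `T`. -/
def At (I : Ints α) (T : TNode) (i : ℕ) : Prop :=
  T.a < T.b ∧ T.c - T.s < I.top (2 * i) ∧ I.top (2 * i + 1) < T.c + T.s

theorem sep_top {T : TNode} (h : I.root.Below I.rkey (2 * I.n) T) {i : ℕ} (hi : i < I.n) (ha : I.At T i)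
    {e : ℕ} (he : e = 2 * i ∨ e = 2 * i + 1) :
    (I.top e < T.c ↔ I.key e < I.rkey T.mid) ∧ (T.c < I.top e ↔ I.rkey T.mid < I.key e) ∧
      (I.key e < I.rkey T.mid → T.left.Has I.rkey (I.key e)) ∧
      (I.rkey T.mid < I.key e → T.right.Has I.rkey (I.key e)) := by
  obtain ⟨hlt, h1, h2⟩ := ha
  have h3 := top_le hi
  obtain ⟨j, hj, rfl⟩ := I.eid_surj e (by omega)
  have h4 : T.c - T.s < I.top (I.eid j) ∧ I.top (I.eid j) < T.c + T.s := by
    rcases he with he | he <;> rw [he] <;> omega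
  obtain ⟨g1, g2⟩ := h.sep I.mono' hlt hj h4.1 h4.2
  obtain ⟨-, g3⟩ := h.has hlt j hj h4.1 h4.2
  exact ⟨g1, g2, g3.left I.mono' h.b_le, g3.right I.mono' h.b_le⟩

theorem at_left {T : TNode} (h : I.root.Below I.rkey (2 * I.n) T) (hlt : T.a < T.b) {i : ℕ} (hi : i < I.n) :
    I.At T.left i ↔ I.At T i ∧ I.key (2 * i + 1) < I.rkey T.mid := by
  have hs := h.sized.le hlt
  have hab := top_le hi
  constructor
  · rintro ⟨h1, h2, h3⟩
    simp only [TNode.left] at h1 h2 h3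
    have hh := h.sized.half (by omega)
    have ha : I.At T i := ⟨hlt, by omega, by omega⟩
    exact ⟨ha, (sep_top h hi ha (Or.inr rfl)).1.1 (by omega)⟩
  · rintro ⟨ha, hk⟩
    obtain ⟨g1, -, g3, -⟩ := sep_top h hi ha (Or.inr rfl)
    obtain ⟨j, j1, j2, -⟩ := g3 hk
    have := g1.2 hk
    obtain ⟨-, h1, h2⟩ := ha
    refine ⟨by omega, ?_, ?_⟩ <;> simp only [TNode.left] at j1 j2 ⊢ <;> have hh := h.sized.half (by omega) <;> omega

theorem at_right {T : TNode} (h : I.root.Below I.rkey (2 * I.n) T) (hlt : T.a < T.b) {i : ℕ} (hi : i < I.n) :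
    I.At T.right i ↔ I.At T i ∧ I.rkey T.mid < I.key (2 * i) := by
  have hs := h.sized.le hlt
  have hab := top_le hi
  constructor
  · rintro ⟨h1, h2, h3⟩
    simp only [TNode.right] at h1 h2 h3
    have hh := h.sized.half (by omega)
    have ha : I.At T i := ⟨hlt, by omega, by omega⟩
    exact ⟨ha, (sep_top h hi ha (Or.inl rfl)).2.1.1 (by omega)⟩
  · rintro ⟨ha, hk⟩
    obtain ⟨-, g1, -, g3⟩ := sep_top h hi ha (Or.inl rfl)
    obtain ⟨j, j1, j2, -⟩ := g3 hk
    have := g1.2 hk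
    obtain ⟨-, h1, h2⟩ := ha
    refine ⟨by omega, ?_, ?_⟩ <;> simp only [TNode.right] at j1 j2 ⊢ <;> have hh := h.sized.half (by omega) <;> omega

theorem node_eq_iff {T : TNode} (h : I.root.Below I.rkey (2 * I.n) T) (hlt : T.a < T.b) {i : ℕ} (hi : i < I.n) :
    I.node i = T.c ↔ I.At T i ∧ I.key (2 * i) ≤ I.rkey T.mid ∧ I.rkey T.mid ≤ I.key (2 * i + 1) := by
  obtain ⟨-, g, l, hs, hc⟩ := h.sized hlt
  have e1 : 2 * l * 2 ^ g = T.c - T.s := by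
    rw [hs, hc, Nat.add_mul, one_mul, Nat.add_sub_cancel]
  have e2 : (2 * l + 2) * 2 ^ g = T.c + T.s := by rw [hs, hc]; ring
  have hA := I.top_mem (e := 2 * i) (by omega)
  have key : (I.At T i ∧ I.key (2 * i) ≤ I.rkey T.mid ∧ I.rkey T.mid ≤ I.key (2 * i + 1)) ↔
      (I.At T i ∧ I.top (2 * i) ≤ T.c ∧ T.c ≤ I.top (2 * i + 1)) := by
    refine and_congr_right fun ha => ?_
    have h1 := (sep_top h hi ha (Or.inl rfl)).2.1
    have h2 := (sep_top h hi ha (Or.inr rfl)).1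
    rw [← not_lt, ← h1, not_lt, ← not_lt (b := I.rkey T.mid), ← h2, not_lt]
  rw [key]
  constructor
  · intro e
    obtain ⟨l', f1, -, -, f2, f3, f4, f5⟩ := node_spec hi
    have hg := odd_mul_two_pow_inj (f1.symm.trans (e.trans hc))
    rw [hg, ← hs, e] at f2 f5
    rw [e] at f3 f4
    exact ⟨⟨hlt, f2, f5⟩, f3, f4⟩
  · rintro ⟨⟨-, h1, h2⟩, h3, h4⟩
    rw [node, (lca_eq hA.1 (g := g) (l := l) (by omega) (by omega) (by omega) (by omega)).2, hc]

theorem stored_outer {T : TNode}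
    (h : TreeAll TNode.a TNode.b TNode.left TNode.right (I.OutAt · m) T)
    (hb : I.root.Below I.rkey (2 * I.n) T) (hb' : I.root.Below (fun j => j) (2 * I.n) T) {S : Finset (Fin I.n)}
    (hS : ∀ i : Fin I.n, i ∈ S ↔ I.At T i) :
    ∃ t F, Stored m (intervalLabelAt m) (tptr (11 * I.Z) T.a T.b) t F ∧
      F ⊆ regionOf TNode.a TNode.b I.outCells T ∧
      IsIntervalTree (fun i : Fin I.n => I.key (2 * i)) (fun i : Fin I.n => I.key (2 * i + 1))
        (I.keys T.a T.b) S t := by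
  have hZ : I.Z = 16 * I.n + 8 := rfl
  induction h generalizing S with
  | @empty T h =>
    refine ⟨.nil, ∅, ?_, by simp, ?_, ?_⟩
    · rw [tptr, if_pos h]
      exact .nil
    · simp [keys, h]
    · refine Finset.eq_empty_of_forall_notMem fun i hi => ?_
      have := ((hS i).1 hi).1
      omega
  | @node T hlt hx _ _ ihl ihr =>
    have hTb := hb.b_le
    obtain ⟨tl, Fl, sl, fl, il⟩ := ihl (hb.left I.mono' hlt) (hb'.left (fun _ _ h _ => h) hlt)
      (S := S.filter fun i : Fin I.n => I.key (2 * i + 1) < I.rkey T.mid)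
      fun i => by rw [at_left hb hlt i.2, Finset.mem_filter, hS]
    obtain ⟨tr, Fr, sr, fr, ir⟩ := ihr (hb.right I.mono' hlt) (hb'.right (fun _ _ h _ => h) hlt)
      (S := S.filter fun i : Fin I.n => I.rkey T.mid < I.key (2 * i))
      fun i => by rw [at_right hb hlt i.2, Finset.mem_filter, hS]
    have hown : I.own T.mid = T.c :=
      (hb'.path _ (fun _ => by simp only [TNode.mid]; omega)
        fun _ => by simp only [TNode.mid]; omega).trans (TNode.code_eq (kk := fun j => j) hlt)
    obtain ⟨h1, h2, h3, h4, h5, gl, gr⟩ := hx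
    have hS' : ∀ i : Fin I.n, (i ∈ S.filter fun i : Fin I.n => I.key (2 * i) ≤ I.rkey T.mid ∧
        I.rkey T.mid ≤ I.key (2 * i + 1)) ↔ I.node i = I.own T.mid := fun i => by
      rw [Finset.mem_filter, hS, hown, node_eq_iff hb hlt i.2]
    obtain ⟨ta, Fa, sa, fa, ia⟩ := GroupDone.isInnerTree (s := 0) (by norm_num) (fun i => rfl) hS' gl
    obtain ⟨tb, Fb, sb, fb, ib⟩ := GroupDone.isInnerTree (s := 1) (by norm_num) (fun i => rfl) hS' gr
    have hmid : T.a ≤ T.mid ∧ T.mid < T.b := by simp only [TNode.mid]; omega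
    have hmid' : (T.a + T.b) / 2 = T.mid := rfl
    have hcards : T.mid - T.a ≤ T.b - (T.mid + 1) + 1 ∧ T.b - (T.mid + 1) ≤ T.mid - T.a + 1 := by omega
    obtain ⟨P, hP⟩ : ∃ P, 11 * I.Z + 5 * T.mid = P := ⟨_, rfl⟩
    rw [hP] at h1 h2 h3 h4 h5
    have hpc : ∀ c, c ∈ ({P, P + 1} : Set ℕ) ∪ {P + 2, P + 2 + 1, P + 2 + 2} → ∃ j < 5, c = 11 * I.Z + 5 * T.mid + j := by
      intro c hc
      simp only [Set.mem_union, Set.mem_insert_iff, Set.mem_singleton_iff] at hc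
      exact ⟨c - P, by omega, by omega⟩
    have hP12 : ∀ c, (∃ j < 5, c = 11 * I.Z + 5 * T.mid + j) → c < 12 * I.Z := by
      rintro c ⟨j, hj, rfl⟩
      omega
    have hga : ∀ c ∈ Fa, 12 * I.Z ≤ c := fun c hc => (groupCells_le (fa hc)).1
    have hgb : ∀ c ∈ Fb, 12 * I.Z ≤ c := fun c hc => (groupCells_le (fb hc)).1
    have hG : ({P, P + 1} : Set ℕ) ∪ ({P + 2, P + 2 + 1, P + 2 + 2} ∪ Fa ∪ Fb) ⊆ I.outCells T.mid := by
      rintro c (hc | (hc | hc) | hc)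
      · exact Or.inl (Or.inl (hpc c (Or.inl hc)))
      · exact Or.inl (Or.inl (hpc c (Or.inr hc)))
      · exact Or.inl (Or.inr (fa hc))
      · exact Or.inr (fb hc)
    have hdl : Disjoint (I.outCells T.mid) Fl := by
      rw [Set.disjoint_left]
      intro c hc hc'
      obtain ⟨i, i1, i2, i3⟩ := fl hc'
      simp only [TNode.left] at i1 i2
      exact Set.disjoint_left.1 (outCells_disjoint (by omega) (by omega) (by omega)) hc i3
    have hdr : Disjoint (I.outCells T.mid) Fr := by
      rw [Set.disjoint_left]
      intro c hc hc'
      obtain ⟨i, i1, i2, i3⟩ := fr hc'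
      simp only [TNode.right] at i1 i2
      exact Set.disjoint_left.1 (outCells_disjoint (by omega) (by omega) (by omega)) hc i3
    have hlr : Disjoint Fl Fr := by
      rw [Set.disjoint_left]
      intro c hc hc'
      obtain ⟨i, i1, i2, i3⟩ := fl hc
      obtain ⟨j, j1, j2, j3⟩ := fr hc'
      simp only [TNode.left, TNode.right] at i1 i2 j1 j2
      exact Set.disjoint_left.1 (outCells_disjoint (by omega) (by omega) (by omega)) i3 j3
    refine ⟨.node ⟨I.rkey T.mid, ta, tb⟩ tl tr,
      {P, P + 1} ∪ ({P + 2, P + 2 + 1, P + 2 + 2} ∪ Fa ∪ Fb) ∪ Fl ∪ Fr, ?_, ?_, ?_⟩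
    · rw [tptr, if_neg (by omega), hmid', hP]
      refine .node (by omega) h1 h2 ⟨_, _, Fa, Fb, h3, h4, h5, sa, sb, ?_, ?_, rfl⟩ sl sr ?_ (hdl.mono_left hG) ?_
      · exact Set.disjoint_left.2 fun c hc hc' => absurd (hga c hc') (not_le.2 (hP12 c (hpc c (Or.inr hc))))
      · refine Set.disjoint_union_left.2 ⟨Set.disjoint_left.2 fun c hc hc' =>
          absurd (hgb c hc') (not_le.2 (hP12 c (hpc c (Or.inr hc)))), ?_⟩
        exact (groupCells_disjoint (by omega)).mono fa fb
      · rw [Set.disjoint_left]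
        rintro c hc ((hc' | hc') | hc')
        · simp only [Set.mem_insert_iff, Set.mem_singleton_iff] at hc hc'
          omega
        · exact absurd (hga c hc') (not_le.2 (hP12 c (hpc c (Or.inl hc))))
        · exact absurd (hgb c hc') (not_le.2 (hP12 c (hpc c (Or.inl hc))))
      · exact Set.disjoint_union_left.2 ⟨hdr.mono_left hG, hlr⟩
    · rintro c ((hc | hc) | hc)
      · exact ⟨T.mid, hmid.1, hmid.2, hG hc⟩
      · obtain ⟨i, i1, i2, i3⟩ := fl hc
        simp only [TNode.left] at i1 i2
        exact ⟨i, i1, by omega, i3⟩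
      · obtain ⟨i, i1, i2, i3⟩ := fr hc
        simp only [TNode.right] at i1 i2
        exact ⟨i, by omega, i2, i3⟩
    · refine ⟨isMedian_keys hlt hTb, ia, ib, _, _, keys_split hmid.1 hmid.2, ?_, ?_, ?_, ?_, il, ir⟩
      · intro x hx
        obtain ⟨i, hi, rfl⟩ := Multiset.mem_map.1 hx
        rw [Finset.mem_val, Finset.mem_Ico] at hi
        exact I.mono' _ _ (by omega) (by omega)
      · intro x hx
        obtain ⟨i, hi, rfl⟩ := Multiset.mem_map.1 hx
        rw [Finset.mem_val, Finset.mem_Ico] at hi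
        exact I.mono' _ _ (by omega) (by omega)
      · rw [card_keys, card_keys]
        exact hcards.1
      · rw [card_keys, card_keys]
        exact hcards.2

end Ints

/-! ## The program for interval trees -/

def intSetup : Cmd :=
  .set 23 (16 * V 0 + 8) ;; .set 24 (2 * V 0) ;; .set 25 (V 22 + 1) ;; .set 26 (V 24 / V 25 + 1) ;;
  .set 27 (2 * V 25 * V 26) ;; .set 28 (2 * V 20)

/-- Constructs the tree, when the constants have been computed. -/
def intPhases : Cmd :=
  logRun 1 ;; topRun 2 ;; parFor 3 24 ;; parFor 4 26 ;; upRun 5 ;; downRun 6 ;; parFor 7 26 ;;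
  parFor 8 24 ;; outRun 9 ;; .store 0 (11 * V 23 + 5 * V 0)

def intMain : Cmd :=
  .ite (.le (V 0) 0) (.store 0 0) (.set 21 (V 0 + 1) ;; doubling ;; intSetup ;; intPhases)

def intProcs : List Cmd :=
  [intMain, logProc 1, topProc 2, rangeProc 3 proHalf levBody .skip, rangeProc 4 proHalf countBody .skip,
    upProc 5, downProc 6, rangeProc 7 proHalf placeBody .skip, rangeProc 8 proHalf boundBody .skip,
    outProc 9 10, innerProc 10]

section
variable {α : Type u} [LinearOrder α] {C : Ctx} {σ : St α}

theorem Tri.framed {c : Cmd} {R W : Set ℕ} {T D T' D' : ℕ} {Q : St α → Prop} (h : Tri C c R W T D σ Q)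
    (hT : T ≤ T') (hD : D ≤ D') :
    Tri C c Set.univ Set.univ T' D' σ fun σ' => Q σ' ∧ ∀ x, x ∉ W → σ'.mem x = σ.mem x :=
  h.mono hT hD (Set.subset_univ _) (Set.subset_univ _) fun _ h _ _ hm => ⟨h, hm⟩

theorem Ints.Logs.congr {I : Ints α} {x : ℕ} {m m' : Mem α} (h : I.Logs x m) (hx : x < 2 * 2 ^ I.K)
    (hm : ∀ c, c < 2 * I.Z ∨ 9 * I.Z ≤ c → m' c = m c) : I.Logs x m' := by
  have hZ : I.Z = 16 * I.n + 8 := rfl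
  have hK := I.pow_le
  exact ⟨(hm _ (by omega)).trans h.log, (hm _ (by omega)).trans h.s0, (hm _ (by omega)).trans h.s1,
    (hm _ (by omega)).trans h.e0, (hm _ (by omega)).trans h.e1⟩

theorem Stored.congr_interval {m m' : Mem α} {p : ℕ} {t : BTree (IntervalLabel α)} {G : Set ℕ}
    (h : Stored m (intervalLabelAt m) p t G) (hm : ∀ c ∈ G, m' c = m c) :
    Stored m' (intervalLabelAt m') p t G := by
  refine h.congr hm fun q v H hv hH => ?_
  obtain ⟨pl, pr, Fl, Fr, h1, h2, h3, h4, h5, h6, h7, rfl⟩ := hv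
  exact ⟨pl, pr, Fl, Fr, by rw [hm _ (hH (by simp)), h1], by rw [hm _ (hH (by simp)), h2],
    by rw [hm _ (hH (by simp)), h3], h4.congr_inner fun c hc => hm c (hH (Or.inl (Or.inr hc))),
    h5.congr_inner fun c hc => hm c (hH (Or.inr hc)), h6, h7, rfl⟩

/-- The depth of the construction, where `X` bounds the logarithms of all numbers. -/
def intDepth (X : ℕ) : ℕ :=
  (X + 3) * 300 + ((X + 3) * 400 + ((X + 3) * 400 + ((X + 3) * (X * 300) + ((X + 3) * 400 + ((X + 3) * 400 +
    ((X + 3) * (X * 300) + ((X + 3) * 400 + ((X + 3) * ((X + 3) * 400) + 18))))))))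

theorem intTime_le {n k M : ℕ} (h1 : k ≤ 2 * n + 1) (h2 : M ≤ 8 * n + 2) :
    2 * k * 300 + 500 + ((2 * n * 400 + 700) + ((2 * n * 400 + 700) + (((4 * n + 1) * 400 + 200) +
      ((M * 400 + 700) + ((M * 400 + 700) + (((4 * n + 1) * 400 + 200) + ((2 * n * 400 + 700) +
      ((2 * n * 1100 + 300) + 18)))))))) ≤ 20000 * (n + 1) := by
  omega

theorem intPhases_tri {I : Ints α} (hΓ : C.Γ = intProcs) (hB : 1000 * (I.n + 1) ≤ C.B)
    (he : Env I.env σ.n) (hin : I.Input σ.mem) {X : ℕ} (hX : Nat.size (8 * I.n + 2) ≤ X) (hKX : I.K + 1 ≤ X) :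
    Tri C intPhases Set.univ Set.univ (20000 * (I.n + 1)) (intDepth X) σ fun σ' =>
      ∃ t F, σ'.mem 0 = .num (tptr (11 * I.Z) 0 (2 * I.n)) ∧
        Stored σ'.mem (intervalLabelAt σ'.mem) (tptr (11 * I.Z) 0 (2 * I.n)) t F ∧ 0 ∉ F ∧
        IsIntervalTree (fun i : Fin I.n => I.key (2 * i)) (fun i : Fin I.n => I.key (2 * i + 1))
          (I.keys 0 (2 * I.n)) Finset.univ t := by
  have hZ : I.Z = 16 * I.n + 8 := rfl
  have hK := I.pow_le
  have hM := I.M_le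
  have h1n := I.one_le
  have hs : ∀ k, k ≤ 8 * I.n + 2 → Nat.size k + 3 ≤ X + 3 := fun k hk =>
    Nat.add_le_add_right ((Nat.size_le_size hk).trans hX) 3
  refine (Tri.seq ((logRun_tri (p := 1) (by rw [hΓ]; rfl) hB he).framed
    (T' := 2 * 2 ^ I.K * 300 + 500) (D' := (X + 3) * 300) le_rfl (Nat.mul_le_mul_right _ (hs _ (by omega)))) ?_
    (T₂ := (2 * I.n * 400 + 700) + ((2 * I.n * 400 + 700) + (((4 * I.n + 1) * 400 + 200) + ((I.M * 400 + 700) +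
      ((I.M * 400 + 700) + (((4 * I.n + 1) * 400 + 200) + ((2 * I.n * 400 + 700) + ((2 * I.n * 1100 + 300) + 18))))))))
    (D₂ := (X + 3) * 400 + ((X + 3) * 400 + ((X + 3) * (X * 300) + ((X + 3) * 400 + ((X + 3) * 400 +
    ((X + 3) * (X * 300) + ((X + 3) * 400 + ((X + 3) * ((X + 3) * 400) + 18))))))))).conseq ?_ le_rfl fun _ h _ _ _ => h
  rotate_left
  · exact intTime_le hK hM
  rintro σ₁ ⟨lg₁, f₁⟩ n₁ - -
  have e₁ : Env I.env σ₁.n := he.frame n₁ (by decide)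
  have i₁ : I.Input σ₁.mem := hin.congr fun c hc => f₁ c (by simp only [Set.mem_ofPred_eq]; omega)
  refine Tri.seq ((topRun_tri (p := 2) (by rw [hΓ]; rfl) hB e₁ i₁).framed
    le_rfl (Nat.mul_le_mul_right _ (hs _ (by omega)))) ?_
  rintro σ₂ ⟨tp₂, f₂⟩ n₂ - -
  have e₂ : Env I.env σ₂.n := e₁.frame n₂ (by decide)
  have i₂ : I.Input σ₂.mem := i₁.congr fun c hc => f₂ c (by simp only [Set.mem_ofPred_eq]; omega)
  refine Tri.seq ((levRun_tri (p := 3) (by rw [hΓ]; rfl) hB e₂ i₂ (fun x h1 h2 => (lg₁ x h1 h2).congr h2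
    fun c hc => f₂ c (by simp only [Set.mem_ofPred_eq]; omega)) tp₂).framed
    le_rfl (Nat.mul_le_mul_right _ (hs _ (by omega)))) ?_
  rintro σ₃ ⟨⟨lv₃, gp₃⟩, f₃⟩ n₃ - -
  have e₃ : Env I.env σ₃.n := e₂.frame n₃ (by decide)
  refine Tri.seq ((countRun_tri (p := 4) (by rw [hΓ]; rfl) hB e₃ lv₃).framed
    le_rfl (Nat.mul_le_mul (hs _ (by omega)) (Nat.mul_le_mul_right _ hKX))) ?_
  rintro σ₄ ⟨ct₄, f₄⟩ n₄ - -
  have e₄ : Env I.env σ₄.n := e₃.frame n₄ (by decide)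
  refine Tri.seq ((upRun_tri (p := 5) (by rw [hΓ]; rfl) hB e₄ ct₄ I.sum_cnt_le).framed
    le_rfl (Nat.mul_le_mul_right _ (hs _ hM))) ?_
  rintro σ₅ ⟨st₅, f₅⟩ n₅ - -
  have e₅ : Env I.env σ₅.n := e₄.frame n₅ (by decide)
  refine Tri.seq ((downRun_tri (p := 6) (by rw [hΓ]; rfl) hB e₅
    (ct₄.congr fun c h1 h2 => f₅ c (by simp only [Set.mem_ofPred_eq]; omega)) I.sum_cnt_le st₅).framed
    le_rfl (Nat.mul_le_mul_right _ (hs _ hM))) ?_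
  rintro σ₆ ⟨sm₆, f₆⟩ n₆ - -
  have e₆ : Env I.env σ₆.n := e₅.frame n₆ (by decide)
  have g₆ : ∀ c, c < 5 * I.Z ∨ 9 * I.Z ≤ c → σ₆.mem c = σ₃.mem c := fun c hc =>
    (f₆ c (by simp only [Set.mem_ofPred_eq]; omega)).trans
      ((f₅ c (by simp only [Set.mem_ofPred_eq]; omega)).trans (f₄ c (by simp only [Set.mem_ofPred_eq]; omega)))
  refine Tri.seq ((placeRun_tri (p := 7) (by rw [hΓ]; rfl) hB e₆
    (lv₃.congr fun c h1 h2 => g₆ c (by omega)) sm₆).framed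
    le_rfl (Nat.mul_le_mul (hs _ (by omega)) (Nat.mul_le_mul_right _ hKX))) ?_
  rintro σ₇ ⟨ot₇, f₇⟩ n₇ - -
  have e₇ : Env I.env σ₇.n := e₆.frame n₇ (by decide)
  have g₇ : ∀ c, c < 5 * I.Z ∨ 9 * I.Z ≤ c → σ₇.mem c = σ₃.mem c := fun c hc =>
    (f₇ c (by simp only [Set.mem_ofPred_eq]; omega)).trans (g₆ c hc)
  have k₇ : ∀ c, c < 2 * I.Z ∨ 9 * I.Z ≤ c → σ₇.mem c = σ₁.mem c := fun c hc =>
    (g₇ c (by omega)).trans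
      ((f₃ c (by simp only [Set.mem_ofPred_eq]; omega)).trans (f₂ c (by simp only [Set.mem_ofPred_eq]; omega)))
  have lg₇ : ∀ x, 1 ≤ x → x < 2 * 2 ^ I.K → I.Logs x σ₇.mem := fun x h1 h2 => (lg₁ x h1 h2).congr h2 k₇
  refine Tri.seq ((boundRun_tri (p := 8) (by rw [hΓ]; rfl) hB e₇ ot₇
    (gp₃.congr fun c h1 h2 => g₇ c (by omega)) fun g h1 h2 => ?_).framed
    le_rfl (Nat.mul_le_mul_right _ (hs _ (by omega)))) ?_
  · have hl := lg₇ (g / 2) (by omega) (by omega)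
    rcases Nat.mod_two_eq_zero_or_one g with h | h
    · have hg : g = 2 * (g / 2) := by omega
      exact ⟨by rw [hg]; exact hl.s0, by rw [hg]; exact hl.e0⟩
    · have hg : g = 2 * (g / 2) + 1 := by omega
      exact ⟨by rw [hg]; exact hl.s1, by rw [hg]; exact hl.e1⟩
  rintro σ₈ ⟨bd₈, f₈⟩ n₈ - -
  have e₈ : Env I.env σ₈.n := e₇.frame n₈ (by decide)
  have r₈ : I.Ready σ₈.mem := by
    have k : ∀ c, c < 2 * I.Z → σ₈.mem c = σ₁.mem c := fun c hc =>
      (f₈ c (by simp only [Set.mem_ofPred_eq]; omega)).trans (k₇ c (Or.inl hc))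
    exact ⟨i₁.congr fun c hc => k c (by omega), fun x h1 h2 => by rw [k _ (by omega), (lg₁ x h1 h2).log],
      ot₇.congr fun c h1 h2 => f₈ c (by simp only [Set.mem_ofPred_eq]; omega),
      fun g h1 h2 => (bd₈ g h1 h2).1, fun g h1 h2 => (bd₈ g h1 h2).2⟩
  refine Tri.seq ((outRun_tri (p := 9) (p' := 10) (by rw [hΓ]; rfl) (by rw [hΓ]; rfl) hB e₈ r₈).framed
    le_rfl (Nat.mul_le_mul (hs _ (by omega)) (Nat.mul_le_mul_right _ (hs _ (by omega))))) ?_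
  rintro σ₉ ⟨tr, -⟩ n₉ - -
  have e₉ : Env I.env σ₉.n := e₈.frame n₉ (by decide)
  obtain ⟨h0, -, -, h23, -⟩ := Ints.env_facts e₉
  obtain ⟨t, F, s, hF, ht⟩ := Ints.stored_outer (S := Finset.univ) tr I.root_below (.root I.root_sized rfl rfl)
    fun i => by
      have h1 := I.top_mem (e := 2 * i) (by omega)
      have h2 := I.top_mem (e := 2 * i + 1) (by omega)
      simp only [Finset.mem_univ, true_iff, Ints.At, Ints.root]
      omega
  have hF0 : 0 ∉ F := fun h => by
    obtain ⟨i, -, -, (⟨j, -, h⟩ | h) | h⟩ := hF h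
    · omega
    · have := Ints.groupCells_le h
      omega
    · have := Ints.groupCells_le h
      omega
  have hptr : tptr (11 * I.Z) 0 (2 * I.n) = 11 * I.Z + 5 * I.n := by
    rw [tptr, if_neg (by omega)]
    omega
  refine (Tri.store ?_ ?_ (Set.mem_univ _) ⟨t, F, ?_, s.congr_interval fun c hc => ?_, hF0, ht⟩).conseq
    (by decide) (by decide) fun _ h _ _ _ => h
  · simp
    omega
  · simp [h0, h23]
    omega
  · simp [h0, h23, hptr]
  · have : c ≠ 0 := fun h => hF0 (h ▸ hc)
    simp [this]

theorem intSetup_wp {I : Ints α} {R W : Set ℕ} (hB : 1000 * (I.n + 1) ≤ C.B)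
    (he : ∀ v, v = 0 ∨ 20 ≤ v → v < 23 ∨ 28 < v → σ.n v = I.env v) :
    wp C.B R W intSetup (fun σ' => Env I.env σ'.n ∧ σ'.mem = σ.mem) σ := by
  have hB1 := C.one_lt_B
  have hK := I.pow_le
  have hM : 2 * (I.K + 1) * I.NB ≤ 8 * I.n + 2 := I.M_le
  have hK3 : I.K + 1 ≤ 2 ^ I.K := Nat.lt_two_pow_self
  have hNB : 2 * I.n / (I.K + 1) ≤ 2 * I.n := Nat.div_le_self ..
  have h0 : σ.n 0 = I.n := he 0 (by simp) (by simp)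
  have h20 : σ.n 20 = 2 ^ I.K := he 20 (by simp) (by simp)
  have h22 : σ.n 22 = I.K := he 22 (by simp) (by simp)
  simp only [Ints.NB] at hM
  simp [intSetup, wp, h0, h20, h22]
  refine ⟨by omega, by omega, by omega, by omega, by omega, by omega, fun v hv => ?_⟩
  by_cases hv' : 23 ≤ v ∧ v ≤ 28
  · obtain ⟨h1, h2⟩ := hv'
    interval_cases v <;> simp [Ints.env, Ints.Z, Ints.M, Ints.NB, h0, h20]
  · simp [he v hv (by omega), show v ≠ 28 by omega, show v ≠ 27 by omega, show v ≠ 26 by omega,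
      show v ≠ 25 by omega, show v ≠ 24 by omega, show v ≠ 23 by omega]

/-- The problem instance in memory. -/
theorem exists_ints {n K : ℕ} (hn : 1 ≤ n) (hK : n < 2 ^ K) (hK' : 2 ^ K ≤ 2 * n + 1) {lo hi : Fin n → α}
    {m : Mem α} (hle : ∀ i, lo i ≤ hi i) (h : HoldsSortedIntervals m lo hi) :
    ∃ I : Ints α, ∃ _ : I.n = n, I.K = K ∧ I.Input m ∧
      (∀ i : Fin n, I.key (2 * i) = lo i ∧ I.key (2 * i + 1) = hi i) ∧
      Finset.univ.val.map (endpoint lo hi) = I.keys 0 (2 * n) := by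
  obtain ⟨h1, σ, hmono, h2⟩ := h
  let b : Bool → ℕ := fun s => if s then 1 else 0
  let eid : ℕ → ℕ := fun j => if h : j < 2 * n then 2 * ((σ ⟨j, h⟩).1 : ℕ) + b (σ ⟨j, h⟩).2 else 0
  let key : ℕ → α := fun e => if e % 2 = 0 then extend hn lo (e / 2) else extend hn hi (e / 2)
  have hb : ∀ s, b s < 2 := fun s => by cases s <;> simp [b]
  have k0 : ∀ i : Fin n, key (2 * i) = lo i := fun i => by
    simp only [key, Nat.mul_mod_right, if_true, Nat.mul_div_cancel_left _ (Nat.zero_lt_two), extend_val]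
  have k1 : ∀ i : Fin n, key (2 * i + 1) = hi i := fun i => by
    simp only [key]
    rw [if_neg (by omega), show (2 * (i : ℕ) + 1) / 2 = i by omega, extend_val]
  have ee : ∀ j : Fin (2 * n), eid j = 2 * ((σ j).1 : ℕ) + b (σ j).2 := fun j => by simp [eid]
  have ek : ∀ j : Fin (2 * n), key (eid j) = endpoint lo hi (σ j) := fun j => by
    rw [ee, endpoint]
    generalize σ j = x
    obtain ⟨i, s⟩ := x
    cases s
    · exact k0 i
    · exact k1 i
  refine ⟨⟨n, K, key, eid, fun j hj => ?_, fun i hi j hj hij => ?_, fun e he => ?_, fun i j hij hj => ?_,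
    fun i hi' => ?_, hn, hK, hK'⟩, rfl, rfl, ⟨fun e he => ?_, fun j hj => ?_⟩, fun i => ⟨k0 i, k1 i⟩, ?_⟩
  · have := hb (σ ⟨j, hj⟩).2
    have := ee ⟨j, hj⟩
    simp only at this
    omega
  · have e1 := ee ⟨i, hi⟩
    have e2 := ee ⟨j, hj⟩
    simp only at e1 e2
    have b1 := hb (σ ⟨i, hi⟩).2
    have b2 := hb (σ ⟨j, hj⟩).2
    have e3 : (σ ⟨i, hi⟩).2 = (σ ⟨j, hj⟩).2 := by
      have : b (σ ⟨i, hi⟩).2 = b (σ ⟨j, hj⟩).2 := by omega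
      generalize (σ ⟨i, hi⟩).2 = s at *
      generalize (σ ⟨j, hj⟩).2 = t at *
      cases s <;> cases t <;> simp_all [b]
    have := σ.injective (Prod.ext (Fin.ext (by omega)) e3)
    simpa using this
  · refine ⟨σ.symm (⟨e / 2, by omega⟩, decide (e % 2 = 1)), Fin.is_lt _, ?_⟩
    rw [ee, Equiv.apply_symm_apply]
    rcases Nat.mod_two_eq_zero_or_one e with h | h <;> simp [b, h] <;> omega
  · have := hmono (show (⟨i, by omega⟩ : Fin (2 * n)) ≤ ⟨j, hj⟩ from hij)
    simpa only [← ek] using this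
  · rw [k0 ⟨i, hi'⟩, k1 ⟨i, hi'⟩]
    exact hle _
  · simp only at he ⊢
    rcases Nat.mod_two_eq_zero_or_one e with h | h
    · obtain ⟨i, rfl⟩ : ∃ i, e = 2 * i := ⟨e / 2, by omega⟩
      rw [k0 ⟨i, by omega⟩]
      exact (h1 ⟨i, by omega⟩).1
    · obtain ⟨i, rfl⟩ : ∃ i, e = 2 * i + 1 := ⟨e / 2, by omega⟩
      rw [k1 ⟨i, by omega⟩, show 1 + (2 * i + 1) = 2 + 2 * i by omega]
      exact (h1 ⟨i, by omega⟩).2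
  · exact (h2 ⟨j, hj⟩).trans (congrArg Val.num (ee ⟨j, hj⟩).symm)
  · rw [Ints.keys, Nat.Ico_zero_eq_range]
    have e1 : (Finset.univ : Finset (Fin (2 * n))).val.map Fin.val = (Finset.range (2 * n)).val := by
      have := congrArg Finset.val (Fin.map_valEmbedding_univ (n := 2 * n))
      rwa [Nat.Iio_eq_range] at this
    have e2 : (Finset.univ : Finset (Fin n × Bool)).val = (Finset.univ : Finset (Fin (2 * n))).val.map σ := by
      have := congrArg Finset.val (Finset.map_univ_equiv σ)
      exact this.symm
    rw [← e1, e2, Multiset.map_map, Multiset.map_map]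
    exact Multiset.map_congr rfl fun j _ => (ek j).symm

theorem intMain_tri {n : ℕ} (hΓ : C.Γ = intProcs) (hB : 1000 * (n + 1) ≤ C.B) {lo hi : Fin n → α} {m : Mem α}
    (hle : ∀ i, lo i ≤ hi i) (h : HoldsSortedIntervals m lo hi) :
    Tri C intMain Set.univ Set.univ (21000 * (n + 1)) (intDepth (Nat.size n + 4) + (Nat.size n + 2) * 50 + 100)
      (initSt n m) fun σ => HoldsIntervalTree lo hi σ.mem := by
  have hB1 := C.one_lt_B
  have h0 : (initSt n m).n 0 = n := rfl
  have hc : (Cond.le (V 0) 0).code.length + 2 = 5 := by decide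
  have hs : (Cmd.store 0 0).len = 3 := by decide
  have hl : (Cmd.set 21 (V 0 + 1)).len = 4 := by decide
  have hl' : intSetup.len = 30 := by decide
  unfold intMain
  rcases Nat.eq_zero_or_pos n with rfl | hn
  · refine (Tri.ite (T := (Cmd.store 0 0).len) (D := (Cmd.store 0 0).len) ?_ (fun _ => ?_)
      (fun h => ?_)).conseq ?_ ?_ fun _ h _ _ _ => h
    · simp [Cond.Ok]; omega
    · refine Tri.store (by simp; omega) (by simp; omega) (by simp) ?_
      refine ⟨0, .nil, ∅, by simp, .nil, by simp, ?_⟩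
      simp [IsIntervalTree]
    · simp [Cond.Holds, h0] at h
    · rw [hc, hs]
      norm_num
    · rw [hc, hs]
      exact (by norm_num : 5 + 3 ≤ 100).trans (Nat.le_add_left _ _)
  have hsz : Nat.size (n + 1) ≤ Nat.size n + 1 := by
    refine Nat.size_le.2 ?_
    have := Nat.lt_size_self n
    rw [pow_succ]
    omega
  refine (Tri.ite (by simp [Cond.Ok]; omega) (fun h => ?_)
    (fun _ => Tri.seq (Tri.set (Q := fun σ => σ = (initSt n m).setN 21 (n + 1)) (by simp [h0]; omega) (by simp [h0])) ?_
      (T₂ := (Nat.size (n + 1) + 1) * 50 + (30 + 20000 * (n + 1)))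
      (D₂ := (Nat.size (n + 1) + 1) * 50 + (30 + intDepth (Nat.size n + 4))))).conseq ?_ ?_ fun _ h _ _ _ => h
  · simp [Cond.Holds, h0] at h
    omega
  rotate_left
  · rw [hc, hl]
    have := Nat.size_le_self n
    clear hc hl hs hl' hB h0 hle h
    omega
  · rw [hc, hl]
    generalize intDepth (Nat.size n + 4) = z
    clear hc hl hs hl' hB h0 hle h
    omega
  rintro _ rfl - - -
  refine Tri.seq (doubling_tri (M := n + 1) (by omega) (by omega) (by simp)) ?_
  rintro σ₂ ⟨m₂, K, h20, h22, hK1, hK2⟩ fn₂ - -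
  obtain ⟨I, rfl, rfl, hin, hlh, hE⟩ := exists_ints (K := K) hn (by omega) (by omega) hle h
  have fn : ∀ v, v ≠ 20 → v ≠ 22 → σ₂.n v = ((initSt I.n m).setN 21 (I.n + 1)).n v := fun v h1 h2 =>
    fn₂ v (by simp [doubling, Cmd.mods, h1, h2])
  have hw : wp C.B Set.univ Set.univ intSetup (fun σ' => Env I.env σ'.n ∧ σ'.mem = σ₂.mem) σ₂ := by
    refine intSetup_wp hB fun v hv hv' => ?_
    by_cases hv'' : 20 ≤ v ∧ v ≤ 22
    · obtain ⟨g1, g2⟩ := hv''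
      interval_cases v
      · exact h20
      · rw [fn 21 (by norm_num) (by norm_num)]
        simp [Ints.env]
      · exact h22
    · rw [fn v (by omega) (by omega)]
      rcases hv with rfl | hv
      · simp [Ints.env, h0]
      · obtain ⟨k, rfl⟩ : ∃ k, v = k + 29 := ⟨v - 29, by omega⟩
        simp [Ints.env, initSt]
  refine Tri.seq (hl' ▸ Tri.basic hw) ?_
  rintro σ₃ ⟨he, em⟩ - - -
  rw [m₂] at em
  have hX : Nat.size (8 * I.n + 2) ≤ Nat.size I.n + 4 := by
    refine Nat.size_le.2 ?_
    have := Nat.lt_size_self I.n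
    rw [pow_add]
    omega
  have hKX : I.K + 1 ≤ Nat.size I.n + 4 := by
    have h1 := I.pow_le
    have : 2 ^ I.K < 2 ^ (Nat.size I.n + 2) := by
      have := Nat.lt_size_self I.n
      rw [pow_add]
      omega
    have := (Nat.pow_lt_pow_iff_right (by norm_num : 1 < 2)).1 this
    omega
  refine (intPhases_tri (σ := σ₃) hΓ hB he (by rw [em]; exact hin) hX hKX).conseq le_rfl le_rfl ?_
  rintro σ' ⟨t, F, h1, h2, h3, h4⟩ - - -
  refine ⟨_, t, F, h1, h2, h3, ?_⟩
  rw [hE]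
  have e1 : lo = fun i : Fin I.n => I.key (2 * i) := funext fun i => (hlh i).1.symm
  have e2 : hi = fun i : Fin I.n => I.key (2 * i + 1) := funext fun i => (hlh i).2.symm
  rw [e1, e2]
  exact h4

theorem exists_interval_program : ∃ (P : Program) (k s : ℕ) (K : ℝ),
    ∀ (α : Type u) [LinearOrder α] (n : ℕ) (lo hi : Fin n → α) (m : Mem α), (∀ i, lo i ≤ hi i) →
      HoldsSortedIntervals m lo hi → BuildsWithin P k s K n m (HoldsIntervalTree lo hi) := by
  refine ⟨link intProcs, 20, 0, (1000000 : ℕ), fun α _ n lo hi m hle h => ?_⟩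
  refine buildsWithin_of_tri (main := intMain) rfl (by norm_num) fun C hΓ hw =>
    ⟨_, _, _, _, intMain_tri hΓ ?_ hle h, fun hn => ⟨by omega, ?_⟩⟩
  · have := le_two_pow_of_log hw (by norm_num)
    simp only [Ctx.B]
    omega
  have h5 := Nat.size_le_log_add_one n
  have h6 : 1 ≤ Nat.log 2 n := Nat.log_pos (by norm_num) hn
  simp only [intDepth]
  generalize Nat.log 2 n = q at *
  generalize Nat.size n = z at *
  have h7 : (z + 4 + 3) * ((z + 4 + 3) * 400) ≤ (q * 9) * ((q * 9) * 400) :=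
    Nat.mul_le_mul (by omega) (Nat.mul_le_mul_right _ (by omega))
  have h8 : (z + 4 + 3) * ((z + 4) * 300) ≤ (q * 9) * ((q * 9) * 300) :=
    Nat.mul_le_mul (by omega) (Nat.mul_le_mul_right _ (by omega))
  nlinarith

end

end ANP

theorem mainTheorem4 :
    (∃ (P : ANP.Program) (k s : ℕ) (C : ℝ),
      ∀ (α : Type*) [LinearOrder α] (n : ℕ) (lo hi : Fin n → α) (m : ANP.Mem α),
        (∀ i, lo i ≤ hi i) → ANP.HoldsSortedIntervals m lo hi →
        ANP.BuildsWithin P k s C n m (ANP.HoldsIntervalTree lo hi)) ∧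
    (∃ (P : ANP.Program) (k s : ℕ) (C : ℝ),
      ∀ (α : Type*) [LinearOrder α] (n : ℕ) (x y : Fin n → α) (m : ANP.Mem α),
        ANP.HoldsSortedPoints m x y →
        ANP.BuildsWithin P k s C n m (ANP.HoldsPriorityTree x y)) :=
  ⟨ANP.exists_interval_program, ANP.exists_pst_program⟩
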